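/- **Setting.** Work in $\mathbb R^{1+4}$ with Minkowski metric $m=-(dX^0)^2+|dX'|^2$; write $\langle s\rangle=\sqrt{1+s^2}$. Fix $R_f>0$, $0<\kappa<\frac54$, constants $\Lambda$, $C_0,C_1,\dots$, and a smooth $\chi_1:\mathbb R\to[0,1]$ with $\chi_1=0$ on $s\le1$, $\chi_1=1$ on $s\ge2$; put $\chi=\chi_R(r)=\chi_1(r/R)$. Let $\xi,\ell$ be smooth $\mathbb R^4$-valued functions of $\sigma$ such that for $\sigma\in[0,\sigma_f]$ one has the smallness $|\ell|\le\Lambda\epsilon$ and the bootstrap bounds $|\frac{d^k}{d\sigma^k}(\dot\ell,\dot\xi-\ell)|\le 2C_k\delta_\wp\epsilon\langle\sigma\rangle^{-9/4+\kappa}$ for all $k\ge0$, where $\delta_\wp=\epsilon^{1/2}+R_f^{-1}$. Put $\gamma=(1-|\ell|^2)^{-1/2}$, $\eta=\xi-\gamma R_f\ell$, $\tau=\sigma-\gamma(\sigma)R_f$, and use hyperboloidal coordinates $X^0=\tau+\langle r\rangle$, $X'=\eta(\tau)+r\Theta(\theta)$, $\theta\in S^3$, on leaves $\Sigma_\tau$;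 $\eta'=d\eta/d\tau$. Let $Q=Q(|rA_\ell\Theta-\gamma\langle r\rangle\ell|)$, where $Q'(s)=(s^6-1)^{-1/2}$, $A_\ell=\gamma P_\ell+P_\ell^\perp$ and $P_\ell$ is the orthogonal projection onto $\ell$, and with $s^2=1+\nabla^\alpha Q\nabla_\alpha Q$ let $$\mathcal P_{\rm graph}=\Box_m-s^{-2}\nabla^\mu Q\nabla^\nu Q\nabla_\mu\nabla_\nu-2s^{-2}(\nabla^\mu\nabla^\nu Q)(\nabla_\mu Q)\nabla_\nu+2s^{-4}\nabla^\nu Q\nabla^\mu Q\nabla^\lambda Q(\nabla_\lambda\nabla_\mu Q)\nabla_\nu .$$ **Unknown and sources.** Let $U$ be smooth near $\{\tau_1\le\tau\le\tau_2,\ r\ge R\}$ and solve $\mathcal P_{\rm graph}U=\mathcal F$ there, where $\tau_1<\tau_2$ and the corresponding $\sigma$ lie in $[0,\sigma_f]$. Put $\tilde U=r^{3/2}U$, $K=r^{3/2}\partial_r$, $Y=K\tilde U$, $\tilde{\mathcal F}=r^{3/2}(1-\Theta\cdot\eta')\mathcal F$, $Q_0=-\frac3{4r^2}-2\partial_r\partial_\tau+\partial_r^2+r^{-2}\Delta_{S^3}$.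 Let $V$ be the operator obtained from $r^{3/2}(1-\Theta\cdot\eta')\mathcal P_{\rm graph}r^{-3/2}-Q_0$ by deleting its $\partial_r\partial_\tau$ and $\partial_r^2$ terms, and put $$\mathcal G_1=(K+2r^{1/2})\tilde{\mathcal F},\qquad \mathcal G_2=-\big([K,V]+2r^{1/2}V\big)\tilde U .$$ (The equation commuted with $K$ then has the form $R_cY=\mathcal G_1+\mathcal G_2$ with a second-order operator $R_c$ whose principal part is $-2\partial_r\partial_\tau+\partial_r^2+r^{-2}\Delta_{S^3}$ up to small errors.) **Energies.** With $\nabla\!\!\!\!/$ the gradient on the unit sphere $S^3$, $\mathcal D_{\tau_1}^{\tau_2}=\bigcup_{\tau_1\le\tau\le\tau_2}\Sigma_\tau$, and all quantities valued in $[0,\infty]$, $$\mathcal E^p[f](\tau)=\int_{\Sigma_\tau}\chi r^p(\partial_rf)^2\,dr\,d\theta,\qquad \tilde{\mathcal E}^p[f](\tau)=\int_{\Sigma_\tau}\chi r^p\big((\partial_rf)^2+r^{-2}f^2+r^{-4}|\nabla\!\!\!\!/f|^2\big)\,dr\,d\theta,$$ $$\mathcal B^p[f](\tau_1,\tau_2)=\int_{\mathcal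 D_{\tau_1}^{\tau_2}}\chi r^{p-1}\big((\partial_rf)^2+r^{-2}(f^2+|\nabla\!\!\!\!/f|^2)\big)\,d\tau\,dr\,d\theta,$$ $$\mathrm{Err}_\chi[Y]=|\chi'|\,r^p\big((\partial_rY)^2+(\partial_\tau Y)^2+r^{-2}|\nabla\!\!\!\!/Y|^2+r^{-2}Y^2\big).$$ The functions $\tilde U_k$, $0\le|k|\le1$, are $\tilde U$, $\partial_\tau\tilde U$, $r\partial_r\tilde U$ and $\Omega_{ij}\tilde U$, with $\Omega_{ij}$ $(i<j)$ the six rotation fields of $S^3$. **Proposition.** Let $0<\alpha<\frac34$. There are $M,\tilde R,\tilde\epsilon>0$ with $M(\tilde\epsilon+\tilde R^{-\alpha})<2\alpha$, depending only on $\alpha$, $R_f$, $\kappa$, $\Lambda$, $(C_k)$, $\chi_1$, such that for every $\delta>0$ there is a constant $C$, depending only on these data and $\delta$, with the following property. For all $R>\tilde R$ and $0<\epsilon<\tilde\epsilon$ with $M(\epsilon+R^{-\alpha})\le\delta$, all $\xi,\ell,\sigma_f,\tau_1<\tau_2,U,\mathcal F$ as above, and all $\delta<p<\frac32-2\alpha$,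 $$\sup_{\tau_1\le\tau\le\tau_2}\tilde{\mathcal E}^p[Y](\tau)+\mathcal B^p[Y](\tau_1,\tau_2)\le C\Big(\tilde{\mathcal E}^p[Y](\tau_1)+\sum_{0\le|k|\le1}\big(\mathcal B^p[\tilde U_k](\tau_1,\tau_2)+\sup_{\tau_1\le\tau\le\tau_2}\mathcal E^{p-1}[\tilde U_k](\tau)\big)$$ $$\qquad+\int_{\mathcal D_{\tau_1}^{\tau_2}}\mathrm{Err}_\chi[Y]+\chi r^p|\mathcal G_1+\mathcal G_2|\big(|\partial_rY|+r^{-1}|Y|+r^{-3}|\nabla\!\!\!\!/Y|+r^{-2}|\partial_\tau Y|\big)\,d\tau\,dr\,d\theta\Big).$$ -/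

import Mathlib

open Set MeasureTheory
open scoped NNReal ENNReal ContDiff

noncomputable section

namespace HypRp

/-- The spatial factor `ℝ⁴`.  Hyperboloidal polar coordinates `(τ, r, θ)` are written as
`(τ, y)` with `y = r Θ(θ)`, i.e. `r = ‖y‖` and `Θ = y / ‖y‖`. -/
abbrev E4 := EuclideanSpace ℝ (Fin 4)

/-- Scalar functions of the coordinates `(τ, y)`. -/
abbrev Fld := ℝ → E4 → ℝ

/-- Japanese bracket. -/
def jap (s : ℝ) : ℝ := Real.sqrt (1 + s ^ 2)

/-! ### Coordinate derivatives -/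

/-- `∂_τ` at fixed `(r, θ)`. -/
def dT (f : Fld) : Fld := fun τ y => deriv (fun s => f s y) τ

/-- `∂_{y_j}` at fixed `τ`. -/
def dY (j : Fin 4) (f : Fld) : Fld :=
  fun τ y => fderiv ℝ (f τ) y (EuclideanSpace.single j 1)

/-- `∂_r` at fixed `(τ, θ)`. -/
def dR (f : Fld) : Fld := fun τ y => fderiv ℝ (f τ) y (‖y‖⁻¹ • y)

/-- The rotation field `y_i ∂_{y_j} - y_j ∂_{y_i}`; these six fields (`i < j`) span the angular
derivatives `∂_θ`. -/
def rot (i j : Fin 4) (f : Fld) : Fld := fun τ y => y i * dY j f τ y - y j * dY i f τ y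

/-- `|∇̸ f|²`, the squared length of the gradient along the unit sphere `S³`. -/
def angSq (f : Fld) : Fld := fun τ y => ∑ i : Fin 4, ∑ j ∈ Finset.Ioi i, (rot i j f τ y) ^ 2

/-- The Laplacian of the unit sphere `S³`. -/
def sphLap (f : Fld) : Fld := fun τ y => ∑ i : Fin 4, ∑ j ∈ Finset.Ioi i, rot i j (rot i j f) τ y

/-- Multiplication by `r ^ a`. -/
def rMul (a : ℝ) (f : Fld) : Fld := fun τ y => ‖y‖ ^ a * f τ y

/-- The commutator field `K = r^{3/2} ∂_r`. -/
def K (f : Fld) : Fld := rMul (3 / 2) (dR f)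

/-! ### Moving hyperboloidal foliation -/

/-- Lorentz factor of the velocity `l`. -/
def lorentz (l : E4) : ℝ := 1 / Real.sqrt (1 - ‖l‖ ^ 2)

/-- The map `A_l = γ P_l + P_l^⊥`, with `(γ - 1) / |l|² = γ² / (γ + 1)`. -/
def boostSpace (l y : E4) : E4 :=
  y + ((lorentz l) ^ 2 / (lorentz l + 1) * inner ℝ l y) • l

/-- The centre `η = ξ - γ R_f ℓ`, as a function of `τ` through `σ = sig τ`. -/
def centre (Rf : ℝ) (xi ell : ℝ → E4) (sig : ℝ → ℝ) : ℝ → E4 :=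
  fun τ => xi (sig τ) - (lorentz (ell (sig τ)) * Rf) • ell (sig τ)

/-- `Θ · η'` with `η' = dη/dτ`. -/
def thetaDot (eta : ℝ → E4) : Fld := fun τ y => inner ℝ (‖y‖⁻¹ • y) (deriv eta τ)

/-- `∂τ/∂X^μ` for the coordinates `X⁰ = τ + ⟨r⟩`, `X' = η(τ) + y`. -/
def tauX (eta : ℝ → E4) (μ : Fin 5) : Fld := fun τ y =>
  Fin.cases (motive := fun _ => ℝ) (1 / (1 - inner ℝ y (deriv eta τ) / jap ‖y‖))
    (fun j => -(y j / jap ‖y‖) / (1 - inner ℝ y (deriv eta τ) / jap ‖y‖)) μ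

/-- The Cartesian coordinate field `∂/∂X^μ` of Minkowski space `ℝ^{1+4}`, written in the
coordinates `(τ, y)`; the chain rule uses `y = X' - η(τ)`. -/
def dX (eta : ℝ → E4) (μ : Fin 5) (f : Fld) : Fld := fun τ y =>
  Fin.cases (motive := fun _ => ℝ) 0 (fun j => dY j f τ y) μ
    + tauX eta μ τ y * (dT f τ y - fderiv ℝ (f τ) y (deriv eta τ))

/-- Diagonal entries of the Minkowski metric `-(dX⁰)² + ∑ (dX^j)²`. -/
def mink (μ : Fin 5) : ℝ := if μ = 0 then -1 else 1

/-! ### The profile and the linearised operator -/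

/-- Height of the Riemannian catenoid in `ℝ⁵` over the radius `s`:
`Q'(s) = (s⁶ - 1)^{-1/2}`, `Q(1) = 0`. -/
def catenoidHeight (s : ℝ) : ℝ := ∫ t in (1 : ℝ)..s, 1 / Real.sqrt (t ^ 6 - 1)

/-- The boosted profile `Q_℘ = Q(|r A_ℓ Θ - γ ⟨r⟩ ℓ|)` in the hyperboloidal region, where `l τ`
is the velocity on the leaf `τ`. -/
def profile (l : ℝ → E4) : Fld := fun τ y =>
  catenoidHeight ‖boostSpace (l τ) y - (lorentz (l τ) * jap ‖y‖) • l τ‖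

/-- `∇^μ Q`. -/
def gradUp (eta l : ℝ → E4) (μ : Fin 5) : Fld := fun τ y =>
  mink μ * dX eta μ (profile l) τ y

/-- `1 + ∇^α Q ∇_α Q`. -/
def sSq (eta l : ℝ → E4) : Fld := fun τ y =>
  1 + ∑ μ : Fin 5, mink μ * (dX eta μ (profile l) τ y) ^ 2

/-- The inverse metric `h^{μν} = m^{μν} - (1 + ∇^α Q ∇_α Q)⁻¹ ∇^μ Q ∇^ν Q`. -/
def hInv (eta l : ℝ → E4) (μ ν : Fin 5) : Fld := fun τ y =>
  (if μ = ν then mink μ else 0) - (sSq eta l τ y)⁻¹ * gradUp eta l μ τ y * gradUp eta l ν τ y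

/-- The operator `P_graph`:
`□_m - s⁻² ∇^μQ ∇^νQ ∇_μ∇_ν - 2 s⁻² (∇^μ∇^νQ)(∇_μQ) ∇_ν
  + 2 s⁻⁴ ∇^νQ ∇^μQ ∇^λQ (∇_λ∇_μQ) ∇_ν`, `s² = 1 + ∇^αQ ∇_αQ`. -/
def Pgraph (eta l : ℝ → E4) (f : Fld) : Fld := fun τ y =>
  (∑ μ : Fin 5, mink μ * dX eta μ (dX eta μ f) τ y)
  - (sSq eta l τ y)⁻¹ * (∑ μ : Fin 5, ∑ ν : Fin 5,
      gradUp eta l μ τ y * gradUp eta l ν τ y * dX eta μ (dX eta ν f) τ y)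
  - 2 * (sSq eta l τ y)⁻¹ * (∑ μ : Fin 5, ∑ ν : Fin 5,
      (mink μ * mink ν * dX eta μ (dX eta ν (profile l)) τ y)
        * dX eta μ (profile l) τ y * dX eta ν f τ y)
  + 2 * (sSq eta l τ y)⁻¹ ^ 2 * (∑ μ : Fin 5, ∑ ν : Fin 5, ∑ lam : Fin 5,
      gradUp eta l ν τ y * gradUp eta l μ τ y * gradUp eta l lam τ y
        * dX eta lam (dX eta μ (profile l)) τ y * dX eta ν f τ y)

/-! ### The conjugated equation and the source terms `G₁`, `G₂` -/

/-- `Q₀ = -3/(4r²) - 2 ∂_r ∂_τ + ∂_r² + r⁻² Δ̸`. -/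
def Qzero (f : Fld) : Fld := fun τ y =>
  -(3 / 4) * ‖y‖ ^ (-2 : ℝ) * f τ y - 2 * dR (dT f) τ y + dR (dR f) τ y
    + ‖y‖ ^ (-2 : ℝ) * sphLap f τ y

/-- The error operator defined by
`r^{3/2} (1 - Θ·η') P_graph (r^{-3/2} ·) = Q₀ + ErrQ₀`. -/
def errQ (eta l : ℝ → E4) (f : Fld) : Fld := fun τ y =>
  ‖y‖ ^ (3 / 2 : ℝ) * (1 - thetaDot eta τ y) * Pgraph eta l (rMul (-(3 / 2)) f) τ y
    - Qzero f τ y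

/-- Coefficient of `∂_r ∂_τ` in `ErrQ₀`, namely `2 (1 - Θ·η') h(dτ, dr) + 2`. -/
def coefRT (eta l : ℝ → E4) : Fld := fun τ y =>
  2 * (1 - thetaDot eta τ y) * (∑ μ : Fin 5, ∑ ν : Fin 5,
    hInv eta l μ ν τ y * tauX eta μ τ y * dX eta ν (fun _ z => ‖z‖) τ y) + 2

/-- Coefficient of `∂_r²` in `ErrQ₀`, namely `(1 - Θ·η') h(dr, dr) - 1`. -/
def coefRR (eta l : ℝ → E4) : Fld := fun τ y =>
  (1 - thetaDot eta τ y) * (∑ μ : Fin 5, ∑ ν : Fin 5,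
    hInv eta l μ ν τ y * dX eta μ (fun _ z => ‖z‖) τ y * dX eta ν (fun _ z => ‖z‖) τ y) - 1

/-- `ErrQ₀` without its `∂_r ∂_τ` and `∂_r²` terms. -/
def errRest (eta l : ℝ → E4) (f : Fld) : Fld := fun τ y =>
  errQ eta l f τ y - coefRT eta l τ y * dR (dT f) τ y - coefRR eta l τ y * dR (dR f) τ y

/-- `G₁ = (K + 2 r^{1/2}) F̃`, where `F̃ = r^{3/2} (1 - Θ·η') F`. -/
def G1 (eta : ℝ → E4) (F : Fld) : Fld :=
  let Ft : Fld := fun τ y => ‖y‖ ^ (3 / 2 : ℝ) * (1 - thetaDot eta τ y) * F τ y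
  fun τ y => K Ft τ y + 2 * ‖y‖ ^ (1 / 2 : ℝ) * Ft τ y

/-- `G₂ = -([K, V] + 2 r^{1/2} V) Ũ`, where `V` is `ErrQ₀` without its `∂_r ∂_τ` and `∂_r²` terms.
Since `(K + 2 r^{1/2})(Q₀ + ErrQ₀) Ũ = G₁`, the function `Y = K Ũ` solves
`(Q₁ + V) Y + (K + 2 r^{1/2})(coefRT ∂_r∂_τ Ũ + coefRR ∂_r² Ũ) = G₁ + G₂`,
whose left side is an operator applied to `Y`. -/
def G2 (eta l : ℝ → E4) (Ut : Fld) : Fld := fun τ y =>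
  errRest eta l (K Ut) τ y - K (errRest eta l Ut) τ y
    - 2 * ‖y‖ ^ (1 / 2 : ℝ) * errRest eta l Ut τ y

/-! ### Cutoffs, energies and bulk integrals -/

/-- Profiles of the cutoffs `χ_R(r) = χ₁(r / R)`. -/
structure IsCutoffProfile (chi : ℝ → ℝ) : Prop where
  smooth : ContDiff ℝ ∞ chi
  zero_of_le : ∀ s, s ≤ 1 → chi s = 0
  one_of_ge : ∀ s, 2 ≤ s → chi s = 1
  mem_Icc : ∀ s, chi s ∈ Icc (0 : ℝ) 1

/-- `χ_R`. -/
def cut (chi : ℝ → ℝ) (R : ℝ) : ℝ → ℝ := fun r => chi (r / R)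

/-- `∫_{Σ_τ} f dr dθ` for a nonnegative integrand, with values in `[0, ∞]`; note that
`dy = r³ dr dθ`. -/
def sliceInt (f : E4 → ℝ) : ℝ≥0∞ := ∫⁻ y : E4, ENNReal.ofReal (‖y‖ ^ (-3 : ℝ) * f y)

/-- `∫ f dτ dr dθ` over `τ₁ ≤ τ ≤ τ₂`, for a nonnegative integrand. -/
def bulkInt (τ₁ τ₂ : ℝ) (f : Fld) : ℝ≥0∞ := ∫⁻ τ in Icc τ₁ τ₂, sliceInt (f τ)

/-- `E^p[f](τ)`. -/
def Ep (chi : ℝ → ℝ) (R p : ℝ) (f : Fld) (τ : ℝ) : ℝ≥0∞ :=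
  sliceInt fun y => cut chi R ‖y‖ * ‖y‖ ^ p * (dR f τ y) ^ 2

/-- `Ẽ^p[f](τ)`. -/
def EpTilde (chi : ℝ → ℝ) (R p : ℝ) (f : Fld) (τ : ℝ) : ℝ≥0∞ :=
  sliceInt fun y => cut chi R ‖y‖ * ‖y‖ ^ p *
    ((dR f τ y) ^ 2 + ‖y‖ ^ (-2 : ℝ) * (f τ y) ^ 2 + ‖y‖ ^ (-4 : ℝ) * angSq f τ y)

/-- `B^p[f](τ₁, τ₂)`. -/
def Bp (chi : ℝ → ℝ) (R p : ℝ) (f : Fld) (τ₁ τ₂ : ℝ) : ℝ≥0∞ :=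
  bulkInt τ₁ τ₂ fun τ y => cut chi R ‖y‖ * ‖y‖ ^ (p - 1) *
    ((dR f τ y) ^ 2 + ‖y‖ ^ (-2 : ℝ) * ((f τ y) ^ 2 + angSq f τ y))

/-- The cutoff error: `|χ_R'| r^p` times the squares of `∂_r f`, `∂_τ f`, `r⁻¹ ∂_θ f`, `r⁻¹ f`. -/
def ErrChi (chi : ℝ → ℝ) (R p : ℝ) (f : Fld) (τ₁ τ₂ : ℝ) : ℝ≥0∞ :=
  bulkInt τ₁ τ₂ fun τ y => |deriv (cut chi R) ‖y‖| * ‖y‖ ^ p *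
    ((dR f τ y) ^ 2 + (dT f τ y) ^ 2
      + ‖y‖ ^ (-2 : ℝ) * (angSq f τ y + (f τ y) ^ 2))

/-- `∫ χ_R r^p |G| (|∂_r Y| + r⁻¹ |Y| + r⁻³ |∂_θ Y| + r⁻² |∂_τ Y|) dτ dr dθ`. -/
def sourceInt (chi : ℝ → ℝ) (R p : ℝ) (G Y : Fld) (τ₁ τ₂ : ℝ) : ℝ≥0∞ :=
  bulkInt τ₁ τ₂ fun τ y => cut chi R ‖y‖ * ‖y‖ ^ p * (|G τ y| *
    (|dR Y τ y| + ‖y‖ ^ (-1 : ℝ) * |Y τ y| + ‖y‖ ^ (-3 : ℝ) * Real.sqrt (angSq Y τ y)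
      + ‖y‖ ^ (-2 : ℝ) * |dT Y τ y|))

/-- `B^p[f](τ₁, τ₂) + sup_{τ₁ ≤ τ ≤ τ₂} E^{p-1}[f](τ)`. -/
def lowTerm (chi : ℝ → ℝ) (R p : ℝ) (f : Fld) (τ₁ τ₂ : ℝ) : ℝ≥0∞ :=
  Bp chi R p f τ₁ τ₂ + ⨆ τ ∈ Icc τ₁ τ₂, Ep chi R (p - 1) f τ

/-- The sum of `lowTerm` over `f_k = (r∂_r)^{k₃} ∂_θ^{k₂} ∂_τ^{k₁} f` with `0 ≤ |k| ≤ 1`. -/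
def lowSum (chi : ℝ → ℝ) (R p : ℝ) (f : Fld) (τ₁ τ₂ : ℝ) : ℝ≥0∞ :=
  lowTerm chi R p f τ₁ τ₂ + lowTerm chi R p (dT f) τ₁ τ₂
    + lowTerm chi R p (rMul 1 (dR f)) τ₁ τ₂
    + ∑ i : Fin 4, ∑ j ∈ Finset.Ioi i, lowTerm chi R p (rot i j f) τ₁ τ₂

/-! ### Hypotheses on the modulation parameters -/

/-- The parameters `ξ`, `ℓ` (functions of `σ ∈ [0, σ_f]`) are smooth, obey the smallness
`|ℓ| ≤ Λ ε` and the bootstrap bounds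
`|d^k/dσ^k (ℓ', ξ' - ℓ)| ≤ 2 C_k δ_℘ ε ⟨σ⟩^{-9/4 + κ}` for all `k`,
with `δ_℘ = ε^{1/2} + R_f⁻¹`. -/
structure SmallParams (Rf kap Lam : ℝ) (Cb : ℕ → ℝ) (ε sf : ℝ) (xi ell : ℝ → E4) : Prop where
  smooth_xi : ContDiff ℝ ∞ xi
  smooth_ell : ContDiff ℝ ∞ ell
  small : ∀ s ∈ Icc 0 sf, ‖ell s‖ ≤ Lam * ε
  boot_ell : ∀ k : ℕ, ∀ s ∈ Icc 0 sf, ‖iteratedDeriv k (deriv ell) s‖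
    ≤ 2 * Cb k * (Real.sqrt ε + Rf⁻¹) * ε * (jap s) ^ (-(9 / 4) + kap)
  boot_xi : ∀ k : ℕ, ∀ s ∈ Icc 0 sf, ‖iteratedDeriv k (fun t => deriv xi t - ell t) s‖
    ≤ 2 * Cb k * (Real.sqrt ε + Rf⁻¹) * ε * (jap s) ^ (-(9 / 4) + kap)

/-- `sig` inverts the change of time `τ = σ - γ(σ) R_f` on `[τ₁, τ₂]`. -/
structure IsTimeChange (Rf sf : ℝ) (ell : ℝ → E4) (τ₁ τ₂ : ℝ) (sig : ℝ → ℝ) : Prop where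
  smooth : ContDiff ℝ ∞ sig
  mem : ∀ τ ∈ Icc τ₁ τ₂, sig τ ∈ Icc 0 sf
  eq : ∀ τ ∈ Icc τ₁ τ₂, sig τ - lorentz (ell (sig τ)) * Rf = τ

end HypRp

end

open HypRp

/-!
# The commuted `r^p` estimate on moving hyperboloidal leaves

In the coordinates `(τ, y)`, `y = rΘ`, of the exterior region, every term of the equation for
`Y = K Ũ = r^{3/2} ∂_r Ũ` can be written as an operator applied to `Y` itself
(`commuted_equation`): the `∂_r ∂_τ` and `∂_r²` terms of the error operator see `Ũ` only through
`∂_r Ũ = r^{-3/2} Y`, and the remaining terms `V Ũ` become `V Y` up to the commutator in `G₂`. The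
operator obtained is a perturbation of the model operator
`-2 ∂_r ∂_τ + ∂_r² + r⁻² Δ̸ - r⁻² ∂_τ² - r⁻¹ ∂_τ - r⁻¹ ∂_r`,
whose first-order terms come from the commutation with `K`. The perturbation has relative size `ε +
1/R` (`exists_perturbed`). To prove this its coefficients are estimated in symbol classes `Sym`
that are uniform over all geometries with small parameters; the terms coming from the profile are
quadratic in `∇Q = O(r⁻²)`, because the profile depends on `(τ, y)` only through the boosted time
`zz`, which is comparable to `r`. The bounds on `ξ`, `ℓ` and on the change of time enter only
through `exists_param_bounds`.

The estimate itself is the multiplier identity `energy_identity` for the multiplier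
`-ω (Y_r + Y/(2r) + r⁻² Y_τ)`, where `ω = r⁻³ χ r^p` and `r⁻³` accounts for `dy = r³ dr dθ`.
Two integrations by parts in `r` make its terms definite:

* After a Hardy current has been added, the bulk form is coercive when the logarithmic derivative
  of the weight lies in `[-2 + δ, 3/2]`, and it then absorbs perturbations of size `δ / 40000`
  (`bulk_lower`, `energy_pointwise`).
* Modulo the divergence of a radial current, the energy density is comparable to
  `ω (Y_r² + (Y/r)²)` up to terms in `r⁻⁴ Y_τ²` and `r⁻⁴ |∇̸Y|²`; here the logarithmic derivative may
  not exceed `3/2 - 2α` (`flux_pointwise`). The angular part of the flux through a leaf is not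
  controlled by the multiplier. It is a lower-order quantity instead: `∂_r` commutes with `∂_τ` and
  with the rotations, so `Y_τ` and `∇̸Y` are `r^{3/2}` times radial derivatives of the `Ũ_k`, and
  their weighted squares are bounded by `E^{p-1}[Ũ_k]` (`jetL_le`).

`U` is not assumed to decay, so the weight `χ_R r^p` cannot be used directly. It is replaced by a
compactly supported one: `r^p` is tamed to `r^{p-2}` beyond a radius `ρ` (`capv`), which keeps the
logarithmic derivative in the admissible range because `δ ≤ p`, and the result is cut off on
the logarithmic scale `exp n` (`capκ`). The outer cutoff contributes at most `O(ρ² / n)` times the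
lower-order sum (`dCut_le`, `cap_estimate`). With `ρ = j + 1` and `n = (j + 1)³` this tends to `0`
unless that sum is infinite, in which case there is nothing to prove; Fatou's lemma removes the
truncation (`rp_estimate`).

Finally `M` is `40000` times the constant comparing the relative size of the perturbation with
`ε + R^{-α}`, so that `M (ε + R^{-α}) ≤ δ` is exactly the smallness that the coercivity of the bulk
needs.
-/

open Filter Topology

noncomputable section

namespace HypRp

/-! ### Coordinate derivatives on `ℝ × ℝ⁴` -/

/-- The space of coordinates `(τ, y)`. -/
abbrev X5 := ℝ × E4

/-- The coordinate basis of `ℝ × ℝ⁴`: index `0` is the `τ` direction, `j.succ` the `y_j` direction. -/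
def bv : Fin 5 → X5 := Fin.cases ((1, 0) : X5) (fun j => ((0, EuclideanSpace.single j 1) : X5))

/-- Partial derivative in the direction of the basis vector `bv a`. -/
def pd (a : Fin 5) (f : X5 → ℝ) : X5 → ℝ := fun x => fderiv ℝ f x (bv a)

/-- Smoothness of a scalar function at a point. -/
abbrev Sm (f : X5 → ℝ) (x : X5) : Prop := ContDiffAt ℝ ∞ f x

/-- The radius `r = ‖y‖`. -/
def rr (x : X5) : ℝ := ‖x.2‖

/-- The coordinate function `y_j`. -/
def yc (j : Fin 4) (x : X5) : ℝ := x.2 j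

lemma bv_zero : bv 0 = ((1, 0) : X5) := rfl
lemma bv_succ (j : Fin 4) : bv j.succ = ((0, EuclideanSpace.single j 1) : X5) := rfl

lemma Sm.diff {f : X5 → ℝ} {x : X5} (h : Sm f x) : DifferentiableAt ℝ f x :=
  h.differentiableAt (by simp)

lemma Sm.ev_diff {f : X5 → ℝ} {x : X5} (h : Sm f x) : ∀ᶠ z in 𝓝 x, DifferentiableAt ℝ f z := by
  have h1 : ContDiffAt ℝ 1 f x := contDiffAt_infty.1 h 1
  filter_upwards [h1.eventually (by simp)] with z hz
  exact hz.differentiableAt (by simp)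

lemma pd_sm {f : X5 → ℝ} {x : X5} (a : Fin 5) (h : Sm f x) : Sm (pd a f) x := by
  have : ContDiffAt ℝ ∞ (fderiv ℝ f) x := h.fderiv_right (by simp)
  exact this.clm_apply contDiffAt_const

lemma Sm.congr {f g : X5 → ℝ} {x : X5} (h : Sm f x) (e : g =ᶠ[𝓝 x] f) : Sm g x :=
  ContDiffAt.congr_of_eventuallyEq h e

lemma pd_congr {f g : X5 → ℝ} {x : X5} (a : Fin 5) (e : f =ᶠ[𝓝 x] g) :
    pd a f =ᶠ[𝓝 x] pd a g := by
  filter_upwards [e.fderiv (𝕜 := ℝ)] with z hz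
  simp only [pd, hz]

lemma pd_congr' {f g : X5 → ℝ} {x : X5} (a : Fin 5) (e : f =ᶠ[𝓝 x] g) :
    pd a f x = pd a g x := (pd_congr a e).eq_of_nhds

lemma pd_const (a : Fin 5) (c : ℝ) (x : X5) : pd a (fun _ => c) x = 0 := by simp [pd]

lemma pd_add' {f g : X5 → ℝ} {x : X5} (a : Fin 5) (hf : DifferentiableAt ℝ f x)
    (hg : DifferentiableAt ℝ g x) :
    pd a (fun z => f z + g z) x = pd a f x + pd a g x := by
  simp only [pd, fderiv_fun_add hf hg, add_apply]

lemma pd_sub' {f g : X5 → ℝ} {x : X5} (a : Fin 5) (hf : DifferentiableAt ℝ f x)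
    (hg : DifferentiableAt ℝ g x) :
    pd a (fun z => f z - g z) x = pd a f x - pd a g x := by
  simp only [pd, fderiv_fun_sub hf hg]; rfl

lemma pd_neg (a : Fin 5) (f : X5 → ℝ) (x : X5) : pd a (fun z => - f z) x = - pd a f x := by
  simp only [pd, fderiv_fun_neg]; rfl

lemma pd_mul' {f g : X5 → ℝ} {x : X5} (a : Fin 5) (hf : DifferentiableAt ℝ f x)
    (hg : DifferentiableAt ℝ g x) :
    pd a (fun z => f z * g z) x = pd a f x * g x + f x * pd a g x := by
  simp only [pd, fderiv_fun_mul hf hg, add_apply, smul_apply, smul_eq_mul]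
  ring

lemma pd_const_mul (a : Fin 5) (c : ℝ) (f : X5 → ℝ) (x : X5) :
    pd a (fun z => c * f z) x = c * pd a f x := by
  have h2 : (fun z => c * f z) = c • f := rfl
  rw [pd, h2, fderiv_const_smul_field]; rfl

lemma pd_sum' {ι : Type*} (s : Finset ι) {f : ι → X5 → ℝ} {x : X5} (a : Fin 5)
    (hf : ∀ i ∈ s, DifferentiableAt ℝ (f i) x) :
    pd a (fun z => ∑ i ∈ s, f i z) x = ∑ i ∈ s, pd a (f i) x := by
  simp only [pd, fderiv_fun_sum hf, sum_apply]

lemma pd_add {f g : X5 → ℝ} {x : X5} (a : Fin 5) (hf : Sm f x) (hg : Sm g x) :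
    pd a (fun z => f z + g z) x = pd a f x + pd a g x := pd_add' a hf.diff hg.diff
lemma pd_sub {f g : X5 → ℝ} {x : X5} (a : Fin 5) (hf : Sm f x) (hg : Sm g x) :
    pd a (fun z => f z - g z) x = pd a f x - pd a g x := pd_sub' a hf.diff hg.diff
lemma pd_mul {f g : X5 → ℝ} {x : X5} (a : Fin 5) (hf : Sm f x) (hg : Sm g x) :
    pd a (fun z => f z * g z) x = pd a f x * g x + f x * pd a g x := pd_mul' a hf.diff hg.diff
lemma pd_sum {ι : Type*} (s : Finset ι) {f : ι → X5 → ℝ} {x : X5} (a : Fin 5)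
    (hf : ∀ i ∈ s, Sm (f i) x) :
    pd a (fun z => ∑ i ∈ s, f i z) x = ∑ i ∈ s, pd a (f i) x :=
  pd_sum' s a fun i hi => (hf i hi).diff

lemma pd_add_ev {f g : X5 → ℝ} {x : X5} (a : Fin 5) (hf : Sm f x) (hg : Sm g x) :
    pd a (fun z => f z + g z) =ᶠ[𝓝 x] fun z => pd a f z + pd a g z := by
  filter_upwards [hf.ev_diff, hg.ev_diff] with z h1 h2 using pd_add' a h1 h2
lemma pd_mul_ev {f g : X5 → ℝ} {x : X5} (a : Fin 5) (hf : Sm f x) (hg : Sm g x) :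
    pd a (fun z => f z * g z) =ᶠ[𝓝 x] fun z => pd a f z * g z + f z * pd a g z := by
  filter_upwards [hf.ev_diff, hg.ev_diff] with z h1 h2 using pd_mul' a h1 h2

lemma pd_comp {φ : ℝ → ℝ} {φ' : ℝ} {f : X5 → ℝ} {x : X5} (a : Fin 5)
    (hφ : HasDerivAt φ φ' (f x)) (hf : DifferentiableAt ℝ f x) :
    pd a (fun z => φ (f z)) x = φ' * pd a f x := by
  have := (hφ.comp_hasFDerivAt x hf.hasFDerivAt).fderiv
  simp only [pd]
  have h2 : (fun z => φ (f z)) = φ ∘ f := rfl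
  rw [h2, this]; rfl

lemma pd_comm_ev {f : X5 → ℝ} {x : X5} (a b : Fin 5) (h : Sm f x) :
    pd a (pd b f) =ᶠ[𝓝 x] pd b (pd a f) := by
  have h2 : ContDiffAt ℝ 3 f x := contDiffAt_infty.1 h 3
  filter_upwards [h2.eventually (by simp)] with z hz
  have hs : IsSymmSndFDerivAt ℝ f z := hz.isSymmSndFDerivAt (by simp; norm_cast)
  have hd : DifferentiableAt ℝ (fderiv ℝ f) z :=
    (hz.fderiv_right (m := 1) (by norm_cast)).differentiableAt (by simp)
  have key : ∀ (a : Fin 5) (v : X5), fderiv ℝ (pd a f) z v = fderiv ℝ (fderiv ℝ f) z v (bv a) := by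
    intro a v
    unfold pd
    rw [fderiv_clm_apply hd (by fun_prop)]
    simp
  rw [pd, pd, key, key]
  exact hs.eq _ _

lemma pd_comm {f : X5 → ℝ} {x : X5} (a b : Fin 5) (h : Sm f x) :
    pd a (pd b f) x = pd b (pd a f) x := (pd_comm_ev a b h).eq_of_nhds

lemma rr_sm {x : X5} (h : x.2 ≠ 0) : Sm rr x := contDiffAt_snd.norm ℝ h
lemma yc_sm (j : Fin 4) (x : X5) : Sm (yc j) x := by
  have : ContDiff ℝ ∞ (yc j) := by
    have h : yc j = fun x : X5 => (EuclideanSpace.proj j : E4 →L[ℝ] ℝ) x.2 := rfl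
    rw [h]; fun_prop
  exact this.contDiffAt

lemma pd_yc (j : Fin 4) (a : Fin 5) (x : X5) : pd a (yc j) x = if a = j.succ then 1 else 0 := by
  have h : yc j = ((EuclideanSpace.proj j : E4 →L[ℝ] ℝ).comp (ContinuousLinearMap.snd ℝ ℝ E4)) := rfl
  rw [pd, h, ContinuousLinearMap.fderiv]
  refine Fin.cases ?_ (fun i => ?_) a
  · simp [bv_zero, (Fin.succ_ne_zero j).symm]
  · simp [bv_succ, Fin.succ_inj, eq_comm]

lemma rr_sq (x : X5) : rr x ^ 2 = ∑ j, yc j x ^ 2 := by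
  simp [rr, yc, EuclideanSpace.norm_sq_eq]

lemma rr_pos {x : X5} (h : x.2 ≠ 0) : 0 < rr x := norm_pos_iff.2 h

/-- A function of `τ` alone. -/
lemma pd_fst {φ : ℝ → ℝ} {x : X5} (hφ : DifferentiableAt ℝ φ x.1) (a : Fin 5) :
    pd a (fun z => φ z.1) x = if a = 0 then deriv φ x.1 else 0 := by
  have := (hφ.hasDerivAt.comp_hasFDerivAt (f := fun z : X5 => z.1) x
    (hasFDerivAt_fst (𝕜 := ℝ) (E := ℝ) (F := E4))).fderiv
  have h2 : (fun z : X5 => φ z.1) = φ ∘ (fun z : X5 => z.1) := rfl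
  rw [pd, h2, this]
  refine Fin.cases ?_ (fun i => ?_) a
  · simp [bv_zero]
  · simp [bv_succ]

/-- `∂_a r = y_a / r`, written through the inner product with the basis vector. -/
lemma pd_rr {x : X5} (h : x.2 ≠ 0) (a : Fin 5) :
    pd a rr x = Fin.cases (motive := fun _ => ℝ) 0 (fun j => yc j x / rr x) a := by
  have hs : ∀ z : X5, rr z * rr z = ∑ j, yc j z * yc j z := by
    intro z; simpa [sq] using rr_sq z
  have h1 : pd a (fun z => rr z * rr z) x = pd a (fun z => ∑ j, yc j z * yc j z) x := by
    congr 1; funext z; exact hs z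
  rw [pd_mul a (rr_sm h) (rr_sm h), pd_sum _ a (fun j _ => (yc_sm j x).mul (yc_sm j x))] at h1
  have h2 : ∀ j, pd a (fun z => yc j z * yc j z) x = 2 * (if a = j.succ then yc j x else 0) := by
    intro j; rw [pd_mul a (yc_sm j x) (yc_sm j x), pd_yc]; split_ifs <;> ring
  simp only [h2] at h1
  have hr := rr_pos h
  revert h1
  refine Fin.cases ?_ (fun i => ?_) a
  · intro h1
    simp [(Fin.succ_ne_zero _).symm] at h1 ⊢
    have : 2 * rr x * pd 0 rr x = 0 := by linarith
    rcases mul_eq_zero.1 this with h | h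
    · linarith
    · exact h
  · intro h1
    simp only [Fin.succ_inj, ← Finset.mul_sum, Finset.sum_ite_eq, Finset.mem_univ, if_true] at h1
    simp only [Fin.cases_succ]
    rw [eq_div_iff hr.ne']; linarith

lemma pd_rr_zero {x : X5} (h : x.2 ≠ 0) : pd 0 rr x = 0 := by rw [pd_rr h]; rfl
lemma pd_rr_succ {x : X5} (h : x.2 ≠ 0) (j : Fin 4) : pd j.succ rr x = yc j x / rr x := by
  rw [pd_rr h]; rfl

lemma ev_ne {x : X5} (h : x.2 ≠ 0) : ∀ᶠ z : X5 in 𝓝 x, z.2 ≠ 0 :=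
  continuous_snd.continuousAt.eventually_ne h

/-! ### Dictionary between curried coordinate derivatives and partial derivatives -/

/-- A scalar function of `(τ, y)` as a function on `ℝ × ℝ⁴`. -/
abbrev uc (f : Fld) : X5 → ℝ := Function.uncurry f

lemma dT_at {f : Fld} {x : X5} (h : DifferentiableAt ℝ (uc f) x) : dT f x.1 x.2 = pd 0 (uc f) x := by
  have h1 : HasDerivAt (fun s : ℝ => ((s, x.2) : X5)) ((1, 0) : X5) x.1 :=
    (hasDerivAt_id _).prodMk (hasDerivAt_const _ _)
  have := h.hasFDerivAt.comp_hasDerivAt (f := fun s : ℝ => ((s, x.2) : X5)) x.1 h1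
  exact this.deriv

lemma dsnd_at {f : Fld} {x : X5} (h : DifferentiableAt ℝ (uc f) x) (v : E4) :
    fderiv ℝ (f x.1) x.2 v = fderiv ℝ (uc f) x ((0, v) : X5) := by
  have h1 : HasFDerivAt (fun y : E4 => ((x.1, y) : X5)) (ContinuousLinearMap.inr ℝ ℝ E4) x.2 :=
    hasFDerivAt_prodMk_right _ _
  have := HasFDerivAt.comp (f := fun y : E4 => ((x.1, y) : X5)) (g := uc f) x.2 h.hasFDerivAt h1
  have h2 : (uc f ∘ fun y : E4 => ((x.1, y) : X5)) = f x.1 := rfl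
  rw [h2] at this
  rw [this.fderiv]; simp

lemma dY_at {f : Fld} {x : X5} (h : DifferentiableAt ℝ (uc f) x) (j : Fin 4) :
    dY j f x.1 x.2 = pd j.succ (uc f) x := dsnd_at h _

lemma vec_eq_sum (v : E4) : v = ∑ j, v j • EuclideanSpace.single j (1 : ℝ) := by
  ext i; simp [Finset.sum_apply, Pi.single_apply]

lemma fd_snd_sum (f : X5 → ℝ) (x : X5) (v : E4) :
    fderiv ℝ f x ((0, v) : X5) = ∑ j, v j * pd j.succ f x := by
  have : ((0, v) : X5) = ∑ j, v j • bv j.succ := by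
    conv_lhs => rw [vec_eq_sum v]
    ext <;> simp [bv_succ, Prod.snd_sum, Prod.fst_sum]
  rw [this, map_sum]; simp [pd]

lemma dsnd_sum {f : Fld} {x : X5} (h : DifferentiableAt ℝ (uc f) x) (v : E4) :
    fderiv ℝ (f x.1) x.2 v = ∑ j, v j * pd j.succ (uc f) x := by
  rw [dsnd_at h, fd_snd_sum]

/-- `∂_r` in terms of partial derivatives. -/
def rD (f : X5 → ℝ) : X5 → ℝ := fun x => ∑ j, yc j x / rr x * pd j.succ f x

/-- The rotation field `y_i ∂_j - y_j ∂_i` in terms of partial derivatives. -/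
def rot5 (i j : Fin 4) (f : X5 → ℝ) : X5 → ℝ :=
  fun x => yc i x * pd j.succ f x - yc j x * pd i.succ f x

lemma dR_at {f : Fld} {x : X5} (h : DifferentiableAt ℝ (uc f) x) : dR f x.1 x.2 = rD (uc f) x := by
  rw [dR, dsnd_sum h, rD]
  refine Finset.sum_congr rfl fun j _ => ?_
  simp [yc, rr, div_eq_inv_mul]

lemma rot_at {f : Fld} {x : X5} (h : DifferentiableAt ℝ (uc f) x) (i j : Fin 4) :
    rot i j f x.1 x.2 = rot5 i j (uc f) x := by
  rw [rot, dY_at h, dY_at h]; rfl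

lemma dT_ev {f : Fld} {x : X5} (h : Sm (uc f) x) : uc (dT f) =ᶠ[𝓝 x] pd 0 (uc f) := by
  filter_upwards [h.ev_diff] with z hz using dT_at hz
lemma dR_ev {f : Fld} {x : X5} (h : Sm (uc f) x) : uc (dR f) =ᶠ[𝓝 x] rD (uc f) := by
  filter_upwards [h.ev_diff] with z hz using dR_at hz
lemma rot_ev {f : Fld} {x : X5} (h : Sm (uc f) x) (i j : Fin 4) :
    uc (rot i j f) =ᶠ[𝓝 x] rot5 i j (uc f) := by
  filter_upwards [h.ev_diff] with z hz using rot_at hz i j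

lemma th_sm {x : X5} (h : x.2 ≠ 0) (j : Fin 4) : Sm (fun z => yc j z / rr z) x :=
  ContDiffAt.div (yc_sm j x) (rr_sm h) (rr_pos h).ne'

lemma rD_sm {f : X5 → ℝ} {x : X5} (h0 : x.2 ≠ 0) (h : Sm f x) : Sm (rD f) x :=
  ContDiffAt.sum fun j _ => (th_sm h0 j).mul (pd_sm _ h)

lemma rot5_sm {f : X5 → ℝ} {x : X5} (i j : Fin 4) (h : Sm f x) : Sm (rot5 i j f) x :=
  ((yc_sm i x).mul (pd_sm _ h)).sub ((yc_sm j x).mul (pd_sm _ h))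

lemma rD_congr {f g : X5 → ℝ} {x : X5} (e : f =ᶠ[𝓝 x] g) : rD f =ᶠ[𝓝 x] rD g := by
  have : ∀ᶠ z in 𝓝 x, ∀ j : Fin 4, pd j.succ f z = pd j.succ g z :=
    eventually_all.2 fun j => pd_congr j.succ e
  filter_upwards [this] with z hz
  simp only [rD, hz]

lemma rot5_congr {f g : X5 → ℝ} {x : X5} (i j : Fin 4) (e : f =ᶠ[𝓝 x] g) :
    rot5 i j f =ᶠ[𝓝 x] rot5 i j g := by
  filter_upwards [pd_congr i.succ e, pd_congr j.succ e] with z h1 h2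
  simp only [rot5, h1, h2]

lemma uc_congr_dR {f : Fld} {g : X5 → ℝ} {x : X5} (hg : Sm g x) (e : uc f =ᶠ[𝓝 x] g) :
    uc (dR f) =ᶠ[𝓝 x] rD g := (dR_ev (hg.congr e)).trans (rD_congr e)
lemma uc_congr_rot {f : Fld} {g : X5 → ℝ} {x : X5} (hg : Sm g x) (e : uc f =ᶠ[𝓝 x] g) (i j : Fin 4) :
    uc (rot i j f) =ᶠ[𝓝 x] rot5 i j g := (rot_ev (hg.congr e) i j).trans (rot5_congr i j e)

/-! ### The energy identity for a second-order operator -/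

section identity
variable (A : Fin 5 → Fin 5 → X5 → ℝ) (X : Fin 5 → X5 → ℝ) (q Y : X5 → ℝ)

/-- The vector `P^a = A^{ab} ∂_b Y`. -/
def Pv (a : Fin 5) : X5 → ℝ := fun z => ∑ b, A a b z * pd b Y z

/-- The quadratic form `A^{ab} ∂_a Y ∂_b Y`. -/
def quadA : X5 → ℝ := fun z => ∑ a, pd a Y z * Pv A Y a z

/-- The multiplier `X^c ∂_c Y + q Y`. -/
def mult : X5 → ℝ := fun z => ∑ c, X c z * pd c Y z + q z * Y z

/-- The energy current `J^a = P^a (X Y + q Y) - ½ X^a A(∂Y, ∂Y)`. -/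
def cur (a : Fin 5) : X5 → ℝ := fun z => Pv A Y a z * mult X q Y z - 1 / 2 * X a z * quadA A Y z

/-- The second-order operator `A^{ab} ∂_a ∂_b`. -/
def L2 : X5 → ℝ := fun z => ∑ a, ∑ b, A a b z * pd a (pd b Y) z

/-- The bulk density produced by the multiplier `X^c ∂_c + q` and the operator `A^{ab} ∂_a ∂_b`. -/
def Bq : X5 → ℝ := fun z =>
  - mult X q Y z * (∑ a, ∑ b, pd a (A a b) z * pd b Y z)
  - (∑ a, Pv A Y a z * (∑ c, pd a (X c) z * pd c Y z))
  - Y z * (∑ a, Pv A Y a z * pd a q z) - q z * quadA A Y z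
  + 1 / 2 * (∑ a, pd a (X a) z) * quadA A Y z
  + 1 / 2 * ∑ c, X c z * (∑ a, ∑ b, pd c (A a b) z * pd a Y z * pd b Y z)

variable {A X q Y}

lemma Pv_sm {x : X5} (hA : ∀ a b, Sm (A a b) x) (hY : Sm Y x) (a : Fin 5) : Sm (Pv A Y a) x :=
  ContDiffAt.sum fun b _ => (hA a b).mul (pd_sm b hY)

lemma quadA_sm {x : X5} (hA : ∀ a b, Sm (A a b) x) (hY : Sm Y x) : Sm (quadA A Y) x :=
  ContDiffAt.sum fun a _ => (pd_sm a hY).mul (Pv_sm hA hY a)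

lemma mult_sm {x : X5} (hX : ∀ a, Sm (X a) x) (hq : Sm q x) (hY : Sm Y x) : Sm (mult X q Y) x :=
  (ContDiffAt.sum fun c _ => (hX c).mul (pd_sm c hY)).add (hq.mul hY)

lemma cur_sm {x : X5} (hA : ∀ a b, Sm (A a b) x) (hX : ∀ a, Sm (X a) x) (hq : Sm q x) (hY : Sm Y x)
    (a : Fin 5) : Sm (cur A X q Y a) x :=
  ((Pv_sm hA hY a).mul (mult_sm hX hq hY)).sub
    ((contDiffAt_const.mul (hX a)).mul (quadA_sm hA hY))

/-- Multiplier identity: a first-order multiplier times the principal part is the divergence of the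
energy current plus a quadratic form in the jet of `Y`. -/
lemma energy_identity {x : X5} (hsym : ∀ a b z, A a b z = A b a z) (hA : ∀ a b, Sm (A a b) x)
    (hX : ∀ a, Sm (X a) x) (hq : Sm q x) (hY : Sm Y x) :
    mult X q Y x * L2 A Y x = ∑ a, pd a (cur A X q Y a) x + Bq A X q Y x := by
  have hPd : ∀ c a, pd c (Pv A Y a) x
      = ∑ b, (pd c (A a b) x * pd b Y x + A a b x * pd c (pd b Y) x) := by
    intro c a
    rw [show Pv A Y a = fun z => ∑ b, A a b z * pd b Y z from rfl,
      pd_sum _ c (fun b _ => (hA a b).mul (pd_sm b hY))]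
    exact Finset.sum_congr rfl fun b _ => pd_mul c (hA a b) (pd_sm b hY)
  have hSd : ∀ c, pd c (quadA A Y) x
      = ∑ a, (pd c (pd a Y) x * Pv A Y a x + pd a Y x * pd c (Pv A Y a) x) := by
    intro c
    rw [show quadA A Y = fun z => ∑ a, pd a Y z * Pv A Y a z from rfl,
      pd_sum _ c (fun a _ => (pd_sm a hY).mul (Pv_sm hA hY a))]
    exact Finset.sum_congr rfl fun a _ => pd_mul c (pd_sm a hY) (Pv_sm hA hY a)
  have hmd : ∀ a, pd a (mult X q Y) x
      = ∑ c, (pd a (X c) x * pd c Y x + X c x * pd a (pd c Y) x)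
        + (pd a q x * Y x + q x * pd a Y x) := by
    intro a
    rw [show mult X q Y = fun z => ∑ c, X c z * pd c Y z + q z * Y z from rfl,
      pd_add a (ContDiffAt.sum fun c _ => (hX c).mul (pd_sm c hY)) (hq.mul hY),
      pd_sum _ a (fun c _ => (hX c).mul (pd_sm c hY)), pd_mul a hq hY]
    congr 1
    exact Finset.sum_congr rfl fun c _ => pd_mul a (hX c) (pd_sm c hY)
  have hJ : ∀ a, pd a (cur A X q Y a) x = pd a (Pv A Y a) x * mult X q Y x
      + Pv A Y a x * pd a (mult X q Y) x
      - 1 / 2 * (pd a (X a) x * quadA A Y x + X a x * pd a (quadA A Y) x) := by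
    intro a
    have e : cur A X q Y a = fun z => Pv A Y a z * mult X q Y z - 1 / 2 * (X a z * quadA A Y z) := by
      funext z; simp only [cur]; ring
    rw [e, pd_sub a ((Pv_sm hA hY a).mul (mult_sm hX hq hY))
      (contDiffAt_const.mul ((hX a).mul (quadA_sm hA hY))), pd_const_mul,
      pd_mul a (Pv_sm hA hY a) (mult_sm hX hq hY), pd_mul a (hX a) (quadA_sm hA hY)]
  -- the contraction `∂_c ∂_a Y · A^{ab} ∂_b Y` in its two orders
  have h1 : ∀ c, ∑ a, pd a Y x * (∑ b, A a b x * pd c (pd b Y) x)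
      = ∑ a, pd c (pd a Y) x * Pv A Y a x := by
    intro c
    simp only [Pv, Finset.mul_sum]
    rw [Finset.sum_comm]
    refine Finset.sum_congr rfl fun a _ => Finset.sum_congr rfl fun b _ => ?_
    rw [hsym]; ring
  have h2 : ∑ a, Pv A Y a x * (∑ c, X c x * pd a (pd c Y) x)
      = ∑ c, X c x * (∑ a, pd c (pd a Y) x * Pv A Y a x) := by
    simp only [Finset.mul_sum]
    rw [Finset.sum_comm]
    refine Finset.sum_congr rfl fun a _ => Finset.sum_congr rfl fun b _ => ?_
    rw [pd_comm b a hY]; ring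
  have h3 : ∀ c, ∑ a, pd a Y x * (∑ b, pd c (A a b) x * pd b Y x)
      = ∑ a, ∑ b, pd c (A a b) x * pd a Y x * pd b Y x := by
    intro c
    refine Finset.sum_congr rfl fun a _ => ?_
    rw [Finset.mul_sum]
    exact Finset.sum_congr rfl fun b _ => by ring
  have hS : ∀ c, pd c (quadA A Y) x = 2 * (∑ a, pd c (pd a Y) x * Pv A Y a x)
      + ∑ a, ∑ b, pd c (A a b) x * pd a Y x * pd b Y x := by
    intro c
    rw [hSd c, ← h3, Finset.sum_add_distrib]
    simp only [hPd, Finset.sum_add_distrib, mul_add]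
    rw [h1]; ring
  have hq' : ∑ a, Pv A Y a x * (q x * pd a Y x) = q x * quadA A Y x := by
    simp only [quadA, Finset.mul_sum]
    exact Finset.sum_congr rfl fun b _ => by ring
  have hq2 : ∑ a, Pv A Y a x * (pd a q x * Y x) = Y x * ∑ a, Pv A Y a x * pd a q x := by
    simp only [Finset.mul_sum]
    exact Finset.sum_congr rfl fun b _ => by ring
  have hX2 : ∑ a, X a x * pd a (quadA A Y) x
      = 2 * (∑ c, X c x * (∑ a, pd c (pd a Y) x * Pv A Y a x))
        + ∑ c, X c x * (∑ a, ∑ b, pd c (A a b) x * pd a Y x * pd b Y x) := by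
    rw [Finset.mul_sum, ← Finset.sum_add_distrib]
    refine Finset.sum_congr rfl fun c _ => ?_
    rw [hS]; ring
  have hdP : ∑ a, pd a (Pv A Y a) x
      = (∑ a, ∑ b, pd a (A a b) x * pd b Y x) + L2 A Y x := by
    simp only [hPd, Finset.sum_add_distrib, L2]
  have hPm : ∑ a, Pv A Y a x * pd a (mult X q Y) x
      = ∑ a, Pv A Y a x * (∑ c, pd a (X c) x * pd c Y x)
        + ∑ c, X c x * (∑ a, pd c (pd a Y) x * Pv A Y a x)
        + Y x * (∑ a, Pv A Y a x * pd a q x) + q x * quadA A Y x := by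
    rw [← h2, ← hq', ← hq2]
    simp only [← Finset.sum_add_distrib]
    refine Finset.sum_congr rfl fun a _ => ?_
    rw [hmd, Finset.sum_add_distrib]; ring
  have : ∑ a, pd a (cur A X q Y a) x = (∑ a, pd a (Pv A Y a) x) * mult X q Y x
      + ∑ a, Pv A Y a x * pd a (mult X q Y) x
      - 1 / 2 * ((∑ a, pd a (X a) x) * quadA A Y x + ∑ a, X a x * pd a (quadA A Y) x) := by
    rw [Finset.sum_mul, Finset.sum_mul, ← Finset.sum_add_distrib, ← Finset.sum_add_distrib,
      Finset.mul_sum, ← Finset.sum_sub_distrib]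
    exact Finset.sum_congr rfl fun a _ => hJ a
  rw [this, hdP, hPm, hX2, Bq]
  ring
end identity

/-! ### The model operator -/

/-- Principal coefficients of the model operator
`-r⁻² ∂_τ² - 2 ∂_r ∂_τ + Δ_y`. -/
def A0 : Fin 5 → Fin 5 → X5 → ℝ := fun a b z =>
  Fin.cases (motive := fun _ => ℝ)
    (Fin.cases (motive := fun _ => ℝ) (-(1 / rr z ^ 2)) (fun j => -(yc j z / rr z)) b)
    (fun i => Fin.cases (motive := fun _ => ℝ) (-(yc i z / rr z))
      (fun j => if i = j then 1 else 0) b) a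

/-- First-order coefficients of the model operator: `-r⁻¹ ∂_τ - 4 r⁻¹ ∂_r`. -/
def b0 : Fin 5 → X5 → ℝ := fun a z =>
  Fin.cases (motive := fun _ => ℝ) (-(1 / rr z)) (fun j => -(4 * yc j z / rr z ^ 2)) a

/-- The vector field `-F(r) (y·∂_y + r⁻¹ ∂_τ)`. -/
def X0 (F : ℝ → ℝ) : Fin 5 → X5 → ℝ := fun a z =>
  Fin.cases (motive := fun _ => ℝ) (-(F (rr z) / rr z)) (fun j => -(F (rr z) * yc j z)) a

/-- The zero-order part `-F(r)/2` of the multiplier. -/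
def q0 (F : ℝ → ℝ) : X5 → ℝ := fun z => -(1 / 2) * F (rr z)

lemma A0_symm (a b : Fin 5) (z : X5) : A0 a b z = A0 b a z := by
  refine Fin.cases ?_ (fun i => ?_) a <;> refine Fin.cases ?_ (fun j => ?_) b
  · rfl
  · rfl
  · rfl
  · simp [A0, eq_comm]

lemma A0_sm {x : X5} (h : x.2 ≠ 0) (a b : Fin 5) : Sm (A0 a b) x := by
  have hr := (rr_pos h).ne'
  refine Fin.cases ?_ (fun i => ?_) a <;> refine Fin.cases ?_ (fun j => ?_) b
  · exact (contDiffAt_const.div ((rr_sm h).pow 2) (pow_ne_zero 2 hr)).neg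
  · exact (th_sm h j).neg
  · exact (th_sm h i).neg
  · exact contDiffAt_const

lemma Frr_sm {F : ℝ → ℝ} {x : X5} (h : x.2 ≠ 0) (hF : ContDiffAt ℝ ∞ F (rr x)) :
    Sm (fun z => F (rr z)) x := ContDiffAt.comp x hF (rr_sm h)

lemma X0_sm {F : ℝ → ℝ} {x : X5} (h : x.2 ≠ 0) (hF : ContDiffAt ℝ ∞ F (rr x)) (a : Fin 5) :
    Sm (X0 F a) x := by
  refine Fin.cases ?_ (fun i => ?_) a
  · exact ((Frr_sm h hF).div (rr_sm h) (rr_pos h).ne').neg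
  · exact ((Frr_sm h hF).mul (yc_sm i x)).neg

lemma q0_sm {F : ℝ → ℝ} {x : X5} (h : x.2 ≠ 0) (hF : ContDiffAt ℝ ∞ F (rr x)) :
    Sm (q0 F) x := contDiffAt_const.mul (Frr_sm h hF)

/-- `y · ∂_y f`. -/
def rho (f : X5 → ℝ) : X5 → ℝ := fun x => ∑ j, yc j x * pd j.succ f x

/-- `|∂_y f|²`. -/
def gsq (f : X5 → ℝ) : X5 → ℝ := fun x => ∑ j : Fin 4, pd j.succ f x ^ 2

lemma pd_rad {φ : ℝ → ℝ} {φ' : ℝ} {x : X5} (h : x.2 ≠ 0) (hφ : HasDerivAt φ φ' (rr x)) (a : Fin 5) :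
    pd a (fun z => φ (rr z)) x
      = Fin.cases (motive := fun _ => ℝ) 0 (fun j => φ' * (yc j x / rr x)) a := by
  rw [pd_comp a hφ (rr_sm h).diff]
  refine Fin.cases ?_ (fun i => ?_) a
  · simp [pd_rr_zero h]
  · simp [pd_rr_succ h]

lemma Pv_A0_zero (Y : X5 → ℝ) (x : X5) :
    Pv A0 Y 0 x = -(1 / rr x ^ 2) * pd 0 Y x - rho Y x / rr x := by
  rw [Pv, Fin.sum_univ_succ]
  simp only [A0, Fin.cases_zero, Fin.cases_succ, rho, Finset.sum_div, sub_eq_add_neg,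
    ← Finset.sum_neg_distrib]
  congr 1
  exact Finset.sum_congr rfl fun j _ => by ring

lemma Pv_A0_succ (Y : X5 → ℝ) (x : X5) (j : Fin 4) :
    Pv A0 Y j.succ x = pd j.succ Y x - yc j x / rr x * pd 0 Y x := by
  rw [Pv, Fin.sum_univ_succ]
  simp only [A0, Fin.cases_zero, Fin.cases_succ, ite_mul, one_mul, zero_mul, Finset.sum_ite_eq,
    Finset.mem_univ, if_true]
  ring

lemma quadA_A0 (Y : X5 → ℝ) (x : X5) :
    quadA A0 Y x = -(1 / rr x ^ 2) * pd 0 Y x ^ 2 - 2 * rho Y x / rr x * pd 0 Y x + gsq Y x := by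
  rw [quadA, Fin.sum_univ_succ]
  simp only [Pv_A0_zero, Pv_A0_succ, mul_sub, Finset.sum_sub_distrib]
  have : ∑ j : Fin 4, pd j.succ Y x * (yc j x / rr x * pd 0 Y x) = rho Y x / rr x * pd 0 Y x := by
    simp only [rho, Finset.sum_div, Finset.sum_mul]
    exact Finset.sum_congr rfl fun j _ => by ring
  rw [this]
  simp only [gsq, sq]
  ring

lemma mult_X0 (F : ℝ → ℝ) (Y : X5 → ℝ) (x : X5) :
    mult (X0 F) (q0 F) Y x
      = -(F (rr x)) * (rho Y x + pd 0 Y x / rr x + Y x / 2) := by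
  rw [mult, Fin.sum_univ_succ]
  simp only [X0, q0, Fin.cases_zero, Fin.cases_succ]
  have : ∑ j, -(F (rr x) * yc j x) * pd j.succ Y x = -F (rr x) * rho Y x := by
    simp only [rho, Finset.mul_sum]
    exact Finset.sum_congr rfl fun j _ => by ring
  rw [this]; ring

lemma sum_pd_b0 (Y : X5 → ℝ) (x : X5) :
    ∑ a, b0 a x * pd a Y x = -(1 / rr x) * pd 0 Y x - 4 / rr x ^ 2 * rho Y x := by
  rw [Fin.sum_univ_succ]
  simp only [b0, Fin.cases_zero, Fin.cases_succ, rho, Finset.mul_sum, sub_eq_add_neg,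
    ← Finset.sum_neg_distrib]
  congr 1
  exact Finset.sum_congr rfl fun j _ => by ring

lemma pd_th {x : X5} (h : x.2 ≠ 0) (j : Fin 4) (i : Fin 4) :
    pd i.succ (fun z => yc j z / rr z) x
      = (if i = j then 1 else 0) / rr x - yc i x * yc j x / rr x ^ 3 := by
  have hr := rr_pos h
  have e : (fun z => yc j z / rr z) = fun z => yc j z * (fun s : ℝ => s⁻¹) (rr z) := by
    funext z; simp [div_eq_mul_inv]
  have hi : Sm (fun z => (fun s : ℝ => s⁻¹) (rr z)) x := (rr_sm h).inv hr.ne'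
  rw [e, pd_mul _ (yc_sm j x) hi, pd_rad h (hasDerivAt_inv hr.ne'), pd_yc]
  simp only [Fin.cases_succ, Fin.succ_inj]
  split_ifs <;> field_simp <;> ring

lemma pd_th_zero {x : X5} (h : x.2 ≠ 0) (j : Fin 4) : pd 0 (fun z => yc j z / rr z) x = 0 := by
  have hr := rr_pos h
  have e : (fun z => yc j z / rr z) = fun z => yc j z * (fun s : ℝ => s⁻¹) (rr z) := by
    funext z; simp [div_eq_mul_inv]
  have hi : Sm (fun z => (fun s : ℝ => s⁻¹) (rr z)) x := (rr_sm h).inv hr.ne'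
  rw [e, pd_mul _ (yc_sm j x) hi, pd_rad h (hasDerivAt_inv hr.ne'), pd_yc]
  simp [(Fin.succ_ne_zero _).symm]

lemma sum_yc_sq (x : X5) : ∑ j, yc j x * yc j x = rr x ^ 2 := by
  rw [rr_sq]; exact Finset.sum_congr rfl fun j _ => by ring

lemma pd_X0_tau {F : ℝ → ℝ} {F' : ℝ} {x : X5} (h : x.2 ≠ 0)
    (hF : ContDiffAt ℝ ∞ F (rr x)) (hF' : HasDerivAt F F' (rr x)) (c : Fin 5) :
    pd 0 (X0 F c) x = 0 := by
  have hr0 := (rr_pos h).ne'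
  refine Fin.cases ?_ (fun j => ?_) c
  · have e : X0 F 0 = fun z => (fun s : ℝ => -(F s / s)) (rr z) := rfl
    have hd : DifferentiableAt ℝ (fun s : ℝ => -(F s / s)) (rr x) :=
      (hF'.differentiableAt.div differentiableAt_id hr0).neg
    rw [e, pd_rad h hd.hasDerivAt]; rfl
  · have e : X0 F j.succ = fun z => -(fun z => F (rr z) * yc j z) z := rfl
    rw [e, pd_neg, pd_mul 0 (Frr_sm h hF) (yc_sm j x), pd_rad h hF', pd_yc]
    simp [(Fin.succ_ne_zero _).symm]

lemma pd_X0_succ {F : ℝ → ℝ} {F' : ℝ} {x : X5} (h : x.2 ≠ 0)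
    (hF : ContDiffAt ℝ ∞ F (rr x)) (hF' : HasDerivAt F F' (rr x)) (i j : Fin 4) :
    pd i.succ (X0 F j.succ) x
      = -(F' * (yc i x / rr x) * yc j x) - F (rr x) * if i = j then 1 else 0 := by
  have e : X0 F j.succ = fun z => -(fun z => F (rr z) * yc j z) z := rfl
  rw [e, pd_neg, pd_mul _ (Frr_sm h hF) (yc_sm j x), pd_rad h hF', pd_yc]
  simp only [Fin.cases_succ, Fin.succ_inj]; ring

lemma pd_X0_zero {F : ℝ → ℝ} {F' : ℝ} {x : X5} (h : x.2 ≠ 0)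
    (hF' : HasDerivAt F F' (rr x)) (i : Fin 4) :
    pd i.succ (X0 F 0) x = -((F' / rr x - F (rr x) / rr x ^ 2) * (yc i x / rr x)) := by
  have hr0 := (rr_pos h).ne'
  have e : X0 F 0 = fun z => (fun s : ℝ => -(F s / s)) (rr z) := rfl
  have hd : HasDerivAt (fun s : ℝ => -(F s / s)) (-((F' * rr x - F (rr x) * 1) / rr x ^ 2))
      (rr x) := (hF'.div (hasDerivAt_id _) hr0).neg
  rw [e, pd_rad h hd]
  simp only [Fin.cases_succ]
  field_simp

/-- The bulk density of the model operator for the multiplier `-F (y·∂_y + r⁻¹∂_τ + ½)`. -/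
lemma Bq_A0 {F : ℝ → ℝ} {F' : ℝ} {Y : X5 → ℝ} {x : X5} (h : x.2 ≠ 0)
    (hF : ContDiffAt ℝ ∞ F (rr x)) (hF' : HasDerivAt F F' (rr x)) :
    Bq A0 (X0 F) (q0 F) Y x + mult (X0 F) (q0 F) Y x * ∑ a, b0 a x * pd a Y x
      = (rr x * F' / 2 + 7 / 2 * F (rr x)) * (rho Y x / rr x) ^ 2
        + (rr x * F' / 2 + 2 * F (rr x)) * (rho Y x / rr x) * (Y x / rr x)
        - (rr x * F' / 2 + 1 / 2 * F (rr x)) * (gsq Y x - (rho Y x / rr x) ^ 2)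
        - (rr x * F' / 2 + 1 / 2 * F (rr x)) * (pd 0 Y x / rr x) ^ 2
        + (rr x * F' + 3 * F (rr x)) / rr x * (rho Y x / rr x) * (pd 0 Y x / rr x)
        - (rr x * F' / 2 + F (rr x)) * Y x * pd 0 Y x / rr x := by
  have hr := rr_pos h
  have hr0 := hr.ne'
  have hdA : ∑ a, ∑ b, pd a (A0 a b) x * pd b Y x = -(3 / rr x) * pd 0 Y x := by
    have e0 : ∀ b, pd 0 (A0 0 b) x = 0 := by
      intro b
      refine Fin.cases ?_ (fun j => ?_) b
      · have e : A0 0 0 = fun z => (fun s : ℝ => -(1 / s ^ 2)) (rr z) := rfl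
        have hd : DifferentiableAt ℝ (fun s : ℝ => -(1 / s ^ 2)) (rr x) := by
          fun_prop (disch := positivity)
        rw [e, pd_rad h hd.hasDerivAt]; rfl
      · have e : A0 0 j.succ = fun z => -(fun z => yc j z / rr z) z := rfl
        rw [e, pd_neg, pd_th_zero h, neg_zero]
    have e1 : ∀ (i : Fin 4) (j : Fin 4), pd i.succ (A0 i.succ j.succ) x = 0 := by
      intro i j
      have e : A0 i.succ j.succ = fun _ => if i = j then 1 else 0 := rfl
      rw [e, pd_const]
    have e2 : ∀ i : Fin 4, pd i.succ (A0 i.succ 0) x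
        = -(1 / rr x) + yc i x * yc i x * (1 / rr x ^ 3) := by
      intro i
      have e : A0 i.succ 0 = fun z => -(fun z => yc i z / rr z) z := rfl
      rw [e, pd_neg, pd_th h, if_pos rfl]; ring
    rw [Fin.sum_univ_succ]
    simp only [e0, zero_mul, Finset.sum_const_zero, zero_add]
    have e3 : ∀ i : Fin 4, ∑ b, pd i.succ (A0 i.succ b) x * pd b Y x
        = (-(1 / rr x) + yc i x * yc i x * (1 / rr x ^ 3)) * pd 0 Y x := by
      intro i
      rw [Fin.sum_univ_succ]; simp [e1, e2]
    simp only [e3, ← Finset.sum_mul, Finset.sum_add_distrib, sum_yc_sq]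
    simp only [Finset.sum_const, Finset.card_univ, Fintype.card_fin, nsmul_eq_mul]
    field_simp; push_cast; ring
  have hpF := fun a => pd_rad h hF' a
  have hX0 := pd_X0_tau h hF hF'
  have hXs := pd_X0_succ h hF hF'
  have hXs0 := pd_X0_zero h hF'
  have hPy : ∑ j : Fin 4, Pv A0 Y j.succ x * yc j x = rho Y x - rr x * pd 0 Y x := by
    simp only [Pv_A0_succ, sub_mul, Finset.sum_sub_distrib, rho]
    have : ∑ j, yc j x / rr x * pd 0 Y x * yc j x = (∑ j, yc j x * yc j x) * (pd 0 Y x / rr x) := by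
      rw [Finset.sum_mul]; exact Finset.sum_congr rfl fun j _ => by ring
    rw [this, sum_yc_sq]
    have e2 : rr x ^ 2 * (pd 0 Y x / rr x) = rr x * pd 0 Y x := by field_simp
    rw [e2]
    congr 1
    exact Finset.sum_congr rfl fun j _ => by ring
  have hPY : ∑ j : Fin 4, Pv A0 Y j.succ x * pd j.succ Y x
      = gsq Y x - rho Y x / rr x * pd 0 Y x := by
    simp only [Pv_A0_succ, sub_mul, Finset.sum_sub_distrib, rho, gsq, Finset.sum_div,
      Finset.sum_mul]
    congr 1
    · exact Finset.sum_congr rfl fun j _ => by ring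
    · exact Finset.sum_congr rfl fun j _ => by ring
  have hPX : ∑ a, Pv A0 Y a x * (∑ c, pd a (X0 F c) x * pd c Y x)
      = -(F' / rr x) * rho Y x * (rho Y x - rr x * pd 0 Y x)
        - F (rr x) * (gsq Y x - rho Y x / rr x * pd 0 Y x)
        - (F' / rr x - F (rr x) / rr x ^ 2) / rr x * pd 0 Y x * (rho Y x - rr x * pd 0 Y x) := by
    rw [Fin.sum_univ_succ]
    simp only [hX0, zero_mul, Finset.sum_const_zero, mul_zero, zero_add]
    have e : ∀ i : Fin 4, ∑ c, pd i.succ (X0 F c) x * pd c Y x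
        = -(F' / rr x) * rho Y x * yc i x - F (rr x) * pd i.succ Y x
          - (F' / rr x - F (rr x) / rr x ^ 2) / rr x * pd 0 Y x * yc i x := by
      intro i
      rw [Fin.sum_univ_succ, hXs0]
      simp only [hXs, sub_mul, Finset.sum_sub_distrib, mul_assoc, ite_mul, one_mul, zero_mul,
        mul_ite, mul_zero, Finset.sum_ite_eq, Finset.mem_univ, if_true]
      have : ∑ j, -(F' * (yc i x / rr x * yc j x)) * pd j.succ Y x
          = -(F' / rr x) * (rho Y x * yc i x) := by
        simp only [rho, Finset.mul_sum, Finset.sum_mul]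
        exact Finset.sum_congr rfl fun j _ => by ring
      rw [this]; ring
    rw [← hPy, ← hPY]
    simp only [e, Finset.mul_sum]
    rw [← Finset.sum_sub_distrib, ← Finset.sum_sub_distrib]
    exact Finset.sum_congr rfl fun j _ => by ring
  have hPq : ∑ a, Pv A0 Y a x * pd a (q0 F) x
      = -(1 / 2) * (F' / rr x) * (rho Y x - rr x * pd 0 Y x) := by
    have e : ∀ a, pd a (q0 F) x = -(1 / 2) * pd a (fun z => F (rr z)) x := fun a => pd_const_mul _ _ _ _
    rw [Fin.sum_univ_succ, ← hPy, Finset.mul_sum]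
    simp only [e, hpF, Fin.cases_zero, Fin.cases_succ, mul_zero, zero_add]
    exact Finset.sum_congr rfl fun j _ => by ring
  have hdiv : ∑ a, pd a (X0 F a) x = -(rr x * F') - 4 * F (rr x) := by
    rw [Fin.sum_univ_succ, hX0]
    simp only [hXs, if_true, mul_one, Finset.sum_sub_distrib, Finset.sum_const, Finset.card_univ,
      Fintype.card_fin, nsmul_eq_mul]
    have : ∑ i, -(F' * (yc i x / rr x) * yc i x) = -(F' / rr x) * ∑ i, yc i x * yc i x := by
      rw [Finset.mul_sum]; exact Finset.sum_congr rfl fun j _ => by ring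
    rw [this, sum_yc_sq]; field_simp; push_cast; ring
  have hXA : ∑ c, X0 F c x * (∑ a, ∑ b, pd c (A0 a b) x * pd a Y x * pd b Y x)
      = -(2 * F (rr x) / rr x ^ 2) * pd 0 Y x ^ 2 := by
    rw [Finset.sum_congr rfl fun c _ => Finset.mul_sum _ _ _, Finset.sum_comm]
    have e : ∀ a, ∑ c, X0 F c x * ∑ b, pd c (A0 a b) x * pd a Y x * pd b Y x
        = ∑ b, (∑ c, X0 F c x * pd c (A0 a b) x) * (pd a Y x * pd b Y x) := by
      intro a
      simp only [Finset.mul_sum, Finset.sum_mul]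
      rw [Finset.sum_comm]
      exact Finset.sum_congr rfl fun b _ => Finset.sum_congr rfl fun c _ => by ring
    simp only [e]
    have hth : ∀ j : Fin 4, ∑ c, X0 F c x * pd c (fun z => -(fun z => yc j z / rr z) z) x = 0 := by
      intro j
      rw [Fin.sum_univ_succ]
      simp only [pd_neg, pd_th_zero h, pd_th h, X0, Fin.cases_succ]
      have : ∑ i : Fin 4, -(F (rr x) * yc i x) * -((if i = j then 1 else 0) / rr x
            - yc i x * yc j x / rr x ^ 3)
          = ∑ i : Fin 4, (if i = j then F (rr x) * yc i x / rr x else 0)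
            - F (rr x) * yc j x / rr x ^ 3 * ∑ i, yc i x * yc i x := by
        rw [Finset.mul_sum, ← Finset.sum_sub_distrib]
        exact Finset.sum_congr rfl fun j _ => by split_ifs <;> ring
      rw [this, sum_yc_sq]
      simp only [Finset.sum_ite_eq', Finset.mem_univ, if_true]
      field_simp
      simp
    have h00 : ∑ c, X0 F c x * pd c (A0 0 0) x = -(2 * F (rr x) / rr x ^ 2) := by
      have e : A0 0 0 = fun z => (fun s : ℝ => -((s ^ 2)⁻¹)) (rr z) := by
        funext z; simp [A0]
      have hd : HasDerivAt (fun s : ℝ => -((s ^ 2)⁻¹)) (2 / rr x ^ 3) (rr x) := by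
        have := ((hasDerivAt_pow 2 (rr x)).inv (pow_ne_zero 2 hr0)).neg
        exact this.congr_deriv (by field_simp; norm_num [mul_comm])
      rw [e, Fin.sum_univ_succ]
      simp only [pd_rad h hd, X0, Fin.cases_zero, Fin.cases_succ]
      have : ∑ i : Fin 4, -(F (rr x) * yc i x) * (2 / rr x ^ 3 * (yc i x / rr x))
          = -(2 * F (rr x) / rr x ^ 4) * ∑ i, yc i x * yc i x := by
        rw [Finset.mul_sum]; exact Finset.sum_congr rfl fun j _ => by field_simp
      rw [this, sum_yc_sq]; field_simp; ring
    have h0j : ∀ j : Fin 4, ∑ c, X0 F c x * pd c (A0 0 j.succ) x = 0 := hth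
    have hj0 : ∀ j : Fin 4, ∑ c, X0 F c x * pd c (A0 j.succ 0) x = 0 := hth
    have hij : ∀ i j : Fin 4, ∑ c, X0 F c x * pd c (A0 i.succ j.succ) x = 0 := by
      intro i j
      have e : A0 i.succ j.succ = fun _ => if i = j then 1 else 0 := rfl
      simp [e, pd_const]
    have r0 : ∑ b, (∑ c, X0 F c x * pd c (A0 0 b) x) * (pd 0 Y x * pd b Y x)
        = -(2 * F (rr x) / rr x ^ 2) * pd 0 Y x ^ 2 := by
      rw [Fin.sum_univ_succ, h00]
      simp only [h0j, zero_mul, Finset.sum_const_zero, add_zero]; ring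
    have rj : ∀ i : Fin 4, ∑ b, (∑ c, X0 F c x * pd c (A0 i.succ b) x)
        * (pd i.succ Y x * pd b Y x) = 0 := by
      intro i
      rw [Fin.sum_univ_succ, hj0]
      simp only [hij, zero_mul, Finset.sum_const_zero, add_zero]
    rw [Fin.sum_univ_succ, r0]
    simp only [rj, Finset.sum_const_zero, add_zero]
  rw [Bq, hdA, hPX, hPq, hdiv, hXA, quadA_A0, mult_X0, sum_pd_b0]
  simp only [q0]
  field_simp
  ring

/-! ### Perturbations of the model operator -/

/-- Relative size of a coefficient index: `1/r` for the `τ` index, `1` for a `y` index. -/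
def sw (r : ℝ) : Fin 5 → ℝ := Fin.cases (1 / r) (fun _ => 1)

/-- Cost of a derivative: `1` for `∂_τ`, `1/r` for `∂_{y_j}`. -/
def dw (r : ℝ) : Fin 5 → ℝ := Fin.cases 1 (fun _ => 1 / r)

lemma sw_dw (r : ℝ) (a : Fin 5) : dw r a * sw r a = 1 / r := by
  refine Fin.cases ?_ (fun _ => ?_) a <;> simp [sw, dw]

lemma sw_pos {r : ℝ} (hr : 0 < r) (a : Fin 5) : 0 < sw r a := by
  refine Fin.cases ?_ (fun _ => ?_) a <;> simp [sw, hr]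

lemma sw_le {r : ℝ} (hr : 1 ≤ r) (a : Fin 5) : sw r a ≤ 1 := by
  refine Fin.cases ?_ (fun _ => ?_) a
  · simp only [sw, Fin.cases_zero]; rw [div_le_one (by linarith)]; exact hr
  · simp [sw]

/-- The first-order jet of `Y` at `x`, weighted by `sw`. -/
def jet (Y : X5 → ℝ) (x : X5) : ℝ := ∑ a, sw (rr x) a * |pd a Y x| + |Y x| / rr x

section
variable {K : Fin 5 → Fin 5 → X5 → ℝ} {X b : Fin 5 → X5 → ℝ} {q c Y : X5 → ℝ} {x : X5}

lemma sum_sw_le_jet (hr : 0 < rr x) : ∑ a, sw (rr x) a * |pd a Y x| ≤ jet Y x := by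
  have : 0 ≤ |Y x| / rr x := by positivity
  unfold jet; linarith

lemma sw_pd_le_jet (hr : 0 < rr x) (a : Fin 5) : sw (rr x) a * |pd a Y x| ≤ jet Y x :=
  (Finset.single_le_sum (f := fun a => sw (rr x) a * |pd a Y x|)
    (fun a _ => mul_nonneg (sw_pos hr a).le (abs_nonneg _)) (Finset.mem_univ a)).trans
    (sum_sw_le_jet hr)

lemma jet_nonneg (hr : 0 < rr x) : 0 ≤ jet Y x :=
  (mul_nonneg (sw_pos hr 0).le (abs_nonneg _)).trans (sw_pd_le_jet hr 0)

lemma abs_Pv_le {η : ℝ} (hr : 0 < rr x)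
    (hK : ∀ a b, |K a b x| ≤ η * sw (rr x) a * sw (rr x) b) (hη : 0 ≤ η) (a : Fin 5) :
    |Pv K Y a x| ≤ η * sw (rr x) a * jet Y x := by
  calc |Pv K Y a x| ≤ ∑ b, |K a b x * pd b Y x| := Finset.abs_sum_le_sum_abs _ _
    _ ≤ ∑ b, η * sw (rr x) a * (sw (rr x) b * |pd b Y x|) := by
        refine Finset.sum_le_sum fun b _ => ?_
        rw [abs_mul]
        calc _ ≤ η * sw (rr x) a * sw (rr x) b * |pd b Y x| := by gcongr; exact hK a b
          _ = _ := by ring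
    _ = η * sw (rr x) a * ∑ b, sw (rr x) b * |pd b Y x| := by rw [Finset.mul_sum]
    _ ≤ _ := by
        have := sw_pos hr a
        gcongr; exact sum_sw_le_jet hr

lemma abs_quadA_le {η : ℝ} (hr : 0 < rr x)
    (hK : ∀ a b, |K a b x| ≤ η * sw (rr x) a * sw (rr x) b) (hη : 0 ≤ η) :
    |quadA K Y x| ≤ η * jet Y x ^ 2 := by
  have hj := jet_nonneg (Y := Y) hr
  calc |quadA K Y x| ≤ ∑ a, |pd a Y x * Pv K Y a x| := Finset.abs_sum_le_sum_abs _ _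
    _ ≤ ∑ a, η * jet Y x * (sw (rr x) a * |pd a Y x|) := by
        refine Finset.sum_le_sum fun a _ => ?_
        rw [abs_mul]
        calc _ ≤ |pd a Y x| * (η * sw (rr x) a * jet Y x) := by
              gcongr; exact abs_Pv_le hr hK hη a
          _ = _ := by ring
    _ = η * jet Y x * ∑ b, sw (rr x) b * |pd b Y x| := by rw [Finset.mul_sum]
    _ ≤ η * jet Y x * jet Y x := by gcongr; exact sum_sw_le_jet hr
    _ = _ := by ring

lemma abs_mult_le {φ : ℝ} (hX : ∀ a, |X a x| ≤ φ * sw (rr x) a)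
    (hq : |q x| ≤ φ / rr x) : |mult X q Y x| ≤ φ * jet Y x := by
  calc |mult X q Y x| ≤ |∑ c, X c x * pd c Y x| + |q x * Y x| := abs_add_le _ _
    _ ≤ ∑ c, |X c x * pd c Y x| + |q x * Y x| := by gcongr; exact Finset.abs_sum_le_sum_abs _ _
    _ ≤ ∑ c, φ * (sw (rr x) c * |pd c Y x|) + φ * (|Y x| / rr x) := by
        gcongr with c
        · rw [abs_mul]
          calc _ ≤ φ * sw (rr x) c * |pd c Y x| := by gcongr; exact hX c
            _ = _ := by ring
        · rw [abs_mul]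
          calc _ ≤ φ / rr x * |Y x| := by gcongr
            _ = _ := by ring
    _ = _ := by rw [← Finset.mul_sum, jet]; ring

/-- The bulk density of a perturbation `k^{ab}∂_a∂_b + b^a∂_a + c` that is small relative to the
weights `sw`, `dw` is bounded by the squared jet. -/
lemma abs_Bq_le {η φ φ' : ℝ} (hr : 0 < rr x) (hη : 0 ≤ η) (hφ : 0 ≤ φ) (hφ' : 0 ≤ φ')
    (hK : ∀ a b, |K a b x| ≤ η * sw (rr x) a * sw (rr x) b)
    (hdK : ∀ c a b, |pd c (K a b) x| ≤ η * dw (rr x) c * (sw (rr x) a * sw (rr x) b))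
    (hX : ∀ a, |X a x| ≤ φ * sw (rr x) a) (hq : |q x| ≤ φ / rr x)
    (hsw : ∀ a, sw (rr x) a ≤ 1)
    (hdX : ∀ a c, |pd a (X c) x| ≤ φ' * sw (rr x) c)
    (hdq : ∀ a, |pd a q x| ≤ φ' / rr x)
    (hb : ∀ a, |b a x| ≤ η * sw (rr x) a / rr x) (hc : |c x| ≤ η / rr x ^ 2) :
    |Bq K X q Y x + mult X q Y x * (∑ a, b a x * pd a Y x + c x * Y x)|
      ≤ 30 * η * (φ / rr x + φ') * jet Y x ^ 2 := by
  set T := jet Y x with hT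
  have hT0 : 0 ≤ T := jet_nonneg hr
  have hs := fun a => (sw_pos hr a).le
  have hm : |mult X q Y x| ≤ φ * T := abs_mult_le hX hq
  have hP : ∀ a, |Pv K Y a x| ≤ η * T := fun a =>
    (abs_Pv_le hr hK hη a).trans (by
      have := hsw a
      calc η * sw (rr x) a * T ≤ η * 1 * T := by gcongr
        _ = _ := by ring)
  have hS : |quadA K Y x| ≤ η * T ^ 2 := abs_quadA_le hr hK hη
  have hz : ∑ a, sw (rr x) a * |pd a Y x| ≤ T := sum_sw_le_jet hr
  have hY : |Y x| / rr x ≤ T := by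
    have : 0 ≤ ∑ a, sw (rr x) a * |pd a Y x| :=
      Finset.sum_nonneg fun a _ => mul_nonneg (hs a) (abs_nonneg _)
    rw [hT, jet]; linarith
  have h1 : |∑ a, ∑ b, pd a (K a b) x * pd b Y x| ≤ 5 * (η / rr x * T) := by
    refine (Finset.abs_sum_le_sum_abs _ _).trans ?_
    have : ∀ a, |∑ b, pd a (K a b) x * pd b Y x| ≤ η / rr x * T := by
      intro a
      calc _ ≤ ∑ b, |pd a (K a b) x * pd b Y x| := Finset.abs_sum_le_sum_abs _ _
        _ ≤ ∑ b, η / rr x * (sw (rr x) b * |pd b Y x|) := by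
            refine Finset.sum_le_sum fun b _ => ?_
            rw [abs_mul]
            calc _ ≤ η * dw (rr x) a * (sw (rr x) a * sw (rr x) b) * |pd b Y x| := by
                  gcongr; exact hdK a a b
              _ = η * (dw (rr x) a * sw (rr x) a) * (sw (rr x) b * |pd b Y x|) := by ring
              _ = _ := by rw [sw_dw]; ring
        _ = η / rr x * ∑ b, sw (rr x) b * |pd b Y x| := by rw [Finset.mul_sum]
        _ ≤ _ := by gcongr
    calc _ ≤ ∑ _a : Fin 5, η / rr x * T := Finset.sum_le_sum fun a _ => this a
      _ = _ := by simp
  have h2 : |∑ a, Pv K Y a x * (∑ c, pd a (X c) x * pd c Y x)| ≤ 5 * (η * T * (φ' * T)) := by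
    refine (Finset.abs_sum_le_sum_abs _ _).trans ?_
    have : ∀ a, |∑ c, pd a (X c) x * pd c Y x| ≤ φ' * T := by
      intro a
      calc _ ≤ ∑ b, |pd a (X b) x * pd b Y x| := Finset.abs_sum_le_sum_abs _ _
        _ ≤ ∑ b, φ' * (sw (rr x) b * |pd b Y x|) := by
            refine Finset.sum_le_sum fun b _ => ?_
            rw [abs_mul]
            calc _ ≤ φ' * sw (rr x) b * |pd b Y x| := by gcongr; exact hdX a b
              _ = _ := by ring
        _ = φ' * ∑ b, sw (rr x) b * |pd b Y x| := by rw [Finset.mul_sum]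
        _ ≤ _ := by gcongr
    calc _ ≤ ∑ _a : Fin 5, η * T * (φ' * T) := Finset.sum_le_sum fun a _ => by
            rw [abs_mul]; gcongr; exacts [hP a, this a]
      _ = _ := by simp
  have h3 : |Y x * ∑ a, Pv K Y a x * pd a q x| ≤ 5 * (η * T * (φ' * T)) := by
    rw [abs_mul]
    calc _ ≤ |Y x| * ∑ _a : Fin 5, η * T * (φ' / rr x) := by
            gcongr
            refine (Finset.abs_sum_le_sum_abs _ _).trans (Finset.sum_le_sum fun a _ => ?_)
            rw [abs_mul]; gcongr; exacts [hP a, hdq a]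
      _ = 5 * (η * T * (φ' * (|Y x| / rr x))) := by simp; ring
      _ ≤ _ := by gcongr
  have h4 : |q x * quadA K Y x| ≤ φ / rr x * (η * T ^ 2) := by
    rw [abs_mul]; gcongr
  have h5 : |(∑ a, pd a (X a) x) * quadA K Y x| ≤ 5 * φ' * (η * T ^ 2) := by
    rw [abs_mul]; gcongr
    calc _ ≤ ∑ a, |pd a (X a) x| := Finset.abs_sum_le_sum_abs _ _
      _ ≤ ∑ _a : Fin 5, φ' := Finset.sum_le_sum fun a _ => (hdX a a).trans (by
          have := hsw a; calc φ' * sw (rr x) a ≤ φ' * 1 := by gcongr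
                      _ = φ' := mul_one _)
      _ = _ := by simp
  have h6 : |∑ c, X c x * (∑ a, ∑ b, pd c (K a b) x * pd a Y x * pd b Y x)|
      ≤ 5 * (φ / rr x * (η * T ^ 2)) := by
    refine (Finset.abs_sum_le_sum_abs _ _).trans ?_
    have : ∀ c, |∑ a, ∑ b, pd c (K a b) x * pd a Y x * pd b Y x|
        ≤ η * dw (rr x) c * T ^ 2 := by
      intro c
      have hd : 0 ≤ dw (rr x) c := by
        refine Fin.cases ?_ (fun _ => ?_) c <;> simp [dw, hr.le]
      calc _ ≤ ∑ a, ∑ b, |pd c (K a b) x * pd a Y x * pd b Y x| :=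
            (Finset.abs_sum_le_sum_abs _ _).trans
              (Finset.sum_le_sum fun a _ => Finset.abs_sum_le_sum_abs _ _)
        _ ≤ ∑ a, ∑ b, η * dw (rr x) c * ((sw (rr x) a * |pd a Y x|) * (sw (rr x) b * |pd b Y x|)) := by
            refine Finset.sum_le_sum fun a _ => Finset.sum_le_sum fun b _ => ?_
            rw [abs_mul, abs_mul]
            calc _ ≤ η * dw (rr x) c * (sw (rr x) a * sw (rr x) b) * |pd a Y x| * |pd b Y x| := by
                  gcongr; exact hdK c a b
              _ = _ := by ring
        _ = η * dw (rr x) c * ((∑ a, sw (rr x) a * |pd a Y x|) * (∑ a, sw (rr x) a * |pd a Y x|)) := by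
            rw [Finset.sum_mul_sum]; simp only [Finset.mul_sum]
        _ ≤ η * dw (rr x) c * (T * T) := by
            have : 0 ≤ ∑ a, sw (rr x) a * |pd a Y x| :=
              Finset.sum_nonneg fun a _ => mul_nonneg (hs a) (abs_nonneg _)
            gcongr
        _ = _ := by ring
    calc _ ≤ ∑ c : Fin 5, φ / rr x * (η * T ^ 2) := Finset.sum_le_sum fun c _ => by
            rw [abs_mul]
            calc _ ≤ φ * sw (rr x) c * (η * dw (rr x) c * T ^ 2) := by
                  have hsc := hs c
                  gcongr; exacts [hX c, this c]
              _ = φ * (dw (rr x) c * sw (rr x) c) * (η * T ^ 2) := by ring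
              _ = _ := by rw [sw_dw]; ring
      _ = _ := by simp
  have h7 : |∑ a, b a x * pd a Y x + c x * Y x| ≤ η / rr x * T := by
    calc _ ≤ ∑ a, |b a x * pd a Y x| + |c x * Y x| :=
          (abs_add_le _ _).trans (by gcongr; exact Finset.abs_sum_le_sum_abs _ _)
      _ ≤ ∑ a, η / rr x * (sw (rr x) a * |pd a Y x|) + η / rr x * (|Y x| / rr x) := by
          gcongr with a
          · rw [abs_mul]
            calc _ ≤ η * sw (rr x) a / rr x * |pd a Y x| := by gcongr; exact hb a
              _ = _ := by ring
          · rw [abs_mul]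
            calc _ ≤ η / rr x ^ 2 * |Y x| := by gcongr
              _ = _ := by field_simp
      _ = _ := by rw [← Finset.mul_sum, hT, jet]; ring
  have h8 : |mult X q Y x * (∑ a, b a x * pd a Y x + c x * Y x)| ≤ φ * T * (η / rr x * T) := by
    rw [abs_mul]; gcongr
  have h9 : |mult X q Y x * (∑ a, ∑ b, pd a (K a b) x * pd b Y x)|
      ≤ φ * T * (5 * (η / rr x * T)) := by
    rw [abs_mul]; gcongr
  have hp1 : 0 ≤ η * φ / rr x * T ^ 2 := by positivity
  have hp2 : 0 ≤ η * φ' * T ^ 2 := by positivity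
  unfold Bq
  rw [abs_le] at h2 h3 h4 h5 h6 h8 h9 ⊢
  have e1 : φ * T * (5 * (η / rr x * T)) = 5 * (η * φ / rr x * T ^ 2) := by ring
  have e2 : 5 * (η * T * (φ' * T)) = 5 * (η * φ' * T ^ 2) := by ring
  have e3 : φ / rr x * (η * T ^ 2) = η * φ / rr x * T ^ 2 := by ring
  have e4 : 5 * φ' * (η * T ^ 2) = 5 * (η * φ' * T ^ 2) := by ring
  have e5 : φ * T * (η / rr x * T) = η * φ / rr x * T ^ 2 := by ring
  have e6 : 30 * η * (φ / rr x + φ') * T ^ 2 = 30 * (η * φ / rr x * T ^ 2) + 30 * (η * φ' * T ^ 2) := by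
    ring
  rw [e1] at h9
  rw [e2] at h2 h3
  rw [e3] at h4 h6
  rw [e4] at h5
  rw [e5] at h8
  rw [e6]
  constructor <;> linarith [h2.1, h2.2, h3.1, h3.2, h4.1, h4.2, h5.1, h5.2, h6.1, h6.2, h8.1, h8.2, h9.1, h9.2]
end

/-! ### Weights and pointwise energy densities -/

/-- Admissible radial weights `κ v`: `κ` is a cutoff supported in `R ≤ r ≤ R'`, and the logarithmic
derivative `r v'/v` lies in `[-2 + δ, 3/2 - 2α]`. -/
structure Weight (R R' δ α : ℝ) (κ v : ℝ → ℝ) : Prop where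
  smooth_κ : ∀ r, 0 < r → ContDiffAt ℝ ∞ κ r
  smooth_v : ∀ r, 0 < r → ContDiffAt ℝ ∞ v r
  nonneg : ∀ r, 0 ≤ κ r
  zero_in : ∀ r, r ≤ R → κ r = 0
  zero_out : ∀ r, R' ≤ r → κ r = 0
  pos : ∀ r, 0 < r → 0 < v r
  low : ∀ r, R ≤ r → (-2 + δ) * v r ≤ r * deriv v r
  high : ∀ r, R ≤ r → r * deriv v r ≤ (3 / 2 - 2 * α) * v r

/-- `r⁻³ κ v`. -/
def om (κ v : ℝ → ℝ) (r : ℝ) : ℝ := κ r * v r / r ^ 3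
/-- `r⁻³ κ' v`. -/
def omd (κ v : ℝ → ℝ) (r : ℝ) : ℝ := deriv κ r * v r / r ^ 3
/-- `r⁻⁴ κ v`, the coefficient of the multiplier field. -/
def Fw (κ v : ℝ → ℝ) (r : ℝ) : ℝ := κ r * v r / r ^ 4
/-- `r v' / v`. -/
def ldv (v : ℝ → ℝ) (r : ℝ) : ℝ := r * deriv v r / v r

/-- A small second-order perturbation of the model operator near `τ ∈ [τ₁, τ₂]`, `r ≥ R`, with
relative size `η`, and a smooth function `Y` there. -/
structure Perturbed (R τ₁ τ₂ η : ℝ) (K : Fin 5 → Fin 5 → X5 → ℝ) (b : Fin 5 → X5 → ℝ)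
    (c Y : X5 → ℝ) : Prop where
  one_le : 1 ≤ R
  inv_le : 1 / R ≤ η
  symm : ∀ a b z, K a b z = K b a z
  smK : ∀ x : X5, x.1 ∈ Icc τ₁ τ₂ → R ≤ rr x → ∀ a b, Sm (K a b) x
  smb : ∀ x : X5, x.1 ∈ Icc τ₁ τ₂ → R ≤ rr x → ∀ a, Sm (b a) x
  smc : ∀ x : X5, x.1 ∈ Icc τ₁ τ₂ → R ≤ rr x → Sm c x
  smY : ∀ x : X5, x.1 ∈ Icc τ₁ τ₂ → R ≤ rr x → Sm Y x
  K_le : ∀ x : X5, x.1 ∈ Icc τ₁ τ₂ → R ≤ rr x → ∀ a b, |K a b x| ≤ η * sw (rr x) a * sw (rr x) b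
  dK_le : ∀ x : X5, x.1 ∈ Icc τ₁ τ₂ → R ≤ rr x → ∀ c a b,
    |pd c (K a b) x| ≤ η * dw (rr x) c * (sw (rr x) a * sw (rr x) b)
  b_le : ∀ x : X5, x.1 ∈ Icc τ₁ τ₂ → R ≤ rr x → ∀ a, |b a x| ≤ η * sw (rr x) a / rr x
  c_le : ∀ x : X5, x.1 ∈ Icc τ₁ τ₂ → R ≤ rr x → |c x| ≤ η / rr x ^ 2

/-- The full operator: model operator plus perturbation, applied to `Y`. -/
def opL (K : Fin 5 → Fin 5 → X5 → ℝ) (b : Fin 5 → X5 → ℝ) (c Y : X5 → ℝ) : X5 → ℝ := fun x =>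
  L2 (fun a b z => A0 a b z + K a b z) Y x + ∑ a, (b0 a x + b a x) * pd a Y x + c x * Y x

/-- The radial derivative `Y_r`. -/
def ya (Y : X5 → ℝ) (x : X5) : ℝ := rho Y x / rr x
/-- The weighted sum of squares of the jet of `Y` controlled by the bulk. -/
def bulkN (Y : X5 → ℝ) (x : X5) : ℝ := gsq Y x + (Y x / rr x) ^ 2 + (pd 0 Y x / rr x) ^ 2

/-- Zeroth-order correction of the energy density. -/
def exd (κ v : ℝ → ℝ) (Y : X5 → ℝ) : X5 → ℝ := fun z =>
  -(1 / 4) * ((om κ v (rr z) * (ldv v (rr z) - 2) / rr z - omd κ v (rr z)) / rr z) * Y z ^ 2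

/-- The energy density. -/
def edens (K : Fin 5 → Fin 5 → X5 → ℝ) (κ v : ℝ → ℝ) (Y : X5 → ℝ) : X5 → ℝ := fun z =>
  cur (fun a b z => A0 a b z + K a b z) (X0 (Fw κ v)) (q0 (Fw κ v)) Y 0 z + exd κ v Y z

/-- A radial current `g(r) y_j Y²`. -/
def hcur (g : ℝ → ℝ) (Y : X5 → ℝ) (j : Fin 4) : X5 → ℝ := fun z => g (rr z) * yc j z * Y z ^ 2

/-- The spatial current of the energy identity, including the Hardy current. -/
def scur (K : Fin 5 → Fin 5 → X5 → ℝ) (κ v : ℝ → ℝ) (Y : X5 → ℝ) (j : Fin 4) : X5 → ℝ := fun z =>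
  cur (fun a b z => A0 a b z + K a b z) (X0 (Fw κ v)) (q0 (Fw κ v)) Y j.succ z
    + hcur (fun r => 1 / 2 * Fw κ v r / r ^ 2) Y j z

lemma div_hcur {g : ℝ → ℝ} {g' : ℝ} {Y : X5 → ℝ} {x : X5} (h : x.2 ≠ 0)
    (hg : ContDiffAt ℝ ∞ g (rr x)) (hg' : HasDerivAt g g' (rr x)) (hY : Sm Y x) :
    ∑ j : Fin 4, pd j.succ (hcur g Y j) x
      = (rr x * g' + 4 * g (rr x)) * Y x ^ 2 + 2 * g (rr x) * Y x * rho Y x := by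
  have hr := rr_pos h
  have e : ∀ j : Fin 4, pd j.succ (hcur g Y j) x
      = g' / rr x * Y x ^ 2 * (yc j x * yc j x) + g (rr x) * Y x ^ 2
        + 2 * g (rr x) * Y x * (yc j x * pd j.succ Y x) := by
    intro j
    have e1 : hcur g Y j = fun z => (fun z => g (rr z)) z * (yc j z * (Y z * Y z)) := by
      funext z; simp only [hcur]; ring
    rw [e1, pd_mul _ (Frr_sm h hg) ((yc_sm j x).mul (hY.mul hY)),
      pd_mul _ (yc_sm j x) (hY.mul hY), pd_mul _ hY hY, pd_rad h hg', pd_yc]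
    simp only [Fin.cases_succ, if_true]
    ring
  simp only [e, Finset.sum_add_distrib, ← Finset.mul_sum, sum_yc_sq, Finset.sum_const,
    Finset.card_univ, Fintype.card_fin, nsmul_eq_mul]
  rw [rho]; field_simp; push_cast; ring

section
variable {A B : Fin 5 → Fin 5 → X5 → ℝ} {X : Fin 5 → X5 → ℝ} {q Y : X5 → ℝ} {x : X5}

lemma Pv_add (a : Fin 5) : Pv (fun a b z => A a b z + B a b z) Y a x = Pv A Y a x + Pv B Y a x := by
  simp only [Pv, add_mul, Finset.sum_add_distrib]

lemma quadA_add : quadA (fun a b z => A a b z + B a b z) Y x = quadA A Y x + quadA B Y x := by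
  simp only [quadA, Pv_add, mul_add, Finset.sum_add_distrib]

lemma cur_add (a : Fin 5) : cur (fun a b z => A a b z + B a b z) X q Y a x
    = cur A X q Y a x + cur B X q Y a x := by
  simp only [cur, Pv_add, quadA_add]; ring

lemma Bq_add (hA : ∀ a b, Sm (A a b) x) (hB : ∀ a b, Sm (B a b) x) :
    Bq (fun a b z => A a b z + B a b z) X q Y x = Bq A X q Y x + Bq B X q Y x := by
  have e : ∀ c a b, pd c (fun z => A a b z + B a b z) x = pd c (A a b) x + pd c (B a b) x :=
    fun c a b => pd_add c (hA a b) (hB a b)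
  simp only [Bq, e, Pv_add, quadA_add, add_mul, mul_add, Finset.sum_add_distrib]
  ring
end

section
variable {R R' δ α τ₁ τ₂ η : ℝ} {K : Fin 5 → Fin 5 → X5 → ℝ} {b : Fin 5 → X5 → ℝ} {c Y : X5 → ℝ}
  {κ v : ℝ → ℝ}

lemma Fw_smooth (hw : Weight R R' δ α κ v) {r : ℝ} (hr : 0 < r) : ContDiffAt ℝ ∞ (Fw κ v) r :=
  ((hw.smooth_κ r hr).mul (hw.smooth_v r hr)).div (contDiffAt_id.pow 4) (pow_ne_zero 4 hr.ne')

lemma om_eq {r : ℝ} (hr : 0 < r) : om κ v r = r * Fw κ v r := by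
  simp only [om, Fw]; field_simp

/-- `r F' = (π - 4) F + ω'`, where `F = r⁻⁴ κ v` and `π = r v'/v`. -/
lemma Fw_deriv (hw : Weight R R' δ α κ v) {r : ℝ} (hr : 0 < r) :
    HasDerivAt (Fw κ v) (((ldv v r - 4) * Fw κ v r + omd κ v r) / r) r := by
  have hk := ((hw.smooth_κ r hr).differentiableAt (by simp)).hasDerivAt
  have hv := ((hw.smooth_v r hr).differentiableAt (by simp)).hasDerivAt
  have := (hk.mul hv).div (hasDerivAt_pow 4 r) (pow_ne_zero 4 hr.ne')
  refine this.congr_deriv ?_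
  have := (hw.pos r hr).ne'
  simp only [Pi.mul_apply, ldv, Fw, omd]
  field_simp
  push_cast; ring

lemma ldv_bounds (hw : Weight R R' δ α κ v) {r : ℝ} (hr : 0 < r) (hR : R ≤ r) :
    -2 + δ ≤ ldv v r ∧ ldv v r ≤ 3 / 2 - 2 * α := by
  have hv := hw.pos r hr
  constructor
  · rw [ldv, le_div_iff₀ hv]; exact hw.low r hR
  · rw [ldv, div_le_iff₀ hv]; exact hw.high r hR

lemma om_nonneg (hw : Weight R R' δ α κ v) {r : ℝ} (hr : 0 < r) : 0 ≤ om κ v r := by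
  have := hw.pos r hr; have := hw.nonneg r
  unfold om; positivity

lemma ne_zero_of_rr {x : X5} (h : 0 < rr x) : x.2 ≠ 0 := norm_pos_iff.1 h

lemma rho_sq_le (Y : X5 → ℝ) (x : X5) : rho Y x ^ 2 ≤ rr x ^ 2 * gsq Y x := by
  rw [rr_sq]; exact Finset.sum_mul_sq_le_sq_mul_sq _ _ _

lemma ya_sq_le (Y : X5 → ℝ) {x : X5} (hr : 0 < rr x) : ya Y x ^ 2 ≤ gsq Y x := by
  rw [ya, div_pow, div_le_iff₀ (by positivity), mul_comm]; exact rho_sq_le Y x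

lemma jet_sq_le (Y : X5 → ℝ) {x : X5} : jet Y x ^ 2 ≤ 6 * bulkN Y x := by
  have e : jet Y x = |pd 0 Y x / rr x| + ∑ j : Fin 4, |pd j.succ Y x| + |Y x / rr x| := by
    rw [jet, Fin.sum_univ_succ]
    have : |rr x| = rr x := abs_of_nonneg (norm_nonneg _)
    simp only [sw, Fin.cases_zero, Fin.cases_succ, one_mul, abs_div, this]; ring
  have e2 : bulkN Y x = |pd 0 Y x / rr x| ^ 2 + ∑ j : Fin 4, |pd j.succ Y x| ^ 2
      + |Y x / rr x| ^ 2 := by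
    simp only [bulkN, gsq, sq_abs]; ring
  rw [e, e2]
  simp only [Fin.sum_univ_four]
  generalize |pd 0 Y x / rr x| = t0
  generalize |Y x / rr x| = t5
  generalize |pd (Fin.succ 0) Y x| = t1
  generalize |pd (Fin.succ 1) Y x| = t2
  generalize |pd (Fin.succ 2) Y x| = t3
  generalize |pd (Fin.succ 3) Y x| = t4
  nlinarith [sq_nonneg (t0-t1), sq_nonneg (t0-t2), sq_nonneg (t0-t3), sq_nonneg (t0-t4),
    sq_nonneg (t0-t5), sq_nonneg (t1-t2), sq_nonneg (t1-t3), sq_nonneg (t1-t4), sq_nonneg (t1-t5),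
    sq_nonneg (t2-t3), sq_nonneg (t2-t4), sq_nonneg (t2-t5), sq_nonneg (t3-t4), sq_nonneg (t3-t5),
    sq_nonneg (t4-t5)]

/-- Coercivity of the bulk quadratic form after the Hardy correction; it degenerates only at
`π = -2`. -/
lemma bulk_form_coercive {π δ a b : ℝ} (h1 : -2 + δ ≤ π) (h2 : π ≤ 3 / 2) (hδ : 0 < δ)
    (hδ' : δ ≤ 3 / 2) :
    δ / 12 * (a ^ 2 + b ^ 2) ≤ (π + 3) / 2 * a ^ 2 + (π - 2) / 2 * (a * b) + (2 - π) / 2 * b ^ 2 := by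
  have e : (π + 3) / 2 * a ^ 2 + (π - 2) / 2 * (a * b) + (2 - π) / 2 * b ^ 2
      = (2 - π) / 8 * (a - 2 * b) ^ 2 + 5 * (π + 2) / 8 * a ^ 2 := by ring
  rw [e]
  have i1 : δ / 24 * (a - 2 * b) ^ 2 ≤ (2 - π) / 8 * (a - 2 * b) ^ 2 := by
    exact mul_le_mul_of_nonneg_right (by linarith) (sq_nonneg _)
  have i2 : 5 * δ / 8 * a ^ 2 ≤ 5 * (π + 2) / 8 * a ^ 2 :=
    mul_le_mul_of_nonneg_right (by linarith) (sq_nonneg _)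
  nlinarith [sq_nonneg (a - b), sq_nonneg a, mul_nonneg hδ.le (sq_nonneg (a - b)),
    mul_nonneg hδ.le (sq_nonneg (a)), mul_nonneg hδ.le (sq_nonneg (b)), mul_nonneg hδ.le (sq_nonneg (3 * a - b))]

/-- Bounds for the multiplier field and its derivatives. -/
lemma X0_bounds (hw : Weight R R' δ α κ v) (hα : 0 < α) (hδ : 0 < δ) {x : X5} (hR1 : 1 ≤ R)
    (hR : R ≤ rr x) :
    (∀ a, |X0 (Fw κ v) a x| ≤ om κ v (rr x) * sw (rr x) a) ∧
    |q0 (Fw κ v) x| ≤ om κ v (rr x) / rr x ∧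
    (∀ a c, |pd a (X0 (Fw κ v) c) x|
      ≤ (|omd κ v (rr x)| + 7 * om κ v (rr x) / rr x) * sw (rr x) c) ∧
    (∀ a, |pd a (q0 (Fw κ v)) x| ≤ (|omd κ v (rr x)| + 7 * om κ v (rr x) / rr x) / rr x) := by
  have hr1 : 1 ≤ rr x := hR1.trans hR
  have hr : 0 < rr x := by linarith
  have h := ne_zero_of_rr hr
  have hF := Fw_smooth hw hr
  have hF' := Fw_deriv hw hr
  have hom : om κ v (rr x) = rr x * Fw κ v (rr x) := om_eq hr
  have hF0 : 0 ≤ Fw κ v (rr x) := by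
    have := om_nonneg hw hr; rw [hom] at this
    exact nonneg_of_mul_nonneg_right this hr
  obtain ⟨hl, hh⟩ := ldv_bounds hw hr hR
  set f := Fw κ v (rr x) with hf
  set d := omd κ v (rr x) with hd
  set π := ldv v (rr x)
  set f' := ((π - 4) * f + d) / rr x with hf'
  have hom7 : 7 * om κ v (rr x) / rr x = 7 * f := by rw [hom]; field_simp
  have hf'r : |f'| * rr x ≤ |d| + 6 * f := by
    have e : |f'| * rr x = |(π - 4) * f + d| := by
      rw [hf', abs_div, abs_of_pos hr]; field_simp
    rw [e]
    have h6 : |π - 4| ≤ 6 := abs_le.2 ⟨by linarith, by linarith⟩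
    calc _ ≤ |(π - 4) * f| + |d| := abs_add_le _ _
      _ = |π - 4| * f + |d| := by rw [abs_mul, abs_of_nonneg hF0]
      _ ≤ 6 * f + |d| := by gcongr
      _ = _ := by ring
  have hy : ∀ j, |yc j x| ≤ rr x := fun j => by
    have := PiLp.norm_apply_le x.2 j
    simpa [yc, rr] using this
  have hyr : ∀ j, |yc j x / rr x| ≤ 1 := fun j => by
    rw [abs_div, abs_of_pos hr, div_le_one hr]; exact hy j
  rw [hom7, hom]
  refine ⟨fun a => ?_, ?_, fun a c => ?_, fun a => ?_⟩
  · refine Fin.cases ?_ (fun j => ?_) a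
    · simp only [X0, sw, Fin.cases_zero, abs_neg, abs_div, abs_of_pos hr, ← hf, abs_of_nonneg hF0]
      rw [mul_one_div]; gcongr; nlinarith
    · simp only [X0, sw, Fin.cases_succ, abs_neg, abs_mul, ← hf, abs_of_nonneg hF0, mul_one]
      nlinarith [hy j]
  · simp only [q0, ← hf, abs_mul, abs_of_nonneg hF0]
    rw [mul_div_assoc, mul_div_cancel₀ _ hr.ne'] <;> norm_num <;> linarith
  · refine Fin.cases ?_ (fun i => ?_) a
    · rw [pd_X0_tau h hF hF', abs_zero]
      have := sw_pos hr c; positivity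
    · refine Fin.cases ?_ (fun j => ?_) c
      · rw [pd_X0_zero h hF']
        simp only [sw, Fin.cases_zero, abs_neg, abs_mul]
        have e : f' / rr x - f / rr x ^ 2 = (f' * rr x - f) / rr x ^ 2 := by field_simp
        have h2 : |f' * rr x - f| ≤ |d| + 7 * f := by
          calc _ ≤ |f' * rr x| + |f| := abs_sub _ _
            _ ≤ _ := by rw [abs_mul, abs_of_pos hr, abs_of_nonneg hF0]; linarith
        calc _ ≤ |f' / rr x - f / rr x ^ 2| * 1 := by gcongr; exact hyr i
          _ = |f' * rr x - f| / rr x ^ 2 := by rw [e, abs_div, abs_of_pos (pow_pos hr 2), mul_one]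
          _ ≤ (|d| + 7 * f) / rr x := by
              gcongr; nlinarith
          _ = _ := by ring
      · rw [pd_X0_succ h hF hF']
        simp only [sw, Fin.cases_succ, mul_one]
        have hb : |f' * (yc i x / rr x) * yc j x| ≤ |d| + 6 * f := by
          rw [abs_mul, abs_mul]
          calc _ ≤ |f'| * 1 * rr x := by gcongr; exacts [hyr i, hy j]
            _ ≤ _ := by rw [mul_one]; exact hf'r
        have hb2 : |f * (if i = j then 1 else 0)| ≤ f := by
          split_ifs
          · rw [mul_one, abs_of_nonneg hF0]
          · simpa using hF0
        calc _ ≤ |-(f' * (yc i x / rr x) * yc j x)| + |f * (if i = j then 1 else 0)| := abs_sub _ _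
          _ ≤ _ := by rw [abs_neg]; linarith
  · have e : pd a (q0 (Fw κ v)) x = -(1 / 2) * pd a (fun z => Fw κ v (rr z)) x := pd_const_mul _ _ _ _
    rw [e, pd_rad h hF']
    refine Fin.cases ?_ (fun i => ?_) a
    · simp; positivity
    · simp only [Fin.cases_succ, abs_mul]
      rw [le_div_iff₀ hr]
      calc _ ≤ |(-(1 / 2) : ℝ)| * (|f'| * 1) * rr x := by gcongr; exact hyr i
        _ = 1 / 2 * (|f'| * rr x) := by rw [abs_neg, abs_of_pos (by norm_num : (0:ℝ) < 1 / 2)]; ring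
        _ ≤ _ := by have := abs_nonneg d; linarith

end

/-! ### The differential energy inequality -/

section
variable {R R' δ α τ₁ τ₂ η : ℝ} {K : Fin 5 → Fin 5 → X5 → ℝ} {b : Fin 5 → X5 → ℝ} {c Y : X5 → ℝ}
  {κ v : ℝ → ℝ}

lemma deriv_smooth {f : ℝ → ℝ} {r : ℝ} (h : ContDiffAt ℝ ∞ f r) : ContDiffAt ℝ ∞ (deriv f) r := by
  have h1 : ContDiffAt ℝ ∞ (fderiv ℝ f) r := h.fderiv_right (by simp)
  have h2 : ContDiffAt ℝ ∞ (fun s => fderiv ℝ f s 1) r := h1.clm_apply contDiffAt_const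
  exact h2.congr_of_eventuallyEq (Eventually.of_forall fun s => (fderiv_apply_one_eq_deriv).symm)

lemma om_smooth (hw : Weight R R' δ α κ v) {r : ℝ} (hr : 0 < r) : ContDiffAt ℝ ∞ (om κ v) r :=
  ((hw.smooth_κ r hr).mul (hw.smooth_v r hr)).div (contDiffAt_id.pow 3) (pow_ne_zero 3 hr.ne')

lemma omd_smooth (hw : Weight R R' δ α κ v) {r : ℝ} (hr : 0 < r) : ContDiffAt ℝ ∞ (omd κ v) r :=
  ((deriv_smooth (hw.smooth_κ r hr)).mul (hw.smooth_v r hr)).div (contDiffAt_id.pow 3)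
    (pow_ne_zero 3 hr.ne')

lemma ldv_smooth (hw : Weight R R' δ α κ v) {r : ℝ} (hr : 0 < r) : ContDiffAt ℝ ∞ (ldv v) r :=
  (contDiffAt_id.mul (deriv_smooth (hw.smooth_v r hr))).div (hw.smooth_v r hr) (hw.pos r hr).ne'

lemma exdCoeff_smooth (hw : Weight R R' δ α κ v) {r : ℝ} (hr : 0 < r) : ContDiffAt ℝ ∞
    (fun r => -(1 / 4) * ((om κ v r * (ldv v r - 2) / r - omd κ v r) / r)) r := by
  refine contDiffAt_const.mul (ContDiffAt.div (ContDiffAt.sub ?_ (omd_smooth hw hr)) contDiffAt_id hr.ne')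
  exact ContDiffAt.div ((om_smooth hw hr).mul ((ldv_smooth hw hr).sub contDiffAt_const))
    contDiffAt_id hr.ne'

lemma exd_sm (hw : Weight R R' δ α κ v) {x : X5} (hr : 0 < rr x) (hY : Sm Y x) :
    Sm (exd κ v Y) x :=
  (Frr_sm (ne_zero_of_rr hr) (exdCoeff_smooth hw hr)).mul (hY.pow 2)

lemma hcur_sm {g : ℝ → ℝ} {x : X5} (hr : 0 < rr x) (hg : ContDiffAt ℝ ∞ g (rr x)) (hY : Sm Y x)
    (j : Fin 4) : Sm (hcur g Y j) x :=
  ((Frr_sm (ne_zero_of_rr hr) hg).mul (yc_sm j x)).mul (hY.pow 2)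

lemma hardyCoeff_smooth (hw : Weight R R' δ α κ v) {r : ℝ} (hr : 0 < r) :
    ContDiffAt ℝ ∞ (fun r => 1 / 2 * Fw κ v r / r ^ 2) r :=
  (contDiffAt_const.mul (Fw_smooth hw hr)).div (contDiffAt_id.pow 2) (pow_ne_zero 2 hr.ne')

lemma AK_sm {x : X5} (hr : 0 < rr x) (hK : ∀ a b, Sm (K a b) x) (a b : Fin 5) :
    Sm (fun z => A0 a b z + K a b z) x := (A0_sm (ne_zero_of_rr hr) a b).add (hK a b)

lemma curAK_sm (hw : Weight R R' δ α κ v) {x : X5} (hr : 0 < rr x) (hK : ∀ a b, Sm (K a b) x)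
    (hY : Sm Y x) (a : Fin 5) :
    Sm (cur (fun a b z => A0 a b z + K a b z) (X0 (Fw κ v)) (q0 (Fw κ v)) Y a) x :=
  cur_sm (AK_sm hr hK) (X0_sm (ne_zero_of_rr hr) (Fw_smooth hw hr))
    (q0_sm (ne_zero_of_rr hr) (Fw_smooth hw hr)) hY a

lemma edens_sm (hw : Weight R R' δ α κ v) {x : X5} (hr : 0 < rr x) (hK : ∀ a b, Sm (K a b) x)
    (hY : Sm Y x) : Sm (edens K κ v Y) x :=
  (curAK_sm hw hr hK hY 0).add (exd_sm hw hr hY)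

lemma scur_sm (hw : Weight R R' δ α κ v) {x : X5} (hr : 0 < rr x) (hK : ∀ a b, Sm (K a b) x)
    (hY : Sm Y x) (j : Fin 4) : Sm (scur K κ v Y j) x :=
  (curAK_sm hw hr hK hY j.succ).add (hcur_sm hr (hardyCoeff_smooth hw hr) hY j)

/-- Lower bound for the main bulk, in the variables `a = Y_r`, `β = Y/r`, `t = Y_τ/r`, `n = |∂_y Y|²`,
`f = r⁻⁴ κ v`, `d = r⁻³ κ' v`. -/
lemma bulk_lower {π δ η r f d a β n t y : ℝ} (hl : -2 + δ ≤ π) (hh : π ≤ 3 / 2) (hδ : 0 < δ)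
    (hδ' : δ ≤ 3 / 2) (hη : 40000 * η ≤ δ) (hr : 0 < r) (hηr : 1 / r ≤ η) (hf0 : 0 ≤ f)
    (hn : a ^ 2 ≤ n) :
    f * ((δ / 24 + 1440 * η) * (n + β ^ 2 + t ^ 2))
        - |d| * (2 * (n + β ^ 2 + t ^ 2) + |β| * |y|)
      ≤ f * ((π + 3) / 2 * a ^ 2 + (π - 2) / 2 * (a * β) + (2 - π) / 2 * β ^ 2
          + (3 - π) / 2 * (n - a ^ 2) + (3 - π) / 2 * t ^ 2 + (π - 1) * (1 / r) * (a * t))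
        + d * (a ^ 2 / 2 + a * β / 2 - (n - a ^ 2) / 2 - t ^ 2 / 2 + 1 / r * (a * t) - β ^ 2 / 2
          - β * y) := by
  have hη0 : 0 ≤ η := le_trans (by positivity) hηr
  have hcoer := bulk_form_coercive (a := a) (b := β) hl hh hδ hδ'
  have hcross : |1 / r * (a * t)| ≤ η * ((a ^ 2 + t ^ 2) / 2) := by
    rw [abs_mul, abs_of_pos (by positivity : 0 < 1 / r)]
    have : |a * t| ≤ (a ^ 2 + t ^ 2) / 2 := by
      rw [abs_le]; constructor <;> nlinarith [sq_nonneg (a - t), sq_nonneg (a + t)]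
    gcongr
  have hd1 : -(|d| * (2 * (n + β ^ 2 + t ^ 2) + |β| * |y|))
      ≤ d * (a ^ 2 / 2 + a * β / 2 - (n - a ^ 2) / 2 - t ^ 2 / 2 + 1 / r * (a * t) - β ^ 2 / 2
          - β * y) := by
    have h1 : |a ^ 2 / 2 + a * β / 2 - (n - a ^ 2) / 2 - t ^ 2 / 2 + 1 / r * (a * t) - β ^ 2 / 2
          - β * y| ≤ 2 * (n + β ^ 2 + t ^ 2) + |β| * |y| := by
      have h3 : η * ((a ^ 2 + t ^ 2) / 2) ≤ (a ^ 2 + t ^ 2) / 2 := by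
        have h0 : 0 ≤ (a ^ 2 + t ^ 2) / 2 := by positivity
        exact mul_le_of_le_one_left h0 (by linarith)
      have h4 := abs_le.1 (hcross.trans h3)
      have h5 := abs_le.1 (le_refl |β * y|)
      rw [abs_mul] at h5
      have s1 := sq_nonneg (a - β)
      have s2 := sq_nonneg (a + β)
      have s3 := sq_nonneg t
      have s4 := sq_nonneg β
      have s5 := sq_nonneg a
      rw [abs_le]
      constructor <;> linarith [h4.1, h4.2, h5.1, h5.2]
    exact (abs_le.1 ((abs_mul d _).le.trans (mul_le_mul_of_nonneg_left h1 (abs_nonneg d)))).1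
  have hf1 : f * ((δ / 24 + 1440 * η) * (n + β ^ 2 + t ^ 2))
      ≤ f * ((π + 3) / 2 * a ^ 2 + (π - 2) / 2 * (a * β) + (2 - π) / 2 * β ^ 2
          + (3 - π) / 2 * (n - a ^ 2) + (3 - π) / 2 * t ^ 2 + (π - 1) * (1 / r) * (a * t)) := by
    apply mul_le_mul_of_nonneg_left _ hf0
    have h1 : -(3 * (η * ((a ^ 2 + t ^ 2) / 2))) ≤ (π - 1) * (1 / r) * (a * t) := by
      have h2 : |(π - 1) * (1 / r * (a * t))| ≤ 3 * (η * ((a ^ 2 + t ^ 2) / 2)) := by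
        rw [abs_mul]
        have : |π - 1| ≤ 3 := abs_le.2 ⟨by linarith, by linarith⟩
        gcongr
      have := (abs_le.1 h2).1
      linarith
    have i1 : 0 ≤ ((3 - π) / 2 - δ / 24 - 1440 * η) * (n - a ^ 2) :=
      mul_nonneg (by linarith) (by linarith)
    have i2 : 0 ≤ ((3 - π) / 2 - δ / 24 - 1442 * η) * t ^ 2 :=
      mul_nonneg (by linarith) (sq_nonneg _)
    have i3 : 0 ≤ (δ / 12 - δ / 24 - 1442 * η) * (a ^ 2 + β ^ 2) :=
      mul_nonneg (by linarith) (by positivity)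
    have i4 : 0 ≤ η * t ^ 2 := by positivity
    have i5 : 0 ≤ η * a ^ 2 := by positivity
    have i6 : 0 ≤ η * β ^ 2 := by positivity
    linarith
  linarith

set_option maxHeartbeats 800000 in
/-- The differential energy inequality: the bulk controls the weighted jet, up to terms supported
where the cutoff varies. -/
lemma energy_pointwise (hw : Weight R R' δ α κ v) (hP : Perturbed R τ₁ τ₂ η K b c Y)
    (hα : 0 < α) (hδ : 0 < δ) (hδ' : δ ≤ 3 / 2) (hη : 40000 * η ≤ δ) {x : X5}
    (hx : x.1 ∈ Icc τ₁ τ₂) (hR : R ≤ rr x) :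
    pd 0 (edens K κ v Y) x + ∑ j : Fin 4, pd j.succ (scur K κ v Y j) x
      ≤ |mult (X0 (Fw κ v)) (q0 (Fw κ v)) Y x * opL K b c Y x|
        - δ / 24 * (om κ v (rr x) / rr x) * bulkN Y x
        + |omd κ v (rr x)| * (3 * bulkN Y x + |Y x / rr x| * |pd 0 Y x|) := by
  have hr1 : 1 ≤ rr x := hP.one_le.trans hR
  have hr : 0 < rr x := by linarith
  have h := ne_zero_of_rr hr
  have hY := hP.smY x hx hR
  have hK := hP.smK x hx hR
  have hF := Fw_smooth hw hr
  have hF' := Fw_deriv hw hr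
  have hη0 : 0 ≤ η := le_trans (by have := hP.one_le; positivity) hP.inv_le
  have hsymm : ∀ a b z, A0 a b z + K a b z = A0 b a z + K b a z := fun a b z => by
    rw [A0_symm, hP.symm]
  have id1 := energy_identity (A := fun a b z => A0 a b z + K a b z) (X := X0 (Fw κ v))
    (q := q0 (Fw κ v)) (Y := Y) (x := x) hsymm (AK_sm hr hK) (X0_sm h hF) (q0_sm h hF) hY
  have id2 := Bq_add (X := X0 (Fw κ v)) (q := q0 (Fw κ v)) (Y := Y) (A0_sm h) hK
  have id3 := Bq_A0 (Y := Y) h hF hF'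
  have hG' : HasDerivAt (fun r => 1 / 2 * Fw κ v r / r ^ 2)
      (((ldv v (rr x) - 6) * Fw κ v (rr x) + omd κ v (rr x)) / (2 * rr x ^ 3)) (rr x) := by
    have := ((hF'.const_mul (1 / 2)).div (hasDerivAt_pow 2 (rr x)) (pow_ne_zero 2 hr.ne'))
    refine this.congr_deriv ?_
    field_simp; push_cast; ring
  have id4 := div_hcur h (hardyCoeff_smooth hw hr) hG' hY
  have id5 : pd 0 (exd κ v Y) x = -(1 / 2) * ((om κ v (rr x) * (ldv v (rr x) - 2) / rr x
      - omd κ v (rr x)) / rr x) * Y x * pd 0 Y x := by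
    have e : exd κ v Y = fun z => (fun z => (fun r => -(1 / 4) * ((om κ v r * (ldv v r - 2) / r
      - omd κ v r) / r)) (rr z)) z * (Y z * Y z) := by funext z; simp only [exd]; ring
    have hs := exdCoeff_smooth hw hr
    rw [e, pd_mul 0 (Frr_sm h hs) (hY.mul hY), pd_mul 0 hY hY,
      pd_rad h (hs.differentiableAt (by simp)).hasDerivAt]
    simp only [Fin.cases_zero]; ring
  obtain ⟨bX, bq, bdX, bdq⟩ := X0_bounds hw hα hδ hP.one_le hR
  have hom0 := om_nonneg hw hr
  have err := abs_Bq_le (K := K) (X := X0 (Fw κ v)) (q := q0 (Fw κ v)) (b := b) (c := c) (Y := Y)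
    hr hη0 hom0 (by positivity) (hP.K_le x hx hR) (hP.dK_le x hx hR) bX bq (sw_le hr1) bdX bdq
    (hP.b_le x hx hR) (hP.c_le x hx hR)
  have hom : om κ v (rr x) = rr x * Fw κ v (rr x) := om_eq hr
  obtain ⟨hl, hh⟩ := ldv_bounds hw hr hR
  have sumJ : pd 0 (edens K κ v Y) x + ∑ j : Fin 4, pd j.succ (scur K κ v Y j) x
      = ∑ a, pd a (cur (fun a b z => A0 a b z + K a b z) (X0 (Fw κ v)) (q0 (Fw κ v)) Y a) x
        + pd 0 (exd κ v Y) x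
        + ∑ j : Fin 4, pd j.succ (hcur (fun r => 1 / 2 * Fw κ v r / r ^ 2) Y j) x := by
    rw [Fin.sum_univ_succ (n := 4)]
    have e1 : pd 0 (edens K κ v Y) x = _ := pd_add 0 (curAK_sm hw hr hK hY 0) (exd_sm hw hr hY)
    have e2 : ∀ j : Fin 4, pd j.succ (scur K κ v Y j) x = _ := fun j =>
      pd_add j.succ (curAK_sm hw hr hK hY j.succ) (hcur_sm hr (hardyCoeff_smooth hw hr) hY j)
    rw [e1, Finset.sum_congr rfl fun j _ => e2 j, Finset.sum_add_distrib]; ring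
  have hsplit : mult (X0 (Fw κ v)) (q0 (Fw κ v)) Y x * opL K b c Y x
      = mult (X0 (Fw κ v)) (q0 (Fw κ v)) Y x * L2 (fun a b z => A0 a b z + K a b z) Y x
        + mult (X0 (Fw κ v)) (q0 (Fw κ v)) Y x * (∑ a, b0 a x * pd a Y x)
        + mult (X0 (Fw κ v)) (q0 (Fw κ v)) Y x * (∑ a, b a x * pd a Y x + c x * Y x) := by
    simp only [opL, add_mul, Finset.sum_add_distrib]; ring
  rw [id1, id2] at hsplit
  have hab := le_abs_self (mult (X0 (Fw κ v)) (q0 (Fw κ v)) Y x * opL K b c Y x)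
  rw [sumJ]
  have hjet := jet_sq_le Y (x := x)
  rw [abs_le] at err
  have hN : 0 ≤ bulkN Y x := by
    have : 0 ≤ gsq Y x := Finset.sum_nonneg fun _ _ => sq_nonneg _
    unfold bulkN; positivity
  -- abbreviations: `f = r⁻⁴ κ v`, `d = r⁻³ κ' v`, `a = Y_r`, `β = Y/r`, `t = Y_τ/r`, `n = |∂_y Y|²`
  have hf0 : 0 ≤ Fw κ v (rr x) := by
    have := hom0; rw [hom] at this
    exact nonneg_of_mul_nonneg_right this hr
  have hfr : om κ v (rr x) / rr x = Fw κ v (rr x) := by rw [hom]; field_simp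
  have hn := ya_sq_le Y hr
  have herr : 30 * η * (om κ v (rr x) / rr x + (|omd κ v (rr x)| + 7 * om κ v (rr x) / rr x))
      * jet Y x ^ 2 ≤ (1440 * η * Fw κ v (rr x) + |omd κ v (rr x)|) * bulkN Y x := by
    have h1 : 7 * om κ v (rr x) / rr x = 7 * Fw κ v (rr x) := by rw [← hfr]; ring
    rw [h1, hfr]
    have hd := abs_nonneg (omd κ v (rr x))
    calc _ ≤ 30 * η * (Fw κ v (rr x) + (|omd κ v (rr x)| + 7 * Fw κ v (rr x))) * (6 * bulkN Y x) := by
          gcongr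
      _ = (1440 * η * Fw κ v (rr x) + 180 * η * |omd κ v (rr x)|) * bulkN Y x := by ring
      _ ≤ (1440 * η * Fw κ v (rr x) + 1 * |omd κ v (rr x)|) * bulkN Y x := by
          gcongr; linarith
      _ = _ := by ring
  have hηr : 1 / rr x ≤ η := (one_div_le_one_div_of_le (by linarith [hP.one_le]) hR).trans hP.inv_le
  rw [id5, id4]
  rw [hfr]
  set f := Fw κ v (rr x) with hfdef
  set d := omd κ v (rr x) with hddef
  set π := ldv v (rr x) with hπdef
  set r := rr x with hrdef
  have ha : rho Y x = r * ya Y x := (mul_div_cancel₀ _ hr.ne').symm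
  have ha' : rho Y x / r = ya Y x := rfl
  rw [ha'] at id3
  set a := ya Y x with hadef
  set β := Y x / r with hβdef
  set t := pd 0 Y x / r with htdef
  set n := gsq Y x with hndef
  -- exact value of the main bulk after inserting the Hardy current and the correction `exd`
  have hmain : Bq A0 (X0 (Fw κ v)) (q0 (Fw κ v)) Y x
      + mult (X0 (Fw κ v)) (q0 (Fw κ v)) Y x * ∑ a, b0 a x * pd a Y x
      - -(1 / 2) * ((om κ v r * (π - 2) / r - d) / r) * Y x * pd 0 Y x
      - ((r * (((π - 6) * f + d) / (2 * r ^ 3)) + 4 * (1 / 2 * f / r ^ 2)) * Y x ^ 2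
        + 2 * (1 / 2 * f / r ^ 2) * Y x * rho Y x)
      = f * ((π + 3) / 2 * a ^ 2 + (π - 2) / 2 * (a * β) + (2 - π) / 2 * β ^ 2
          + (3 - π) / 2 * (n - a ^ 2) + (3 - π) / 2 * t ^ 2 + (π - 1) * (1 / r) * (a * t))
        + d * (a ^ 2 / 2 + a * β / 2 - (n - a ^ 2) / 2 - t ^ 2 / 2 + 1 / r * (a * t) - β ^ 2 / 2
          - β * pd 0 Y x) := by
    rw [id3, hom, ha]
    simp only [hβdef, htdef]
    field_simp
    ring
  have hlow := bulk_lower (a := a) (β := β) (n := n) (t := t) (y := pd 0 Y x) (d := d) hl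
    (by linarith) hδ hδ' hη hr hηr hf0 hn
  have hNdef : bulkN Y x = n + β ^ 2 + t ^ 2 := rfl
  rw [← hNdef] at hlow
  have e2 : f * ((δ / 24 + 1440 * η) * bulkN Y x) = δ / 24 * f * bulkN Y x + 1440 * η * f * bulkN Y x := by
    ring
  have e3 : (1440 * η * f + |d|) * bulkN Y x = 1440 * η * f * bulkN Y x + |d| * bulkN Y x := by ring
  rw [e2] at hlow
  rw [e3] at herr
  have e4 : |d| * (3 * bulkN Y x + |β| * |pd 0 Y x|)
    = |d| * bulkN Y x + |d| * (2 * bulkN Y x + |β| * |pd 0 Y x|) := by ring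
  rw [e4]
  linarith [hmain, hlow, err.1, herr, hab, hsplit]

end

/-! ### Two-sided bounds for the energy density -/

section
variable {R R' δ α τ₁ τ₂ η : ℝ} {K : Fin 5 → Fin 5 → X5 → ℝ} {b : Fin 5 → X5 → ℝ} {c Y : X5 → ℝ}
  {κ v : ℝ → ℝ}

/-- The part of the energy density that is not a lower-order term: `Y_r² + (Y/r)²`. -/
def fluxN (Y : X5 → ℝ) (x : X5) : ℝ := ya Y x ^ 2 + (Y x / rr x) ^ 2

/-- The lower-order part of the energy density: `r⁻⁴ Y_τ² + r⁻⁴ |∇̸Y|²`. -/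
def fluxL (Y : X5 → ℝ) (x : X5) : ℝ :=
  (pd 0 Y x / rr x ^ 2) ^ 2 + (gsq Y x - ya Y x ^ 2) / rr x ^ 2

lemma fluxL_nonneg {x : X5} (hr : 0 < rr x) : 0 ≤ fluxL Y x := by
  have := sub_nonneg.2 (ya_sq_le Y hr)
  unfold fluxL; positivity

/-- The multiplier is `-ω (Y_r + Y/(2r) + Y_τ/r²)` with `ω = r⁻³ κ v`. -/
lemma mult_eq {x : X5} (hr : 0 < rr x) : mult (X0 (Fw κ v)) (q0 (Fw κ v)) Y x
    = -(om κ v (rr x)) * (ya Y x + (Y x / rr x) / 2 + pd 0 Y x / rr x ^ 2) := by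
  rw [mult_X0, om_eq hr, ya]; field_simp; ring

/-- The real inequality behind the two-sided bound for the energy density. -/
lemma flux_algebra {α η π a β u A2 e : ℝ} (hα : 0 < α) (hα' : α < 3 / 4)
    (hη' : 32 * η ≤ α) (hl : -2 ≤ π) (hh : π ≤ 3 / 2 - 2 * α) (hA : 0 ≤ A2)
    (he : |e| ≤ 8 * η * (a ^ 2 + β ^ 2 + (u ^ 2 + A2)))
    {n2 : ℝ} (h0 : 0 ≤ n2) (hn2 : n2 ≤ a ^ 2 + A2) :
    α / 2 * (a ^ 2 + β ^ 2) - (2 + 1 / α) * (u ^ 2 + A2)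
      ≤ a ^ 2 + (3 / 4 - π / 2) * β ^ 2 + a * u + u ^ 2 / 2 + β * u / 2 + n2 / 2 + e ∧
    a ^ 2 + (3 / 4 - π / 2) * β ^ 2 + a * u + u ^ 2 / 2 + β * u / 2 + n2 / 2 + e
      ≤ 10 * (a ^ 2 + β ^ 2 + (u ^ 2 + A2)) := by
  obtain ⟨e1, e2⟩ := abs_le.1 he
  have hβ := sq_nonneg β
  have ha := sq_nonneg a
  have hu := sq_nonneg u
  have i1 : 8 * η * (a ^ 2 + β ^ 2 + (u ^ 2 + A2)) ≤ α / 4 * (a ^ 2 + β ^ 2 + (u ^ 2 + A2)) := by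
    gcongr; linarith
  have i2 : α * β ^ 2 ≤ (3 / 4 - π / 2) * β ^ 2 := by gcongr; linarith
  have i3 : (3 / 4 - π / 2) * β ^ 2 ≤ 7 / 4 * β ^ 2 := by gcongr; linarith
  have i4 : -(α / 4 * β ^ 2 + 1 / α * u ^ 2 / 4) ≤ β * u / 2 := by
    have : 0 ≤ (α * β + u) ^ 2 / (4 * α) := by positivity
    have e : (α * β + u) ^ 2 / (4 * α) = α / 4 * β ^ 2 + β * u / 2 + 1 / α * u ^ 2 / 4 := by
      field_simp; ring
    linarith
  have i5 : α / 4 * (a ^ 2 + β ^ 2 + (u ^ 2 + A2)) ≤ 1 * (a ^ 2 + β ^ 2 + (u ^ 2 + A2)) := by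
    gcongr; linarith
  have i6 : 0 ≤ 1 / α * u ^ 2 := by positivity
  have i7 : 0 ≤ 1 / α * A2 := by positivity
  have i8 : α * a ^ 2 ≤ 3 / 4 * a ^ 2 := by gcongr
  have i9 : α * u ^ 2 ≤ 3 / 4 * u ^ 2 := by gcongr
  have i10 : α * A2 ≤ 3 / 4 * A2 := by gcongr
  constructor
  · nlinarith [sq_nonneg (a + 2 * u)]
  · nlinarith [sq_nonneg (a - u), sq_nonneg (β - u)]

lemma fluxCorr_smooth (hw : Weight R R' δ α κ v) {r : ℝ} (hr : 0 < r) :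
    ContDiffAt ℝ ∞ (fun r => 1 / 4 * Fw κ v r / r) r :=
  (contDiffAt_const.mul (Fw_smooth hw hr)).div contDiffAt_id hr.ne'

set_option maxHeartbeats 800000 in
/-- Modulo the divergence of a radial current, the energy density is comparable to
`ω (Y_r² + (Y/r)²)` up to lower-order terms; no derivative of the cutoff enters. -/
lemma flux_pointwise (hw : Weight R R' δ α κ v) (hP : Perturbed R τ₁ τ₂ η K b c Y)
    (hα : 0 < α) (hα' : α < 3 / 4) (hδ : 0 < δ) (hη : 32 * η ≤ α) {x : X5}
    (hx : x.1 ∈ Icc τ₁ τ₂) (hR : R ≤ rr x) :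
    om κ v (rr x) * (α / 2 * fluxN Y x - (2 + 1 / α) * fluxL Y x)
      ≤ edens K κ v Y x - ∑ j : Fin 4, pd j.succ (hcur (fun r => 1 / 4 * Fw κ v r / r) Y j) x ∧
    edens K κ v Y x - ∑ j : Fin 4, pd j.succ (hcur (fun r => 1 / 4 * Fw κ v r / r) Y j) x
      ≤ om κ v (rr x) * (10 * (fluxN Y x + fluxL Y x)) := by
  have hr1 : 1 ≤ rr x := hP.one_le.trans hR
  have hr : 0 < rr x := by linarith
  have h := ne_zero_of_rr hr
  have hY := hP.smY x hx hR
  have hF := Fw_smooth hw hr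
  have hF' := Fw_deriv hw hr
  have hη0 : 0 ≤ η := le_trans (by have := hP.one_le; positivity) hP.inv_le
  have hom0 := om_nonneg hw hr
  have hom : om κ v (rr x) = rr x * Fw κ v (rr x) := om_eq hr
  have hG' : HasDerivAt (fun r => 1 / 4 * Fw κ v r / r)
      (((ldv v (rr x) - 5) * Fw κ v (rr x) + omd κ v (rr x)) / (4 * rr x ^ 2)) (rr x) := by
    have := ((hF'.const_mul (1 / 4)).div (hasDerivAt_id (rr x)) hr.ne')
    refine this.congr_deriv ?_
    simp only [id]; field_simp; ring
  have id4 := div_hcur h (fluxCorr_smooth hw hr) hG' hY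
  obtain ⟨bX, bq, -, -⟩ := X0_bounds hw hα hδ hP.one_le hR
  obtain ⟨hl, hh⟩ := ldv_bounds hw hr hR
  have hPk := abs_Pv_le (Y := Y) hr (hP.K_le x hx hR) hη0 0
  have hSk := abs_quadA_le (Y := Y) hr (hP.K_le x hx hR) hη0
  have hjet := jet_sq_le Y (x := x)
  have hn := ya_sq_le Y hr
  have hj0 := jet_nonneg (Y := Y) hr
  have hcur : edens K κ v Y x = cur A0 (X0 (Fw κ v)) (q0 (Fw κ v)) Y 0 x
      + cur K (X0 (Fw κ v)) (q0 (Fw κ v)) Y 0 x + exd κ v Y x := by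
    rw [edens, cur_add]
  -- the perturbation part of the energy density
  have hk : |cur K (X0 (Fw κ v)) (q0 (Fw κ v)) Y 0 x|
      ≤ om κ v (rr x) * (8 * η * (fluxN Y x + fluxL Y x)) := by
    have hm := mult_eq (κ := κ) (v := v) (Y := Y) hr
    set a := ya Y x
    set β := Y x / rr x
    set u := pd 0 Y x / rr x ^ 2
    set ϖ := om κ v (rr x)
    set f := jet Y x / rr x with hf
    have hf0 : 0 ≤ f := by positivity
    have h1 : |cur K (X0 (Fw κ v)) (q0 (Fw κ v)) Y 0 x|
        ≤ η * f * (ϖ * (|a| + |β| / 2 + |u|)) + 1 / 2 * (ϖ * (η * f ^ 2)) := by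
      refine (abs_sub _ _).trans (add_le_add ?_ ?_)
      · rw [abs_mul]
        have e1 : |Pv K Y 0 x| ≤ η * f := hPk.trans_eq (by simp [sw, hf]; ring)
        have e2 : |mult (X0 (Fw κ v)) (q0 (Fw κ v)) Y x| ≤ ϖ * (|a| + |β| / 2 + |u|) := by
          rw [hm, abs_mul, abs_neg, abs_of_nonneg hom0]
          gcongr
          refine (abs_add_three _ _ _).trans ?_
          rw [abs_div, abs_two]
        gcongr
      · rw [abs_mul, abs_mul, abs_of_pos (by norm_num : (0:ℝ) < 1 / 2), mul_assoc]
        have e3 : |X0 (Fw κ v) 0 x| ≤ ϖ * (1 / rr x) / rr x := by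
          have : |X0 (Fw κ v) 0 x| = ϖ * (1 / rr x) / rr x := by
            have hF0 : 0 ≤ Fw κ v (rr x) := by
              have := hom0; rw [hom] at this
              exact nonneg_of_mul_nonneg_right this hr
            simp only [X0, Fin.cases_zero, abs_neg, abs_div, abs_of_pos hr, abs_of_nonneg hF0]
            rw [hom]; field_simp
          exact this.le
        calc _ ≤ 1 / 2 * (ϖ * (1 / rr x) / rr x * (η * jet Y x ^ 2)) := by gcongr
          _ = _ := by rw [hf]; field_simp
    have hf2 : f ^ 2 ≤ 6 * (fluxN Y x + fluxL Y x) := by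
      have e1 : f ^ 2 ≤ 6 * bulkN Y x / rr x ^ 2 := by rw [hf, div_pow]; gcongr
      have e2 : bulkN Y x / rr x ^ 2 = u ^ 2 + (gsq Y x - a ^ 2) / rr x ^ 2
          + (a ^ 2 + β ^ 2) / rr x ^ 2 := by
        simp only [bulkN, u, β]; field_simp; ring
      have e3 : (a ^ 2 + β ^ 2) / rr x ^ 2 ≤ a ^ 2 + β ^ 2 :=
        div_le_self (by positivity) (one_le_pow₀ hr1)
      have e4 : fluxN Y x = a ^ 2 + β ^ 2 := rfl
      have e5 : fluxL Y x = u ^ 2 + (gsq Y x - a ^ 2) / rr x ^ 2 := rfl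
      rw [mul_div_assoc, e2] at e1
      rw [e4, e5]; linarith
    have hs : (|a| + |β| / 2 + |u|) ^ 2 ≤ 3 * (fluxN Y x + fluxL Y x) := by
      have e4 : fluxN Y x = a ^ 2 + β ^ 2 := rfl
      have e5 : fluxL Y x = u ^ 2 + (gsq Y x - a ^ 2) / rr x ^ 2 := rfl
      have e6 : 0 ≤ (gsq Y x - a ^ 2) / rr x ^ 2 := div_nonneg (by linarith) (by positivity)
      rw [e4, e5, ← sq_abs a, ← sq_abs β, ← sq_abs u]
      rw [← sq_abs a] at e6
      nlinarith [sq_nonneg (|a| - |β| / 2), sq_nonneg (|a| - |u|), sq_nonneg (|β| / 2 - |u|),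
        sq_nonneg |β|]
    refine h1.trans ?_
    have h2 : f * (|a| + |β| / 2 + |u|) + f ^ 2 / 2 ≤ 8 * (fluxN Y x + fluxL Y x) := by
      have : 0 ≤ fluxN Y x + fluxL Y x := by
        have := fluxL_nonneg (Y := Y) hr
        have : 0 ≤ fluxN Y x := by unfold fluxN; positivity
        linarith
      have h3 := two_mul_le_add_sq f (|a| + |β| / 2 + |u|)
      linarith
    calc _ = ϖ * (η * (f * (|a| + |β| / 2 + |u|) + f ^ 2 / 2)) := by ring
      _ ≤ ϖ * (η * (8 * (fluxN Y x + fluxL Y x))) := by gcongr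
      _ = _ := by ring
  have hmain : cur A0 (X0 (Fw κ v)) (q0 (Fw κ v)) Y 0 x + exd κ v Y x
      - ((rr x * (((ldv v (rr x) - 5) * Fw κ v (rr x) + omd κ v (rr x)) / (4 * rr x ^ 2))
          + 4 * (1 / 4 * Fw κ v (rr x) / rr x)) * Y x ^ 2
        + 2 * (1 / 4 * Fw κ v (rr x) / rr x) * Y x * rho Y x)
      = om κ v (rr x) * (ya Y x ^ 2 + (3 / 4 - ldv v (rr x) / 2) * (Y x / rr x) ^ 2
          + ya Y x * (pd 0 Y x / rr x ^ 2) + (pd 0 Y x / rr x ^ 2) ^ 2 / 2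
          + (Y x / rr x) * (pd 0 Y x / rr x ^ 2) / 2 + (gsq Y x / rr x ^ 2) / 2) := by
    rw [cur, Pv_A0_zero, quadA_A0, mult_X0, exd, hom]
    simp only [X0, Fin.cases_zero, ya]
    field_simp
    ring
  rw [hcur, id4]
  have hL : fluxL Y x = (pd 0 Y x / rr x ^ 2) ^ 2 + (gsq Y x - ya Y x ^ 2) / rr x ^ 2 := rfl
  have hNN : fluxN Y x = ya Y x ^ 2 + (Y x / rr x) ^ 2 := rfl
  rcases eq_or_lt_of_le hom0 with h0 | hpos
  · rw [← h0] at hk hmain ⊢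
    have : cur K (X0 (Fw κ v)) (q0 (Fw κ v)) Y 0 x = 0 := by
      rw [zero_mul] at hk; exact abs_nonpos_iff.1 hk
    constructor <;> linarith
  · set ϖ := om κ v (rr x)
    set E := cur K (X0 (Fw κ v)) (q0 (Fw κ v)) Y 0 x
    have hE : E = ϖ * (E / ϖ) := by field_simp
    have he : |E / ϖ| ≤ 8 * η * (ya Y x ^ 2 + (Y x / rr x) ^ 2
        + ((pd 0 Y x / rr x ^ 2) ^ 2 + (gsq Y x - ya Y x ^ 2) / rr x ^ 2)) := by
      rw [abs_div, abs_of_pos hpos, div_le_iff₀ hpos]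
      rw [hNN, hL] at hk; linarith
    have hA : 0 ≤ (gsq Y x - ya Y x ^ 2) / rr x ^ 2 := div_nonneg (by linarith) (by positivity)
    have hn2 : gsq Y x / rr x ^ 2 ≤ ya Y x ^ 2 + (gsq Y x - ya Y x ^ 2) / rr x ^ 2 := by
      have e : gsq Y x / rr x ^ 2 = ya Y x ^ 2 / rr x ^ 2 + (gsq Y x - ya Y x ^ 2) / rr x ^ 2 := by
        ring
      rw [e]
      gcongr
      exact div_le_self (by positivity) (one_le_pow₀ hr1)
    have hg : 0 ≤ gsq Y x / rr x ^ 2 := by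
      have : 0 ≤ gsq Y x := Finset.sum_nonneg fun _ _ => sq_nonneg _
      positivity
    obtain ⟨f1, f2⟩ := flux_algebra hα hα' hη (by linarith) hh hA he hg hn2
    have f1' := mul_le_mul_of_nonneg_left f1 hom0
    have f2' := mul_le_mul_of_nonneg_left f2 hom0
    rw [hNN, hL]
    constructor <;> linarith
end

/-! ### Slice integrals of compactly supported functions -/

/-- Functions on `[τ₁, τ₂] × ℝ⁴` that are continuous and vanish for `r > R'`. -/
structure CC (R' τ₁ τ₂ : ℝ) (f : X5 → ℝ) : Prop where
  cont : ∀ x : X5, x.1 ∈ Icc τ₁ τ₂ → ContinuousAt f x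
  supp : ∀ x : X5, R' < rr x → f x = 0

/-- Integral over the slice of constant `τ`. -/
def sI (f : X5 → ℝ) (τ : ℝ) : ℝ := ∫ y : E4, f (τ, y)

section
variable {R' τ₁ τ₂ : ℝ} {f g : X5 → ℝ}

lemma CC.add (hf : CC R' τ₁ τ₂ f) (hg : CC R' τ₁ τ₂ g) : CC R' τ₁ τ₂ (fun x => f x + g x) :=
  ⟨fun x hx => (hf.cont x hx).add (hg.cont x hx), fun x hx => by
    simp [hf.supp x hx, hg.supp x hx]⟩

lemma CC.const_mul (c : ℝ) (hf : CC R' τ₁ τ₂ f) : CC R' τ₁ τ₂ (fun x => c * f x) :=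
  ⟨fun x hx => (hf.cont x hx).const_mul c, fun x hx => by simp [hf.supp x hx]⟩

lemma CC.sub (hf : CC R' τ₁ τ₂ f) (hg : CC R' τ₁ τ₂ g) : CC R' τ₁ τ₂ (fun x => f x - g x) :=
  ⟨fun x hx => (hf.cont x hx).sub (hg.cont x hx), fun x hx => by
    simp [hf.supp x hx, hg.supp x hx]⟩

lemma CC.sum {ι : Type*} (s : Finset ι) {f : ι → X5 → ℝ} (hf : ∀ i ∈ s, CC R' τ₁ τ₂ (f i)) :
    CC R' τ₁ τ₂ (fun x => ∑ i ∈ s, f i x) :=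
  ⟨fun x hx => tendsto_finsetSum _ fun i hi => (hf i hi).cont x hx, fun x hx =>
    Finset.sum_eq_zero fun i hi => (hf i hi).supp x hx⟩

lemma CC.slice_cont (hf : CC R' τ₁ τ₂ f) {τ : ℝ} (hτ : τ ∈ Icc τ₁ τ₂) :
    Continuous fun y : E4 => f (τ, y) :=
  continuous_iff_continuousAt.2 fun y =>
    ContinuousAt.comp (f := fun y : E4 => ((τ, y) : X5)) (hf.cont (τ, y) hτ) (by fun_prop)

lemma CC.slice_supp (hf : CC R' τ₁ τ₂ f) (τ : ℝ) : HasCompactSupport fun y : E4 => f (τ, y) :=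
  HasCompactSupport.intro (isCompact_closedBall (0 : E4) R') fun y hy => hf.supp (τ, y) (by
    simpa [rr] using hy)

lemma CC.integrable (hf : CC R' τ₁ τ₂ f) {τ : ℝ} (hτ : τ ∈ Icc τ₁ τ₂) :
    Integrable fun y : E4 => f (τ, y) :=
  (hf.slice_cont hτ).integrable_of_hasCompactSupport (hf.slice_supp τ)

lemma CC.continuousOn_sI (hf : CC R' τ₁ τ₂ f) : ContinuousOn (sI f) (Icc τ₁ τ₂) := by
  refine continuousOn_integral_of_compact_support (isCompact_closedBall (0 : E4) R')
    (f := fun τ y => f (τ, y)) (fun x hx => ?_) (fun p y _ hy => hf.supp (p, y) ?_)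
  · exact (hf.cont x (by simpa using hx)).continuousWithinAt
  · simpa [rr] using hy

lemma sI_mono (hf : CC R' τ₁ τ₂ f) (hg : CC R' τ₁ τ₂ g) {τ : ℝ} (hτ : τ ∈ Icc τ₁ τ₂)
    (h : ∀ y : E4, f (τ, y) ≤ g (τ, y)) : sI f τ ≤ sI g τ :=
  integral_mono (hf.integrable hτ) (hg.integrable hτ) h

lemma sI_add (hf : CC R' τ₁ τ₂ f) (hg : CC R' τ₁ τ₂ g) {τ : ℝ} (hτ : τ ∈ Icc τ₁ τ₂) :
    sI (fun x => f x + g x) τ = sI f τ + sI g τ :=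
  integral_add (hf.integrable hτ) (hg.integrable hτ)

lemma sI_sub (hf : CC R' τ₁ τ₂ f) (hg : CC R' τ₁ τ₂ g) {τ : ℝ} (hτ : τ ∈ Icc τ₁ τ₂) :
    sI (fun x => f x - g x) τ = sI f τ - sI g τ :=
  integral_sub (hf.integrable hτ) (hg.integrable hτ)

lemma sI_const_mul (c : ℝ) (f : X5 → ℝ) (τ : ℝ) : sI (fun x => c * f x) τ = c * sI f τ :=
  integral_const_mul _ _

/-- Smooth functions on `[τ₁, τ₂] × ℝ⁴` vanishing for `r ≥ R'`. -/
structure CS (R' τ₁ τ₂ : ℝ) (f : X5 → ℝ) : Prop where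
  sm : ∀ x : X5, x.1 ∈ Icc τ₁ τ₂ → Sm f x
  supp : ∀ x : X5, R' ≤ rr x → f x = 0

lemma CS.cc (hf : CS R' τ₁ τ₂ f) : CC R' τ₁ τ₂ f :=
  ⟨fun x hx => (hf.sm x hx).continuousAt, fun x hx => hf.supp x hx.le⟩

lemma rr_continuous : Continuous rr := continuous_snd.norm

lemma CS.pd_cc (hf : CS R' τ₁ τ₂ f) (a : Fin 5) : CC R' τ₁ τ₂ (pd a f) := by
  refine ⟨fun x hx => (pd_sm a (hf.sm x hx)).continuousAt, fun x hx => ?_⟩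
  have e : f =ᶠ[𝓝 x] fun _ => 0 := by
    filter_upwards [rr_continuous.continuousAt.eventually (lt_mem_nhds hx)] with z hz
    exact hf.supp z (le_of_lt hz)
  rw [pd_congr' a e, pd_const]

/-- The slice integral of a divergence vanishes. -/
lemma sI_pd_succ (hf : CS R' τ₁ τ₂ f) {τ : ℝ} (hτ : τ ∈ Icc τ₁ τ₂) (j : Fin 4) :
    sI (pd j.succ f) τ = 0 := by
  have hd : ∀ y : E4, fderiv ℝ (fun y : E4 => f (τ, y)) y (EuclideanSpace.single j 1)
      = pd j.succ f (τ, y) := fun y =>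
    dsnd_at (f := fun τ y => f (τ, y)) (x := (τ, y)) (hf.sm (τ, y) hτ).diff _
  have hdiff : ∀ y : E4, DifferentiableAt ℝ (fun y : E4 => f (τ, y)) y := fun y =>
    DifferentiableAt.comp (g := f) (f := fun y : E4 => ((τ, y) : X5)) y (hf.sm (τ, y) hτ).diff
      (by fun_prop)
  have h1 := (hf.pd_cc j.succ).integrable hτ
  have h2 := hf.cc.integrable hτ
  have := integral_mul_fderiv_eq_neg_fderiv_mul_of_integrable (μ := (volume : Measure E4))
    (f := fun _ => (1 : ℝ)) (g := fun y : E4 => f (τ, y)) (v := EuclideanSpace.single j 1)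
    (by simp) (by simpa [hd] using h1) (by simpa using h2) (by simp)
    (fun x _ => hdiff x)
  simpa [hd, sI] using this

lemma sI_sum_pd_succ {f : Fin 4 → X5 → ℝ} (hf : ∀ j, CS R' τ₁ τ₂ (f j)) {τ : ℝ}
    (hτ : τ ∈ Icc τ₁ τ₂) : sI (fun x => ∑ j : Fin 4, pd j.succ (f j) x) τ = 0 := by
  have : sI (fun x => ∑ j : Fin 4, pd j.succ (f j) x) τ = ∑ j : Fin 4, sI (pd j.succ (f j)) τ :=
    integral_finsetSum _ fun j _ => ((hf j).pd_cc j.succ).integrable hτ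
  rw [this]
  exact Finset.sum_eq_zero fun j _ => sI_pd_succ (hf j) hτ j

/-- Differentiation under the slice integral. -/
lemma hasDerivAt_sI (hf : CS R' τ₁ τ₂ f) {τ : ℝ} (hτ : τ ∈ Ioo τ₁ τ₂) :
    HasDerivAt (sI f) (sI (pd 0 f) τ) τ := by
  have hs : Icc τ₁ τ₂ ∈ 𝓝 τ := Icc_mem_nhds hτ.1 hτ.2
  have hcc := hf.pd_cc 0
  obtain ⟨B, hB⟩ : ∃ B, ∀ x ∈ Icc τ₁ τ₂ ×ˢ Metric.closedBall (0 : E4) R', ‖pd 0 f x‖ ≤ B :=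
    (isCompact_Icc.prod (isCompact_closedBall _ _)).exists_bound_of_continuousOn fun x hx =>
      (hcc.cont x hx.1).continuousWithinAt
  refine (hasDerivAt_integral_of_dominated_loc_of_deriv_le (F := fun τ (y : E4) => f (τ, y))
    (F' := fun τ (y : E4) => pd 0 f (τ, y))
    (bound := (Metric.closedBall (0 : E4) R').indicator fun _ => B) hs ?_
    (hf.cc.integrable (Ioo_subset_Icc_self hτ))
    (hcc.integrable (Ioo_subset_Icc_self hτ)).aestronglyMeasurable ?_ ?_ ?_).2
  · filter_upwards [hs] with t ht using (hf.cc.integrable ht).aestronglyMeasurable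
  · refine Eventually.of_forall fun y t ht => ?_
    by_cases hy : y ∈ Metric.closedBall (0 : E4) R'
    · rw [indicator_of_mem hy]; exact hB (t, y) ⟨ht, hy⟩
    · rw [indicator_of_notMem hy, hcc.supp (t, y) (by simpa [rr] using hy), norm_zero]
  · exact (integrable_indicator_iff Metric.isClosed_closedBall.measurableSet).2
      (integrableOn_const (isCompact_closedBall _ _).measure_lt_top.ne)
  · refine Eventually.of_forall fun y t ht => ?_
    have hd := (hf.sm (t, y) ht).diff
    have := dT_at (f := fun τ y => f (τ, y)) (x := (t, y)) hd
    have hd2 : DifferentiableAt ℝ (fun s => f (s, y)) t :=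
      DifferentiableAt.comp (g := f) (f := fun s : ℝ => ((s, y) : X5)) t hd (by fun_prop)
    exact hd2.hasDerivAt.congr_deriv this

lemma CC.ofReal_sI (hf : CC R' τ₁ τ₂ f) {τ : ℝ} (hτ : τ ∈ Icc τ₁ τ₂)
    (h0 : ∀ y : E4, 0 ≤ f (τ, y)) :
    ENNReal.ofReal (sI f τ) = ∫⁻ y : E4, ENNReal.ofReal (f (τ, y)) :=
  ofReal_integral_eq_lintegral_ofReal (hf.integrable hτ) (Eventually.of_forall h0)

lemma sI_nonneg {τ : ℝ} (h0 : ∀ y : E4, 0 ≤ f (τ, y)) : 0 ≤ sI f τ := integral_nonneg h0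

/-- Spacetime integrals as iterated lower integrals. -/
lemma CC.ofReal_bulk (hf : CC R' τ₁ τ₂ f) {τ : ℝ} (hτ : τ ∈ Icc τ₁ τ₂)
    (h0 : ∀ x : X5, x.1 ∈ Icc τ₁ τ₂ → 0 ≤ f x) :
    ENNReal.ofReal (∫ s in τ₁..τ, sI f s)
      = ∫⁻ s in Icc τ₁ τ, ∫⁻ y : E4, ENNReal.ofReal (f (s, y)) := by
  have hsub : Icc τ₁ τ ⊆ Icc τ₁ τ₂ := Icc_subset_Icc_right hτ.2
  rw [intervalIntegral.integral_of_le hτ.1, ← integral_Icc_eq_integral_Ioc,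
    ofReal_integral_eq_lintegral_ofReal]
  · exact setLIntegral_congr_fun measurableSet_Icc fun s hs =>
      hf.ofReal_sI (hsub hs) fun y => h0 (s, y) (hsub hs)
  · exact (hf.continuousOn_sI.mono hsub).integrableOn_Icc
  · exact (ae_restrict_iff' measurableSet_Icc).2 (Eventually.of_forall fun s hs =>
      sI_nonneg fun y => h0 (s, y) (hsub hs))
end

/-! ### The integrated energy inequality -/

section
variable {R R' δ α τ₁ τ₂ η : ℝ} {K : Fin 5 → Fin 5 → X5 → ℝ} {b : Fin 5 → X5 → ℝ} {c Y : X5 → ℝ}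
  {κ v : ℝ → ℝ} {f : X5 → ℝ}

lemma ev_lt {x : X5} (h : rr x < R) : ∀ᶠ z in 𝓝 x, rr z ≤ R := by
  filter_upwards [rr_continuous.continuousAt.eventually (gt_mem_nhds h)] with z hz using hz.le

lemma CS.of_region (h1 : ∀ x : X5, x.1 ∈ Icc τ₁ τ₂ → R ≤ rr x → Sm f x)
    (h2 : ∀ x, rr x ≤ R → f x = 0) (h3 : ∀ x, R' ≤ rr x → f x = 0) : CS R' τ₁ τ₂ f := by
  refine ⟨fun x hx => ?_, h3⟩
  rcases le_or_gt R (rr x) with h | h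
  · exact h1 x hx h
  · have e : f =ᶠ[𝓝 x] fun _ => 0 := (ev_lt h).mono fun z hz => h2 z hz
    exact Sm.congr contDiffAt_const e

lemma CC.of_region (h1 : ∀ x : X5, x.1 ∈ Icc τ₁ τ₂ → R ≤ rr x → ContinuousAt f x)
    (h2 : ∀ x, rr x ≤ R → f x = 0) (h3 : ∀ x, R' ≤ rr x → f x = 0) : CC R' τ₁ τ₂ f := by
  refine ⟨fun x hx => ?_, fun x hx => h3 x hx.le⟩
  rcases le_or_gt R (rr x) with h | h
  · exact h1 x hx h
  · have e : f =ᶠ[𝓝 x] fun _ => 0 := (ev_lt h).mono fun z hz => h2 z hz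
    exact continuousAt_const.congr e.symm

/-- Density of the flux controlled by the energy: `Y_r` and `Y / r`. -/
def dFN (κ v : ℝ → ℝ) (Y : X5 → ℝ) : X5 → ℝ := fun x => om κ v (rr x) * fluxN Y x
/-- Density of the lower-order flux: angular and `τ` derivatives. -/
def dFL (κ v : ℝ → ℝ) (Y : X5 → ℝ) : X5 → ℝ := fun x => om κ v (rr x) * fluxL Y x
/-- Density of the bulk term. -/
def dBk (κ v : ℝ → ℝ) (Y : X5 → ℝ) : X5 → ℝ := fun x => om κ v (rr x) / rr x * bulkN Y x
/-- Density of the source term: multiplier times operator. -/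
def dSrc (K : Fin 5 → Fin 5 → X5 → ℝ) (b : Fin 5 → X5 → ℝ) (c : X5 → ℝ) (κ v : ℝ → ℝ)
    (Y : X5 → ℝ) : X5 → ℝ := fun x =>
  |mult (X0 (Fw κ v)) (q0 (Fw κ v)) Y x * opL K b c Y x|
/-- Density supported where the cutoff `κ` varies. -/
def dCut (κ v : ℝ → ℝ) (Y : X5 → ℝ) : X5 → ℝ := fun x =>
  |omd κ v (rr x)| * (3 * bulkN Y x + |Y x / rr x| * |pd 0 Y x|)

lemma Weight.deriv_zero (hw : Weight R R' δ α κ v) {r : ℝ} (h : κ r = 0) : deriv κ r = 0 :=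
  IsLocalMin.deriv_eq_zero (Eventually.of_forall fun s => by rw [h]; exact hw.nonneg s)

section zero
variable {r : ℝ}
lemma om_zero (h : κ r = 0) : om κ v r = 0 := by simp [om, h]
lemma Fw_zero (h : κ r = 0) : Fw κ v r = 0 := by simp [Fw, h]
lemma omd_zero (hw : Weight R R' δ α κ v) (h : κ r = 0) : omd κ v r = 0 := by
  simp [omd, hw.deriv_zero h]
lemma mult_zero {x : X5} (h : κ (rr x) = 0) : mult (X0 (Fw κ v)) (q0 (Fw κ v)) Y x = 0 := by
  rw [mult_X0, Fw_zero h]; ring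
lemma X0_zero {x : X5} (h : κ (rr x) = 0) (a : Fin 5) : X0 (Fw κ v) a x = 0 := by
  refine Fin.cases ?_ (fun j => ?_) a <;> simp [X0, Fw_zero h]
lemma edens_zero (hw : Weight R R' δ α κ v) {x : X5} (h : κ (rr x) = 0) :
    edens K κ v Y x = 0 := by
  simp [edens, cur, mult_zero h, X0_zero h, exd, om_zero h, omd_zero hw h]
lemma scur_zero {x : X5} (h : κ (rr x) = 0) (j : Fin 4) : scur K κ v Y j x = 0 := by
  simp [scur, cur, mult_zero h, X0_zero h, hcur, Fw_zero h]
end zero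

lemma rho_sm {x : X5} (hY : Sm Y x) : Sm (rho Y) x :=
  ContDiffAt.sum fun j _ => (yc_sm j x).mul (pd_sm _ hY)
lemma gsq_sm {x : X5} (hY : Sm Y x) : Sm (gsq Y) x :=
  ContDiffAt.sum fun _ _ => (pd_sm _ hY).pow 2
lemma ya_sm {x : X5} (hr : 0 < rr x) (hY : Sm Y x) : Sm (ya Y) x :=
  (rho_sm hY).div (rr_sm (ne_zero_of_rr hr)) hr.ne'
lemma bulkN_sm {x : X5} (hr : 0 < rr x) (hY : Sm Y x) : Sm (bulkN Y) x :=
  ((gsq_sm hY).add ((hY.div (rr_sm (ne_zero_of_rr hr)) hr.ne').pow 2)).add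
    (((pd_sm 0 hY).div (rr_sm (ne_zero_of_rr hr)) hr.ne').pow 2)
lemma fluxN_sm {x : X5} (hr : 0 < rr x) (hY : Sm Y x) : Sm (fluxN Y) x :=
  ((ya_sm hr hY).pow 2).add ((hY.div (rr_sm (ne_zero_of_rr hr)) hr.ne').pow 2)
lemma fluxL_sm {x : X5} (hr : 0 < rr x) (hY : Sm Y x) : Sm (fluxL Y) x :=
  (((pd_sm 0 hY).div ((rr_sm (ne_zero_of_rr hr)).pow 2) (pow_ne_zero 2 hr.ne')).pow 2).add
    (((gsq_sm hY).sub ((ya_sm hr hY).pow 2)).div ((rr_sm (ne_zero_of_rr hr)).pow 2)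
      (pow_ne_zero 2 hr.ne'))

lemma b0_sm {x : X5} (hr : 0 < rr x) (a : Fin 5) : Sm (b0 a) x := by
  have h := rr_sm (ne_zero_of_rr hr)
  refine Fin.cases ?_ (fun j => ?_) a
  · exact (contDiffAt_const.div h hr.ne').neg
  · exact (((contDiffAt_const (c := (4 : ℝ))).mul (yc_sm j x)).div (h.pow 2) (pow_ne_zero 2 hr.ne')).neg

lemma opL_sm (hP : Perturbed R τ₁ τ₂ η K b c Y) {x : X5} (hx : x.1 ∈ Icc τ₁ τ₂) (hR : R ≤ rr x) :
    Sm (opL K b c Y) x := by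
  have hr : 0 < rr x := by linarith [hP.one_le]
  have hY := hP.smY x hx hR
  refine ContDiffAt.add (ContDiffAt.add ?_ ?_) ((hP.smc x hx hR).mul hY)
  · exact ContDiffAt.sum fun a _ => ContDiffAt.sum fun b _ =>
      (AK_sm hr (hP.smK x hx hR) a b).mul (pd_sm a (pd_sm b hY))
  · exact ContDiffAt.sum fun a _ => ((b0_sm hr a).add (hP.smb x hx hR a)).mul (pd_sm a hY)

section cc
variable (hw : Weight R R' δ α κ v) (hP : Perturbed R τ₁ τ₂ η K b c Y)
include hw hP

lemma cc_of {f : X5 → ℝ} (h1 : ∀ x : X5, x.1 ∈ Icc τ₁ τ₂ → R ≤ rr x → 0 < rr x → ContinuousAt f x)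
    (h2 : ∀ x, κ (rr x) = 0 → f x = 0) : CC R' τ₁ τ₂ f :=
  CC.of_region (fun x hx hR => h1 x hx hR (by linarith [hP.one_le]))
    (fun x hx => h2 x (hw.zero_in _ hx)) (fun x hx => h2 x (hw.zero_out _ hx))

lemma cc_dFN : CC R' τ₁ τ₂ (dFN κ v Y) := cc_of hw hP
  (fun x hx hR hr => ((Frr_sm (ne_zero_of_rr hr) (om_smooth hw hr)).mul
    (fluxN_sm hr (hP.smY x hx hR))).continuousAt) (fun x h => by simp [dFN, om_zero h])

lemma cc_dFL : CC R' τ₁ τ₂ (dFL κ v Y) := cc_of hw hP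
  (fun x hx hR hr => ((Frr_sm (ne_zero_of_rr hr) (om_smooth hw hr)).mul
    (fluxL_sm hr (hP.smY x hx hR))).continuousAt) (fun x h => by simp [dFL, om_zero h])

lemma cc_dBk : CC R' τ₁ τ₂ (dBk κ v Y) := cc_of hw hP
  (fun x hx hR hr => (((Frr_sm (ne_zero_of_rr hr) (om_smooth hw hr)).div
    (rr_sm (ne_zero_of_rr hr)) hr.ne').mul
    (bulkN_sm hr (hP.smY x hx hR))).continuousAt) (fun x h => by simp [dBk, om_zero h])

lemma cc_dSrc : CC R' τ₁ τ₂ (dSrc K b c κ v Y) := cc_of hw hP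
  (fun x hx hR hr => (((mult_sm (X0_sm (ne_zero_of_rr hr) (Fw_smooth hw hr))
    (q0_sm (ne_zero_of_rr hr) (Fw_smooth hw hr)) (hP.smY x hx hR)).mul
    (opL_sm hP hx hR)).continuousAt).abs) (fun x h => by simp [dSrc, mult_zero h])

lemma cc_dCut : CC R' τ₁ τ₂ (dCut κ v Y) := cc_of hw hP
  (fun x hx hR hr => by
    have hY := hP.smY x hx hR
    have h1 := (Frr_sm (ne_zero_of_rr hr) (omd_smooth hw hr)).continuousAt.abs
    have h2 := (bulkN_sm hr hY).continuousAt.const_mul 3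
    have h3 := (hY.div (rr_sm (ne_zero_of_rr hr)) hr.ne').continuousAt.abs
    have h4 := (pd_sm 0 hY).continuousAt.abs
    exact h1.mul (h2.add (h3.mul h4))) (fun x h => by simp [dCut, omd_zero hw h])

lemma cs_edens : CS R' τ₁ τ₂ (edens K κ v Y) := CS.of_region
  (fun x hx hR => edens_sm hw (by linarith [hP.one_le]) (hP.smK x hx hR) (hP.smY x hx hR))
  (fun x hx => edens_zero hw (hw.zero_in _ hx)) (fun x hx => edens_zero hw (hw.zero_out _ hx))

lemma cs_scur (j : Fin 4) : CS R' τ₁ τ₂ (scur K κ v Y j) := CS.of_region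
  (fun x hx hR => scur_sm hw (by linarith [hP.one_le]) (hP.smK x hx hR) (hP.smY x hx hR) j)
  (fun x hx => scur_zero (hw.zero_in _ hx) j) (fun x hx => scur_zero (hw.zero_out _ hx) j)

lemma cs_hcur (j : Fin 4) : CS R' τ₁ τ₂ (hcur (fun r => 1 / 4 * Fw κ v r / r) Y j) := CS.of_region
  (fun x hx hR => have hr : 0 < rr x := by linarith [hP.one_le]
    hcur_sm hr (fluxCorr_smooth hw hr) (hP.smY x hx hR) j)
  (fun x hx => by simp [hcur, Fw_zero (hw.zero_in _ hx)])
  (fun x hx => by simp [hcur, Fw_zero (hw.zero_out _ hx)])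

omit hw hP in
lemma dCut_nonneg (x : X5) : 0 ≤ dCut κ v Y x := by
  have : 0 ≤ gsq Y x := Finset.sum_nonneg fun _ _ => sq_nonneg _
  unfold dCut bulkN; positivity

omit hw hP in
lemma pd_zero_in {f : X5 → ℝ} {x : X5} (h : rr x < R) (hf : ∀ z, rr z ≤ R → f z = 0) (a : Fin 5) :
    pd a f x = 0 := by
  have e : f =ᶠ[𝓝 x] fun _ => 0 := (ev_lt h).mono fun z hz => hf z hz
  rw [pd_congr' a e, pd_const]

/-- The integrated weighted energy inequality on `[τ₁, τ]`. -/
theorem energy_inequality (hα : 0 < α) (hα' : α < 3 / 4) (hδ : 0 < δ) (hδ' : δ ≤ 3 / 2)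
    (hη : 40000 * η ≤ δ) (hηα : 32 * η ≤ α) {τ : ℝ} (hτ : τ ∈ Icc τ₁ τ₂) :
    α / 2 * sI (dFN κ v Y) τ + δ / 24 * ∫ s in τ₁..τ, sI (dBk κ v Y) s
      ≤ (2 + 1 / α) * sI (dFL κ v Y) τ + 10 * (sI (dFN κ v Y) τ₁ + sI (dFL κ v Y) τ₁)
        + ((∫ s in τ₁..τ, sI (dSrc K b c κ v Y) s) + ∫ s in τ₁..τ, sI (dCut κ v Y) s) := by
  have hR0 : 0 < R := by linarith [hP.one_le]
  have hτ1 : τ₁ ∈ Icc τ₁ τ₂ := ⟨le_rfl, hτ.1.trans hτ.2⟩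
  have hsub : Icc τ₁ τ ⊆ Icc τ₁ τ₂ := Icc_subset_Icc_right hτ.2
  have cE := (cs_edens hw hP).cc
  have cS := cc_dSrc hw hP
  have cB := cc_dBk hw hP
  have cC := cc_dCut hw hP
  have cN := cc_dFN hw hP
  have cL := cc_dFL hw hP
  -- the time derivative of the energy
  have hder : ∀ s ∈ Ioo τ₁ τ, sI (pd 0 (edens K κ v Y)) s
      ≤ sI (dSrc K b c κ v Y) s - δ / 24 * sI (dBk κ v Y) s + sI (dCut κ v Y) s := by
    intro s hs
    have hs' : s ∈ Icc τ₁ τ₂ := hsub (Ioo_subset_Icc_self hs)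
    have c1 := (cs_edens hw hP).pd_cc 0
    have c2 : CC R' τ₁ τ₂ fun x => ∑ j : Fin 4, pd j.succ (scur K κ v Y j) x :=
      CC.sum _ fun j _ => (cs_scur hw hP j).pd_cc j.succ
    have c3 := (cS.sub (cB.const_mul (δ / 24))).add cC
    have h0 := sI_sum_pd_succ (cs_scur hw hP) hs'
    have h1 : sI (pd 0 (edens K κ v Y)) s
        = sI (fun x => pd 0 (edens K κ v Y) x + ∑ j : Fin 4, pd j.succ (scur K κ v Y j) x) s := by
      rw [sI_add c1 c2 hs', h0, add_zero]
    rw [h1, ← sI_const_mul, ← sI_sub cS (cB.const_mul (δ / 24)) hs',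
      ← sI_add (cS.sub (cB.const_mul (δ / 24))) cC hs']
    refine sI_mono (c1.add c2) c3 hs' fun y => ?_
    rcases le_or_gt R (rr (s, y)) with h | h
    · have := energy_pointwise hw hP hα hδ hδ' hη (x := (s, y)) hs' h
      simp only [dSrc, dBk, dCut]
      rw [← mul_assoc]; exact this
    · have hk := hw.zero_in _ h.le
      rw [pd_zero_in h (fun z hz => edens_zero hw (hw.zero_in _ hz)),
        Finset.sum_eq_zero fun j _ => pd_zero_in h (fun z hz => scur_zero (hw.zero_in _ hz) j) _]
      simp [dSrc, dBk, dCut, mult_zero hk, om_zero hk, omd_zero hw hk]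
  have hcS := cS.continuousOn_sI.mono hsub
  have hcB := cB.continuousOn_sI.mono hsub
  have hcC := cC.continuousOn_sI.mono hsub
  have hmain := intervalIntegral.sub_le_integral_of_hasDeriv_right_of_le hτ.1
    (cE.continuousOn_sI.mono hsub)
    (fun s hs => (hasDerivAt_sI (cs_edens hw hP)
      ⟨hs.1, hs.2.trans_le hτ.2⟩).hasDerivWithinAt)
    (φ := fun s => sI (dSrc K b c κ v Y) s - δ / 24 * sI (dBk κ v Y) s + sI (dCut κ v Y) s)
    (((hcS.sub (continuousOn_const.mul hcB)).add hcC).integrableOn_Icc) hder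
  have hi : ∀ {g : ℝ → ℝ}, ContinuousOn g (Icc τ₁ τ) → IntervalIntegrable g volume τ₁ τ :=
    fun hg => ContinuousOn.intervalIntegrable_of_Icc hτ.1 hg
  rw [intervalIntegral.integral_add ((hi hcS).sub ((hi hcB).const_mul _)) (hi hcC),
    intervalIntegral.integral_sub (hi hcS) ((hi hcB).const_mul _),
    intervalIntegral.integral_const_mul] at hmain
  -- comparison of the energy with the flux densities
  have c2 : CC R' τ₁ τ₂ fun x => ∑ j : Fin 4,
      pd j.succ (hcur (fun r => 1 / 4 * Fw κ v r / r) Y j) x :=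
    CC.sum _ fun j _ => (cs_hcur hw hP j).pd_cc j.succ
  have hE : ∀ s ∈ Icc τ₁ τ₂, sI (edens K κ v Y) s = sI (fun x => edens K κ v Y x - ∑ j : Fin 4,
      pd j.succ (hcur (fun r => 1 / 4 * Fw κ v r / r) Y j) x) s := by
    intro s hs
    rw [sI_sub cE c2 hs, sI_sum_pd_succ (cs_hcur hw hP) hs, sub_zero]
  have hzero : ∀ s (y : E4), rr (s, y) < R → (edens K κ v Y (s, y) - ∑ j : Fin 4,
      pd j.succ (hcur (fun r => 1 / 4 * Fw κ v r / r) Y j) (s, y)) = 0 := by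
    intro s y h
    rw [edens_zero hw (hw.zero_in _ h.le), Finset.sum_eq_zero fun j _ => pd_zero_in h
      (fun z hz => by simp [hcur, Fw_zero (hw.zero_in _ hz)]) _, sub_zero]
  have hlo : α / 2 * sI (dFN κ v Y) τ - (2 + 1 / α) * sI (dFL κ v Y) τ ≤ sI (edens K κ v Y) τ := by
    rw [hE τ hτ, ← sI_const_mul, ← sI_const_mul,
      ← sI_sub (cN.const_mul _) (cL.const_mul _) hτ]
    refine sI_mono ((cN.const_mul _).sub (cL.const_mul _)) (cE.sub c2) hτ fun y => ?_
    rcases le_or_gt R (rr (τ, y)) with h | h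
    · have := (flux_pointwise hw hP hα hα' hδ hηα (x := (τ, y)) hτ h).1
      simp only [dFN, dFL]; linarith
    · rw [hzero τ y h]; simp [dFN, dFL, om_zero (hw.zero_in _ h.le)]
  have hup : sI (edens K κ v Y) τ₁ ≤ 10 * (sI (dFN κ v Y) τ₁ + sI (dFL κ v Y) τ₁) := by
    rw [hE τ₁ hτ1, ← sI_add cN cL hτ1, ← sI_const_mul]
    refine sI_mono (cE.sub c2) ((cN.add cL).const_mul _) hτ1 fun y => ?_
    rcases le_or_gt R (rr (τ₁, y)) with h | h
    · have := (flux_pointwise hw hP hα hα' hδ hηα (x := (τ₁, y)) hτ1 h).2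
      simp only [dFN, dFL]; linarith
    · rw [hzero τ₁ y h]; simp [dFN, dFL, om_zero (hw.zero_in _ h.le)]
  linarith
end cc
end

/-! ### Symbol classes uniform over slowly varying geometries -/

/-- A moving foliation with centre `eta` and velocity `l` over a set `T` of times, in the exterior
`r ≥ R`, together with a bound `e` for the size of the parameters and of the derivatives used. -/
structure Geo where
  eta : ℝ → E4
  l : ℝ → E4
  T : Set ℝ
  R : ℝ
  e : ℝ
  one_le : 1 ≤ R
  e_nonneg : 0 ≤ e
  sm_eta : ∀ τ ∈ T, ContDiffAt ℝ ∞ eta τ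
  sm_l : ∀ τ ∈ T, ContDiffAt ℝ ∞ l τ
  l_le : ∀ τ ∈ T, ‖l τ‖ ≤ e
  dl_le : ∀ τ ∈ T, ‖deriv l τ‖ ≤ e
  ddl_le : ∀ τ ∈ T, ‖deriv (deriv l) τ‖ ≤ e
  deta_le : ∀ τ ∈ T, ‖deriv eta τ‖ ≤ e
  ddeta_le : ∀ τ ∈ T, ‖deriv (deriv eta) τ‖ ≤ e

/-- The smallness parameter `e + 1/R`. -/
def Geo.gap (G : Geo) : ℝ := G.e + 1 / G.R

/-- The region `τ ∈ T`, `r ≥ R`. -/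
def Geo.reg (G : Geo) : Set X5 := {x | x.1 ∈ G.T ∧ G.R ≤ rr x}

/-- The filter of geometries whose smallness parameter tends to `0`. -/
def small : Filter Geo := comap Geo.gap (𝓝 0)

/-- A family `F` of smooth functions on the regions `G.reg` with `|F| ≤ C (e + 1/R)^g r^m`. -/
def SymB (g : ℕ) (m : ℤ) (F : Geo → X5 → ℝ) : Prop :=
  ∃ C : ℝ, 0 ≤ C ∧ ∀ᶠ G in small, ∀ x ∈ G.reg, Sm (F G) x ∧ |F G x| ≤ C * G.gap ^ g * rr x ^ m

/-- Families of symbols of order `m` and size `(e + 1/R)^g`: each of the first `k` derivatives in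
`y` lowers the order by one, the derivative in `τ` preserves it. -/
def Sym : ℕ → ℕ → ℤ → (Geo → X5 → ℝ) → Prop
  | 0, g, m, F => SymB g m F
  | k + 1, g, m, F => SymB g m F ∧ Sym k g m (fun G => pd 0 (F G)) ∧
      ∀ j : Fin 4, Sym k g (m - 1) (fun G => pd j.succ (F G))

lemma Geo.gap_pos (G : Geo) : 0 < G.gap := by
  have := G.one_le; have := G.e_nonneg
  unfold Geo.gap; positivity

lemma Geo.inv_le (G : Geo) : 1 / G.R ≤ G.gap := by
  have := G.e_nonneg; unfold Geo.gap; linarith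

lemma Geo.e_le (G : Geo) : G.e ≤ G.gap := by
  have : 0 < 1 / G.R := by have := G.one_le; positivity
  unfold Geo.gap; linarith

lemma Geo.r_ge {G : Geo} {x : X5} (hx : x ∈ G.reg) : 1 ≤ rr x := G.one_le.trans hx.2

lemma Geo.y_ne {G : Geo} {x : X5} (hx : x ∈ G.reg) : x.2 ≠ 0 :=
  ne_zero_of_rr (by linarith [Geo.r_ge hx])

lemma gap_lt {c : ℝ} (hc : 0 < c) : ∀ᶠ G in small, G.gap < c :=
  tendsto_comap.eventually (gt_mem_nhds hc)

lemma Sym.base {k g : ℕ} {m : ℤ} {F : Geo → X5 → ℝ} (h : Sym k g m F) : SymB g m F := by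
  cases k with
  | zero => exact h
  | succ k => exact h.1

lemma Sym.sm {k g : ℕ} {m : ℤ} {F : Geo → X5 → ℝ} (h : Sym k g m F) :
    ∀ᶠ G in small, ∀ x ∈ G.reg, Sm (F G) x := by
  obtain ⟨C, _, h⟩ := h.base
  filter_upwards [h] with G hG x hx using (hG x hx).1

lemma Sym.lower {k g : ℕ} {m : ℤ} {F : Geo → X5 → ℝ} (h : Sym (k + 1) g m F) : Sym k g m F := by
  induction k generalizing m F with
  | zero => exact h.1
  | succ k ih => exact ⟨h.1, ih h.2.1, fun j => ih (h.2.2 j)⟩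

lemma Sym.congr {k g : ℕ} {m : ℤ} {F F' : Geo → X5 → ℝ} (h : Sym k g m F)
    (e : ∀ᶠ G in small, ∀ x ∈ G.reg, F' G =ᶠ[𝓝 x] F G) : Sym k g m F' := by
  have hB : ∀ {F F' : Geo → X5 → ℝ} {m : ℤ}, SymB g m F →
      (∀ᶠ G in small, ∀ x ∈ G.reg, F' G =ᶠ[𝓝 x] F G) → SymB g m F' := by
    rintro F F' m ⟨C, hC, h⟩ e
    refine ⟨C, hC, ?_⟩
    filter_upwards [h, e] with G h e x hx
    exact ⟨(h x hx).1.congr (e x hx), by rw [(e x hx).eq_of_nhds]; exact (h x hx).2⟩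
  induction k generalizing m F F' with
  | zero => exact hB h e
  | succ k ih =>
    exact ⟨hB h.1 e, ih h.2.1 (by filter_upwards [e] with G e x hx using pd_congr 0 (e x hx)),
      fun j => ih (h.2.2 j) (by filter_upwards [e] with G e x hx using pd_congr _ (e x hx))⟩

lemma Sym.relax {k g g' : ℕ} {m m' : ℤ} {F : Geo → X5 → ℝ} (h : Sym k g m F) (hg : g' ≤ g)
    (hm : m ≤ m') : Sym k g' m' F := by
  have hB : ∀ {F : Geo → X5 → ℝ} {m m' : ℤ}, m ≤ m' → SymB g m F → SymB g' m' F := by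
    rintro F m m' hm ⟨C, hC, h⟩
    refine ⟨C, hC, ?_⟩
    filter_upwards [h, gap_lt one_pos] with G h h1 x hx
    refine ⟨(h x hx).1, (h x hx).2.trans ?_⟩
    have i1 : G.gap ^ g ≤ G.gap ^ g' := pow_le_pow_of_le_one G.gap_pos.le h1.le hg
    have i2 : rr x ^ m ≤ rr x ^ m' := zpow_le_zpow_right₀ (Geo.r_ge hx) hm
    have := G.gap_pos
    have : 0 < rr x := by linarith [Geo.r_ge hx]
    gcongr
  induction k generalizing m m' F with
  | zero => exact hB hm h
  | succ k ih => exact ⟨hB hm h.1, ih h.2.1 hm, fun j => ih (h.2.2 j) (by omega)⟩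

/-- In the exterior `r ≥ R`, decay can be traded for smallness. -/
lemma Sym.gain {k g : ℕ} {m : ℤ} {F : Geo → X5 → ℝ} (h : Sym k g m F) :
    Sym k (g + 1) (m + 1) F := by
  have hB : ∀ {F : Geo → X5 → ℝ} {m : ℤ}, SymB g m F → SymB (g + 1) (m + 1) F := by
    rintro F m ⟨C, hC, h⟩
    refine ⟨C, hC, ?_⟩
    filter_upwards [h] with G h x hx
    refine ⟨(h x hx).1, (h x hx).2.trans ?_⟩
    have hr : 0 < rr x := by linarith [Geo.r_ge hx]
    have i1 : 1 ≤ G.gap * rr x := by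
      have h1 := G.one_le
      have h2 := hx.2
      calc (1 : ℝ) = 1 / G.R * G.R := by field_simp
        _ ≤ G.gap * rr x := by
          have := G.inv_le; have := G.gap_pos; gcongr
    have := G.gap_pos
    rw [zpow_add_one₀ hr.ne', pow_succ]
    calc C * G.gap ^ g * rr x ^ m = C * G.gap ^ g * rr x ^ m * 1 := by ring
      _ ≤ C * G.gap ^ g * rr x ^ m * (G.gap * rr x) := by gcongr
      _ = _ := by ring
  induction k generalizing m F with
  | zero => exact hB h
  | succ k ih =>
    exact ⟨hB h.1, ih h.2.1, fun j => by
      have := ih (h.2.2 j); rwa [show m + 1 - 1 = m - 1 + 1 by ring]⟩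

lemma Sym.add {k g : ℕ} {m : ℤ} {F F' : Geo → X5 → ℝ} (h : Sym k g m F) (h' : Sym k g m F') :
    Sym k g m (fun G x => F G x + F' G x) := by
  have hB : ∀ {F F' : Geo → X5 → ℝ} {m : ℤ}, SymB g m F → SymB g m F' →
      SymB g m (fun G x => F G x + F' G x) := by
    rintro F F' m ⟨C, hC, h⟩ ⟨C', hC', h'⟩
    refine ⟨C + C', by positivity, ?_⟩
    filter_upwards [h, h'] with G h h' x hx
    refine ⟨(h x hx).1.add (h' x hx).1, (abs_add_le _ _).trans ?_⟩
    linarith [(h x hx).2, (h' x hx).2]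
  have hS := h.sm
  have hS' := h'.sm
  induction k generalizing m F F' with
  | zero => exact hB h h'
  | succ k ih =>
    refine ⟨hB h.1 h'.1, (ih h.2.1 h'.2.1 h.2.1.sm h'.2.1.sm).congr ?_, fun j =>
      (ih (h.2.2 j) (h'.2.2 j) (h.2.2 j).sm (h'.2.2 j).sm).congr ?_⟩ <;>
    filter_upwards [hS, hS'] with G a b x hx using pd_add_ev _ (a x hx) (b x hx)

lemma Sym.mul {k g g' : ℕ} {m m' : ℤ} {F F' : Geo → X5 → ℝ} (h : Sym k g m F)
    (h' : Sym k g' m' F') : Sym k (g + g') (m + m') (fun G x => F G x * F' G x) := by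
  have hB : ∀ {F F' : Geo → X5 → ℝ} {m m' : ℤ}, SymB g m F → SymB g' m' F' →
      SymB (g + g') (m + m') (fun G x => F G x * F' G x) := by
    rintro F F' m m' ⟨C, hC, h⟩ ⟨C', hC', h'⟩
    refine ⟨C * C', by positivity, ?_⟩
    filter_upwards [h, h'] with G h h' x hx
    have hr : 0 < rr x := by linarith [Geo.r_ge hx]
    refine ⟨(h x hx).1.mul (h' x hx).1, ?_⟩
    rw [abs_mul, zpow_add₀ hr.ne', pow_add]
    calc _ ≤ (C * G.gap ^ g * rr x ^ m) * (C' * G.gap ^ g' * rr x ^ m') :=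
          mul_le_mul (h x hx).2 (h' x hx).2 (abs_nonneg _) ((abs_nonneg _).trans (h x hx).2)
      _ = _ := by ring
  have hS := h.sm
  have hS' := h'.sm
  induction k generalizing m m' F F' with
  | zero => exact hB h h'
  | succ k ih =>
    refine ⟨hB h.1 h'.1, ((ih h.2.1 h'.lower h.2.1.sm hS').add
      (ih h.lower h'.2.1 hS h'.2.1.sm)).congr ?_, fun j =>
      (((ih (h.2.2 j) h'.lower (h.2.2 j).sm hS').relax le_rfl
        (show m - 1 + m' ≤ m + m' - 1 by omega)).add ((ih h.lower (h'.2.2 j) hS (h'.2.2 j).sm).relax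
          le_rfl (show m + (m' - 1) ≤ m + m' - 1 by omega))).congr ?_⟩ <;>
    filter_upwards [hS, hS'] with G a b x hx using pd_mul_ev _ (a x hx) (b x hx)

lemma pd_zero_fun (a : Fin 5) (c : ℝ) : pd a (fun _ : X5 => c) = fun _ => 0 := by
  funext x; exact pd_const a c x

lemma Sym.const (k : ℕ) (c : ℝ) : Sym k 0 0 (fun _ _ => c) := by
  have h0 : ∀ (k : ℕ) (m : ℤ), Sym k 0 m (fun _ _ => (0 : ℝ)) := by
    intro k
    have hB : ∀ m : ℤ, SymB 0 m (fun _ _ => (0 : ℝ)) := fun m =>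
      ⟨0, le_rfl, Eventually.of_forall fun G x _ => ⟨contDiffAt_const, by simp⟩⟩
    induction k with
    | zero => exact hB
    | succ k ih =>
      intro m
      refine ⟨hB m, ?_, fun j => ?_⟩ <;> simp only [pd_zero_fun] <;> exact ih _
  have hB : SymB 0 0 (fun _ _ => c) :=
    ⟨|c|, abs_nonneg _, Eventually.of_forall fun G x _ => ⟨contDiffAt_const, by simp⟩⟩
  cases k with
  | zero => exact hB
  | succ k =>
    refine ⟨hB, ?_, fun j => ?_⟩ <;> simp only [pd_zero_fun] <;> exact h0 _ _

lemma Sym.zero_fun (k g : ℕ) (m : ℤ) : Sym k g m (fun _ _ => (0 : ℝ)) := by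
  have hB : ∀ m : ℤ, SymB g m (fun _ _ => (0 : ℝ)) := fun m =>
    ⟨0, le_rfl, Eventually.of_forall fun G x _ => ⟨contDiffAt_const, by simp⟩⟩
  induction k generalizing m with
  | zero => exact hB m
  | succ k ih =>
    refine ⟨hB m, ?_, fun j => ?_⟩ <;> simp only [pd_zero_fun] <;> exact ih _

lemma Sym.cmul {k g : ℕ} {m : ℤ} {F : Geo → X5 → ℝ} (c : ℝ) (h : Sym k g m F) :
    Sym k g m (fun G x => c * F G x) :=
  ((Sym.const k c).mul h).relax (by omega) (by omega)

lemma Sym.neg {k g : ℕ} {m : ℤ} {F : Geo → X5 → ℝ} (h : Sym k g m F) :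
    Sym k g m (fun G x => - F G x) := by
  simpa using h.cmul (-1)

lemma Sym.sub {k g : ℕ} {m : ℤ} {F F' : Geo → X5 → ℝ} (h : Sym k g m F) (h' : Sym k g m F') :
    Sym k g m (fun G x => F G x - F' G x) := by
  simpa only [sub_eq_add_neg] using h.add h'.neg

lemma Sym.sum {ι : Type*} {k g : ℕ} {m : ℤ} (s : Finset ι) {F : ι → Geo → X5 → ℝ}
    (h : ∀ i ∈ s, Sym k g m (F i)) : Sym k g m (fun G x => ∑ i ∈ s, F i G x) := by
  classical
  induction s using Finset.induction_on with
  | empty => simpa using Sym.zero_fun k g m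
  | insert i s hi ih =>
    simp only [Finset.sum_insert hi]
    exact (h i (by simp)).add (ih fun j hj => h j (by simp [hj]))

/-- Lower bound `c r^m ≤ F` with some `c > 0`. -/
def Ell (m : ℤ) (F : Geo → X5 → ℝ) : Prop :=
  ∃ c : ℝ, 0 < c ∧ ∀ᶠ G in small, ∀ x ∈ G.reg, c * rr x ^ m ≤ F G x

/-- The derivative of `1/F` is `-F⁻² ∂F`, so the symbol property passes to the inverse by induction on
the number of derivatives. -/
lemma Sym.inv {k : ℕ} {m : ℤ} {F : Geo → X5 → ℝ} (h : Sym k 0 m F) (hE : Ell m F) :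
    Sym k 0 (-m) (fun G x => (F G x)⁻¹) := by
  obtain ⟨c, hc, hE⟩ := hE
  have hpos : ∀ᶠ G in small, ∀ x ∈ G.reg, 0 < F G x := by
    filter_upwards [hE] with G h x hx
    have hr : 0 < rr x := by linarith [Geo.r_ge hx]
    exact lt_of_lt_of_le (by positivity) (h x hx)
  have hS := h.sm
  have hB : SymB 0 (-m) (fun G x => (F G x)⁻¹) := by
    refine ⟨c⁻¹, by positivity, ?_⟩
    filter_upwards [hE, hS, hpos] with G h1 h2 h3 x hx
    have hr : 0 < rr x := by linarith [Geo.r_ge hx]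
    refine ⟨(h2 x hx).inv (h3 x hx).ne', ?_⟩
    rw [abs_of_pos (inv_pos.2 (h3 x hx)), pow_zero, mul_one, zpow_neg, ← mul_inv]
    exact inv_anti₀ (by positivity) (h1 x hx)
  induction k with
  | zero => exact hB
  | succ k ih =>
    have ih := ih h.lower
    have e : ∀ a, ∀ᶠ G in small, ∀ x ∈ G.reg, pd a (fun x => (F G x)⁻¹) =ᶠ[𝓝 x]
        fun x => -(((F G x)⁻¹ * (F G x)⁻¹) * pd a (F G) x) := by
      intro a
      filter_upwards [hS, hpos] with G h2 h3 x hx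
      filter_upwards [(h2 x hx).ev_diff,
        (h2 x hx).continuousAt.eventually_ne (h3 x hx).ne'] with z hz h0
      rw [pd_comp a (hasDerivAt_inv h0) hz]
      field_simp
    refine ⟨hB, ((((ih.mul ih).mul h.2.1).neg).relax (by omega) (by omega)).congr (e 0), fun j =>
      ((((ih.mul ih).mul (h.2.2 j)).neg).relax (by omega) (by omega)).congr (e _)⟩

lemma Sym.invSqrt {k : ℕ} {m : ℤ} {F : Geo → X5 → ℝ} (h : Sym k 0 (2 * m) F)
    (hE : Ell (2 * m) F) : Sym k 0 (-m) (fun G x => (Real.sqrt (F G x))⁻¹) := by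
  obtain ⟨c, hc, hE⟩ := hE
  have hpos : ∀ᶠ G in small, ∀ x ∈ G.reg, 0 < F G x := by
    filter_upwards [hE] with G h x hx
    have hr : 0 < rr x := by linarith [Geo.r_ge hx]
    exact lt_of_lt_of_le (by positivity) (h x hx)
  have hS := h.sm
  have hB : SymB 0 (-m) (fun G x => (Real.sqrt (F G x))⁻¹) := by
    refine ⟨(Real.sqrt c)⁻¹, by positivity, ?_⟩
    filter_upwards [hE, hS, hpos] with G h1 h2 h3 x hx
    have hr : 0 < rr x := by linarith [Geo.r_ge hx]
    refine ⟨((h2 x hx).sqrt (h3 x hx).ne').inv (Real.sqrt_pos.2 (h3 x hx)).ne', ?_⟩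
    rw [abs_of_pos (inv_pos.2 (Real.sqrt_pos.2 (h3 x hx))), pow_zero, mul_one, zpow_neg, ← mul_inv]
    refine inv_anti₀ (by positivity) ?_
    rw [← Real.sqrt_sq (show 0 ≤ rr x ^ m by positivity), ← Real.sqrt_mul hc.le]
    refine Real.sqrt_le_sqrt (le_trans (le_of_eq ?_) (h1 x hx))
    rw [← zpow_natCast, ← zpow_mul]; congr 2; push_cast; ring
  induction k with
  | zero => exact hB
  | succ k ih =>
    have ih := ih h.lower
    have e : ∀ a, ∀ᶠ G in small, ∀ x ∈ G.reg, pd a (fun x => (Real.sqrt (F G x))⁻¹) =ᶠ[𝓝 x]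
        fun x => (-1 / 2) * (((Real.sqrt (F G x))⁻¹ * ((Real.sqrt (F G x))⁻¹ *
          (Real.sqrt (F G x))⁻¹)) * pd a (F G) x) := by
      intro a
      filter_upwards [hS, hpos] with G h2 h3 x hx
      filter_upwards [(h2 x hx).ev_diff,
        (h2 x hx).continuousAt.eventually (lt_mem_nhds (h3 x hx))] with z hz h0
      have hs := Real.sqrt_pos.2 h0
      rw [show (fun x => (Real.sqrt (F G x))⁻¹) = fun x => (fun t => (Real.sqrt t)⁻¹) (F G x) from rfl,
        pd_comp a ((Real.hasDerivAt_sqrt h0.ne').fun_inv hs.ne') hz]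
      field_simp
    refine ⟨hB, (((ih.mul (ih.mul ih)).mul h.2.1).cmul _ |>.relax (by omega) (by omega)).congr (e 0),
      fun j => (((ih.mul (ih.mul ih)).mul (h.2.2 j)).cmul _ |>.relax (by omega)
        (by omega)).congr (e _)⟩

lemma Sym.yc (k : ℕ) (j : Fin 4) : Sym k 0 1 (fun _ => yc j) := by
  have hB : SymB 0 1 (fun _ => HypRp.yc j) := by
    refine ⟨1, one_pos.le, Eventually.of_forall fun G x _ => ⟨yc_sm j x, ?_⟩⟩
    simp only [pow_zero, mul_one, zpow_one, one_mul]
    have := EuclideanSpace.norm_eq x.2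
    rw [rr]
    exact PiLp.norm_apply_le x.2 j
  cases k with
  | zero => exact hB
  | succ k =>
    have e : ∀ a, pd a (HypRp.yc j) = fun _ => if a = j.succ then 1 else 0 := by
      intro a; funext x; exact pd_yc j a x
    refine ⟨hB, ?_, fun i => ?_⟩ <;> simp only [e]
    · exact (Sym.const k _).relax le_rfl (by omega)
    · exact (Sym.const k _)

/-- Functions of `τ` alone. -/
lemma Sym.time0 {g : ℕ} {φ : Geo → ℝ → ℝ} (hs : ∀ G : Geo, ∀ τ ∈ G.T, ContDiffAt ℝ ∞ (φ G) τ)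
    (hb : ∀ G : Geo, ∀ τ ∈ G.T, |φ G τ| ≤ G.gap ^ g) : Sym 0 g 0 (fun G x => φ G x.1) :=
  ⟨1, one_pos.le, Eventually.of_forall fun G x hx =>
    ⟨(hs G x.1 hx.1).comp x contDiffAt_fst, by simpa using hb G x.1 hx.1⟩⟩

lemma contDiffAt_deriv' {φ : ℝ → ℝ} {τ : ℝ} (h : ContDiffAt ℝ ∞ φ τ) :
    ContDiffAt ℝ ∞ (deriv φ) τ := by
  have : ContDiffAt ℝ ∞ (fderiv ℝ φ) τ := h.fderiv_right (by simp)
  have h2 : deriv φ = fun s => fderiv ℝ φ s 1 := rfl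
  rw [h2]
  exact this.clm_apply contDiffAt_const

lemma Sym.time {k g : ℕ} {φ : Geo → ℝ → ℝ} (hs : ∀ G : Geo, ∀ τ ∈ G.T, ContDiffAt ℝ ∞ (φ G) τ)
    (hb : ∀ i ≤ k, ∀ G : Geo, ∀ τ ∈ G.T, |deriv^[i] (φ G) τ| ≤ G.gap ^ g) :
    Sym k g 0 (fun G x => φ G x.1) := by
  induction k generalizing φ with
  | zero => exact Sym.time0 hs (hb 0 le_rfl)
  | succ k ih =>
    refine ⟨Sym.time0 hs (hb 0 (by omega)), ?_, fun j => ?_⟩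
    · refine (ih (φ := fun G => deriv (φ G)) (fun G τ h => contDiffAt_deriv' (hs G τ h))
        (fun i hi G τ h => ?_)).congr (Eventually.of_forall fun G x hx => ?_)
      · simpa using hb (i + 1) (by omega) G τ h
      · have h1 : ContDiffAt ℝ 1 (φ G) x.1 := contDiffAt_infty.1 (hs G x.1 hx.1) 1
        have h2 := h1.eventually (by simp)
        filter_upwards [continuous_fst.continuousAt.eventually h2] with z hz
        rw [pd_fst (hz.differentiableAt (by simp))]; simp
    · refine (Sym.zero_fun k g (0 - 1)).congr (Eventually.of_forall fun G x hx => ?_)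
      have h1 : ContDiffAt ℝ 1 (φ G) x.1 := contDiffAt_infty.1 (hs G x.1 hx.1) 1
      have h2 := h1.eventually (by simp)
      filter_upwards [continuous_fst.continuousAt.eventually h2] with z hz
      rw [pd_fst (hz.differentiableAt (by simp))]; simp

lemma Sym.rrsq (k : ℕ) : Sym k 0 2 (fun _ x => rr x ^ 2) := by
  simp only [rr_sq]
  simp only [sq]
  exact Sym.sum _ fun j _ => ((Sym.yc k j).mul (Sym.yc k j)).relax (by omega) (by omega)

lemma Sym.irr (k : ℕ) : Sym k 0 (-1) (fun _ x => (rr x)⁻¹) := by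
  have h := Sym.invSqrt (m := 1) (Sym.rrsq k) ⟨1, one_pos, Eventually.of_forall fun G x hx => by
    rw [one_mul]; norm_cast⟩
  refine h.congr (Eventually.of_forall fun G x hx => Eventually.of_forall fun z => ?_)
  simp only [Real.sqrt_sq (show 0 ≤ rr z from norm_nonneg _)]

lemma Sym.rr (k : ℕ) : Sym k 0 1 (fun _ x => rr x) := by
  refine (((Sym.rrsq k).mul (Sym.irr k)).relax (by omega) (by omega)).congr
    (Eventually.of_forall fun G x hx => ?_)
  filter_upwards [ev_ne (Geo.y_ne hx)] with z hz
  have := rr_pos hz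
  field_simp

lemma Sym.jap (k : ℕ) : Sym k 0 1 (fun _ x => jap (HypRp.rr x)) := by
  have h1 : Sym k 0 2 (fun _ x => 1 + HypRp.rr x ^ 2) :=
    ((Sym.const k 1).relax le_rfl (by omega)).add (Sym.rrsq k)
  have h := Sym.invSqrt (m := 1) h1 ⟨1, one_pos, Eventually.of_forall fun G x hx => by
    rw [one_mul, mul_one]
    have : HypRp.rr x ^ (2 : ℤ) = HypRp.rr x ^ 2 := by norm_cast
    rw [this]; linarith⟩
  refine ((h1.mul h).relax (by omega) (by omega)).congr
    (Eventually.of_forall fun G x hx => Eventually.of_forall fun z => ?_)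
  have h0 : 0 < 1 + HypRp.rr z ^ 2 := by positivity
  have h2 := Real.sqrt_pos.2 h0
  simp only [HypRp.jap]
  rw [eq_mul_inv_iff_mul_eq₀ h2.ne', Real.mul_self_sqrt h0.le]

/-! ### The hyperboloidal frame and the Minkowski part of the operator -/

/-- `y · η'`. -/
def yE (eta : ℝ → E4) : X5 → ℝ := fun x => ∑ j, yc j x * deriv eta x.1 j

/-- `W = ⟨r⟩ - y · η'`. -/
def WW (eta : ℝ → E4) : X5 → ℝ := fun x => jap (rr x) - yE eta x

/-- `W⁻¹`. -/
def iW (eta : ℝ → E4) : X5 → ℝ := fun x => (WW eta x)⁻¹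

/-- The factor `1 - Θ · η'`. -/
def mu (eta : ℝ → E4) : X5 → ℝ := fun x => 1 - (rr x)⁻¹ * yE eta x

/-- The field `∂_τ - η' · ∂_y`, in components. -/
def vv (eta : ℝ → E4) (a : Fin 5) : X5 → ℝ := fun x =>
  Fin.cases (motive := fun _ => ℝ) 1 (fun j => -(deriv eta x.1 j)) a

/-- `∂τ/∂X^μ`. -/
def tX (eta : ℝ → E4) (μ : Fin 5) : X5 → ℝ := fun x =>
  Fin.cases (motive := fun _ => ℝ) (jap (rr x) * iW eta x) (fun j => -(yc j x * iW eta x)) μ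

/-- The projection of `∂/∂X^μ` to the constant spatial frame. -/
def kd (μ a : Fin 5) : ℝ := if a = 0 then 0 else if μ = a then 1 else 0

/-- Components of the Cartesian field `∂/∂X^μ` in the coordinates `(τ, y)`. -/
def EE (eta : ℝ → E4) (μ a : Fin 5) : X5 → ℝ := fun x => kd μ a + tX eta μ x * vv eta a x

/-- The Cartesian derivative `∂/∂X^μ`. -/
def Dm (eta : ℝ → E4) (μ : Fin 5) (f : X5 → ℝ) : X5 → ℝ := fun x => ∑ a, EE eta μ a x * pd a f x

/-- The inverse Minkowski metric in the coordinates `(τ, y)`. -/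
def Mk (eta : ℝ → E4) (a b : Fin 5) : X5 → ℝ := fun x =>
  ∑ μ, mink μ * (EE eta μ a x * EE eta μ b x)

/-- The first-order coefficients of the Minkowski wave operator in the coordinates `(τ, y)`. -/
def BM (eta : ℝ → E4) (b : Fin 5) : X5 → ℝ := fun x => ∑ μ, mink μ * Dm eta μ (EE eta μ b) x

lemma mink_zero : mink 0 = -1 := by simp [mink]
lemma mink_succ (j : Fin 4) : mink j.succ = 1 := by simp [mink, Fin.succ_ne_zero]

lemma jap_sq (s : ℝ) : jap s ^ 2 = 1 + s ^ 2 := Real.sq_sqrt (by positivity)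
lemma jap_pos (s : ℝ) : 0 < jap s := Real.sqrt_pos.2 (by positivity)

lemma sum_tX_sq (eta : ℝ → E4) (x : X5) :
    ∑ μ, mink μ * (tX eta μ x * tX eta μ x) = -(iW eta x * iW eta x) := by
  rw [Fin.sum_univ_succ]
  simp only [mink_zero, mink_succ, tX, Fin.cases_zero, Fin.cases_succ, one_mul]
  have h : ∀ j, -(yc j x * iW eta x) * -(yc j x * iW eta x)
      = iW eta x ^ 2 * (yc j x * yc j x) := fun j => by ring
  simp only [h, ← Finset.mul_sum, sum_yc_sq]
  linear_combination (-(iW eta x ^ 2)) * jap_sq (rr x)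

lemma sum_kd (a : Fin 5) (f : Fin 5 → ℝ) :
    ∑ μ, mink μ * (kd μ a * f μ) = if a = 0 then 0 else f a := by
  by_cases h : a = 0
  · simp [kd, h]
  · simp only [kd, h, if_false, ite_mul, one_mul, zero_mul, mul_ite, mul_zero, Finset.sum_ite_eq',
      Finset.mem_univ, if_true]
    obtain ⟨j, rfl⟩ := Fin.exists_succ_eq.2 h
    rw [mink_succ, one_mul]

/-- The inverse metric in closed form: the sum over Cartesian directions collapses by `sum_kd` and
`sum_tX_sq`, the squared Minkowski length of `dτ`. -/
lemma Mk_eq (eta : ℝ → E4) (a b : Fin 5) (x : X5) :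
    Mk eta a b x = (if a = 0 then 0 else kd a b) + vv eta b x * (if a = 0 then 0 else tX eta a x)
      + vv eta a x * (if b = 0 then 0 else tX eta b x)
      - vv eta a x * vv eta b x * (iW eta x * iW eta x) := by
  have e : ∀ μ, mink μ * (EE eta μ a x * EE eta μ b x) = mink μ * (kd μ a * kd μ b)
      + vv eta b x * (mink μ * (kd μ a * tX eta μ x))
      + vv eta a x * (mink μ * (kd μ b * tX eta μ x))
      + vv eta a x * vv eta b x * (mink μ * (tX eta μ x * tX eta μ x)) := by
    intro μ; simp only [EE]; ring
  simp only [Mk, e, Finset.sum_add_distrib, ← Finset.mul_sum, sum_kd, sum_tX_sq]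
  ring

section symbols
variable {k : ℕ}

lemma Geo.comp_le (v : E4) (j : Fin 4) : |v j| ≤ ‖v‖ := PiLp.norm_apply_le v j

lemma contDiffAt_comp_j {φ : ℝ → E4} {τ : ℝ} (h : ContDiffAt ℝ ∞ φ τ) (j : Fin 4) :
    ContDiffAt ℝ ∞ (fun s => φ s j) τ :=
  ((EuclideanSpace.proj j : E4 →L[ℝ] ℝ).contDiff.contDiffAt).comp τ h

lemma contDiffAt_derivE {φ : ℝ → E4} {τ : ℝ} (h : ContDiffAt ℝ ∞ φ τ) :
    ContDiffAt ℝ ∞ (deriv φ) τ := by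
  have : ContDiffAt ℝ ∞ (fderiv ℝ φ) τ := h.fderiv_right (by simp)
  have h2 : deriv φ = fun s => fderiv ℝ φ s 1 := rfl
  rw [h2]
  exact this.clm_apply contDiffAt_const

lemma deriv_comp_j {φ : ℝ → E4} {τ : ℝ} (h : DifferentiableAt ℝ φ τ) (j : Fin 4) :
    deriv (fun s => φ s j) τ = deriv φ τ j :=
  ((EuclideanSpace.proj j : E4 →L[ℝ] ℝ).hasFDerivAt.comp_hasDerivAt τ h.hasDerivAt).deriv

lemma deriv_comp_j_ev {φ : ℝ → E4} {τ : ℝ} (h : ContDiffAt ℝ ∞ φ τ) (j : Fin 4) :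
    deriv (fun s => φ s j) =ᶠ[𝓝 τ] fun s => deriv φ s j := by
  have h1 : ContDiffAt ℝ 1 φ τ := contDiffAt_infty.1 h 1
  filter_upwards [h1.eventually (by simp)] with s hs
  exact deriv_comp_j (hs.differentiableAt (by simp)) j

lemma Sym.deta (j : Fin 4) : Sym 1 1 0 (fun G x => deriv G.eta x.1 j) := by
  refine Sym.time (φ := fun G s => deriv G.eta s j)
    (fun G τ h => contDiffAt_comp_j (contDiffAt_derivE (G.sm_eta τ h)) j) fun i hi G τ h => ?_
  rw [pow_one]
  interval_cases i
  · exact (Geo.comp_le _ _).trans ((G.deta_le τ h).trans G.e_le)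
  · simp only [Function.iterate_one]
    rw [deriv_comp_j ((contDiffAt_derivE (G.sm_eta τ h)).differentiableAt (by simp))]
    exact (Geo.comp_le _ _).trans ((G.ddeta_le τ h).trans G.e_le)

lemma Sym.vv_succ (j : Fin 4) : Sym 1 1 0 (fun G => vv G.eta j.succ) := (Sym.deta j).neg

lemma Sym.vv (a : Fin 5) : Sym 1 0 0 (fun G => vv G.eta a) := by
  refine Fin.cases ?_ (fun j => ?_) a
  · exact Sym.const 1 1
  · exact (Sym.vv_succ j).relax (by omega) le_rfl

lemma Sym.yE : Sym 1 1 1 (fun G => yE G.eta) :=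
  Sym.sum _ fun j _ => ((Sym.yc 1 j).mul (Sym.deta j)).relax (by omega) (by omega)

lemma Sym.WW : Sym 1 0 1 (fun G => WW G.eta) :=
  (Sym.jap 1).sub (Sym.yE.relax (by omega) le_rfl)

lemma rr_le_jap (x : X5) : rr x ≤ jap (rr x) := by
  refine Real.le_sqrt_of_sq_le ?_; linarith

lemma yE_eq (eta : ℝ → E4) (x : X5) : yE eta x = inner ℝ x.2 (deriv eta x.1) := by
  simp only [yE, PiLp.inner_apply]
  exact Finset.sum_congr rfl fun j _ => by simp [yc, mul_comm]

lemma abs_yE_le (G : Geo) {x : X5} (hx : x ∈ G.reg) : |yE G.eta x| ≤ rr x * G.gap := by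
  rw [yE_eq]
  exact (abs_real_inner_le_norm _ _).trans
    (mul_le_mul_of_nonneg_left ((G.deta_le _ hx.1).trans G.e_le) (norm_nonneg _))

lemma Ell.WW : Ell 1 (fun G => WW G.eta) := by
  refine ⟨1 / 2, by norm_num, ?_⟩
  filter_upwards [gap_lt (show (0 : ℝ) < 1 / 2 by norm_num)] with G h x hx
  have h1 := (abs_le.1 (abs_yE_le G hx)).2
  have h2 := rr_le_jap x
  have hr : 0 < rr x := by linarith [Geo.r_ge hx]
  have h3 : rr x * G.gap ≤ rr x * (1 / 2) := by gcongr
  rw [zpow_one, HypRp.WW]; linarith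

lemma Ell.pos {m : ℤ} {F : Geo → X5 → ℝ} (h : Ell m F) :
    ∀ᶠ G in small, ∀ x ∈ G.reg, 0 < F G x := by
  obtain ⟨c, hc, hE⟩ := h
  filter_upwards [hE] with G h x hx
  have hr : 0 < rr x := by linarith [Geo.r_ge hx]
  exact lt_of_lt_of_le (by positivity) (h x hx)

/-- Near each point of the region, `W ≠ 0` and `y ≠ 0`. -/
lemma WW_ne : ∀ᶠ G in small, ∀ x ∈ G.reg, ∀ᶠ z in 𝓝 x, WW G.eta z ≠ 0 ∧ 0 < rr z := by
  filter_upwards [Ell.WW.pos, Sym.WW.sm] with G h1 h2 x hx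
  filter_upwards [(h2 x hx).continuousAt.eventually_ne (h1 x hx).ne', ev_ne (Geo.y_ne hx)]
    with z h3 h4 using ⟨h3, rr_pos h4⟩

lemma Sym.iW : Sym 1 0 (-1) (fun G => iW G.eta) := Sym.WW.inv Ell.WW

lemma Sym.tX (μ : Fin 5) : Sym 1 0 0 (fun G => tX G.eta μ) := by
  refine Fin.cases ?_ (fun j => ?_) μ
  · exact ((Sym.jap 1).mul Sym.iW).relax (by omega) (by omega)
  · exact (((Sym.yc 1 j).mul Sym.iW).neg).relax (by omega) (by omega)

lemma Sym.EE (μ a : Fin 5) : Sym 1 0 0 (fun G => EE G.eta μ a) :=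
  (Sym.const 1 _).add (((Sym.tX μ).mul (Sym.vv a)).relax (by omega) (by omega))

lemma Sym.mu_sub : Sym 1 1 0 (fun G x => mu G.eta x - 1) := by
  have : Sym 1 1 0 (fun G x => -((HypRp.rr x)⁻¹ * HypRp.yE G.eta x)) :=
    (((Sym.irr 1).mul Sym.yE).relax (by omega) (by omega)).neg
  simpa only [mu, sub_sub_cancel_left] using this

lemma Sym.mu : Sym 1 0 0 (fun G => mu G.eta) := by
  simpa using (Sym.mu_sub.relax (Nat.zero_le _) le_rfl).add (Sym.const 1 1)

lemma jap_sub_eq (s : ℝ) : jap s - s = (jap s + s)⁻¹ := by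
  have := jap_pos s
  refine eq_inv_of_mul_eq_one_left ?_
  linear_combination jap_sq s

lemma Sym.jap_sub (k : ℕ) : Sym k 0 (-1) (fun _ x => HypRp.jap (HypRp.rr x) - HypRp.rr x) := by
  have h := ((Sym.jap k).add (Sym.rr k)).inv ⟨1, one_pos, Eventually.of_forall fun G x hx => by
    rw [one_mul, zpow_one]; linarith [rr_le_jap x, Geo.r_ge hx]⟩
  exact h.congr (Eventually.of_forall fun G x hx => Eventually.of_forall fun z =>
    jap_sub_eq _)

/-- The cancellation `1/r - (1 - Θ·η')/W = (⟨r⟩ - r)/(rW)`. -/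
lemma Sym.inv_sub_mu : Sym 1 0 (-3) (fun G x => (HypRp.rr x)⁻¹ - HypRp.mu G.eta x * HypRp.iW G.eta x) := by
  refine (((Sym.irr 1).mul (Sym.iW.mul (Sym.jap_sub 1))).relax (by omega) (by omega)).congr ?_
  filter_upwards [WW_ne] with G h x hx
  filter_upwards [h x hx] with z hz
  have h1 := hz.1
  have h2 := hz.2.ne'
  simp only [HypRp.mu, HypRp.iW]
  field_simp
  simp only [HypRp.WW]; ring

lemma Sym.inv_sub : Sym 1 1 (-1) (fun G x => (HypRp.rr x)⁻¹ - HypRp.iW G.eta x) := by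
  refine (((Sym.irr 1).mul (Sym.iW.mul (((Sym.jap_sub 1).gain.relax (by omega)
    (show (-1 : ℤ) + 1 ≤ 1 by omega)).sub Sym.yE))).relax (by omega) (by omega)).congr ?_
  filter_upwards [WW_ne] with G h x hx
  filter_upwards [h x hx] with z hz
  have h1 := hz.1
  have h2 := hz.2.ne'
  simp only [HypRp.iW]
  field_simp
  simp only [HypRp.WW]; ring

lemma kd_succ (i j : Fin 4) : kd i.succ j.succ = if i = j then 1 else 0 := by
  simp [kd, Fin.succ_ne_zero, Fin.succ_inj]

/-- The weight order of index `a`: `-1` for `τ`, `0` for `y_j`. -/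
def ord : Fin 5 → ℤ := Fin.cases (-1) (fun _ => 0)

/-- The Minkowski part of the second-order coefficients is a small perturbation of the model. -/
lemma Sym.Mk_sub (a b : Fin 5) :
    Sym 1 1 (ord a + ord b) (fun G x => HypRp.mu G.eta x * Mk G.eta a b x - A0 a b x) := by
  have hi : ∀ i : Fin 4, Sym 1 1 (-1 + 0) (fun G x =>
      HypRp.mu G.eta x * Mk G.eta 0 i.succ x - A0 0 i.succ x) := by
    intro i
    have h1 := (((Sym.yc 1 i).mul Sym.inv_sub_mu).gain).relax (le_refl _) (show _ ≤ (-1 : ℤ) by omega)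
    have h2 := ((Sym.mu.mul ((Sym.vv_succ i).mul (Sym.iW.mul Sym.iW))).relax (show 1 ≤ _ by omega)
      (show _ ≤ (-1 : ℤ) by omega))
    refine (h1.sub h2).congr ?_
    filter_upwards [WW_ne] with G h x hx
    filter_upwards [h x hx] with z hz
    have h2 := hz.2.ne'
    simp only [Mk_eq, HypRp.tX, HypRp.vv, A0, Fin.cases_zero, Fin.cases_succ,
      Fin.succ_ne_zero, if_true, if_false]
    field_simp; ring
  refine Fin.cases ?_ (fun i => ?_) a <;> refine Fin.cases ?_ (fun j => ?_) b
  · have h1 := (((Sym.irr 1).mul Sym.inv_sub)).relax (show 1 ≤ _ by omega)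
      (show _ ≤ (-2 : ℤ) by omega)
    have h2 := (Sym.iW.mul Sym.inv_sub_mu).gain.relax (show 1 ≤ _ by omega)
      (show _ ≤ (-2 : ℤ) by omega)
    refine (h1.add h2).congr ?_
    filter_upwards [WW_ne] with G h x hx
    filter_upwards [h x hx] with z hz
    have h2 := hz.2.ne'
    simp only [Mk_eq, HypRp.tX, HypRp.vv, A0, Fin.cases_zero, if_true]
    field_simp; ring
  · exact hi j
  · refine (hi i).congr (Eventually.of_forall fun G x hx => Eventually.of_forall fun z => ?_)
    have : Mk G.eta i.succ 0 z = Mk G.eta 0 i.succ z := by simp only [Mk, mul_comm]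
    simp only [this, A0_symm i.succ 0]
  · have h1 := (Sym.mu_sub.cmul (if i = j then 1 else 0))
    have h2 := (Sym.mu.mul ((Sym.vv_succ j).mul (Sym.tX i.succ))).relax (show 1 ≤ _ by omega)
      (show _ ≤ (0 : ℤ) by omega)
    have h3 := (Sym.mu.mul ((Sym.vv_succ i).mul (Sym.tX j.succ))).relax (show 1 ≤ _ by omega)
      (show _ ≤ (0 : ℤ) by omega)
    have h4 := (Sym.mu.mul (((Sym.vv_succ i).mul (Sym.vv_succ j)).mul (Sym.iW.mul Sym.iW))).relax
      (show 1 ≤ _ by omega) (show _ ≤ (0 : ℤ) by omega)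
    refine (((h1.add h2).add h3).sub h4).congr
      (Eventually.of_forall fun G x hx => Eventually.of_forall fun z => ?_)
    simp only [Mk_eq, A0, Fin.cases_succ, Fin.succ_ne_zero, if_false, kd_succ]
    ring

end symbols

lemma pd_jap {x : X5} (h : x.2 ≠ 0) (a : Fin 5) :
    pd a (fun z => jap (rr z)) x
      = Fin.cases (motive := fun _ => ℝ) 0 (fun j => yc j x / jap (rr x)) a := by
  have h1 : HasDerivAt jap (rr x / jap (rr x)) (rr x) := by
    have h2 : HasDerivAt (fun s : ℝ => 1 + s ^ 2) (2 * rr x) (rr x) := by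
      simpa using ((hasDerivAt_pow 2 (rr x)).const_add 1)
    have := h2.sqrt (by positivity)
    refine this.congr_deriv ?_
    rw [jap]; field_simp
  rw [pd_rad h h1]
  have := (rr_pos h).ne'
  refine Fin.cases rfl (fun j => ?_) a
  simp only [Fin.cases_succ]; field_simp

section
variable {eta : ℝ → E4} {x : X5}

lemma deta_sm (h : ContDiffAt ℝ ∞ eta x.1) (j : Fin 4) : Sm (fun z => deriv eta z.1 j) x :=
  (contDiffAt_comp_j (contDiffAt_derivE h) j).comp x contDiffAt_fst

lemma pd_yE_succ (h : ContDiffAt ℝ ∞ eta x.1) (i : Fin 4) :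
    pd i.succ (yE eta) x = deriv eta x.1 i := by
  have e : ∀ j : Fin 4, pd i.succ (fun z => yc j z * deriv eta z.1 j) x
      = if j = i then deriv eta x.1 j else 0 := by
    intro j
    rw [pd_mul _ (yc_sm j x) (deta_sm h j), pd_yc,
      pd_fst (φ := fun s => deriv eta s j)
        ((contDiffAt_comp_j (contDiffAt_derivE h) j).differentiableAt (by simp))]
    simp [Fin.succ_ne_zero, eq_comm]
  have e2 : yE eta = fun z => ∑ j, yc j z * deriv eta z.1 j := rfl
  rw [e2, pd_sum _ _ fun j _ => (yc_sm j x).mul (deta_sm h j)]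
  simp [e]

lemma yE_sm (h : ContDiffAt ℝ ∞ eta x.1) : Sm (yE eta) x :=
  ContDiffAt.sum fun j _ => (yc_sm j x).mul (deta_sm h j)

lemma jap_sm (h0 : x.2 ≠ 0) : Sm (fun z => jap (rr z)) x :=
  (contDiffAt_const.add ((rr_sm h0).pow 2)).sqrt (by positivity)

lemma WW_sm (h : ContDiffAt ℝ ∞ eta x.1) (h0 : x.2 ≠ 0) : Sm (WW eta) x :=
  (jap_sm h0).sub (yE_sm h)

lemma vv_sm (h : ContDiffAt ℝ ∞ eta x.1) (a : Fin 5) : Sm (vv eta a) x := by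
  refine Fin.cases ?_ (fun j => ?_) a
  · exact contDiffAt_const
  · exact (deta_sm h j).neg

lemma iW_sm (h : ContDiffAt ℝ ∞ eta x.1) (h0 : x.2 ≠ 0) (hW : WW eta x ≠ 0) : Sm (iW eta) x :=
  (WW_sm h h0).inv hW

lemma tX_sm (h : ContDiffAt ℝ ∞ eta x.1) (h0 : x.2 ≠ 0) (hW : WW eta x ≠ 0) (μ : Fin 5) :
    Sm (tX eta μ) x := by
  refine Fin.cases ?_ (fun j => ?_) μ
  · exact (jap_sm h0).mul (iW_sm h h0 hW)
  · exact ((yc_sm j x).mul (iW_sm h h0 hW)).neg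

lemma EE_sm (h : ContDiffAt ℝ ∞ eta x.1) (h0 : x.2 ≠ 0) (hW : WW eta x ≠ 0) (μ a : Fin 5) :
    Sm (EE eta μ a) x := contDiffAt_const.add ((tX_sm h h0 hW μ).mul (vv_sm h a))

lemma pd_vv_succ (h : ContDiffAt ℝ ∞ eta x.1) (i : Fin 4) (b : Fin 5) :
    pd i.succ (vv eta b) x = 0 := by
  refine Fin.cases (pd_const _ _ _) (fun j => ?_) b
  have e : vv eta j.succ = fun z => -(fun z : X5 => (fun s => deriv eta s j) z.1) z := rfl
  rw [e, pd_neg, pd_fst ((contDiffAt_comp_j (contDiffAt_derivE h) j).differentiableAt (by simp))]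
  simp [Fin.succ_ne_zero]

/-- `(∂_τ - η'·∂_y) W`. -/
def TW (eta : ℝ → E4) : X5 → ℝ := fun x => ∑ a, vv eta a x * pd a (WW eta) x

lemma EE_zero (μ : Fin 5) : EE eta μ 0 x = tX eta μ x := by simp [EE, kd, vv]

/-- The Minkowski wave operator applied to `τ`. -/
lemma box_tau (h : ContDiffAt ℝ ∞ eta x.1) (h0 : x.2 ≠ 0) (hW : WW eta x ≠ 0) :
    ∑ μ, mink μ * Dm eta μ (tX eta μ) x
      = -3 * iW eta x - iW eta x ^ 2 / jap (rr x) + iW eta x ^ 3 * TW eta x := by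
  have ht := tX_sm h h0 hW
  have hi := iW_sm h h0 hW
  have hpi : ∀ a, pd a (iW eta) x = -(iW eta x ^ 2) * pd a (WW eta) x := by
    intro a
    have := pd_comp a (hasDerivAt_inv hW) (WW_sm h h0).diff
    rw [show iW eta = fun z => (WW eta z)⁻¹ from rfl, this, inv_pow]
  have e1 : ∀ μ, mink μ * Dm eta μ (tX eta μ) x = ∑ a, mink μ * (kd μ a * pd a (tX eta μ) x)
      + ∑ a, vv eta a x * (mink μ * (tX eta μ x * pd a (tX eta μ) x)) := by
    intro μ
    rw [Dm, Finset.mul_sum, ← Finset.sum_add_distrib]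
    refine Finset.sum_congr rfl fun a _ => ?_
    simp only [EE]; ring
  have e2 : ∀ a, ∑ μ, mink μ * (tX eta μ x * pd a (tX eta μ) x)
      = -(iW eta x * pd a (iW eta) x) := by
    intro a
    have h1 : pd a (fun z => ∑ μ, mink μ * (tX eta μ z * tX eta μ z)) x
        = pd a (fun z => -(iW eta z * iW eta z)) x := by
      congr 1; funext z; exact sum_tX_sq eta z
    rw [pd_neg, pd_mul _ hi hi, pd_sum _ _ fun μ _ => contDiffAt_const.mul ((ht μ).mul (ht μ))] at h1
    have h2 : ∀ μ, pd a (fun z => mink μ * (tX eta μ z * tX eta μ z)) x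
        = 2 * (mink μ * (tX eta μ x * pd a (tX eta μ) x)) := by
      intro μ; rw [pd_const_mul, pd_mul _ (ht μ) (ht μ)]; ring
    simp only [h2, ← Finset.mul_sum] at h1
    linarith
  have e3 : ∑ μ, ∑ a, mink μ * (kd μ a * pd a (tX eta μ) x)
      = ∑ j : Fin 4, pd j.succ (tX eta j.succ) x := by
    rw [Finset.sum_comm]
    simp only [sum_kd _ (fun μ => pd _ (tX eta μ) x)]
    rw [Fin.sum_univ_succ]; simp [Fin.succ_ne_zero]
  have e4 : ∀ j : Fin 4, pd j.succ (tX eta j.succ) x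
      = -(iW eta x) + iW eta x ^ 2 * (yc j x * pd j.succ (WW eta) x) := by
    intro j
    have : tX eta j.succ = fun z => -(yc j z * iW eta z) := rfl
    rw [this, pd_neg, pd_mul _ (yc_sm j x) hi, pd_yc, hpi]
    simp; ring
  have e5 : ∀ j : Fin 4, yc j x * pd j.succ (WW eta) x
      = yc j x * yc j x / jap (rr x) - yc j x * deriv eta x.1 j := by
    intro j
    rw [show WW eta = fun z => jap (rr z) - yE eta z from rfl, pd_sub _ (jap_sm h0) (yE_sm h),
      pd_jap h0, pd_yE_succ h]
    simp; ring
  have hj := (jap_pos (rr x)).ne'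
  have e6 : ∑ j : Fin 4, yc j x * pd j.succ (WW eta) x = WW eta x - 1 / jap (rr x) := by
    simp only [e5, Finset.sum_sub_distrib, ← Finset.sum_div, sum_yc_sq]
    rw [show ∑ j, yc j x * deriv eta x.1 j = yE eta x from rfl, WW]
    field_simp
    linear_combination - jap_sq (rr x)
  simp only [e1, Finset.sum_add_distrib]
  rw [e3, Finset.sum_comm]
  simp only [← Finset.mul_sum, e2, hpi, e4, Finset.sum_add_distrib, e6]
  have e7 : ∑ a, vv eta a x * -(iW eta x * (-iW eta x ^ 2 * pd a (WW eta) x))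
      = iW eta x ^ 3 * TW eta x := by
    rw [TW, Finset.mul_sum]; exact Finset.sum_congr rfl fun a _ => by ring
  rw [e7]
  have e8 : iW eta x * WW eta x = 1 := inv_mul_cancel₀ hW
  simp only [Finset.sum_const, Finset.card_univ, Fintype.card_fin, nsmul_eq_mul]
  push_cast
  linear_combination iW eta x * e8

/-- The wave operator's first-order coefficients in closed form, from `□ τ` and the identity
`m(dτ, dτ) = -iW²`. -/
lemma BM_eq (h : ContDiffAt ℝ ∞ eta x.1) (h0 : x.2 ≠ 0) (hW : WW eta x ≠ 0) (b : Fin 5) :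
    BM eta b x = vv eta b x * (-3 * iW eta x - iW eta x ^ 2 / jap (rr x) + iW eta x ^ 3 * TW eta x)
      - iW eta x ^ 2 * pd 0 (vv eta b) x := by
  have e1 : ∀ μ, mink μ * Dm eta μ (EE eta μ b) x = vv eta b x * (mink μ * Dm eta μ (tX eta μ) x)
      + (mink μ * (tX eta μ x * tX eta μ x)) * pd 0 (vv eta b) x := by
    intro μ
    have e2 : ∀ a, EE eta μ a x * pd a (EE eta μ b) x
        = vv eta b x * (EE eta μ a x * pd a (tX eta μ) x)
          + tX eta μ x * (EE eta μ a x * pd a (vv eta b) x) := by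
      intro a
      rw [show EE eta μ b = fun z => kd μ b + tX eta μ z * vv eta b z from rfl,
        pd_add _ contDiffAt_const ((tX_sm h h0 hW μ).mul (vv_sm h b)), pd_const,
        pd_mul _ (tX_sm h h0 hW μ) (vv_sm h b)]
      ring
    have e3 : ∑ a, EE eta μ a x * pd a (vv eta b) x = tX eta μ x * pd 0 (vv eta b) x := by
      rw [Fin.sum_univ_succ]; simp [pd_vv_succ h, EE_zero]
    simp only [Dm, e2, Finset.sum_add_distrib, ← Finset.mul_sum, e3]; ring
  simp only [BM, e1, Finset.sum_add_distrib, ← Finset.mul_sum, ← Finset.sum_mul, box_tau h h0 hW,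
    sum_tX_sq]
  ring
end

lemma Dm_sm {eta : ℝ → E4} {f : X5 → ℝ} {x : X5} (h : ContDiffAt ℝ ∞ eta x.1) (h0 : x.2 ≠ 0)
    (hW : WW eta x ≠ 0) (hf : Sm f x) (μ : Fin 5) : Sm (Dm eta μ f) x :=
  ContDiffAt.sum fun a _ => (EE_sm h h0 hW μ a).mul (pd_sm a hf)

lemma BM_sm {eta : ℝ → E4} {x : X5} (h : ContDiffAt ℝ ∞ eta x.1) (h0 : x.2 ≠ 0)
    (hW : WW eta x ≠ 0) (b : Fin 5) : Sm (BM eta b) x :=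
  ContDiffAt.sum fun μ _ => contDiffAt_const.mul (Dm_sm h h0 hW (EE_sm h h0 hW μ b) μ)

lemma mu_sm {eta : ℝ → E4} {x : X5} (h : ContDiffAt ℝ ∞ eta x.1) (h0 : x.2 ≠ 0) :
    Sm (mu eta) x :=
  contDiffAt_const.sub (((rr_sm h0).inv (rr_pos h0).ne').mul (yE_sm h))

/-- For symbols without control of derivatives, pointwise equality suffices. -/
lemma Sym.congr0 {g : ℕ} {m : ℤ} {F F' : Geo → X5 → ℝ} (h : Sym 0 g m F)
    (e : ∀ᶠ G in small, ∀ x ∈ G.reg, Sm (F' G) x ∧ F' G x = F G x) : Sym 0 g m F' := by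
  obtain ⟨C, hC, h⟩ := h
  refine ⟨C, hC, ?_⟩
  filter_upwards [h, e] with G h e x hx
  exact ⟨(e x hx).1, by rw [(e x hx).2]; exact (h x hx).2⟩

lemma Sym.TW : Sym 0 1 1 (fun G => TW G.eta) := by
  have h0 : Sym 0 1 1 (fun G => pd 0 (HypRp.WW G.eta)) := by
    refine Sym.congr (Sym.yE.2.1.neg) (Eventually.of_forall fun G x hx => ?_)
    have h := G.sm_eta x.1 hx.1
    have h1 := (yE_sm h).ev_diff
    have h2 := (jap_sm (Geo.y_ne hx)).ev_diff
    filter_upwards [h1, h2, ev_ne (Geo.y_ne hx)] with z h1 h2 h3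
    rw [show HypRp.WW G.eta = fun z => HypRp.jap (HypRp.rr z) - HypRp.yE G.eta z from rfl,
      pd_sub' _ h2 h1, pd_jap h3]
    simp
  refine Sym.sum _ fun a _ => ?_
  refine Fin.cases ?_ (fun j => ?_) a
  · exact ((Sym.vv 0).lower.mul h0).relax (by omega) (by omega)
  · exact ((Sym.vv_succ j).lower.mul (Sym.WW.2.2 j)).relax (by omega) (by omega)

lemma Sym.BM_zero : Sym 0 1 (-2) (fun G x => 3 * (HypRp.rr x)⁻¹
    + HypRp.mu G.eta x * BM G.eta 0 x) := by
  have h1 := ((Sym.inv_sub_mu.cmul 3).lower).gain.relax (show 1 ≤ _ by omega)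
    (show _ ≤ (-2 : ℤ) by omega)
  have hj : Sym 0 0 (-1) (fun _ x => (HypRp.jap (HypRp.rr x))⁻¹) :=
    (Sym.jap 0).inv ⟨1, one_pos, Eventually.of_forall fun G x hx => by
      rw [one_mul, zpow_one]; exact rr_le_jap x⟩
  have h2 := (Sym.mu.lower.mul ((Sym.iW.lower.mul Sym.iW.lower).mul hj)).gain.relax
    (show 1 ≤ _ by omega) (show _ ≤ (-2 : ℤ) by omega)
  have h3 := (Sym.mu.lower.mul (((Sym.iW.lower.mul Sym.iW.lower).mul Sym.iW.lower).mul
    Sym.TW)).relax (show 1 ≤ _ by omega) (show _ ≤ (-2 : ℤ) by omega)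
  refine ((h1.sub h2).add h3).congr0 ?_
  filter_upwards [WW_ne] with G h x hx
  have hs := G.sm_eta x.1 hx.1
  have h0 := Geo.y_ne hx
  have hW := (h x hx).self_of_nhds.1
  refine ⟨(contDiffAt_const.mul ((rr_sm h0).inv (rr_pos h0).ne')).add
    ((mu_sm hs h0).mul (BM_sm hs h0 hW 0)), ?_⟩
  rw [BM_eq hs h0 hW]
  have hv : pd 0 (HypRp.vv G.eta 0) x = 0 := pd_const 0 1 x
  rw [hv]
  simp only [HypRp.vv, Fin.cases_zero]
  ring

lemma Sym.BM_succ (j : Fin 4) : Sym 0 1 (-1) (fun G => BM G.eta j.succ) := by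
  have h1 := (Sym.iW.lower.cmul (-3))
  have hj : Sym 0 0 (-1) (fun _ x => (HypRp.jap (HypRp.rr x))⁻¹) :=
    (Sym.jap 0).inv ⟨1, one_pos, Eventually.of_forall fun G x hx => by
      rw [one_mul, zpow_one]; exact rr_le_jap x⟩
  have h2 := ((Sym.iW.lower.mul Sym.iW.lower).mul hj).relax (le_refl _)
    (show _ ≤ (-1 : ℤ) by omega)
  have h3 := (((Sym.iW.lower.mul Sym.iW.lower).mul Sym.iW.lower).mul
    Sym.TW).relax (Nat.zero_le _) (show _ ≤ (-1 : ℤ) by omega)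
  have h4 := ((Sym.iW.lower.mul Sym.iW.lower).mul (Sym.vv_succ j).2.1).relax (show 1 ≤ _ by omega)
    (show _ ≤ (-1 : ℤ) by omega)
  have h5 := ((Sym.vv_succ j).lower.mul ((h1.sub h2).add h3)).relax (show 1 ≤ _ by omega)
    (show _ ≤ (-1 : ℤ) by omega)
  refine (h5.sub h4).congr0 ?_
  filter_upwards [WW_ne] with G h x hx
  have hs := G.sm_eta x.1 hx.1
  have h0 := Geo.y_ne hx
  have hW := (h x hx).self_of_nhds.1
  refine ⟨BM_sm hs h0 hW _, ?_⟩
  rw [BM_eq hs h0 hW]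
  ring

/-! ### The catenoid profile -/

/-- The singularity of `(t⁶ - 1)^{-1/2}` at `t = 1` is integrable, being bounded by
`(t - 1)^{-1/2}`. -/
lemma catenoid_intervalIntegrable {s : ℝ} (hs : 1 ≤ s) :
    IntervalIntegrable (fun t : ℝ => 1 / Real.sqrt (t ^ 6 - 1)) volume 1 s := by
  have h1 : IntervalIntegrable (fun t : ℝ => (t - 1) ^ (-(1 / 2) : ℝ)) volume 1 s := by
    have := (intervalIntegral.intervalIntegrable_rpow' (a := 0) (b := s - 1)
      (show (-1 : ℝ) < -(1 / 2) by norm_num)).comp_sub_right 1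
    simpa using this
  refine h1.mono_fun (Measurable.aestronglyMeasurable (by fun_prop)) ?_
  rw [uIoc_of_le hs]
  filter_upwards [ae_restrict_mem measurableSet_Ioc] with t ht
  have ht1 : 0 < t - 1 := by linarith [ht.1]
  have h6 : t - 1 ≤ t ^ 6 - 1 := by
    have : t ≤ t ^ 6 := le_self_pow₀ ht.1.le (by norm_num)
    linarith
  rw [Real.rpow_neg ht1.le, ← Real.sqrt_eq_rpow, Real.norm_of_nonneg (by positivity),
    Real.norm_of_nonneg (by positivity), one_div]
  exact inv_anti₀ (Real.sqrt_pos.2 ht1) (Real.sqrt_le_sqrt h6)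

lemma catenoid_hasDerivAt {s : ℝ} (hs : 1 < s) :
    HasDerivAt catenoidHeight (1 / Real.sqrt (s ^ 6 - 1)) s := by
  have h6 : 0 < s ^ 6 - 1 := by
    have : s ≤ s ^ 6 := le_self_pow₀ hs.le (by norm_num)
    linarith
  have hs6 := Real.sqrt_pos.2 h6
  refine intervalIntegral.integral_hasDerivAt_right (catenoid_intervalIntegrable hs.le) ?_ ?_
  · exact (Measurable.stronglyMeasurable (by fun_prop)).stronglyMeasurableAtFilter
  · exact ContinuousAt.div continuousAt_const
      (Real.continuous_sqrt.comp (by fun_prop : Continuous fun t : ℝ => t ^ 6 - 1)).continuousAt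
      hs6.ne'

lemma catenoid_contDiffAt {s : ℝ} (hs : 1 < s) : ContDiffAt ℝ ∞ catenoidHeight s := by
  have h : ContDiffOn ℝ ∞ catenoidHeight (Ioi 1) := by
    rw [contDiffOn_infty_iff_deriv_of_isOpen isOpen_Ioi]
    refine ⟨fun t ht => (catenoid_hasDerivAt ht).differentiableAt.differentiableWithinAt, ?_⟩
    refine ContDiffOn.congr (f := fun t : ℝ => 1 / Real.sqrt (t ^ 6 - 1)) ?_
      fun t ht => (catenoid_hasDerivAt ht).deriv
    intro t ht
    have h6 : 0 < t ^ 6 - 1 := by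
      have : t ≤ t ^ 6 := le_self_pow₀ (le_of_lt ht) (by norm_num)
      have : 1 < t := ht
      linarith
    refine ContDiffAt.contDiffWithinAt ?_
    exact contDiffAt_const.div (((contDiffAt_id.pow 6).sub contDiffAt_const).sqrt h6.ne')
      (Real.sqrt_pos.2 h6).ne'
  exact h.contDiffAt (Ioi_mem_nhds hs)

/-- `γ (⟨r⟩ - l · y)`, the boosted time function; `s² + 1` is its square. -/
def zz (l : ℝ → E4) : X5 → ℝ := fun x =>
  (Real.sqrt (1 - ∑ j, l x.1 j * l x.1 j))⁻¹ * (jap (rr x) - ∑ j, yc j x * l x.1 j)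

/-- A Lorentz boost preserves the unit hyperboloid: the boost of `(⟨|y|⟩, y)` has time component
`γ (⟨|y|⟩ - ℓ · y)`, and the norm of its space component is the argument of the profile. -/
lemma boost_sq (l y : E4) (h : ‖l‖ < 1) :
    ‖boostSpace l y - (lorentz l * jap ‖y‖) • l‖ ^ 2
      = (lorentz l * (jap ‖y‖ - inner ℝ l y)) ^ 2 - 1 := by
  have h1 : 0 < 1 - ‖l‖ ^ 2 := by nlinarith [norm_nonneg l]
  have hg : 0 < lorentz l := by unfold lorentz; positivity
  have hg2 : lorentz l ^ 2 * (1 - ‖l‖ ^ 2) = 1 := by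
    rw [lorentz, div_pow, one_pow, Real.sq_sqrt h1.le]; field_simp
  have e : boostSpace l y - (lorentz l * jap ‖y‖) • l
      = y + (lorentz l ^ 2 / (lorentz l + 1) * inner ℝ l y - lorentz l * jap ‖y‖) • l := by
    rw [boostSpace, sub_smul]; abel
  rw [e, norm_add_sq_real, norm_smul, inner_smul_right, mul_pow, Real.norm_eq_abs, sq_abs,
    real_inner_comm]
  have hJ := jap_sq ‖y‖
  set g := lorentz l
  set J := jap ‖y‖
  set p : ℝ := inner ℝ l y
  have hL : ‖l‖ ^ 2 = (g ^ 2 - 1) / g ^ 2 := by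
    rw [eq_div_iff (by positivity)]; linarith
  rw [hL]
  have : ‖y‖ ^ 2 = J ^ 2 - 1 := by linarith
  rw [this]
  field_simp
  ring

lemma zz_eq (l : ℝ → E4) (x : X5) :
    zz l x = lorentz (l x.1) * (jap ‖x.2‖ - inner ℝ (l x.1) x.2) := by
  have h1 : ∑ j, l x.1 j * l x.1 j = ‖l x.1‖ ^ 2 := by
    rw [EuclideanSpace.norm_sq_eq]
    exact Finset.sum_congr rfl fun j _ => by rw [Real.norm_eq_abs, sq_abs, sq]
  have h2 : ∑ j, yc j x * l x.1 j = inner ℝ (l x.1) x.2 := by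
    simp only [PiLp.inner_apply]
    exact Finset.sum_congr rfl fun j _ => by simp [yc]
  rw [zz, h1, h2, lorentz, one_div]; rfl

/-- The profile is a function of the boosted time `zz` alone, which is smooth in the exterior region
and comparable to `r` there. -/
lemma profile_eq (l : ℝ → E4) (x : X5) (h : ‖l x.1‖ < 1) :
    uc (profile l) x = catenoidHeight (Real.sqrt (zz l x ^ 2 - 1)) := by
  rw [zz_eq, ← boost_sq _ _ h, Real.sqrt_sq (norm_nonneg _)]; rfl

section
variable {k : ℕ}

lemma Sym.vel (j : Fin 4) : Sym 2 1 0 (fun G x => G.l x.1 j) := by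
  refine Sym.time (φ := fun G s => G.l s j)
    (fun G τ h => contDiffAt_comp_j (G.sm_l τ h) j) fun i hi G τ h => ?_
  rw [pow_one]
  have hs := G.sm_l τ h
  interval_cases i
  · exact (Geo.comp_le _ _).trans ((G.l_le τ h).trans G.e_le)
  · simp only [Function.iterate_one]
    rw [deriv_comp_j (hs.differentiableAt (by simp))]
    exact (Geo.comp_le _ _).trans ((G.dl_le τ h).trans G.e_le)
  · simp only [Function.iterate_succ, Function.iterate_zero, Function.comp_apply, id]
    rw [(deriv_comp_j_ev hs j).deriv_eq,
      deriv_comp_j ((contDiffAt_derivE hs).differentiableAt (by simp))]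
    exact (Geo.comp_le _ _).trans ((G.ddl_le τ h).trans G.e_le)

lemma sum_sq_vel (G : Geo) {τ : ℝ} (h : τ ∈ G.T) : ∑ j, G.l τ j * G.l τ j ≤ G.gap ^ 2 := by
  have h1 : ∑ j, G.l τ j * G.l τ j = ‖G.l τ‖ ^ 2 := by
    rw [EuclideanSpace.norm_sq_eq]
    exact Finset.sum_congr rfl fun j _ => by rw [Real.norm_eq_abs, sq_abs, sq]
  rw [h1]
  exact pow_le_pow_left₀ (norm_nonneg _) ((G.l_le τ h).trans G.e_le) 2

lemma Sym.gam : Sym 2 0 0 (fun G x => (Real.sqrt (1 - ∑ j, G.l x.1 j * G.l x.1 j))⁻¹) := by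
  have h1 : Sym 2 0 0 (fun G x => 1 - ∑ j, G.l x.1 j * G.l x.1 j) :=
    (Sym.const 2 1).sub (Sym.sum _ fun j _ => ((Sym.vel j).mul (Sym.vel j)).relax (by omega)
      (by omega))
  refine Sym.invSqrt (m := 0) h1 ⟨3 / 4, by norm_num, ?_⟩
  filter_upwards [gap_lt (show (0 : ℝ) < 1 / 2 by norm_num)] with G h x hx
  have := sum_sq_vel G hx.1
  have h2 : G.gap ^ 2 ≤ (1 / 2) ^ 2 := pow_le_pow_left₀ G.gap_pos.le h.le 2
  rw [mul_zero, zpow_zero]; norm_num at h2; linarith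

lemma Sym.zz : Sym 2 0 1 (fun G => zz G.l) :=
  (Sym.gam.mul ((Sym.jap 2).sub (Sym.sum _ fun j _ => ((Sym.yc 2 j).mul (Sym.vel j)).relax
    (Nat.zero_le _) (show _ ≤ (1 : ℤ) by omega)))).relax (by omega) (by omega)

/-- For small parameters the boosted time is bounded below by `r / 2`. -/
lemma zz_ge : ∀ᶠ G in small, ∀ x ∈ G.reg, 4 ≤ HypRp.rr x ∧ HypRp.rr x / 2 ≤ HypRp.zz G.l x := by
  filter_upwards [gap_lt (show (0 : ℝ) < 1 / 4 by norm_num)] with G h x hx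
  have hR : 4 ≤ G.R := by
    have h1 := G.inv_le
    have h2 := G.one_le
    rw [div_le_iff₀ (by linarith)] at h1
    nlinarith
  have hr : 4 ≤ HypRp.rr x := hR.trans hx.2
  refine ⟨hr, ?_⟩
  have h2 := sum_sq_vel G hx.1
  have h0 : 0 ≤ ∑ j, G.l x.1 j * G.l x.1 j := Finset.sum_nonneg fun j _ => mul_self_nonneg _
  have h3 : G.gap ^ 2 ≤ (1 / 4) ^ 2 := pow_le_pow_left₀ G.gap_pos.le h.le 2
  have h4 : ∑ j, HypRp.yc j x * G.l x.1 j ≤ HypRp.rr x * (1 / 4) := by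
    have e : ∑ j, HypRp.yc j x * G.l x.1 j = inner ℝ (G.l x.1) x.2 := by
      simp only [PiLp.inner_apply]
      exact Finset.sum_congr rfl fun j _ => by simp [HypRp.yc]
    rw [e]
    refine (le_abs_self _).trans ((abs_real_inner_le_norm _ _).trans ?_)
    rw [mul_comm]
    exact mul_le_mul_of_nonneg_left (((G.l_le _ hx.1).trans G.e_le).trans h.le) (norm_nonneg _)
  have h5 := rr_le_jap x
  have h6 : 1 ≤ (Real.sqrt (1 - ∑ j, G.l x.1 j * G.l x.1 j))⁻¹ := by
    rw [one_le_inv₀ (Real.sqrt_pos.2 (by norm_num at h3; linarith))]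
    exact Real.sqrt_le_iff.2 ⟨by norm_num, by linarith⟩
  rw [HypRp.zz]
  have h7 : HypRp.rr x / 2 ≤ HypRp.jap (HypRp.rr x) - ∑ j, HypRp.yc j x * G.l x.1 j := by linarith
  have h8 : 0 ≤ HypRp.jap (HypRp.rr x) - ∑ j, HypRp.yc j x * G.l x.1 j := by linarith
  nlinarith

/-- `(z² - 1) ((z² - 1)³ - 1)`, the square of `s √(s⁶ - 1)`. -/
def NN (l : ℝ → E4) : X5 → ℝ := fun x =>
  (zz l x ^ 2 - 1) * ((zz l x ^ 2 - 1) ^ 3 - 1)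

lemma NN_ge {z r : ℝ} (hr : 4 ≤ r) (hz : r / 2 ≤ z) :
    2 < z ^ 2 - 1 ∧ (1 / 8 * r ^ 2) * (1 / 1024 * r ^ 6) ≤ (z ^ 2 - 1) * ((z ^ 2 - 1) ^ 3 - 1) := by
  have h1 : 1 / 8 * r ^ 2 + 1 ≤ z ^ 2 - 1 := by nlinarith
  have h16 : 16 ≤ r ^ 2 := by nlinarith
  have h2 : (1 / 8 * r ^ 2) ≤ z ^ 2 - 1 := by linarith
  have h3 : (1 / 8 * r ^ 2) ^ 3 ≤ (z ^ 2 - 1) ^ 3 := pow_le_pow_left₀ (by positivity) h2 3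
  have h4 : 1 / 1024 * r ^ 6 ≤ (z ^ 2 - 1) ^ 3 - 1 := by
    have : (1 / 8 * r ^ 2) ^ 3 = 2 * (1 / 1024 * r ^ 6) := by ring
    have : (16 : ℝ) ^ 3 ≤ (r ^ 2) ^ 3 := pow_le_pow_left₀ (by norm_num) h16 3
    nlinarith
  exact ⟨by linarith, mul_le_mul h2 h4 (by positivity) (by linarith)⟩

lemma Sym.NN : Sym 2 0 (2 * 4) (fun G => NN G.l) := by
  have h1 : Sym 2 0 2 (fun G x => HypRp.zz G.l x ^ 2 - 1) := by
    simp only [sq]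
    exact ((Sym.zz.mul Sym.zz).relax (by omega) (by omega)).sub
      ((Sym.const 2 1).relax le_rfl (by omega))
  have h2 : Sym 2 0 6 (fun G x => (HypRp.zz G.l x ^ 2 - 1) ^ 3 - 1) := by
    simp only [pow_succ _ 2]
    simp only [sq (HypRp.zz _ _ ^ 2 - 1)]
    exact (((h1.mul h1).mul h1).relax (by omega) (by omega)).sub
      ((Sym.const 2 1).relax le_rfl (by omega))
  exact (h1.mul h2).relax (by omega) (by omega)

lemma Ell.NN : Ell (2 * 4) (fun G => NN G.l) := by
  refine ⟨1 / 8 * (1 / 1024), by norm_num, ?_⟩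
  filter_upwards [zz_ge] with G h x hx
  have := (NN_ge (h x hx).1 (h x hx).2).2
  have e : HypRp.rr x ^ (2 * 4 : ℤ) = HypRp.rr x ^ 8 := by norm_cast
  rw [e]
  refine le_trans (le_of_eq ?_) this
  ring

/-- Near each point of the region the profile is given by the catenoid height. -/
lemma profile_ev : ∀ᶠ G in small, ∀ x ∈ G.reg, Sm (uc (profile G.l)) x ∧ ∀ a,
    pd a (uc (profile G.l)) =ᶠ[𝓝 x]
      fun z => HypRp.zz G.l z * pd a (HypRp.zz G.l) z * (Real.sqrt (HypRp.NN G.l z))⁻¹ := by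
  filter_upwards [zz_ge, gap_lt one_pos, Sym.zz.sm] with G h h1 hsm x hx
  have hz := hsm x hx
  have hl : ∀ᶠ z : X5 in 𝓝 x, ‖G.l z.1‖ < 1 := by
    have hc : ContinuousAt (fun z : X5 => ‖G.l z.1‖) x :=
      ((G.sm_l x.1 hx.1).continuousAt.comp continuous_fst.continuousAt).norm
    exact hc.eventually (gt_mem_nhds (((G.l_le _ hx.1).trans G.e_le).trans_lt h1))
  have hzz : ∀ᶠ z in 𝓝 x, 2 < HypRp.zz G.l z ^ 2 - 1 :=
    ((hz.pow 2).sub contDiffAt_const).continuousAt.eventually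
      (lt_mem_nhds (NN_ge (h x hx).1 (h x hx).2).1)
  have e : uc (profile G.l) =ᶠ[𝓝 x]
      fun z => catenoidHeight (Real.sqrt (HypRp.zz G.l z ^ 2 - 1)) := by
    filter_upwards [hl] with z hz using profile_eq _ _ hz
  have hone : ∀ {w : ℝ}, 2 < w → 1 < Real.sqrt w := fun hw => by
    rw [Real.lt_sqrt zero_le_one]; linarith
  refine ⟨Sm.congr ?_ e, fun a => (pd_congr a e).trans ?_⟩
  · exact ContDiffAt.comp x (catenoid_contDiffAt (hone hzz.self_of_nhds))
      (((hz.pow 2).sub contDiffAt_const).sqrt (by linarith [hzz.self_of_nhds]))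
  · filter_upwards [hz.ev_diff, hzz] with z hd h2
    have hw : 0 < HypRp.zz G.l z ^ 2 - 1 := by linarith
    have hd1 : HasDerivAt (fun t : ℝ => t ^ 2 - 1) (2 * HypRp.zz G.l z) (HypRp.zz G.l z) := by
      simpa using (hasDerivAt_pow 2 (HypRp.zz G.l z)).sub_const 1
    have hd2 := (catenoid_hasDerivAt (s := Real.sqrt (HypRp.zz G.l z ^ 2 - 1)) (hone h2)).comp
      (HypRp.zz G.l z) (hd1.sqrt hw.ne')
    rw [show (fun z => catenoidHeight (Real.sqrt (HypRp.zz G.l z ^ 2 - 1)))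
      = fun z => (catenoidHeight ∘ fun t => Real.sqrt (t ^ 2 - 1)) (HypRp.zz G.l z) from rfl,
      pd_comp a hd2 hd]
    have e6 : Real.sqrt (HypRp.zz G.l z ^ 2 - 1) ^ 6 = (HypRp.zz G.l z ^ 2 - 1) ^ 3 := by
      rw [show 6 = 2 * 3 from rfl, pow_mul, Real.sq_sqrt hw.le]
    rw [e6, HypRp.NN, Real.sqrt_mul hw.le, mul_inv]
    have hs := Real.sqrt_pos.2 hw
    field_simp

lemma Sym.dprofile (a : Fin 5) : Sym 1 0 (-2) (fun G => pd a (uc (profile G.l))) := by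
  have h1 : Sym 1 0 1 (fun G => pd a (HypRp.zz G.l)) := by
    refine Fin.cases ?_ (fun j => ?_) a
    · exact Sym.zz.2.1
    · exact (Sym.zz.2.2 j).relax le_rfl (by omega)
  refine (((Sym.zz.lower.mul h1).mul (Sym.NN.lower.invSqrt Ell.NN)).relax (by omega)
    (show _ ≤ (-2 : ℤ) by omega)).congr ?_
  filter_upwards [profile_ev] with G h x hx using (h x hx).2 a
end

/-! ### Coefficients of the commuted operator -/

section defs
variable (eta l : ℝ → E4)

/-- The Cartesian derivative `∇_μ Q` of the profile. -/
def QQ (μ : Fin 5) : X5 → ℝ := Dm eta μ (uc (profile l))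

/-- `(1 + ∇^α Q ∇_α Q)⁻¹`. -/
def iS : X5 → ℝ := fun x => (1 + ∑ μ, mink μ * QQ eta l μ x ^ 2)⁻¹

/-- The inverse metric in Cartesian components. -/
def hh (μ ν : Fin 5) : X5 → ℝ := fun x =>
  (if μ = ν then mink μ else 0)
    - iS eta l x * (mink μ * QQ eta l μ x) * (mink ν * QQ eta l ν x)

/-- Cartesian components of the first-order part of the linearised operator. -/
def BB (ν : Fin 5) : X5 → ℝ := fun x =>
  2 * iS eta l x ^ 2 * (∑ μ, ∑ lam, (mink ν * QQ eta l ν x) * (mink μ * QQ eta l μ x)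
      * (mink lam * QQ eta l lam x) * Dm eta lam (QQ eta l μ) x)
    - 2 * iS eta l x * ∑ μ, mink μ * mink ν * Dm eta μ (QQ eta l ν) x * QQ eta l μ x

/-- The inverse metric in the coordinates `(τ, y)`. -/
def AA (a b : Fin 5) : X5 → ℝ := fun x =>
  ∑ μ, ∑ ν, hh eta l μ ν x * (EE eta μ a x * EE eta ν b x)

/-- The first-order coefficients of the linearised operator in the coordinates `(τ, y)`. -/
def Bt (b : Fin 5) : X5 → ℝ := fun x =>
  ∑ μ, ∑ ν, hh eta l μ ν x * Dm eta μ (EE eta ν b) x + ∑ ν, BB eta l ν x * EE eta ν b x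

/-- Second-order coefficients of the perturbation of the model operator. -/
def kk (a b : Fin 5) : X5 → ℝ := fun x => mu eta x * AA eta l a b x - A0 a b x

/-- The coefficient of `∂_r ∂_τ`. -/
def cRT : X5 → ℝ := fun x => 2 * ∑ j : Fin 4, kk eta l 0 j.succ x * (yc j x / rr x)

/-- The coefficient of `∂_r²`. -/
def cRR : X5 → ℝ := fun x =>
  ∑ i : Fin 4, ∑ j : Fin 4, kk eta l i.succ j.succ x * (yc i x / rr x) * (yc j x / rr x)

/-- The logarithmic gradient of `r^{-3/2}`. -/
def pl (j : Fin 4) : X5 → ℝ := fun x => -(3 / 2) * (yc j x / rr x ^ 2)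

/-- The Hessian of `r^{-3/2}` divided by `r^{-3/2}`. -/
def pq (i j : Fin 4) : X5 → ℝ := fun x =>
  -(3 / 2) * ((if i = j then 1 else 0) / rr x ^ 2) + 21 / 4 * (yc i x * yc j x / rr x ^ 4)

/-- First-order coefficients of the perturbation of the model operator. -/
def bb (b : Fin 5) : X5 → ℝ := fun x =>
  2 * (∑ j : Fin 4, mu eta x * AA eta l j.succ b x * pl j x) + mu eta x * Bt eta l b x
    + Fin.cases (motive := fun _ => ℝ) (rD (cRT eta l) x + cRT eta l x / (2 * rr x))
      (fun j => 3 * yc j x / rr x ^ 2 + (rD (cRR eta l) x - cRR eta l x / rr x) * (yc j x / rr x)) b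

/-- Zeroth-order coefficient of the perturbation of the model operator. -/
def cc : X5 → ℝ := fun x =>
  mu eta x * (∑ i : Fin 4, ∑ j : Fin 4, AA eta l i.succ j.succ x * pq i j x
      + ∑ j : Fin 4, Bt eta l j.succ x * pl j x)
    + 3 / (4 * rr x ^ 2) + (3 / (4 * rr x ^ 2) * cRR eta l x - 3 / (2 * rr x) * rD (cRR eta l) x)
end defs

section algebra
variable {eta l : ℝ → E4} {x : X5}

/-- `∇^μ Q` in the coordinates `(τ, y)`. -/
def PQ (eta l : ℝ → E4) (a : Fin 5) : X5 → ℝ := fun x =>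
  ∑ μ, mink μ * QQ eta l μ x * EE eta μ a x

/-- The inverse metric is the Minkowski one minus a rank-one term built from `∇Q`. -/
lemma AA_eq (a b : Fin 5) :
    AA eta l a b x = Mk eta a b x - iS eta l x * (PQ eta l a x * PQ eta l b x) := by
  have e : ∀ μ ν, hh eta l μ ν x * (EE eta μ a x * EE eta ν b x)
      = (if μ = ν then mink μ * (EE eta μ a x * EE eta ν b x) else 0)
        - iS eta l x * ((mink μ * QQ eta l μ x * EE eta μ a x)
          * (mink ν * QQ eta l ν x * EE eta ν b x)) := by
    intro μ ν
    rw [hh]; split_ifs <;> ring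
  simp only [AA, e, Finset.sum_sub_distrib, Finset.sum_ite_eq, Finset.mem_univ, if_true,
    ← Finset.mul_sum, ← Finset.sum_mul]
  rfl

lemma AA_symm (a b : Fin 5) : AA eta l a b x = AA eta l b a x := by
  rw [AA_eq, AA_eq, mul_comm (PQ eta l a x)]
  simp only [Mk, mul_comm]

/-- The first-order coefficients are those of the Minkowski wave operator plus terms quadratic in
`∇Q`. -/
lemma Bt_eq (b : Fin 5) : Bt eta l b x = BM eta b x
    + (∑ ν, BB eta l ν x * EE eta ν b x
      - iS eta l x * ∑ μ, ∑ ν, (mink μ * QQ eta l μ x) * (mink ν * QQ eta l ν x)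
        * Dm eta μ (EE eta ν b) x) := by
  have e : ∀ μ ν, hh eta l μ ν x * Dm eta μ (EE eta ν b) x
      = (if μ = ν then mink μ * Dm eta μ (EE eta ν b) x else 0)
        - iS eta l x * ((mink μ * QQ eta l μ x) * (mink ν * QQ eta l ν x)
          * Dm eta μ (EE eta ν b) x) := by
    intro μ ν
    rw [hh]; split_ifs <;> ring
  simp only [Bt, e, Finset.sum_sub_distrib, Finset.sum_ite_eq, Finset.mem_univ, if_true,
    ← Finset.mul_sum]
  rw [BM]; ring
end algebra

lemma Sym.Dm {k g : ℕ} {m : ℤ} {F : Geo → X5 → ℝ} (hk : k ≤ 1) (μ : Fin 5) (h : Sym (k + 1) g m F) :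
    Sym k g m (fun G => Dm G.eta μ (F G)) := by
  have hE : ∀ a, Sym k 0 0 (fun G => HypRp.EE G.eta μ a) := by
    intro a
    interval_cases k
    · exact (Sym.EE μ a).lower
    · exact Sym.EE μ a
  refine Sym.sum _ fun a _ => ?_
  refine Fin.cases ?_ (fun j => ?_) a
  · exact ((hE 0).mul h.2.1).relax (by omega) (by omega)
  · exact ((hE _).mul (h.2.2 j)).relax (by omega) (by omega)

lemma Sym.QQ (μ : Fin 5) : Sym 1 0 (-2) (fun G => QQ G.eta G.l μ) :=
  show Sym 1 0 (-2) (fun G x => ∑ a, HypRp.EE G.eta μ a x * pd a (uc (profile G.l)) x) from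
  Sym.sum _ fun a _ => ((Sym.EE μ a).mul (Sym.dprofile a)).relax (by omega) (by omega)

lemma Sym.iS : Sym 1 0 0 (fun G => iS G.eta G.l) := by
  have h1 : Sym 1 0 (-4) (fun G x => ∑ μ, mink μ * HypRp.QQ G.eta G.l μ x ^ 2) := by
    simp only [sq]
    exact Sym.sum _ fun μ _ => (((Sym.QQ μ).mul (Sym.QQ μ)).cmul _).relax (by omega) (by omega)
  refine (((Sym.const 1 1).add (h1.relax le_rfl (by omega))).inv ?_ : Sym 1 0 (-0) _).relax
    le_rfl (by omega)
  obtain ⟨C, hC, h⟩ := (h1.gain.relax le_rfl (show (-4 : ℤ) + 1 ≤ 0 by omega)).base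
  refine ⟨1 / 2, by norm_num, ?_⟩
  filter_upwards [h, gap_lt (show 0 < 1 / (2 * (C + 1)) by positivity)] with G h hg x hx
  have h2 := (abs_le.1 (h x hx).2).1
  have h3 : C * G.gap ^ (0 + 1) ≤ 1 / 2 := by
    rw [zero_add, pow_one]
    rw [lt_div_iff₀ (by positivity)] at hg
    nlinarith [G.gap_pos]
  have h4 : -(1 / 2) ≤ ∑ μ, mink μ * HypRp.QQ G.eta G.l μ x ^ 2 := by
    refine le_trans ?_ h2
    rw [zpow_zero, mul_one]; linarith
  rw [zpow_zero]
  linarith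

lemma Sym.PQ (a : Fin 5) : Sym 1 0 (-2) (fun G => PQ G.eta G.l a) :=
  Sym.sum _ fun μ _ => (((Sym.QQ μ).cmul _).mul (Sym.EE μ a)).relax (by omega) (by omega)

lemma ord_le (a : Fin 5) : -1 ≤ ord a := by
  refine Fin.cases ?_ (fun j => ?_) a <;> simp [ord]

/-- The second-order error has relative size `e + 1/R`: the Minkowski part differs from the model by
`Sym.Mk_sub`, and the profile terms are quadratic in `∇Q = O(r⁻²)`, which beats the required order
by a power of `r`. -/
lemma Sym.kk (a b : Fin 5) : Sym 1 1 (ord a + ord b) (fun G => kk G.eta G.l a b) := by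
  have h1 := ((Sym.mu.mul (Sym.iS.mul ((Sym.PQ a).mul (Sym.PQ b)))).gain).relax
    (show 1 ≤ _ by omega) (show _ ≤ ord a + ord b by have := ord_le a; have := ord_le b; omega)
  refine ((Sym.Mk_sub a b).sub h1).congr (Eventually.of_forall fun G x hx =>
    Eventually.of_forall fun z => ?_)
  simp only [HypRp.kk, AA_eq]; ring

lemma Sym.BB (ν : Fin 5) : Sym 0 0 (-4) (fun G => BB G.eta G.l ν) := by
  have hD : ∀ μ ν, Sym 0 0 (-2) (fun G => HypRp.Dm G.eta μ (HypRp.QQ G.eta G.l ν)) :=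
    fun μ ν => (Sym.QQ ν).Dm (by omega) μ
  have hq : ∀ μ, Sym 0 0 (-2) (fun G x => mink μ * HypRp.QQ G.eta G.l μ x) :=
    fun μ => (Sym.QQ μ).lower.cmul _
  have h1 : Sym 0 0 (-4) (fun G x => 2 * HypRp.iS G.eta G.l x ^ 2 * ∑ μ, ∑ lam,
      (mink ν * HypRp.QQ G.eta G.l ν x) * (mink μ * HypRp.QQ G.eta G.l μ x)
      * (mink lam * HypRp.QQ G.eta G.l lam x) * HypRp.Dm G.eta lam (HypRp.QQ G.eta G.l μ) x) := by
    simp only [sq]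
    exact (((Sym.iS.lower.mul Sym.iS.lower).cmul 2).mul (Sym.sum _ fun μ _ => Sym.sum _ fun lam _ =>
      (((hq ν).mul (hq μ)).mul (hq lam)).mul (hD lam μ))).relax (by omega) (by omega)
  have h2 : Sym 0 0 (-4) (fun G x => 2 * HypRp.iS G.eta G.l x * ∑ μ, mink μ * mink ν
      * HypRp.Dm G.eta μ (HypRp.QQ G.eta G.l ν) x * HypRp.QQ G.eta G.l μ x) :=
    ((Sym.iS.lower.cmul 2).mul (Sym.sum _ fun μ _ => ((hD μ ν).cmul _).mul
      (Sym.QQ μ).lower)).relax (by omega) (by omega)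
  exact h1.sub h2

/-- The part of the first-order coefficients due to the profile. -/
lemma Sym.Bt_sub (b : Fin 5) :
    Sym 0 0 (-4) (fun G x => Bt G.eta G.l b x - BM G.eta b x) := by
  have hD : ∀ μ ν, Sym 0 0 0 (fun G => HypRp.Dm G.eta μ (HypRp.EE G.eta ν b)) :=
    fun μ ν => (Sym.EE ν b).Dm (by omega) μ
  have hq : ∀ μ, Sym 0 0 (-2) (fun G x => mink μ * HypRp.QQ G.eta G.l μ x) :=
    fun μ => (Sym.QQ μ).lower.cmul _
  have h1 : Sym 0 0 (-4) (fun G x => ∑ ν, HypRp.BB G.eta G.l ν x * HypRp.EE G.eta ν b x) :=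
    Sym.sum _ fun ν _ => ((Sym.BB ν).mul (Sym.EE ν b).lower).relax (by omega) (by omega)
  have h2 : Sym 0 0 (-4) (fun G x => HypRp.iS G.eta G.l x * ∑ μ, ∑ ν,
      (mink μ * HypRp.QQ G.eta G.l μ x) * (mink ν * HypRp.QQ G.eta G.l ν x)
        * HypRp.Dm G.eta μ (HypRp.EE G.eta ν b) x) :=
    (Sym.iS.lower.mul (Sym.sum _ fun μ _ => Sym.sum _ fun ν _ =>
      ((hq μ).mul (hq ν)).mul (hD μ ν))).relax (by omega) (by omega)
  refine (h1.sub h2).congr (Eventually.of_forall fun G x hx => Eventually.of_forall fun z => ?_)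
  simp only [Bt_eq]; ring

lemma Sym.th (k : ℕ) (j : Fin 4) : Sym k 0 0 (fun _ x => HypRp.yc j x / HypRp.rr x) := by
  simp only [div_eq_mul_inv]
  exact ((Sym.yc k j).mul (Sym.irr k)).relax (by omega) (by omega)

lemma Sym.rD {g : ℕ} {m : ℤ} {F : Geo → X5 → ℝ} (h : Sym 1 g m F) :
    Sym 0 g (m - 1) (fun G => rD (F G)) :=
  Sym.sum _ fun j _ => ((Sym.th 0 j).mul (h.2.2 j)).relax (by omega) (by omega)

lemma Sym.cRT : Sym 1 1 (-1) (fun G => cRT G.eta G.l) :=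
  (Sym.sum _ fun j _ => ((Sym.kk 0 j.succ).mul (Sym.th 1 j)).relax (show 1 ≤ _ by omega)
    (show _ ≤ (-1 : ℤ) by simp [ord])).cmul 2

lemma Sym.cRR : Sym 1 1 0 (fun G => cRR G.eta G.l) :=
  Sym.sum _ fun i _ => Sym.sum _ fun j _ => (((Sym.kk i.succ j.succ).mul (Sym.th 1 i)).mul
    (Sym.th 1 j)).relax (show 1 ≤ _ by omega) (show _ ≤ (0 : ℤ) by simp [ord])

lemma Sym.pl (j : Fin 4) : Sym 0 0 (-1) (fun _ => pl j) := by
  refine (((Sym.th 0 j).mul (Sym.irr 0)).cmul (-(3 / 2))).relax le_rfl (show _ ≤ (-1 : ℤ) by omega)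
    |>.congr (Eventually.of_forall fun G x hx => Eventually.of_forall fun z => ?_)
  simp only [HypRp.pl]; ring

lemma Sym.pq (i j : Fin 4) : Sym 0 0 (-2) (fun _ => pq i j) := by
  have h1 := (((Sym.irr 0).mul (Sym.irr 0)).cmul (-(3 / 2) * (if i = j then 1 else 0))).relax
    le_rfl (show _ ≤ (-2 : ℤ) by omega)
  have h2 := ((((Sym.irr 0).mul (Sym.irr 0)).mul ((Sym.th 0 i).mul (Sym.th 0 j))).cmul
    (21 / 4)).relax le_rfl (show _ ≤ (-2 : ℤ) by omega)
  refine (h1.add h2).congr (Eventually.of_forall fun G x hx => Eventually.of_forall fun z => ?_)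
  simp only [HypRp.pq]; split_ifs <;> ring

/-- The weight order of the first-order coefficients. -/
lemma Sym.bb (b : Fin 5) : Sym 0 1 (ord b - 1) (fun G => bb G.eta G.l b) := by
  have hQ : Sym 0 1 (-2) (fun G x => HypRp.mu G.eta x * (Bt G.eta G.l b x - BM G.eta b x)) :=
    (Sym.mu.lower.mul (Sym.Bt_sub b)).gain.relax (by omega) (by omega)
  have hk : Sym 0 1 (ord b - 1) (fun G x => 2 * ∑ j : Fin 4, HypRp.kk G.eta G.l j.succ b x
      * HypRp.pl j x) :=
    (Sym.sum _ fun j _ => ((Sym.kk j.succ b).lower.mul (Sym.pl j)).relax (show 1 ≤ _ by omega)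
      (show _ ≤ ord b - 1 by simp [ord])).cmul 2
  revert hQ hk
  refine Fin.cases ?_ (fun i => ?_) b
  · intro hQ hk
    have h1 := Sym.cRT.rD
    have h2 := (Sym.cRT.lower.mul (Sym.irr 0)).cmul (1 / 2)
    refine ((((hk.relax le_rfl (show _ ≤ (-2 : ℤ) by simp [ord])).add Sym.BM_zero).add hQ).add
      ((h1.relax le_rfl (show _ ≤ (-2 : ℤ) by omega)).add (h2.relax (show 1 ≤ _ by omega)
        (show _ ≤ (-2 : ℤ) by omega)))).relax le_rfl (show _ ≤ ord 0 - 1 by simp [ord]) |>.congr ?_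
    refine Eventually.of_forall fun G x hx => ?_
    filter_upwards [ev_ne (Geo.y_ne hx)] with z hz
    have hr := (rr_pos hz).ne'
    have e : ∑ j : Fin 4, HypRp.mu G.eta z * HypRp.AA G.eta G.l j.succ 0 z * HypRp.pl j z
        = ∑ j : Fin 4, HypRp.kk G.eta G.l j.succ 0 z * HypRp.pl j z + 3 / 2 * (HypRp.rr z)⁻¹ := by
      have e1 : ∀ j : Fin 4, HypRp.mu G.eta z * HypRp.AA G.eta G.l j.succ 0 z * HypRp.pl j z
          = HypRp.kk G.eta G.l j.succ 0 z * HypRp.pl j z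
            + 3 / 2 / HypRp.rr z ^ 3 * (HypRp.yc j z * HypRp.yc j z) := by
        intro j
        simp only [HypRp.kk, A0, HypRp.pl, Fin.cases_zero, Fin.cases_succ]
        field_simp; ring
      simp only [e1, Finset.sum_add_distrib, ← Finset.mul_sum, sum_yc_sq]
      field_simp
    simp only [HypRp.bb, e, Fin.cases_zero]
    field_simp
    ring
  · intro hQ hk
    have h1 := ((Sym.cRR.rD).sub ((Sym.cRR.lower.mul (Sym.irr 0)).relax (show 1 ≤ _ by omega)
      (show _ ≤ (0 - 1 : ℤ) by omega))).mul (Sym.th 0 i)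
    have h2 := (Sym.mu.lower.mul (Sym.BM_succ i))
    refine ((((hk.relax le_rfl (show _ ≤ (-1 : ℤ) by simp [ord])).add (h2.relax (show 1 ≤ _ by omega)
      (show _ ≤ (-1 : ℤ) by omega))).add (hQ.relax le_rfl (by omega))).add
      (h1.relax (show 1 ≤ _ by omega) (show _ ≤ (-1 : ℤ) by omega))).relax le_rfl
      (show _ ≤ ord i.succ - 1 by simp [ord]) |>.congr ?_
    refine Eventually.of_forall fun G x hx => ?_
    filter_upwards [ev_ne (Geo.y_ne hx)] with z hz
    have hr := (rr_pos hz).ne'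
    have e : ∑ j : Fin 4, HypRp.mu G.eta z * HypRp.AA G.eta G.l j.succ i.succ z * HypRp.pl j z
        = ∑ j : Fin 4, HypRp.kk G.eta G.l j.succ i.succ z * HypRp.pl j z + HypRp.pl i z := by
      have e1 : ∀ j : Fin 4, HypRp.mu G.eta z * HypRp.AA G.eta G.l j.succ i.succ z * HypRp.pl j z
          = HypRp.kk G.eta G.l j.succ i.succ z * HypRp.pl j z
            + (if j = i then HypRp.pl j z else 0) := by
        intro j
        simp only [HypRp.kk, A0, Fin.cases_succ]
        split_ifs <;> ring
      simp only [e1, Finset.sum_add_distrib, Finset.sum_ite_eq', Finset.mem_univ, if_true]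
    simp only [HypRp.bb, e, Fin.cases_succ]
    generalize ∑ j : Fin 4, HypRp.kk G.eta G.l j.succ i.succ z * HypRp.pl j z = S
    simp only [HypRp.pl]
    field_simp
    ring

lemma Sym.cc : Sym 0 1 (-2) (fun G => cc G.eta G.l) := by
  have hk : Sym 0 1 (-2) (fun G x => ∑ i : Fin 4, ∑ j : Fin 4, HypRp.kk G.eta G.l i.succ j.succ x
      * HypRp.pq i j x) :=
    Sym.sum _ fun i _ => Sym.sum _ fun j _ => ((Sym.kk i.succ j.succ).lower.mul
      (Sym.pq i j)).relax (show 1 ≤ _ by omega) (show _ ≤ (-2 : ℤ) by simp [ord])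
  have hB : ∀ j : Fin 4, Sym 0 1 (-1) (fun G => HypRp.Bt G.eta G.l j.succ) := by
    intro j
    refine ((Sym.BM_succ j).add ((Sym.Bt_sub j.succ).gain.relax (by omega)
      (show _ ≤ (-1 : ℤ) by omega))).congr (Eventually.of_forall fun G x hx =>
        Eventually.of_forall fun z => ?_)
    simp only; ring
  have h2 : Sym 0 1 (-2) (fun G x => HypRp.mu G.eta x * ∑ j : Fin 4,
      HypRp.Bt G.eta G.l j.succ x * HypRp.pl j x) :=
    (Sym.mu.lower.mul (Sym.sum _ fun j _ => (hB j).mul (Sym.pl j))).relax (by omega) (by omega)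
  have h3 := ((((Sym.irr 0).mul (Sym.irr 0)).mul Sym.cRR.lower).cmul (3 / 4)).relax
    (show 1 ≤ _ by omega) (show _ ≤ (-2 : ℤ) by omega)
  have h4 := (((Sym.irr 0).mul Sym.cRR.rD).cmul (3 / 2)).relax
    (show 1 ≤ _ by omega) (show _ ≤ (-2 : ℤ) by omega)
  refine ((hk.add h2).add (h3.sub h4)).congr (Eventually.of_forall fun G x hx => ?_)
  filter_upwards [ev_ne (Geo.y_ne hx)] with z hz
  have hr := (rr_pos hz).ne'
  have e : HypRp.mu G.eta z * ∑ i : Fin 4, ∑ j : Fin 4, HypRp.AA G.eta G.l i.succ j.succ z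
        * HypRp.pq i j z
      = ∑ i : Fin 4, ∑ j : Fin 4, HypRp.kk G.eta G.l i.succ j.succ z * HypRp.pq i j z
        - 3 / (4 * HypRp.rr z ^ 2) := by
    have e1 : ∀ i j : Fin 4, HypRp.mu G.eta z * (HypRp.AA G.eta G.l i.succ j.succ z
        * HypRp.pq i j z) = HypRp.kk G.eta G.l i.succ j.succ z * HypRp.pq i j z
          + (if i = j then HypRp.pq i j z else 0) := by
      intro i j
      simp only [HypRp.kk, A0, Fin.cases_succ]
      split_ifs <;> ring
    have e2 : ∀ i : Fin 4, HypRp.pq i i z = -(3 / 2) / HypRp.rr z ^ 2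
        + 21 / 4 / HypRp.rr z ^ 4 * (HypRp.yc i z * HypRp.yc i z) := by
      intro i; simp only [HypRp.pq, if_true]; ring
    simp only [Finset.mul_sum, e1, Finset.sum_add_distrib, Finset.sum_ite_eq, Finset.mem_univ,
      if_true, e2]
    rw [← Finset.mul_sum, sum_yc_sq]
    simp only [Finset.sum_const, Finset.card_univ, Fintype.card_fin, nsmul_eq_mul]
    field_simp; push_cast; ring
  simp only [HypRp.cc, mul_add, e]
  field_simp
  ring

lemma zpow_ord {r : ℝ} (a : Fin 5) : r ^ ord a = sw r a := by
  refine Fin.cases ?_ (fun j => ?_) a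
  · simp [ord, sw]
  · simp [ord, sw]

/-- The commuted operator is a perturbation of the model operator of relative size `e + 1/R`. -/
lemma exists_perturbed : ∃ C : ℝ, 1 ≤ C ∧ ∀ᶠ G in small,
    (∀ x ∈ G.reg, WW G.eta x ≠ 0 ∧ (∀ a, Sm (QQ G.eta G.l a) x) ∧ Sm (iS G.eta G.l) x
      ∧ Sm (uc (profile G.l)) x) ∧
    ∀ τ₁ τ₂ : ℝ, G.T = Icc τ₁ τ₂ → ∀ Y : X5 → ℝ, (∀ x ∈ G.reg, Sm Y x) →
      Perturbed G.R τ₁ τ₂ (C * G.gap) (kk G.eta G.l) (bb G.eta G.l) (cc G.eta G.l) Y := by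
  have hK : ∀ a b, ∃ C : ℝ, 0 ≤ C ∧ ∀ᶠ G in small, ∀ x ∈ G.reg, Sm (kk G.eta G.l a b) x ∧
      |kk G.eta G.l a b x| ≤ C * G.gap ^ 1 * rr x ^ (ord a + ord b) := fun a b => (Sym.kk a b).base
  have hdK : ∀ c a b, ∃ C : ℝ, 0 ≤ C ∧ ∀ᶠ G in small, ∀ x ∈ G.reg,
      |pd c (kk G.eta G.l a b) x| ≤ C * G.gap ^ 1 * (dw (rr x) c * rr x ^ (ord a + ord b)) := by
    intro c a b
    refine Fin.cases ?_ (fun j => ?_) c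
    · obtain ⟨C, hC, h⟩ := (Sym.kk a b).2.1
      refine ⟨C, hC, h.mono fun G h x hx => (h x hx).2.trans (le_of_eq ?_)⟩
      simp [dw]
    · obtain ⟨C, hC, h⟩ := (Sym.kk a b).2.2 j
      refine ⟨C, hC, h.mono fun G h x hx => (h x hx).2.trans (le_of_eq ?_)⟩
      have hr : rr x ≠ 0 := (rr_pos (Geo.y_ne hx)).ne'
      simp only [dw, Fin.cases_succ, zpow_sub_one₀ hr]; ring
  have hb : ∀ a, ∃ C : ℝ, 0 ≤ C ∧ ∀ᶠ G in small, ∀ x ∈ G.reg, Sm (bb G.eta G.l a) x ∧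
      |bb G.eta G.l a x| ≤ C * G.gap ^ 1 * rr x ^ (ord a - 1) := fun a => Sym.bb a
  obtain ⟨C3, hC3, hc⟩ := Sym.cc
  choose C0 hC0 hK using hK
  choose C1 hC1 hdK using hdK
  choose C2 hC2 hb using hb
  have hK := eventually_all.2 fun a => eventually_all.2 fun b => hK a b
  have hdK := eventually_all.2 fun c => eventually_all.2 fun a => eventually_all.2 fun b => hdK c a b
  have hb := eventually_all.2 hb
  set C := 1 + ∑ a, ∑ b, C0 a b + ∑ c, ∑ a, ∑ b, C1 c a b + ∑ a, C2 a + C3 with hCdef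
  have s0 : 0 ≤ ∑ a, ∑ b, C0 a b := Finset.sum_nonneg fun a _ => Finset.sum_nonneg fun b _ => hC0 a b
  have s1 : 0 ≤ ∑ c, ∑ a, ∑ b, C1 c a b := Finset.sum_nonneg fun c _ => Finset.sum_nonneg fun a _ =>
    Finset.sum_nonneg fun b _ => hC1 c a b
  have s2 : 0 ≤ ∑ a, C2 a := Finset.sum_nonneg fun a _ => hC2 a
  have l0 : ∀ a b, C0 a b ≤ C := fun a b => by
    have h1 := Finset.single_le_sum (fun b _ => hC0 a b) (Finset.mem_univ b)
    have h2 := Finset.single_le_sum (f := fun a => ∑ b, C0 a b)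
      (fun a _ => Finset.sum_nonneg fun b _ => hC0 a b) (Finset.mem_univ a)
    linarith
  have l1 : ∀ c a b, C1 c a b ≤ C := fun c a b => by
    have h1 := Finset.single_le_sum (fun b _ => hC1 c a b) (Finset.mem_univ b)
    have h2 := Finset.single_le_sum (f := fun a => ∑ b, C1 c a b)
      (fun a _ => Finset.sum_nonneg fun b _ => hC1 c a b) (Finset.mem_univ a)
    have h3 := Finset.single_le_sum (f := fun c => ∑ a, ∑ b, C1 c a b)
      (fun c _ => Finset.sum_nonneg fun a _ => Finset.sum_nonneg fun b _ => hC1 c a b)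
      (Finset.mem_univ c)
    linarith
  have l2 : ∀ a, C2 a ≤ C := fun a => by
    have h1 := Finset.single_le_sum (fun a _ => hC2 a) (Finset.mem_univ a)
    linarith
  have l3 : C3 ≤ C := by linarith
  refine ⟨C, by linarith, ?_⟩
  have hQ := eventually_all.2 fun a => (Sym.QQ a).sm
  filter_upwards [hK, hdK, hb, hc, WW_ne, hQ, Sym.iS.sm, profile_ev]
    with G hK hdK hb hc hW hQ hS hP
  refine ⟨fun x hx => ⟨(hW x hx).self_of_nhds.1, fun a => hQ a x hx, hS x hx, (hP x hx).1⟩, ?_⟩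
  intro τ₁ τ₂ hT Y hY
  have hreg : ∀ x : X5, x.1 ∈ Icc τ₁ τ₂ → G.R ≤ rr x → x ∈ G.reg := fun x h1 h2 =>
    ⟨hT ▸ h1, h2⟩
  have hg := G.gap_pos
  have hpos : ∀ x : X5, x ∈ G.reg → 0 < rr x := fun x hx => rr_pos (Geo.y_ne hx)
  refine ⟨G.one_le, G.inv_le.trans ?_, fun a b z => ?_, fun x h1 h2 a b => (hK a b x (hreg x h1 h2)).1,
    fun x h1 h2 a => (hb a x (hreg x h1 h2)).1, fun x h1 h2 => (hc x (hreg x h1 h2)).1,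
    fun x h1 h2 => hY x (hreg x h1 h2), fun x h1 h2 a b => ?_, fun x h1 h2 c a b => ?_,
    fun x h1 h2 a => ?_, fun x h1 h2 => ?_⟩
  · nlinarith
  · rw [kk, kk, AA_symm, A0_symm]
  · have hx := hreg x h1 h2
    have := hpos x hx
    refine (hK a b x hx).2.trans ?_
    rw [zpow_add₀ this.ne', zpow_ord, zpow_ord, pow_one, mul_assoc (C * G.gap)]
    have := sw_pos this a; have := sw_pos (hpos x hx) b
    gcongr; exact l0 a b
  · have hx := hreg x h1 h2
    have := hpos x hx
    refine (hdK c a b x hx).trans ?_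
    rw [zpow_add₀ this.ne', zpow_ord, zpow_ord, pow_one, ← mul_assoc]
    have h3 := sw_pos this a; have h4 := sw_pos (hpos x hx) b
    have h5 : 0 ≤ dw (rr x) c := by
      refine Fin.cases ?_ (fun j => ?_) c
      · simp [dw]
      · simp only [dw, Fin.cases_succ]; positivity
    gcongr; exact l1 c a b
  · have hx := hreg x h1 h2
    have := hpos x hx
    refine (hb a x hx).2.trans ?_
    rw [zpow_sub_one₀ this.ne', zpow_ord, pow_one, div_eq_mul_inv, ← mul_assoc]
    have h3 := sw_pos this a
    gcongr; exact l2 a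
  · have hx := hreg x h1 h2
    have := hpos x hx
    refine (hc x hx).2.trans ?_
    rw [pow_one, show (-2 : ℤ) = -(2 : ℕ) from rfl, zpow_neg, zpow_natCast, ← div_eq_mul_inv]
    gcongr

/-! ### The linearised operator in the coordinates `(τ, y)` -/

/-- Points at which the geometric coefficients are smooth. -/
structure Reg (eta l : ℝ → E4) (x : X5) : Prop where
  sm_eta : ContDiffAt ℝ ∞ eta x.1
  ne : x.2 ≠ 0
  W : WW eta x ≠ 0
  Q : ∀ μ, Sm (QQ eta l μ) x
  S : Sm (iS eta l) x
  prof : Sm (uc (profile l)) x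

/-- The second-order operator with coefficients `AA` and `Bt`. -/
def PP (eta l : ℝ → E4) (f : X5 → ℝ) : X5 → ℝ := fun x =>
  ∑ a, ∑ b, AA eta l a b x * pd a (pd b f) x + ∑ b, Bt eta l b x * pd b f x

section
variable {eta l : ℝ → E4} {x : X5} {f : X5 → ℝ}

lemma tauX_eq (μ : Fin 5) (x : X5) : tauX eta μ x.1 x.2 = tX eta μ x := by
  have hj := (jap_pos (rr x)).ne'
  have e : 1 - inner ℝ x.2 (deriv eta x.1) / jap ‖x.2‖ = WW eta x / jap (rr x) := by
    rw [WW, yE_eq]; simp only [rr] at *; field_simp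
  refine Fin.cases ?_ (fun j => ?_) μ
  · simp only [tauX, tX, Fin.cases_zero, e, iW]
    rw [one_div, inv_div, div_eq_mul_inv]
  · simp only [tauX, tX, Fin.cases_succ, e, iW]
    rw [show x.2 j = yc j x from rfl, show ‖x.2‖ = rr x from rfl]
    by_cases hW : WW eta x = 0
    · simp [hW]
    · field_simp

lemma dX_at {f : Fld} (h : DifferentiableAt ℝ (uc f) x) (μ : Fin 5) :
    dX eta μ f x.1 x.2 = Dm eta μ (uc f) x := by
  rw [dX, tauX_eq, dT_at h, dsnd_sum h, Dm,
    Fin.sum_univ_succ (fun a : Fin 5 => EE eta μ a x * pd a (uc f) x)]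
  have e0 : ∀ j : Fin 4, EE eta μ j.succ x * pd j.succ (uc f) x
      = kd μ j.succ * pd j.succ (uc f) x
        - tX eta μ x * (deriv eta x.1 j * pd j.succ (uc f) x) := by
    intro j; simp only [EE, vv, Fin.cases_succ]; ring
  simp only [e0, Finset.sum_sub_distrib, ← Finset.mul_sum, EE_zero]
  refine Fin.cases ?_ (fun i => ?_) μ
  · simp [kd, (Fin.succ_ne_zero _).symm]; ring
  · simp only [kd_succ, Fin.cases_succ, dY_at h, ite_mul, one_mul, zero_mul, Finset.sum_ite_eq,
      Finset.mem_univ, if_true]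
    ring

lemma dX_ev {f : Fld} (h : Sm (uc f) x) (μ : Fin 5) :
    uc (dX eta μ f) =ᶠ[𝓝 x] Dm eta μ (uc f) := by
  filter_upwards [h.ev_diff] with z hz using dX_at hz μ

lemma Dm_congr {g : X5 → ℝ} (μ : Fin 5) (e : f =ᶠ[𝓝 x] g) : Dm eta μ f x = Dm eta μ g x := by
  simp only [Dm, pd_congr' _ e]

lemma Reg.Dm_sm (h : Reg eta l x) (hf : Sm f x) (μ : Fin 5) : Sm (Dm eta μ f) x :=
  HypRp.Dm_sm h.sm_eta h.ne h.W hf μ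

lemma dX_dX_at (h : Reg eta l x) {f : Fld} (hf : Sm (uc f) x) (μ ν : Fin 5) :
    dX eta μ (dX eta ν f) x.1 x.2 = Dm eta μ (Dm eta ν (uc f)) x := by
  have e := dX_ev (eta := eta) hf ν
  have hs : Sm (uc (dX eta ν f)) x := (h.Dm_sm hf ν).congr e
  rw [dX_at hs.diff, Dm_congr μ e]

lemma Dm_Dm (h : Reg eta l x) (hf : Sm f x) (μ ν : Fin 5) :
    Dm eta μ (Dm eta ν f) x = ∑ a, ∑ b, EE eta μ a x * EE eta ν b x * pd a (pd b f) x
      + ∑ b, Dm eta μ (EE eta ν b) x * pd b f x := by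
  have hE := EE_sm h.sm_eta h.ne h.W
  have e : ∀ a, EE eta μ a x * pd a (Dm eta ν f) x
      = ∑ b, EE eta μ a x * EE eta ν b x * pd a (pd b f) x
        + ∑ b, EE eta μ a x * pd a (EE eta ν b) x * pd b f x := by
    intro a
    rw [show Dm eta ν f = fun z => ∑ b, EE eta ν b z * pd b f z from rfl,
      pd_sum _ _ fun b _ => (hE ν b).mul (pd_sm b hf), Finset.mul_sum, ← Finset.sum_add_distrib]
    refine Finset.sum_congr rfl fun b _ => ?_
    rw [pd_mul _ (hE ν b) (pd_sm b hf)]; ring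
  rw [Dm]
  simp only [e, Finset.sum_add_distrib]
  congr 1
  rw [Finset.sum_comm]
  exact Finset.sum_congr rfl fun b _ => by rw [Dm, Finset.sum_mul]

lemma sum_hh_Dm_Dm (h : Reg eta l x) (hf : Sm f x) :
    ∑ μ, ∑ ν, hh eta l μ ν x * Dm eta μ (Dm eta ν f) x
      = ∑ a, ∑ b, AA eta l a b x * pd a (pd b f) x
        + ∑ b, (∑ μ, ∑ ν, hh eta l μ ν x * Dm eta μ (EE eta ν b) x) * pd b f x := by
  simp only [Dm_Dm h hf, mul_add, Finset.sum_add_distrib]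
  congr 1
  · simp only [AA, Finset.mul_sum, Finset.sum_mul]
    rw [Finset.sum_comm' (t' := Finset.univ) (s' := fun _ => Finset.univ) (by simp)]
    have : ∀ F : Fin 5 → Fin 5 → Fin 5 → Fin 5 → ℝ, ∑ ν, ∑ μ, ∑ a, ∑ b, F μ ν a b
        = ∑ a, ∑ b, ∑ μ, ∑ ν, F μ ν a b := by
      intro F
      calc _ = ∑ μ, ∑ ν, ∑ a, ∑ b, F μ ν a b := Finset.sum_comm
        _ = ∑ μ, ∑ a, ∑ ν, ∑ b, F μ ν a b := Finset.sum_congr rfl fun μ _ => Finset.sum_comm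
        _ = ∑ a, ∑ μ, ∑ ν, ∑ b, F μ ν a b := Finset.sum_comm
        _ = ∑ a, ∑ μ, ∑ b, ∑ ν, F μ ν a b := Finset.sum_congr rfl fun a _ =>
          Finset.sum_congr rfl fun μ _ => Finset.sum_comm
        _ = _ := Finset.sum_congr rfl fun a _ => Finset.sum_comm
    rw [this fun μ ν a b => hh eta l μ ν x * (EE eta μ a x * EE eta ν b x * pd a (pd b f) x)]
    refine Finset.sum_congr rfl fun a _ => Finset.sum_congr rfl fun b _ =>
      Finset.sum_congr rfl fun μ _ => Finset.sum_congr rfl fun ν _ => by ring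
  · simp only [Finset.mul_sum, Finset.sum_mul]
    calc _ = ∑ μ, ∑ b, ∑ ν, hh eta l μ ν x * (Dm eta μ (EE eta ν b) x * pd b f x) :=
          Finset.sum_congr rfl fun μ _ => Finset.sum_comm
      _ = ∑ b, ∑ μ, ∑ ν, hh eta l μ ν x * (Dm eta μ (EE eta ν b) x * pd b f x) := Finset.sum_comm
      _ = _ := Finset.sum_congr rfl fun b _ => Finset.sum_congr rfl fun μ _ =>
        Finset.sum_congr rfl fun ν _ => by ring

lemma sSq_eq (h : Reg eta l x) : (sSq eta l x.1 x.2)⁻¹ = iS eta l x := by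
  simp only [sSq, iS, dX_at h.prof.diff]; rfl

lemma gradUp_eq (h : Reg eta l x) (μ : Fin 5) :
    gradUp eta l μ x.1 x.2 = mink μ * QQ eta l μ x := by
  simp only [gradUp, dX_at h.prof.diff]; rfl

lemma hInv_eq (h : Reg eta l x) (μ ν : Fin 5) : hInv eta l μ ν x.1 x.2 = hh eta l μ ν x := by
  rw [hInv, sSq_eq h, gradUp_eq h, gradUp_eq h, hh]

/-- The linearised operator in the coordinates `(τ, y)`. -/
lemma Pgraph_at (h : Reg eta l x) {f : Fld} (hf : Sm (uc f) x) :
    Pgraph eta l f x.1 x.2 = PP eta l (uc f) x := by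
  have e0 : ∀ μ, dX eta μ (profile l) x.1 x.2 = QQ eta l μ x := fun μ => dX_at h.prof.diff μ
  have e1 : ∀ μ ν, dX eta μ (dX eta ν (profile l)) x.1 x.2 = Dm eta μ (QQ eta l ν) x :=
    fun μ ν => dX_dX_at h h.prof μ ν
  have e2 : ∀ ν, dX eta ν f x.1 x.2 = Dm eta ν (uc f) x := fun ν => dX_at hf.diff ν
  simp only [Pgraph, sSq_eq h, gradUp_eq h, e0, e1, e2, dX_dX_at h hf]
  have e3 : ∑ μ, ∑ ν, hh eta l μ ν x * Dm eta μ (Dm eta ν (uc f)) x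
      = (∑ μ, mink μ * Dm eta μ (Dm eta μ (uc f)) x)
        - iS eta l x * ∑ μ, ∑ ν, mink μ * QQ eta l μ x * (mink ν * QQ eta l ν x)
          * Dm eta μ (Dm eta ν (uc f)) x := by
    have e : ∀ μ ν, hh eta l μ ν x * Dm eta μ (Dm eta ν (uc f)) x
        = (if μ = ν then mink μ * Dm eta μ (Dm eta ν (uc f)) x else 0)
          - iS eta l x * (mink μ * QQ eta l μ x * (mink ν * QQ eta l ν x)
            * Dm eta μ (Dm eta ν (uc f)) x) := by
      intro μ ν; rw [hh]; split_ifs <;> ring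
    simp only [e, Finset.sum_sub_distrib, Finset.sum_ite_eq, Finset.mem_univ, if_true,
      ← Finset.mul_sum]
  have e4 : ∑ ν, BB eta l ν x * Dm eta ν (uc f) x
      = ∑ b, (∑ ν, BB eta l ν x * EE eta ν b x) * pd b (uc f) x := by
    simp only [Dm, Finset.mul_sum, Finset.sum_mul]
    rw [Finset.sum_comm]
    exact Finset.sum_congr rfl fun b _ => Finset.sum_congr rfl fun ν _ => by ring
  have e5 : ∑ ν, BB eta l ν x * Dm eta ν (uc f) x
      = 2 * iS eta l x ^ 2 * (∑ μ, ∑ ν, ∑ lam, mink ν * QQ eta l ν x * (mink μ * QQ eta l μ x)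
          * (mink lam * QQ eta l lam x) * Dm eta lam (QQ eta l μ) x * Dm eta ν (uc f) x)
        - 2 * iS eta l x * ∑ μ, ∑ ν, mink μ * mink ν * Dm eta μ (QQ eta l ν) x * QQ eta l μ x
          * Dm eta ν (uc f) x := by
    simp only [BB, sub_mul, Finset.sum_sub_distrib, mul_assoc (2 * iS eta l x ^ 2),
      mul_assoc (2 * iS eta l x), ← Finset.mul_sum, Finset.sum_mul]
    congr 2
    · exact Finset.sum_comm
    · exact Finset.sum_comm
  have e6 := sum_hh_Dm_Dm h hf
  have e7 : PP eta l (uc f) x = ∑ a, ∑ b, AA eta l a b x * pd a (pd b (uc f)) x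
        + ∑ b, (∑ μ, ∑ ν, hh eta l μ ν x * Dm eta μ (EE eta ν b) x) * pd b (uc f) x
        + ∑ b, (∑ ν, BB eta l ν x * EE eta ν b x) * pd b (uc f) x := by
    simp only [PP, Bt, add_mul, Finset.sum_add_distrib]; ring
  rw [e7, ← e6, ← e4, e5, e3]
  ring

lemma PP_congr {g : X5 → ℝ} (e : f =ᶠ[𝓝 x] g) : PP eta l f x = PP eta l g x := by
  simp only [PP, pd_congr' _ e, pd_congr' _ (pd_congr _ e)]

/-- Powers of the radius. -/
def rp (s : ℝ) : X5 → ℝ := fun x => rr x ^ s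

lemma rp_pos (s : ℝ) (h : x.2 ≠ 0) : 0 < rp s x := Real.rpow_pos_of_pos (rr_pos h) s

lemma rp_add (s t : ℝ) (h : x.2 ≠ 0) : rp s x * rp t x = rp (s + t) x :=
  (Real.rpow_add (rr_pos h) s t).symm

lemma rp_sm (s : ℝ) (h : x.2 ≠ 0) : Sm (rp s) x :=
  Frr_sm (F := fun r : ℝ => r ^ s) h (Real.contDiffAt_rpow_const_of_ne (rr_pos h).ne')

lemma pd_rp (s : ℝ) (h : x.2 ≠ 0) (a : Fin 5) :
    pd a (rp s) x = Fin.cases (motive := fun _ => ℝ) 0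
      (fun j => s * rp s x * (yc j x / rr x ^ 2)) a := by
  have hr := rr_pos h
  have := pd_rad h (Real.hasDerivAt_rpow_const (p := s) (Or.inl hr.ne')) a
  rw [show rp s = fun z => (fun r : ℝ => r ^ s) (rr z) from rfl, this]
  refine Fin.cases rfl (fun j => ?_) a
  simp only [Fin.cases_succ]
  rw [Real.rpow_sub_one hr.ne']
  field_simp

lemma pd_pd_rp (s : ℝ) (h : x.2 ≠ 0) (i j : Fin 4) :
    pd i.succ (pd j.succ (rp s)) x = rp s x * (s * ((if i = j then 1 else 0) / rr x ^ 2)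
      + s * (s - 2) * (yc i x * yc j x / rr x ^ 4)) := by
  have hr := rr_pos h
  have e : pd j.succ (rp s) =ᶠ[𝓝 x] fun z => (s * rp (s - 2) z) * yc j z := by
    filter_upwards [ev_ne h] with z hz
    have hz' := rr_pos hz
    rw [pd_rp s hz]
    simp only [Fin.cases_succ, rp]
    rw [Real.rpow_sub hz', Real.rpow_two]; field_simp
  rw [pd_congr' _ e, pd_mul _ (contDiffAt_const.mul (rp_sm _ h)) (yc_sm j x), pd_const_mul, pd_yc,
    pd_rp _ h]
  simp only [Fin.cases_succ, rp, Fin.succ_inj]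
  rw [Real.rpow_sub hr, Real.rpow_two]; field_simp
  ring

/-- Conjugation by `r^{-3/2}`. -/
lemma PP_conj (h : x.2 ≠ 0) (hf : Sm f x) :
    rp (3 / 2) x * PP eta l (fun z => rp (-(3 / 2)) z * f z) x
      = ∑ a, ∑ b, AA eta l a b x * pd a (pd b f) x
        + ∑ b, (2 * (∑ j : Fin 4, AA eta l j.succ b x * pl j x) + Bt eta l b x) * pd b f x
        + (∑ i : Fin 4, ∑ j : Fin 4, AA eta l i.succ j.succ x * pq i j x
          + ∑ j : Fin 4, Bt eta l j.succ x * pl j x) * f x := by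
  have hψ := rp_sm (-(3 / 2)) h
  set ψ := rp (-(3 / 2)) with hψd
  have h1 : rp (3 / 2) x * ψ x = 1 := by
    rw [hψd, rp_add _ _ h]; norm_num [rp]
  -- logarithmic derivatives of `r^{-3/2}`
  let P1 : Fin 5 → ℝ := fun a => Fin.cases (motive := fun _ => ℝ) 0 (fun j => pl j x) a
  let P2 : Fin 5 → Fin 5 → ℝ := fun a b => Fin.cases (motive := fun _ => ℝ) 0
    (fun i => Fin.cases (motive := fun _ => ℝ) 0 (fun j => pq i j x) b) a
  have d1 : ∀ a, pd a ψ x = ψ x * P1 a := by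
    intro a
    rw [hψd, pd_rp _ h]
    refine Fin.cases (by simp [P1]) (fun j => ?_) a
    simp only [P1, Fin.cases_succ, pl]; ring
  have hz0 : ∀ z : X5, z.2 ≠ 0 → pd 0 ψ z = 0 := fun z hz => by rw [hψd, pd_rp _ hz]; rfl
  have d2 : ∀ a b, pd a (pd b ψ) x = ψ x * P2 a b := by
    intro a b
    have e0 : pd 0 ψ =ᶠ[𝓝 x] fun _ => 0 := (ev_ne h).mono hz0
    refine Fin.cases ?_ (fun i => ?_) a <;> refine Fin.cases ?_ (fun j => ?_) b
    · rw [pd_congr' _ e0, pd_const]; simp [P2]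
    · rw [pd_comm _ _ hψ, pd_congr' _ e0, pd_const]; simp [P2]
    · rw [pd_congr' _ e0, pd_const]; simp [P2]
    · rw [hψd, pd_pd_rp _ h]
      simp only [P2, Fin.cases_succ, pq]; ring
  have c1 : ∀ b, pd b (fun z => ψ z * f z) x = ψ x * (P1 b * f x + pd b f x) := by
    intro b; rw [pd_mul _ hψ hf, d1]; ring
  have c2 : ∀ a b, pd a (pd b (fun z => ψ z * f z)) x
      = ψ x * (P2 a b * f x + P1 b * pd a f x + P1 a * pd b f x + pd a (pd b f) x) := by
    intro a b
    rw [pd_congr' _ (pd_mul_ev b hψ hf), pd_add _ ((pd_sm b hψ).mul hf) (hψ.mul (pd_sm b hf)),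
      pd_mul _ (pd_sm b hψ) hf, pd_mul _ hψ (pd_sm b hf), d2, d1, d1]
    ring
  have e1 : ∀ a b, AA eta l a b x * pd a (pd b (fun z => ψ z * f z)) x
      = ψ x * (AA eta l a b x * pd a (pd b f) x + AA eta l a b x * P1 b * pd a f x
        + AA eta l a b x * P1 a * pd b f x + AA eta l a b x * P2 a b * f x) := by
    intro a b; rw [c2]; ring
  have e2 : ∀ b, Bt eta l b x * pd b (fun z => ψ z * f z) x
      = ψ x * (Bt eta l b x * P1 b * f x + Bt eta l b x * pd b f x) := by
    intro b; rw [c1]; ring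
  rw [PP]
  simp only [e1, e2, ← Finset.mul_sum, ← mul_add]
  rw [← mul_assoc, h1, one_mul]
  simp only [Finset.sum_add_distrib, ← Finset.sum_mul, add_mul]
  have s1 : ∀ b, ∑ a, AA eta l a b x * P1 a = ∑ j : Fin 4, AA eta l j.succ b x * pl j x := by
    intro b; rw [Fin.sum_univ_succ]; simp [P1]
  have s2 : ∑ a, (∑ b, AA eta l a b x * P1 b) * pd a f x
      = ∑ b, (∑ j : Fin 4, AA eta l j.succ b x * pl j x) * pd b f x := by
    refine Finset.sum_congr rfl fun b _ => ?_
    rw [← s1]; congr 1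
    exact Finset.sum_congr rfl fun a _ => by rw [AA_symm]
  have s3 : ∑ a, ∑ b, AA eta l a b x * P2 a b
      = ∑ i : Fin 4, ∑ j : Fin 4, AA eta l i.succ j.succ x * pq i j x := by
    rw [Fin.sum_univ_succ]
    simp only [Fin.sum_univ_succ (fun b : Fin 5 => AA eta l (Fin.succ _) b x * P2 _ b)]
    simp [P2]
  have s4 : ∑ b, Bt eta l b x * P1 b = ∑ j : Fin 4, Bt eta l j.succ x * pl j x := by
    rw [Fin.sum_univ_succ]; simp [P1]
  have s5 : ∑ a, ∑ b, AA eta l a b x * P1 a * pd b f x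
      = ∑ b, (∑ j : Fin 4, AA eta l j.succ b x * pl j x) * pd b f x := by
    rw [Finset.sum_comm]
    exact Finset.sum_congr rfl fun b _ => by rw [← s1, Finset.sum_mul]
  have s6 : ∑ b, 2 * (∑ j : Fin 4, AA eta l j.succ b x * pl j x) * pd b f x
      = 2 * ∑ b, (∑ j : Fin 4, AA eta l j.succ b x * pl j x) * pd b f x := by
    rw [Finset.mul_sum]; exact Finset.sum_congr rfl fun b _ => by ring
  rw [s2, s3, s4, s5, s6]
  ring
end

/-! ### The equation satisfied by `Y = K Ũ` -/

section radial
variable {x : X5} {f g : X5 → ℝ}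

lemma rD_congr' (e : f =ᶠ[𝓝 x] g) : rD f x = rD g x := (rD_congr e).eq_of_nhds

lemma rD_add' (hf : DifferentiableAt ℝ f x) (hg : DifferentiableAt ℝ g x) :
    rD (fun z => f z + g z) x = rD f x + rD g x := by
  simp only [rD, pd_add' _ hf hg, mul_add, Finset.sum_add_distrib]

lemma rD_sub' (hf : DifferentiableAt ℝ f x) (hg : DifferentiableAt ℝ g x) :
    rD (fun z => f z - g z) x = rD f x - rD g x := by
  simp only [rD, pd_sub' _ hf hg, mul_sub, Finset.sum_sub_distrib]

lemma rD_mul' (hf : DifferentiableAt ℝ f x) (hg : DifferentiableAt ℝ g x) :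
    rD (fun z => f z * g z) x = rD f x * g x + f x * rD g x := by
  simp only [rD, pd_mul' _ hf hg, mul_add, Finset.sum_add_distrib, Finset.mul_sum, Finset.sum_mul]
  congr 1 <;> exact Finset.sum_congr rfl fun j _ => by ring

lemma rD_const_mul (c : ℝ) (f : X5 → ℝ) : rD (fun z => c * f z) x = c * rD f x := by
  simp only [rD, pd_const_mul, Finset.mul_sum]
  exact Finset.sum_congr rfl fun j _ => by ring

lemma rD_const (c : ℝ) : rD (fun _ => c) x = 0 := by simp [rD, pd_const]

lemma rD_rp (s : ℝ) (h : x.2 ≠ 0) : rD (rp s) x = s * rp s x / rr x := by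
  have hr := rr_pos h
  have e : ∀ j : Fin 4, yc j x / rr x * pd j.succ (rp s) x
      = s * rp s x / rr x ^ 3 * (yc j x * yc j x) := by
    intro j; rw [pd_rp s h]; simp only [Fin.cases_succ]; ring
  simp only [rD, e, ← Finset.mul_sum, sum_yc_sq]
  field_simp

lemma rD_pd_zero_ev (h : x.2 ≠ 0) (hf : Sm f x) : rD (pd 0 f) =ᶠ[𝓝 x] pd 0 (rD f) := by
  have hc : ∀ᶠ z in 𝓝 x, ∀ j : Fin 4, pd 0 (pd j.succ f) z = pd j.succ (pd 0 f) z :=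
    eventually_all.2 fun j => pd_comm_ev _ _ hf
  have hd : ∀ᶠ z in 𝓝 x, ∀ j : Fin 4, DifferentiableAt ℝ (pd j.succ f) z :=
    eventually_all.2 fun j => (pd_sm _ hf).ev_diff
  filter_upwards [hc, hd, ev_ne h] with z hc hd hz
  rw [show rD f = fun z => ∑ j, yc j z / rr z * pd j.succ f z from rfl,
    pd_sum' _ _ fun j _ => (th_sm hz j).diff.fun_mul (hd j)]
  refine Finset.sum_congr rfl fun j _ => ?_
  rw [pd_mul' _ (th_sm hz j).diff (hd j), pd_th_zero hz, hc]; ring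

lemma rot5_th {z : X5} (hz : z.2 ≠ 0) (i j k : Fin 4) :
    rot5 i j (fun z => yc k z / rr z) z
      = (if j = k then yc i z / rr z else 0) - if i = k then yc j z / rr z else 0 := by
  rw [rot5, pd_th hz, pd_th hz]
  split_ifs <;> ring

lemma rD_rot5_ev (i j : Fin 4) (h : x.2 ≠ 0) (hf : Sm f x) :
    rD (rot5 i j f) =ᶠ[𝓝 x] rot5 i j (rD f) := by
  have hc : ∀ᶠ z in 𝓝 x, ∀ k m : Fin 4, pd k.succ (pd m.succ f) z = pd m.succ (pd k.succ f) z :=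
    eventually_all.2 fun k => eventually_all.2 fun m => pd_comm_ev _ _ hf
  have hd : ∀ᶠ z in 𝓝 x, ∀ j : Fin 4, DifferentiableAt ℝ (pd j.succ f) z :=
    eventually_all.2 fun j => (pd_sm _ hf).ev_diff
  filter_upwards [hc, hd, ev_ne h] with z hc hd hz
  have hr := (rr_pos hz).ne'
  have hy : ∀ k, DifferentiableAt ℝ (yc k) z := fun k => (yc_sm k z).diff
  have e1 : ∀ k : Fin 4, yc k z / rr z * pd k.succ (rot5 i j f) z
      = ((if k = i then yc k z / rr z * pd j.succ f z else 0)
          - if k = j then yc k z / rr z * pd i.succ f z else 0)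
        + (yc i z * (yc k z / rr z * pd j.succ (pd k.succ f) z)
          - yc j z * (yc k z / rr z * pd i.succ (pd k.succ f) z)) := by
    intro k
    rw [show rot5 i j f = fun z => yc i z * pd j.succ f z - yc j z * pd i.succ f z from rfl,
      pd_sub' _ ((hy i).fun_mul (hd j)) ((hy j).fun_mul (hd i)), pd_mul' _ (hy i) (hd j),
      pd_mul' _ (hy j) (hd i), pd_yc, pd_yc, hc k j, hc k i]
    simp only [Fin.succ_inj]
    split_ifs <;> ring
  have e2 : ∀ a : Fin 4, pd a.succ (rD f) z = ∑ k, (pd a.succ (fun z => yc k z / rr z) z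
      * pd k.succ f z + yc k z / rr z * pd a.succ (pd k.succ f) z) := by
    intro a
    rw [show rD f = fun z => ∑ j, yc j z / rr z * pd j.succ f z from rfl,
      pd_sum' _ _ fun j _ => (th_sm hz j).diff.fun_mul (hd j)]
    exact Finset.sum_congr rfl fun k _ => pd_mul' _ (th_sm hz k).diff (hd k)
  have e3 : rot5 i j (rD f) z = ∑ k, (rot5 i j (fun z => yc k z / rr z) z * pd k.succ f z
      + (yc i z * (yc k z / rr z * pd j.succ (pd k.succ f) z)
          - yc j z * (yc k z / rr z * pd i.succ (pd k.succ f) z))) := by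
    rw [rot5, e2, e2, Finset.mul_sum, Finset.mul_sum, ← Finset.sum_sub_distrib]
    refine Finset.sum_congr rfl fun k _ => ?_
    rw [rot5]; ring
  rw [e3, rD]
  simp only [e1, rot5_th hz, Finset.sum_add_distrib, Finset.sum_sub_distrib, sub_mul, ite_mul,
    zero_mul, Finset.sum_ite_eq', Finset.sum_ite_eq, Finset.mem_univ, if_true]

lemma rot5_rp_mul_ev (s : ℝ) (i j : Fin 4) (h : x.2 ≠ 0) (hf : Sm f x) :
    rot5 i j (fun z => rp s z * f z) =ᶠ[𝓝 x] fun z => rp s z * rot5 i j f z := by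
  filter_upwards [hf.ev_diff, ev_ne h] with z hd hz
  rw [rot5, pd_mul' _ (rp_sm s hz).diff hd, pd_mul' _ (rp_sm s hz).diff hd, pd_rp s hz, pd_rp s hz,
    rot5]
  simp only [Fin.cases_succ]; ring

/-- The Laplacian of the unit sphere through the rotation fields. -/
def Lap (f : X5 → ℝ) : X5 → ℝ := fun z => ∑ i : Fin 4, ∑ j ∈ Finset.Ioi i, rot5 i j (rot5 i j f) z

lemma Lap_sm (hf : Sm f x) : Sm (Lap f) x :=
  ContDiffAt.sum fun i _ => ContDiffAt.sum fun j _ => rot5_sm i j (rot5_sm i j hf)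

lemma Lap_congr (e : f =ᶠ[𝓝 x] g) : Lap f x = Lap g x := by
  refine Finset.sum_congr rfl fun i _ => Finset.sum_congr rfl fun j _ => ?_
  exact (rot5_congr i j (rot5_congr i j e)).eq_of_nhds

lemma rD_Lap (h : x.2 ≠ 0) (hf : Sm f x) : rD (Lap f) x = Lap (rD f) x := by
  have hs : ∀ i j, Sm (rot5 i j (rot5 i j f)) x := fun i j => rot5_sm i j (rot5_sm i j hf)
  have e : ∀ k : Fin 4, pd k.succ (Lap f) x
      = ∑ i : Fin 4, ∑ j ∈ Finset.Ioi i, pd k.succ (rot5 i j (rot5 i j f)) x := by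
    intro k
    rw [show Lap f = fun z => ∑ i : Fin 4, ∑ j ∈ Finset.Ioi i, rot5 i j (rot5 i j f) z from rfl,
      pd_sum _ _ fun i _ => ContDiffAt.sum fun j _ => hs i j]
    exact Finset.sum_congr rfl fun i _ => pd_sum _ _ fun j _ => hs i j
  have e2 : rD (Lap f) x = ∑ i : Fin 4, ∑ j ∈ Finset.Ioi i, rD (rot5 i j (rot5 i j f)) x := by
    simp only [rD, e, Finset.mul_sum]
    rw [Finset.sum_comm]
    exact Finset.sum_congr rfl fun i _ => Finset.sum_comm
  rw [e2]
  refine Finset.sum_congr rfl fun i _ => Finset.sum_congr rfl fun j _ => ?_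
  rw [(rD_rot5_ev i j h (rot5_sm i j hf)).eq_of_nhds]
  exact (rot5_congr i j (rD_rot5_ev i j h hf)).eq_of_nhds

lemma Lap_rp_mul (s : ℝ) (h : x.2 ≠ 0) (hf : Sm f x) :
    Lap (fun z => rp s z * f z) x = rp s x * Lap f x := by
  simp only [Lap, Finset.mul_sum]
  refine Finset.sum_congr rfl fun i _ => Finset.sum_congr rfl fun j _ => ?_
  rw [(rot5_congr i j (rot5_rp_mul_ev s i j h hf)).eq_of_nhds,
    (rot5_rp_mul_ev s i j h (rot5_sm i j hf)).eq_of_nhds]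
end radial

/-- The model operator `Q₀` in terms of partial derivatives. -/
def Qz (f : X5 → ℝ) : X5 → ℝ := fun z =>
  -(3 / 4) * rp (-2) z * f z - 2 * rD (pd 0 f) z + rD (rD f) z + rp (-2) z * Lap f z

/-- The conjugated operator `r^{3/2} (1 - Θ·η') P_graph r^{-3/2}`. -/
def PC (eta l : ℝ → E4) (f : X5 → ℝ) : X5 → ℝ := fun z =>
  rp (3 / 2) z * mu eta z * PP eta l (fun z => rp (-(3 / 2)) z * f z) z

/-- The operator `V` in terms of partial derivatives. -/
def ER (eta l : ℝ → E4) (f : X5 → ℝ) : X5 → ℝ := fun z =>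
  PC eta l f z - Qz f z - cRT eta l z * rD (pd 0 f) z - cRR eta l z * rD (rD f) z

section dictionary
variable {eta l : ℝ → E4} {x : X5}

lemma thetaDot_eq : 1 - thetaDot eta x.1 x.2 = mu eta x := by
  rw [thetaDot, inner_smul_left, mu, yE_eq]; simp [rr]

lemma dR_dT_at {f : Fld} (hf : Sm (uc f) x) :
    dR (dT f) x.1 x.2 = rD (pd 0 (uc f)) x :=
  (uc_congr_dR (pd_sm 0 hf) (dT_ev hf)).eq_of_nhds

lemma dR_dR_at {f : Fld} (h : x.2 ≠ 0) (hf : Sm (uc f) x) :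
    dR (dR f) x.1 x.2 = rD (rD (uc f)) x :=
  (uc_congr_dR (rD_sm h hf) (dR_ev hf)).eq_of_nhds

lemma Qzero_at {f : Fld} (h : x.2 ≠ 0) (hf : Sm (uc f) x) :
    Qzero f x.1 x.2 = Qz (uc f) x := by
  have e : sphLap f x.1 x.2 = Lap (uc f) x := by
    refine Finset.sum_congr rfl fun i _ => Finset.sum_congr rfl fun j _ => ?_
    exact (uc_congr_rot (rot5_sm i j hf) (rot_ev hf i j) i j).eq_of_nhds
  rw [Qzero, dR_dT_at hf, dR_dR_at h hf, e]; rfl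

lemma rMul_sm {s : ℝ} {f : Fld} (h : x.2 ≠ 0) (hf : Sm (uc f) x) : Sm (uc (rMul s f)) x :=
  (rp_sm s h).mul hf

lemma errQ_at (h : Reg eta l x) {f : Fld} (hf : Sm (uc f) x) :
    errQ eta l f x.1 x.2 = PC eta l (uc f) x - Qz (uc f) x := by
  rw [errQ, thetaDot_eq, Pgraph_at h (rMul_sm h.ne hf), Qzero_at h.ne hf]; rfl

lemma Dm_rr (h : x.2 ≠ 0) (ν : Fin 5) :
    dX eta ν (fun _ z => ‖z‖) x.1 x.2 = ∑ j : Fin 4, EE eta ν j.succ x * (yc j x / rr x) := by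
  rw [dX_at (f := fun _ z => ‖z‖) (rr_sm h).diff, Dm, Fin.sum_univ_succ]
  rw [show uc (fun (_ : ℝ) (z : E4) => ‖z‖) = rr from rfl, pd_rr_zero h, mul_zero, zero_add]
  exact Finset.sum_congr rfl fun j _ => by rw [pd_rr_succ h]

lemma coefRT_at (h : Reg eta l x) : coefRT eta l x.1 x.2 = cRT eta l x := by
  have hr := (rr_pos h.ne).ne'
  have e1 : ∑ μ, ∑ ν, hh eta l μ ν x * tX eta μ x * ∑ j : Fin 4, EE eta ν j.succ x * (yc j x / rr x)
      = ∑ j : Fin 4, AA eta l 0 j.succ x * (yc j x / rr x) := by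
    simp only [AA, Finset.sum_mul, Finset.mul_sum]
    rw [Finset.sum_comm (s := (Finset.univ : Finset (Fin 4)))]
    refine Finset.sum_congr rfl fun μ _ => ?_
    rw [Finset.sum_comm]
    refine Finset.sum_congr rfl fun j _ => Finset.sum_congr rfl fun ν _ => ?_
    rw [EE_zero]; ring
  have e2 : ∀ j : Fin 4, kk eta l 0 j.succ x * (yc j x / rr x)
      = mu eta x * (AA eta l 0 j.succ x * (yc j x / rr x)) + 1 / rr x ^ 2 * (yc j x * yc j x) := by
    intro j; simp only [kk, A0, Fin.cases_zero, Fin.cases_succ]; field_simp; ring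
  rw [coefRT, thetaDot_eq, cRT]
  simp only [hInv_eq h, tauX_eq, Dm_rr h.ne, e1, e2, Finset.sum_add_distrib, ← Finset.mul_sum,
    sum_yc_sq]
  field_simp

lemma coefRR_at (h : Reg eta l x) : coefRR eta l x.1 x.2 = cRR eta l x := by
  have hr := (rr_pos h.ne).ne'
  have e1 : ∑ μ, ∑ ν, hh eta l μ ν x * (∑ i : Fin 4, EE eta μ i.succ x * (yc i x / rr x))
        * (∑ j : Fin 4, EE eta ν j.succ x * (yc j x / rr x))
      = ∑ i : Fin 4, ∑ j : Fin 4, AA eta l i.succ j.succ x * (yc i x / rr x) * (yc j x / rr x) := by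
    simp only [AA, Finset.sum_mul, Finset.mul_sum]
    calc _ = ∑ μ, ∑ j : Fin 4, ∑ ν, ∑ i : Fin 4, hh eta l μ ν x * (EE eta μ i.succ x * (yc i x / rr x))
        * (EE eta ν j.succ x * (yc j x / rr x)) := Finset.sum_congr rfl fun μ _ => Finset.sum_comm
      _ = ∑ j : Fin 4, ∑ μ, ∑ ν, ∑ i : Fin 4, hh eta l μ ν x * (EE eta μ i.succ x * (yc i x / rr x))
        * (EE eta ν j.succ x * (yc j x / rr x)) := Finset.sum_comm
      _ = ∑ j : Fin 4, ∑ μ, ∑ i : Fin 4, ∑ ν, hh eta l μ ν x * (EE eta μ i.succ x * (yc i x / rr x))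
        * (EE eta ν j.succ x * (yc j x / rr x)) := Finset.sum_congr rfl fun j _ =>
          Finset.sum_congr rfl fun μ _ => Finset.sum_comm
      _ = ∑ j : Fin 4, ∑ i : Fin 4, ∑ μ, ∑ ν, hh eta l μ ν x * (EE eta μ i.succ x * (yc i x / rr x))
        * (EE eta ν j.succ x * (yc j x / rr x)) := Finset.sum_congr rfl fun j _ => Finset.sum_comm
      _ = ∑ i : Fin 4, ∑ j : Fin 4, ∑ μ, ∑ ν, hh eta l μ ν x * (EE eta μ i.succ x * (yc i x / rr x))
        * (EE eta ν j.succ x * (yc j x / rr x)) := Finset.sum_comm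
      _ = _ := Finset.sum_congr rfl fun i _ => Finset.sum_congr rfl fun j _ =>
        Finset.sum_congr rfl fun μ _ => Finset.sum_congr rfl fun ν _ => by ring
  have e2 : ∀ i j : Fin 4, kk eta l i.succ j.succ x * (yc i x / rr x) * (yc j x / rr x)
      = mu eta x * (AA eta l i.succ j.succ x * (yc i x / rr x) * (yc j x / rr x))
        - (if i = j then 1 / rr x ^ 2 * (yc i x * yc j x) else 0) := by
    intro i j; simp only [kk, A0, Fin.cases_succ]; split_ifs <;> (field_simp; try ring)
  rw [coefRR, thetaDot_eq, cRR]
  simp only [hInv_eq h, Dm_rr h.ne, e1, e2, Finset.sum_sub_distrib, ← Finset.mul_sum,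
    Finset.sum_ite_eq, Finset.mem_univ, if_true, sum_yc_sq]
  field_simp

lemma errRest_at (h : Reg eta l x) {f : Fld} (hf : Sm (uc f) x) :
    errRest eta l f x.1 x.2 = ER eta l (uc f) x := by
  rw [errRest, errQ_at h hf, coefRT_at h, coefRR_at h, dR_dT_at hf, dR_dR_at h.ne hf]; rfl

/-- Radial derivative on a fixed time slice. -/
lemma dR_slice {f : Fld} {g : X5 → ℝ} {τ : ℝ} {y : E4} (hg : DifferentiableAt ℝ g (τ, y))
    (e : f τ =ᶠ[𝓝 y] fun y' => g (τ, y')) : dR f τ y = rD g (τ, y) := by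
  have h1 : dR f τ y = dR (fun t y' => g (t, y')) τ y := by
    rw [dR, dR, e.fderiv_eq]
  rw [h1]
  exact dR_at (f := fun t y' => g (t, y')) (x := (τ, y)) hg
end dictionary

lemma sum_cases (A : ℝ) (B : Fin 4 → ℝ) :
    ∑ a : Fin 5, Fin.cases (motive := fun _ => ℝ) A B a = A + ∑ j, B j := by
  rw [Fin.sum_univ_succ]; rfl

section smooth
variable {eta l : ℝ → E4} {x : X5} (h : Reg eta l x)
include h

lemma Reg.EE_sm (μ a : Fin 5) : Sm (EE eta μ a) x := HypRp.EE_sm h.sm_eta h.ne h.W μ a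

lemma Reg.hh_sm (μ ν : Fin 5) : Sm (hh eta l μ ν) x :=
  contDiffAt_const.sub ((h.S.mul (contDiffAt_const.mul (h.Q μ))).mul (contDiffAt_const.mul (h.Q ν)))

lemma Reg.AA_sm (a b : Fin 5) : Sm (AA eta l a b) x :=
  ContDiffAt.sum fun μ _ => ContDiffAt.sum fun ν _ =>
    (h.hh_sm μ ν).mul ((h.EE_sm μ a).mul (h.EE_sm ν b))

lemma Reg.BB_sm (ν : Fin 5) : Sm (BB eta l ν) x := by
  have hq : ∀ μ, Sm (fun x => mink μ * QQ eta l μ x) x := fun μ => contDiffAt_const.mul (h.Q μ)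
  have hD : ∀ lam μ, Sm (Dm eta lam (QQ eta l μ)) x := fun lam μ => h.Dm_sm (h.Q μ) lam
  refine ContDiffAt.sub ?_ ?_
  · exact (contDiffAt_const.mul (h.S.pow 2)).mul (ContDiffAt.sum fun μ _ => ContDiffAt.sum
      fun lam _ => (((hq ν).mul (hq μ)).mul (hq lam)).mul (hD lam μ))
  · exact (contDiffAt_const.mul h.S).mul (ContDiffAt.sum fun μ _ =>
      (contDiffAt_const.mul (hD μ ν)).mul (h.Q μ))

lemma Reg.Bt_sm (b : Fin 5) : Sm (Bt eta l b) x :=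
  (ContDiffAt.sum fun μ _ => ContDiffAt.sum fun ν _ =>
    (h.hh_sm μ ν).mul (h.Dm_sm (h.EE_sm ν b) μ)).add
    (ContDiffAt.sum fun ν _ => (h.BB_sm ν).mul (h.EE_sm ν b))

lemma Reg.mu_sm : Sm (mu eta) x := HypRp.mu_sm h.sm_eta h.ne

lemma Reg.kk_sm (a b : Fin 5) : Sm (kk eta l a b) x :=
  (h.mu_sm.mul (h.AA_sm a b)).sub (A0_sm h.ne a b)

lemma Reg.cRT_sm : Sm (cRT eta l) x :=
  contDiffAt_const.mul (ContDiffAt.sum fun j _ => (h.kk_sm 0 j.succ).mul (th_sm h.ne j))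

lemma Reg.cRR_sm : Sm (cRR eta l) x :=
  ContDiffAt.sum fun i _ => ContDiffAt.sum fun j _ =>
    ((h.kk_sm i.succ j.succ).mul (th_sm h.ne i)).mul (th_sm h.ne j)

lemma Reg.Qz_sm {f : X5 → ℝ} (hf : Sm f x) : Sm (Qz f) x :=
  ((((contDiffAt_const.mul (rp_sm _ h.ne)).mul hf).sub (contDiffAt_const.mul
    (rD_sm h.ne (pd_sm 0 hf)))).add (rD_sm h.ne (rD_sm h.ne hf))).add
    ((rp_sm _ h.ne).mul (Lap_sm hf))

lemma Reg.ER_sm {f : X5 → ℝ} (hf : Sm f x) : Sm (ER eta l f) x := by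
  have hg : Sm (fun z => rp (-(3 / 2)) z * f z) x := (rp_sm _ h.ne).mul hf
  have hP : Sm (PP eta l (fun z => rp (-(3 / 2)) z * f z)) x :=
    (ContDiffAt.sum fun a _ => ContDiffAt.sum fun b _ => (h.AA_sm a b).mul
      (pd_sm a (pd_sm b hg))).add (ContDiffAt.sum fun b _ => (h.Bt_sm b).mul (pd_sm b hg))
  exact (((((rp_sm _ h.ne).mul h.mu_sm).mul hP).sub (h.Qz_sm hf)).sub
    (h.cRT_sm.mul (rD_sm h.ne (pd_sm 0 hf)))).sub (h.cRR_sm.mul (rD_sm h.ne (rD_sm h.ne hf)))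

/-- The operator acting on `Y`, in terms of the conjugated operator. -/
lemma opL_eq {Y : X5 → ℝ} (hY : Sm Y x) :
    opL (kk eta l) (bb eta l) (cc eta l) Y x = PC eta l Y x - pd 0 Y x / rr x - rD Y x / rr x
      + 3 / (4 * rr x ^ 2) * Y x
      + (rD (cRT eta l) x + cRT eta l x / (2 * rr x)) * pd 0 Y x
      + (rD (cRR eta l) x - cRR eta l x / rr x) * rD Y x
      + (3 / (4 * rr x ^ 2) * cRR eta l x - 3 / (2 * rr x) * rD (cRR eta l) x) * Y x := by
  have hr := (rr_pos h.ne).ne'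
  have e0 : PC eta l Y x = mu eta x * (rp (3 / 2) x * PP eta l (fun z => rp (-(3 / 2)) z * Y z) x) := by
    rw [PC]; ring
  rw [e0, PP_conj h.ne hY, opL]
  have e1 : L2 (fun a b z => A0 a b z + kk eta l a b z) Y x
      = mu eta x * ∑ a, ∑ b, AA eta l a b x * pd a (pd b Y) x := by
    simp only [L2, kk, add_sub_cancel, mul_assoc, Finset.mul_sum]
  have e2 : ∑ a, (b0 a x + bb eta l a x) * pd a Y x
      = mu eta x * ∑ b, (2 * (∑ j : Fin 4, AA eta l j.succ b x * pl j x) + Bt eta l b x) * pd b Y x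
        - pd 0 Y x / rr x - rD Y x / rr x
        + (rD (cRT eta l) x + cRT eta l x / (2 * rr x)) * pd 0 Y x
        + (rD (cRR eta l) x - cRR eta l x / rr x) * rD Y x := by
    have e3 : ∀ b, bb eta l b x = mu eta x * (2 * (∑ j : Fin 4, AA eta l j.succ b x * pl j x)
        + Bt eta l b x) + Fin.cases (motive := fun _ => ℝ)
          (rD (cRT eta l) x + cRT eta l x / (2 * rr x))
          (fun j => 3 * yc j x / rr x ^ 2
            + (rD (cRR eta l) x - cRR eta l x / rr x) * (yc j x / rr x)) b := by
      intro b
      simp only [bb, mul_assoc, ← Finset.mul_sum]; ring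
    have e4 : ∀ a, (b0 a x + bb eta l a x) * pd a Y x
        = mu eta x * ((2 * (∑ j : Fin 4, AA eta l j.succ a x * pl j x) + Bt eta l a x) * pd a Y x)
          + Fin.cases (motive := fun _ => ℝ)
          (-(pd 0 Y x / rr x) + (rD (cRT eta l) x + cRT eta l x / (2 * rr x)) * pd 0 Y x)
          (fun j => (-(1 / rr x) + (rD (cRR eta l) x - cRR eta l x / rr x))
            * (yc j x / rr x * pd j.succ Y x)) a := by
      intro a
      rw [e3]
      refine Fin.cases ?_ (fun j => ?_) a
      · simp only [b0, Fin.cases_zero]; ring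
      · simp only [b0, Fin.cases_succ]; field_simp; ring
    simp only [e4, Finset.sum_add_distrib, ← Finset.mul_sum]
    rw [sum_cases]
    simp only [← Finset.mul_sum]
    rw [show ∑ j : Fin 4, yc j x / rr x * pd j.succ Y x = rD Y x from rfl]
    ring
  rw [e1, e2, cc]
  ring
end smooth

/-- Commuting `K + 2 r^{1/2}` past the terms of the equation with leading part
`-2 ∂_r ∂_τ + ∂_r²`. -/
lemma commute_K {eta l : ℝ → E4} {x : X5} (h : Reg eta l x) {u : X5 → ℝ} (hu : Sm u x) :
    rp (3 / 2) x * rD (fun z => Qz u z + cRT eta l z * rD (pd 0 u) z + cRR eta l z * rD (rD u) z) x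
      + 2 * rp (1 / 2) x * (Qz u x + cRT eta l x * rD (pd 0 u) x + cRR eta l x * rD (rD u) x)
      + ER eta l (fun z => rp (3 / 2) z * rD u z) x
      = opL (kk eta l) (bb eta l) (cc eta l) (fun z => rp (3 / 2) z * rD u z) x := by
  have h0 := h.ne
  have hr := rr_pos h0
  have hrd := rD_sm h0 hu
  have hY : Sm (fun z => rp (3 / 2) z * rD u z) x := (rp_sm _ h0).mul hrd
  rw [opL_eq h hY, ER]
  set Y : X5 → ℝ := fun z => rp (3 / 2) z * rD u z with hYd
  have hcan : ∀ z : X5, z.2 ≠ 0 → rp (-(3 / 2)) z * rp (3 / 2) z = 1 := fun z hz => by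
    rw [rp_add _ _ hz]; norm_num [rp]
  have E1 : rD u =ᶠ[𝓝 x] fun z => rp (-(3 / 2)) z * Y z := by
    filter_upwards [ev_ne h0] with z hz
    rw [hYd]; simp only
    rw [← mul_assoc, hcan z hz, one_mul]
  have E2 : rD (pd 0 u) =ᶠ[𝓝 x] fun z => rp (-(3 / 2)) z * pd 0 Y z := by
    refine (rD_pd_zero_ev h0 hu).trans ((pd_congr 0 E1).trans ?_)
    filter_upwards [hY.ev_diff, ev_ne h0] with z hd hz
    rw [pd_mul' _ (rp_sm _ hz).diff hd, pd_rp _ hz]; simp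
  have E3 : rD (rD u) =ᶠ[𝓝 x] fun z => rp (-(3 / 2)) z * (rD Y z - 3 / 2 * (Y z * rp (-1) z)) := by
    refine (rD_congr E1).trans ?_
    filter_upwards [hY.ev_diff, ev_ne h0] with z hd hz
    rw [rD_mul' (rp_sm _ hz).diff hd, rD_rp _ hz]
    rw [show rp (-1) z = (rr z)⁻¹ from Real.rpow_neg_one _]
    ring
  have EH : (fun z => Qz u z + cRT eta l z * rD (pd 0 u) z + cRR eta l z * rD (rD u) z)
      =ᶠ[𝓝 x] fun z => rp (-2) z * (-(3 / 4) * u z + Lap u z)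
        + ((cRT eta l z - 2) * (rp (-(3 / 2)) z * pd 0 Y z)
        + (1 + cRR eta l z) * (rp (-(3 / 2)) z * (rD Y z - 3 / 2 * (Y z * rp (-1) z)))) := by
    filter_upwards [E2, E3] with z h2 h3
    rw [Qz, h2, h3]; ring
  have s1 : Sm (fun z => -(3 / 4) * u z + Lap u z) x := (contDiffAt_const.mul hu).add (Lap_sm hu)
  have sT := h.cRT_sm
  have sR := h.cRR_sm
  have sp0 := pd_sm 0 hY
  have srY := rD_sm h0 hY
  have sYr : Sm (fun z => Y z * rp (-1) z) x := hY.mul (rp_sm _ h0)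
  have sW : Sm (fun z => rD Y z - 3 / 2 * (Y z * rp (-1) z)) x :=
    srY.sub (contDiffAt_const.mul sYr)
  have sA : Sm (fun z => rp (-(3 / 2)) z * pd 0 Y z) x := (rp_sm _ h0).mul sp0
  have sB : Sm (fun z => rp (-(3 / 2)) z * (rD Y z - 3 / 2 * (Y z * rp (-1) z))) x :=
    (rp_sm _ h0).mul sW
  have sT2 : Sm (fun z => cRT eta l z - 2) x := sT.sub contDiffAt_const
  have sR2 : Sm (fun z => 1 + cRR eta l z) x := contDiffAt_const.add sR
  have s0 : Sm (fun z => rp (-2) z * (-(3 / 4) * u z + Lap u z)) x := (rp_sm _ h0).mul s1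
  have su : Sm (fun z => -(3 / 4) * u z) x := contDiffAt_const.mul hu
  have sYr' : Sm (fun z => 3 / 2 * (Y z * rp (-1) z)) x := contDiffAt_const.mul sYr
  have sTA : Sm (fun z => (cRT eta l z - 2) * (rp (-(3 / 2)) z * pd 0 Y z)) x := sT2.mul sA
  have sRB : Sm (fun z => (1 + cRR eta l z)
      * (rp (-(3 / 2)) z * (rD Y z - 3 / 2 * (Y z * rp (-1) z)))) x := sR2.mul sB
  have sTB : Sm (fun z => (cRT eta l z - 2) * (rp (-(3 / 2)) z * pd 0 Y z) + (1 + cRR eta l z)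
      * (rp (-(3 / 2)) z * (rD Y z - 3 / 2 * (Y z * rp (-1) z)))) x := sTA.add sRB
  have sc : ∀ c : ℝ, Sm (fun _ => c) x := fun c => contDiffAt_const
  rw [rD_congr' EH, EH.eq_of_nhds, rD_add' s0.diff sTB.diff, rD_mul' (rp_sm _ h0).diff s1.diff,
    rD_add' su.diff (Lap_sm hu).diff, rD_const_mul, rD_add' sTA.diff sRB.diff,
    rD_mul' sT2.diff sA.diff, rD_mul' sR2.diff sB.diff, rD_mul' (rp_sm _ h0).diff sp0.diff,
    rD_mul' (rp_sm _ h0).diff sW.diff, rD_sub' srY.diff sYr'.diff,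
    rD_const_mul, rD_mul' hY.diff (rp_sm _ h0).diff, rD_sub' sT.diff (sc 2).diff,
    rD_add' (sc 1).diff sR.diff, rD_const, rD_const, rD_rp _ h0, rD_rp _ h0, rD_rp _ h0,
    rD_Lap h0 hu, Lap_congr E1, Lap_rp_mul _ h0 hY, E1.eq_of_nhds, Qz]
  have p1 : rp (-1) x = 1 / rr x := by rw [rp, Real.rpow_neg_one, one_div]
  have p2 : rp (-2) x = 1 / rr x ^ 2 := by
    rw [rp, Real.rpow_neg hr.le, Real.rpow_two, one_div]
  have p3 : rp (1 / 2) x = rp (3 / 2) x / rr x := by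
    rw [eq_div_iff hr.ne', show rr x = rp 1 x from (Real.rpow_one _).symm, rp_add _ _ h0]
    norm_num
  have p4 : rp (-(3 / 2)) x = 1 / rp (3 / 2) x := by
    rw [eq_div_iff (rp_pos _ h0).ne', hcan x h0]
  have hp := rp_pos (3 / 2) h0
  rw [p1, p2, p3, p4]
  generalize rp (3 / 2) x = q at *
  generalize rr x = r at *
  field_simp
  ring

/-- The equation for `Y = K Ũ`. -/
theorem commuted_equation {eta l : ℝ → E4} {τ : ℝ} {y : E4} {U F : Fld}
    (hreg : ∀ᶠ y' in 𝓝 y, Reg eta l (τ, y')) (hU : ∀ᶠ y' in 𝓝 y, Sm (uc U) (τ, y'))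
    (hF : ∀ᶠ y' in 𝓝 y, Pgraph eta l U τ y' = F τ y') :
    G1 eta F τ y + G2 eta l (rMul (3 / 2) U) τ y
      = opL (kk eta l) (bb eta l) (cc eta l) (uc (K (rMul (3 / 2) U))) (τ, y) := by
  have h := hreg.self_of_nhds
  have h0 := h.ne
  set Ut : Fld := rMul (3 / 2) U with hUt
  have hu : Sm (uc Ut) (τ, y) := rMul_sm h0 hU.self_of_nhds
  set u := uc Ut with hud
  have hu' : ∀ᶠ y' in 𝓝 y, Sm u (τ, y') := by
    filter_upwards [hreg, hU] with y' h1 h2 using rMul_sm h1.ne h2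
  have hKu : uc (K Ut) =ᶠ[𝓝 (τ, y)] fun z => rp (3 / 2) z * rD u z := by
    filter_upwards [dR_ev hu] with z hz
    rw [← hz]; rfl
  have hY : Sm (fun z => rp (3 / 2) z * rD u z) (τ, y) := (rp_sm _ h0).mul (rD_sm h0 hu)
  have hYu : Sm (uc (K Ut)) (τ, y) := hY.congr hKu
  have hopL : opL (kk eta l) (bb eta l) (cc eta l) (uc (K Ut)) (τ, y)
      = opL (kk eta l) (bb eta l) (cc eta l) (fun z => rp (3 / 2) z * rD u z) (τ, y) := by
    simp only [opL, L2, pd_congr' _ hKu, pd_congr' _ (pd_congr _ hKu), hKu.eq_of_nhds]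
  rw [hopL, ← commute_K h hu]
  have hER : errRest eta l (K Ut) τ y = ER eta l (fun z => rp (3 / 2) z * rD u z) (τ, y) := by
    rw [errRest_at (x := (τ, y)) h hYu]
    have e1 : (fun z => rp (-(3 / 2)) z * uc (K Ut) z)
        =ᶠ[𝓝 (τ, y)] fun z => rp (-(3 / 2)) z * (rp (3 / 2) z * rD u z) := by
      filter_upwards [hKu] with z hz; rw [hz]
    simp only [ER, PC, Qz, PP_congr e1, rD_congr' (pd_congr 0 hKu), rD_congr' (rD_congr hKu),
      Lap_congr hKu, hKu.eq_of_nhds]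
  have hRest : errRest eta l Ut τ =ᶠ[𝓝 y] fun y' => ER eta l u (τ, y') := by
    filter_upwards [hreg, hu'] with y' h1 h2 using errRest_at (x := (τ, y')) h1 h2
  set H : X5 → ℝ := fun z => Qz u z + cRT eta l z * rD (pd 0 u) z + cRR eta l z * rD (rD u) z
    with hH
  have hFt : (fun y' => ‖y'‖ ^ (3 / 2 : ℝ) * (1 - thetaDot eta τ y') * F τ y')
      =ᶠ[𝓝 y] fun y' => ER eta l u (τ, y') + H (τ, y') := by
    filter_upwards [hreg, hU, hF, hu'] with y' h1 h2 h3 h4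
    have e1 : 1 - thetaDot eta τ y' = mu eta (τ, y') := thetaDot_eq (x := (τ, y'))
    have e2 : Pgraph eta l U τ y' = PP eta l (uc U) (τ, y') := Pgraph_at (x := (τ, y')) h1 h2
    have e3 : (fun z => rp (-(3 / 2)) z * u z) =ᶠ[𝓝 (τ, y')] uc U := by
      filter_upwards [ev_ne h1.ne] with z hz
      have : u z = rp (3 / 2) z * uc U z := rfl
      rw [this, ← mul_assoc, rp_add _ _ hz]; norm_num [rp]
    rw [← h3, e1, e2, ← PP_congr e3, ER, hH]
    simp only [PC, rp, rr]
    ring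
  have sER := h.ER_sm hu
  have sH : Sm H (τ, y) := ((h.Qz_sm hu).add (h.cRT_sm.mul (rD_sm h0 (pd_sm 0 hu)))).add
    (h.cRR_sm.mul (rD_sm h0 (rD_sm h0 hu)))
  rw [G1, G2, hER]
  simp only [K, rMul]
  rw [dR_slice (f := fun τ y => ‖y‖ ^ (3 / 2 : ℝ) * (1 - thetaDot eta τ y) * F τ y)
    (g := fun z => ER eta l u z + H z) (Sm.diff (sER.add sH)) hFt, hFt.eq_of_nhds,
    dR_slice (f := errRest eta l Ut) sER.diff hRest, hRest.eq_of_nhds, rD_add' sER.diff sH.diff]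
  rw [show ‖y‖ ^ (3 / 2 : ℝ) = rp (3 / 2) (τ, y) from rfl,
    show ‖y‖ ^ (1 / 2 : ℝ) = rp (1 / 2) (τ, y) from rfl]
  rw [show Qz u (τ, y) + cRT eta l (τ, y) * rD (pd 0 u) (τ, y) + cRR eta l (τ, y) * rD (rD u) (τ, y)
    = H (τ, y) from rfl]
  ring

/-! ### Bounds for the modulation parameters as functions of `τ` -/

section calculus
variable {V : Type*} [NormedAddCommGroup V] [NormedSpace ℝ V]

lemma contDiffAt_derivV {F : ℝ → V} {τ : ℝ} (h : ContDiffAt ℝ ∞ F τ) :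
    ContDiffAt ℝ ∞ (deriv F) τ := by
  have : ContDiffAt ℝ ∞ (fderiv ℝ F) τ := h.fderiv_right (by simp)
  have h2 : deriv F = fun s => fderiv ℝ F s 1 := rfl
  rw [h2]
  exact this.clm_apply contDiffAt_const

lemma ev_differentiable {F : ℝ → V} {τ : ℝ} (h : ContDiffAt ℝ ∞ F τ) :
    ∀ᶠ s in 𝓝 τ, DifferentiableAt ℝ F s := by
  have h1 : ContDiffAt ℝ 1 F τ := contDiffAt_infty.1 h 1
  filter_upwards [h1.eventually (by simp)] with s hs using hs.differentiableAt (by simp)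

lemma deriv_comp_two {F : ℝ → V} {g : ℝ → ℝ} {τ : ℝ} (hF : ContDiffAt ℝ ∞ F (g τ))
    (hg : ContDiffAt ℝ ∞ g τ) :
    deriv (fun s => F (g s)) τ = deriv g τ • deriv F (g τ) ∧
    deriv (deriv fun s => F (g s)) τ
      = deriv (deriv g) τ • deriv F (g τ) + (deriv g τ) ^ 2 • deriv (deriv F) (g τ) := by
  have e : deriv (fun s => F (g s)) =ᶠ[𝓝 τ] fun s => deriv g s • deriv F (g s) := by
    filter_upwards [ev_differentiable hg, hg.continuousAt.eventually (ev_differentiable hF)]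
      with s h1 h2
    exact deriv.scomp s h2 h1
  refine ⟨e.eq_of_nhds, ?_⟩
  rw [e.deriv_eq]
  have h1 := ((contDiffAt_derivV hg).differentiableAt (by simp)).hasDerivAt
  have h2 := ((contDiffAt_derivV hF).differentiableAt (by simp)).hasDerivAt
  have h3 := (hg.differentiableAt (by simp)).hasDerivAt
  have h4 : HasDerivAt (fun s => deriv F (g s)) (deriv g τ • deriv (deriv F) (g τ)) τ :=
    h2.scomp τ h3
  rw [(h1.fun_smul h4).deriv, smul_smul, sq, add_comm]

lemma deriv_smul_two {f : ℝ → ℝ} {F : ℝ → V} {s : ℝ} (hf : ContDiffAt ℝ ∞ f s)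
    (hF : ContDiffAt ℝ ∞ F s) :
    deriv (fun s => f s • F s) s = f s • deriv F s + deriv f s • F s ∧
    deriv (deriv fun s => f s • F s) s = f s • deriv (deriv F) s + (2 * deriv f s) • deriv F s
      + deriv (deriv f) s • F s := by
  have e : deriv (fun s => f s • F s) =ᶠ[𝓝 s] fun s => f s • deriv F s + deriv f s • F s := by
    filter_upwards [ev_differentiable hf, ev_differentiable hF] with s h1 h2
    exact deriv_fun_smul h1 h2
  refine ⟨e.eq_of_nhds, ?_⟩
  rw [e.deriv_eq]
  have h1 := (hf.differentiableAt (by simp)).hasDerivAt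
  have h2 := (hF.differentiableAt (by simp)).hasDerivAt
  have h3 := ((contDiffAt_derivV hf).differentiableAt (by simp)).hasDerivAt
  have h4 := ((contDiffAt_derivV hF).differentiableAt (by simp)).hasDerivAt
  rw [((h1.fun_smul h4).fun_add (h3.fun_smul h2)).deriv, two_mul, add_smul]
  abel

lemma deriv_eq_of_eqOn_Icc {f g : ℝ → ℝ} {a b τ : ℝ} (hab : a < b) (h : EqOn f g (Icc a b))
    (hτ : τ ∈ Icc a b) (hf : DifferentiableAt ℝ f τ) (hg : DifferentiableAt ℝ g τ) :
    deriv f τ = deriv g τ := by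
  have hu := uniqueDiffOn_Icc hab τ hτ
  rw [← hf.derivWithin hu, ← hg.derivWithin hu]
  exact derivWithin_congr h (h hτ)

end calculus

section lorentz
variable {ell : ℝ → E4} {s : ℝ}

lemma lorentz_comp_contDiffAt (h : ContDiffAt ℝ ∞ ell s) (hl : ‖ell s‖ < 1) :
    ContDiffAt ℝ ∞ (fun t => lorentz (ell t)) s := by
  have h1 : 0 < 1 - ‖ell s‖ ^ 2 := by nlinarith [norm_nonneg (ell s)]
  exact contDiffAt_const.div ((contDiffAt_const.sub (h.norm_sq ℝ)).sqrt h1.ne')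
    (Real.sqrt_pos.2 h1).ne'

lemma lorentz_comp_hasDerivAt (h : DifferentiableAt ℝ ell s) (hl : ‖ell s‖ < 1) :
    HasDerivAt (fun t => lorentz (ell t))
      (lorentz (ell s) ^ 3 * inner ℝ (ell s) (deriv ell s)) s := by
  have h1 : 0 < 1 - ‖ell s‖ ^ 2 := by nlinarith [norm_nonneg (ell s)]
  have hs := Real.sqrt_pos.2 h1
  have := ((h.hasDerivAt.norm_sq.const_sub 1).sqrt h1.ne').fun_inv hs.ne'
  simp only [lorentz, one_div]
  refine this.congr_deriv ?_
  field_simp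

lemma lorentz_comp_deriv_two (h : ContDiffAt ℝ ∞ ell s) (hl : ‖ell s‖ < 1) :
    deriv (fun t => lorentz (ell t)) s = lorentz (ell s) ^ 3 * inner ℝ (ell s) (deriv ell s) ∧
    deriv (deriv fun t => lorentz (ell t)) s
      = 3 * lorentz (ell s) ^ 5 * inner ℝ (ell s) (deriv ell s) ^ 2
        + lorentz (ell s) ^ 3 * (inner ℝ (ell s) (deriv (deriv ell) s)
          + inner ℝ (deriv ell s) (deriv ell s)) := by
  have e : deriv (fun t => lorentz (ell t)) =ᶠ[𝓝 s]
      fun t => lorentz (ell t) ^ 3 * inner ℝ (ell t) (deriv ell t) := by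
    filter_upwards [ev_differentiable h, h.continuousAt.norm.eventually (gt_mem_nhds hl)]
      with t h1 h2 using (lorentz_comp_hasDerivAt h1 h2).deriv
  refine ⟨e.eq_of_nhds, ?_⟩
  rw [e.deriv_eq]
  have h1 := (lorentz_comp_hasDerivAt (h.differentiableAt (by simp)) hl).fun_pow 3
  have h2 := (h.differentiableAt (by simp)).hasDerivAt.inner ℝ
    ((contDiffAt_derivV h).differentiableAt (by simp)).hasDerivAt
  rw [(h1.fun_mul h2).deriv]
  push_cast; ring

lemma lorentz_bounds {v : E4} (hv : ‖v‖ ≤ 1 / 2) : 0 < lorentz v ∧ lorentz v ≤ 2 := by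
  have h1 : (1 / 2) ^ 2 ≤ 1 - ‖v‖ ^ 2 := by nlinarith [norm_nonneg v]
  have h2 : 1 / 2 ≤ Real.sqrt (1 - ‖v‖ ^ 2) := Real.le_sqrt_of_sq_le h1
  have h3 : 0 < Real.sqrt (1 - ‖v‖ ^ 2) := by linarith
  refine ⟨by unfold lorentz; positivity, ?_⟩
  rw [lorentz, div_le_iff₀ h3]; linarith

/-- Size of the Lorentz factor and of its derivatives along a small velocity. -/
lemma lorentz_deriv_le {b : ℝ} (hb : b ≤ 1 / 2) (h : ContDiffAt ℝ ∞ ell s) (h0 : ‖ell s‖ ≤ b)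
    (h1 : ‖deriv ell s‖ ≤ b) (h2 : ‖deriv (deriv ell) s‖ ≤ b) :
    |deriv (fun t => lorentz (ell t)) s| ≤ 8 * b ^ 2 ∧
    |deriv (deriv fun t => lorentz (ell t)) s| ≤ 112 * b ^ 2 := by
  have hb0 : 0 ≤ b := (norm_nonneg _).trans h0
  obtain ⟨hg, hg2⟩ := lorentz_bounds (h0.trans hb)
  obtain ⟨e1, e2⟩ := lorentz_comp_deriv_two h (h0.trans_lt (by linarith))
  have i1 : |(inner ℝ (ell s) (deriv ell s) : ℝ)| ≤ b ^ 2 := by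
    refine (abs_real_inner_le_norm _ _).trans ?_
    rw [sq]; gcongr
  have i2 : |(inner ℝ (ell s) (deriv (deriv ell) s) : ℝ)| ≤ b ^ 2 := by
    refine (abs_real_inner_le_norm _ _).trans ?_
    rw [sq]; gcongr
  have i3 : |(inner ℝ (deriv ell s) (deriv ell s) : ℝ)| ≤ b ^ 2 := by
    refine (abs_real_inner_le_norm _ _).trans ?_
    rw [sq]; gcongr
  have g3 : lorentz (ell s) ^ 3 ≤ 8 := by
    calc lorentz (ell s) ^ 3 ≤ 2 ^ 3 := pow_le_pow_left₀ hg.le hg2 3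
      _ = 8 := by norm_num
  have g5 : lorentz (ell s) ^ 5 ≤ 32 := by
    calc lorentz (ell s) ^ 5 ≤ 2 ^ 5 := pow_le_pow_left₀ hg.le hg2 5
      _ = 32 := by norm_num
  rw [e1, e2]
  generalize lorentz (ell s) = g at *
  generalize (inner ℝ (ell s) (deriv ell s) : ℝ) = p at *
  generalize (inner ℝ (ell s) (deriv (deriv ell) s) : ℝ) = q at *
  generalize (inner ℝ (deriv ell s) (deriv ell s) : ℝ) = t at *
  constructor
  · rw [abs_mul, abs_of_pos (by positivity : (0 : ℝ) < g ^ 3)]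
    gcongr
  · have hp2 : p ^ 2 ≤ b ^ 2 := by
      rw [← sq_abs]
      calc |p| ^ 2 ≤ (b ^ 2) ^ 2 := pow_le_pow_left₀ (abs_nonneg _) i1 2
        _ ≤ b ^ 2 * 1 := by
          rw [sq (b ^ 2)]; gcongr; nlinarith
        _ = b ^ 2 := mul_one _
    calc |3 * g ^ 5 * p ^ 2 + g ^ 3 * (q + t)| ≤ |3 * g ^ 5 * p ^ 2| + |g ^ 3 * (q + t)| :=
          abs_add_le _ _
      _ ≤ 3 * 32 * b ^ 2 + 8 * (b ^ 2 + b ^ 2) := by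
        rw [abs_mul, abs_mul (g ^ 3), abs_of_nonneg (by positivity : 0 ≤ 3 * g ^ 5),
          abs_of_nonneg (sq_nonneg p), abs_of_pos (by positivity : (0 : ℝ) < g ^ 3)]
        have := abs_add_le q t
        gcongr
        linarith
      _ = 112 * b ^ 2 := by ring
end lorentz

/-- Uniform bounds for the parameters in the variable `σ`. -/
lemma smallParams_bounds {Rf kap Lam : ℝ} (hRf : 0 < Rf) (hkap : kap < 5 / 4) {Cb : ℕ → ℝ} {ε sf : ℝ}
    (hε : 0 < ε) (hε1 : ε ≤ 1) {xi ell : ℝ → E4} (h : SmallParams Rf kap Lam Cb ε sf xi ell) :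
    ∀ s ∈ Icc 0 sf, let b := (1 + |Lam| + 2 * (|Cb 0| + |Cb 1|) * (1 + Rf⁻¹)) * ε
      ‖ell s‖ ≤ b ∧ ‖deriv ell s‖ ≤ b ∧ ‖deriv (deriv ell) s‖ ≤ b ∧
      ‖deriv xi s‖ ≤ 2 * b ∧ ‖deriv (deriv xi) s‖ ≤ 2 * b := by
  intro s hs b
  have hRi : 0 < Rf⁻¹ := inv_pos.2 hRf
  have hfac : ∀ k : ℕ, 2 * Cb k * (Real.sqrt ε + Rf⁻¹) * ε * (jap s) ^ (-(9 / 4) + kap)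
      ≤ 2 * |Cb k| * (1 + Rf⁻¹) * ε := by
    intro k
    have h1 : (jap s) ^ (-(9 / 4) + kap) ≤ 1 :=
      Real.rpow_le_one_of_one_le_of_nonpos (Real.one_le_sqrt.2 (by nlinarith [sq_nonneg s]))
        (by linarith)
    have h0 : 0 ≤ (jap s) ^ (-(9 / 4) + kap) := Real.rpow_nonneg (jap_pos s).le _
    have h2 : Real.sqrt ε ≤ 1 := Real.sqrt_le_one.2 hε1
    calc _ ≤ 2 * |Cb k| * (Real.sqrt ε + Rf⁻¹) * ε * (jap s) ^ (-(9 / 4) + kap) := by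
          gcongr; exact le_abs_self _
      _ ≤ 2 * |Cb k| * (1 + Rf⁻¹) * ε * 1 := by gcongr
      _ = _ := mul_one _
  have hk0 : 2 * |Cb 0| * (1 + Rf⁻¹) * ε ≤ b := by
    simp only [b]
    rw [show 2 * |Cb 0| * (1 + Rf⁻¹) = 0 + 2 * (|Cb 0| + 0) * (1 + Rf⁻¹) by ring]
    gcongr <;> positivity
  have hk1 : 2 * |Cb 1| * (1 + Rf⁻¹) * ε ≤ b := by
    simp only [b]
    rw [show 2 * |Cb 1| * (1 + Rf⁻¹) = 0 + 2 * (0 + |Cb 1|) * (1 + Rf⁻¹) by ring]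
    gcongr <;> positivity
  have hl : ‖ell s‖ ≤ b := by
    refine (h.small s hs).trans ?_
    simp only [b]
    gcongr
    have : 0 ≤ 2 * (|Cb 0| + |Cb 1|) * (1 + Rf⁻¹) := by positivity
    linarith [le_abs_self Lam]
  have hl1 : ‖deriv ell s‖ ≤ b := by
    simpa using ((h.boot_ell 0 s hs).trans (hfac 0)).trans hk0
  have hl2 : ‖deriv (deriv ell) s‖ ≤ b := by
    simpa using ((h.boot_ell 1 s hs).trans (hfac 1)).trans hk1
  have hx1 : ‖deriv xi s - ell s‖ ≤ b := by
    simpa using ((h.boot_xi 0 s hs).trans (hfac 0)).trans hk0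
  have hdx : DifferentiableAt ℝ (deriv xi) s :=
    (contDiffAt_derivV h.smooth_xi.contDiffAt).differentiableAt (by simp)
  have hdl : DifferentiableAt ℝ ell s := h.smooth_ell.contDiffAt.differentiableAt (by simp)
  have hx2 : ‖deriv (deriv xi) s - deriv ell s‖ ≤ b := by
    have := ((h.boot_xi 1 s hs).trans (hfac 1)).trans hk1
    rw [iteratedDeriv_one, deriv_fun_sub hdx hdl] at this
    exact this
  refine ⟨hl, hl1, hl2, ?_, ?_⟩
  · have := norm_add_le (deriv xi s - ell s) (ell s)
    rw [sub_add_cancel] at this; linarith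
  · have := norm_add_le (deriv (deriv xi) s - deriv ell s) (deriv ell s)
    rw [sub_add_cancel] at this; linarith

/-- Bounds for the first two derivatives `p`, `q` of an inverse function, from its defining
equations. -/
lemma time_change_bounds {p q g k : ℝ} (c1 : 1 = p * (1 - g))
    (c2 : 0 = q * (1 - g) + p ^ 2 * -k) (hg : |g| ≤ 1 / 2) (hk : |k| ≤ 7) :
    |p| ≤ 2 ∧ p ^ 2 ≤ 4 ∧ |q| ≤ 56 := by
  have hden : 1 / 2 ≤ 1 - g := by linarith [(abs_le.1 hg).2]
  have hd : |1 - g| = 1 - g := abs_of_pos (by linarith)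
  have hp : |p| ≤ 2 := by
    have h1 : |p| * (1 - g) = 1 := by rw [← hd, ← abs_mul, ← c1, abs_one]
    have h2 := mul_le_mul_of_nonneg_left hden (abs_nonneg p)
    linarith
  have hp2 : p ^ 2 ≤ 4 := by
    rw [← sq_abs]
    calc |p| ^ 2 ≤ 2 ^ 2 := pow_le_pow_left₀ (abs_nonneg _) hp 2
      _ = 4 := by norm_num
  refine ⟨hp, hp2, ?_⟩
  have e : q * (1 - g) = p ^ 2 * k := by linarith
  have h1 : |q| * (1 - g) = p ^ 2 * |k| := by
    rw [← hd, ← abs_mul, e, abs_mul, abs_of_nonneg (sq_nonneg p)]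
  have h2 : p ^ 2 * |k| ≤ 4 * 7 := by gcongr
  have h3 := mul_le_mul_of_nonneg_left hden (abs_nonneg q)
  linarith

/-- First two derivatives of the inverse of the time change `τ = σ - γ R_f`. -/
lemma timeChange_deriv_le {Rf sf b τ₁ τ₂ : ℝ} {ell : ℝ → E4} {sig : ℝ → ℝ} (hRf : 0 < Rf)
    (h12 : τ₁ < τ₂) (hell : ContDiff ℝ ∞ ell) (hT : IsTimeChange Rf sf ell τ₁ τ₂ sig)
    (hb0 : 0 ≤ b) (hb4 : b ≤ 1 / 4) (hbR : Rf * b ≤ 1 / 16)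
    (hbd : ∀ s ∈ Icc 0 sf, ‖ell s‖ ≤ b ∧ ‖deriv ell s‖ ≤ b ∧ ‖deriv (deriv ell) s‖ ≤ b)
    {τ : ℝ} (hτ : τ ∈ Icc τ₁ τ₂) :
    |deriv sig τ| ≤ 2 ∧ deriv sig τ ^ 2 ≤ 4 ∧ |deriv (deriv sig) τ| ≤ 56 := by
  have hb2 : b ^ 2 ≤ b := by nlinarith
  obtain ⟨γ, hγ⟩ : ∃ γ : ℝ → ℝ, γ = fun t => lorentz (ell t) := ⟨_, rfl⟩
  obtain ⟨φ, hφ⟩ : ∃ φ : ℝ → ℝ, φ = fun t => t - γ t * Rf := ⟨_, rfl⟩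
  have hγs : ∀ s ∈ Icc 0 sf, ContDiffAt ℝ ∞ γ s := fun s hs => by
    rw [hγ]
    exact lorentz_comp_contDiffAt hell.contDiffAt ((hbd s hs).1.trans_lt (by linarith))
  have hφs : ∀ s ∈ Icc 0 sf, ContDiffAt ℝ ∞ φ s := fun s hs => by
    rw [hφ]; exact contDiffAt_id.sub ((hγs s hs).mul contDiffAt_const)
  have hφ1 : ∀ s ∈ Icc 0 sf, deriv φ s = 1 - deriv γ s * Rf ∧
      deriv (deriv φ) s = -(deriv (deriv γ) s * Rf) := by
    intro s hs
    have e : deriv φ =ᶠ[𝓝 s] fun t => 1 - deriv γ t * Rf := by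
      filter_upwards [ev_differentiable (hγs s hs)] with t ht
      rw [hφ]
      exact ((hasDerivAt_id t).fun_sub (ht.hasDerivAt.mul_const Rf)).deriv
    refine ⟨e.eq_of_nhds, ?_⟩
    rw [e.deriv_eq]
    have := ((contDiffAt_derivV (hγs s hs)).differentiableAt (by simp)).hasDerivAt
    exact ((this.mul_const Rf).const_sub 1).deriv
  have hcomp : ∀ τ ∈ Icc τ₁ τ₂, ContDiffAt ℝ ∞ (fun s => φ (sig s)) τ := fun τ hτ =>
    ContDiffAt.comp (g := φ) (f := sig) τ (hφs _ (hT.mem τ hτ)) hT.smooth.contDiffAt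
  have hone : ∀ τ ∈ Icc τ₁ τ₂, deriv (fun s => φ (sig s)) τ = 1 := fun τ hτ => by
    rw [deriv_eq_of_eqOn_Icc h12 (g := id) (fun t ht => by
        rw [hφ, hγ]; exact hT.eq t ht) hτ
      ((hcomp τ hτ).differentiableAt (by simp)) differentiableAt_id, deriv_id]
  have hzero : deriv (deriv fun s => φ (sig s)) τ = 0 := by
    rw [deriv_eq_of_eqOn_Icc h12 (g := fun _ => 1) (fun t ht => hone t ht) hτ
      ((contDiffAt_derivV (hcomp τ hτ)).differentiableAt (by simp)) (differentiableAt_const _),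
      deriv_const]
  have hσ := hT.mem τ hτ
  obtain ⟨c1, c2⟩ := deriv_comp_two (hφs _ hσ) (hT.smooth.contDiffAt (x := τ))
  rw [hone τ hτ, smul_eq_mul, (hφ1 _ hσ).1] at c1
  rw [hzero, smul_eq_mul, smul_eq_mul, (hφ1 _ hσ).1, (hφ1 _ hσ).2] at c2
  obtain ⟨g1, g2⟩ : |deriv γ (sig τ)| ≤ 8 * b ^ 2 ∧ |deriv (deriv γ) (sig τ)| ≤ 112 * b ^ 2 := by
    rw [hγ]
    exact lorentz_deriv_le (by linarith) hell.contDiffAt (hbd _ hσ).1 (hbd _ hσ).2.1 (hbd _ hσ).2.2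
  refine time_change_bounds c1 c2 ?_ ?_
  · rw [abs_mul, abs_of_pos hRf]
    calc |deriv γ (sig τ)| * Rf ≤ 8 * b ^ 2 * Rf := by gcongr
      _ ≤ 8 * b * Rf := by gcongr
      _ ≤ 1 / 2 := by linarith
  · rw [abs_mul, abs_of_pos hRf]
    calc |deriv (deriv γ) (sig τ)| * Rf ≤ 112 * b ^ 2 * Rf := by gcongr
      _ ≤ 112 * b * Rf := by gcongr
      _ ≤ 7 := by linarith

/-- Smoothness and first two derivatives of `ξ - γ R_f ℓ`, as a function of `σ`. -/
lemma centre_deriv_le {Rf b s : ℝ} {xi ell : ℝ → E4} (hRf : 0 < Rf) (hxi : ContDiffAt ℝ ∞ xi s)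
    (hell : ContDiffAt ℝ ∞ ell s) (hb4 : b ≤ 1 / 4) (l0 : ‖ell s‖ ≤ b) (l1 : ‖deriv ell s‖ ≤ b)
    (l2 : ‖deriv (deriv ell) s‖ ≤ b) (x1 : ‖deriv xi s‖ ≤ 2 * b)
    (x2 : ‖deriv (deriv xi) s‖ ≤ 2 * b) :
    ContDiffAt ℝ ∞ (fun t => xi t - (lorentz (ell t) * Rf) • ell t) s ∧
    ‖deriv (fun t => xi t - (lorentz (ell t) * Rf) • ell t) s‖ ≤ (2 + 130 * Rf) * b ∧
    ‖deriv (deriv fun t => xi t - (lorentz (ell t) * Rf) • ell t) s‖ ≤ (2 + 130 * Rf) * b := by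
  have hb0 : 0 ≤ b := (norm_nonneg _).trans l0
  have hb1 : b ^ 2 ≤ 1 := by nlinarith
  obtain ⟨gp, gb⟩ := lorentz_bounds (l0.trans (by linarith : b ≤ 1 / 2))
  have sγ := lorentz_comp_contDiffAt hell (l0.trans_lt (by linarith))
  obtain ⟨g1, g2⟩ := lorentz_deriv_le (by linarith) hell l0 l1 l2
  have gb' : |lorentz (ell s)| ≤ 2 := by rw [abs_of_pos gp]; exact gb
  obtain ⟨γ, hγ⟩ : ∃ γ : ℝ → ℝ, γ = fun t => lorentz (ell t) := ⟨_, rfl⟩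
  rw [← hγ] at sγ g1 g2
  have gb'' : |γ s| ≤ 2 := by rw [hγ]; exact gb'
  have sRγ : ContDiffAt ℝ ∞ (fun t => γ t * Rf) s := sγ.mul contDiffAt_const
  have sg : ContDiffAt ℝ ∞ (fun t => (γ t * Rf) • ell t) s := sRγ.smul hell
  obtain ⟨p1, p2⟩ := deriv_smul_two sRγ hell
  have r1 : deriv (fun t => γ t * Rf) =ᶠ[𝓝 s] fun t => deriv γ t * Rf := by
    filter_upwards [ev_differentiable sγ] with t ht using deriv_mul_const ht Rf
  have r2 : deriv (deriv fun t => γ t * Rf) s = deriv (deriv γ) s * Rf := by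
    rw [r1.deriv_eq, deriv_mul_const ((contDiffAt_derivV sγ).differentiableAt (by simp))]
  have q1 : ‖deriv (fun t => (γ t * Rf) • ell t) s‖ ≤ 130 * Rf * b := by
    rw [p1, r1.eq_of_nhds]
    refine (norm_add_le _ _).trans ?_
    rw [norm_smul, norm_smul, Real.norm_eq_abs, Real.norm_eq_abs, abs_mul, abs_mul, abs_of_pos hRf]
    calc _ ≤ 2 * Rf * b + 8 * b ^ 2 * Rf * b := by gcongr
      _ ≤ 2 * Rf * b + 8 * 1 * Rf * b := by gcongr
      _ ≤ 130 * Rf * b := by linarith [mul_nonneg hRf.le hb0]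
  have q2 : ‖deriv (deriv fun t => (γ t * Rf) • ell t) s‖ ≤ 130 * Rf * b := by
    rw [p2, r1.eq_of_nhds, r2]
    refine (norm_add₃_le).trans ?_
    rw [norm_smul, norm_smul, norm_smul, Real.norm_eq_abs, Real.norm_eq_abs, Real.norm_eq_abs,
      abs_mul, abs_mul, abs_mul, abs_mul, abs_of_pos hRf, abs_two]
    calc _ ≤ 2 * Rf * b + 2 * (8 * b ^ 2 * Rf) * b + 112 * b ^ 2 * Rf * b := by gcongr
      _ ≤ 2 * Rf * b + 2 * (8 * 1 * Rf) * b + 112 * 1 * Rf * b := by gcongr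
      _ = 130 * Rf * b := by ring
  have z1 : deriv (fun t => xi t - (γ t * Rf) • ell t)
      =ᶠ[𝓝 s] fun t => deriv xi t - deriv (fun t => (γ t * Rf) • ell t) t := by
    filter_upwards [ev_differentiable hxi, ev_differentiable sg] with t h1 h2
    exact deriv_fun_sub h1 h2
  have e : (fun t => xi t - (lorentz (ell t) * Rf) • ell t)
      = fun t => xi t - (γ t * Rf) • ell t := by rw [hγ]
  rw [e]
  refine ⟨hxi.sub sg, ?_, ?_⟩
  · rw [z1.eq_of_nhds]
    refine (norm_sub_le _ _).trans ?_
    linarith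
  · rw [z1.deriv_eq, deriv_fun_sub ((contDiffAt_derivV hxi).differentiableAt (by simp))
      ((contDiffAt_derivV sg).differentiableAt (by simp))]
    refine (norm_sub_le _ _).trans ?_
    linarith

/-- Parameters of size `O(ε)` on the leaves `τ₁ ≤ τ ≤ τ₂`. -/
theorem exists_param_bounds {Rf kap : ℝ} (hRf : 0 < Rf) (hkap : kap < 5 / 4) (Lam : ℝ)
    (Cb : ℕ → ℝ) : ∃ D ε₀ : ℝ, 1 ≤ D ∧ 0 < ε₀ ∧ ∀ ε : ℝ, 0 < ε → ε < ε₀ →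
    ∀ (xi ell : ℝ → E4) (sf τ₁ τ₂ : ℝ) (sig : ℝ → ℝ), τ₁ < τ₂ →
    SmallParams Rf kap Lam Cb ε sf xi ell → IsTimeChange Rf sf ell τ₁ τ₂ sig →
    ∀ τ ∈ Icc τ₁ τ₂, ContDiffAt ℝ ∞ (centre Rf xi ell sig) τ ∧
      ContDiffAt ℝ ∞ (fun s => ell (sig s)) τ ∧ ‖ell (sig τ)‖ ≤ D * ε ∧
      ‖deriv (fun s => ell (sig s)) τ‖ ≤ D * ε ∧ ‖deriv (deriv fun s => ell (sig s)) τ‖ ≤ D * ε ∧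
      ‖deriv (centre Rf xi ell sig) τ‖ ≤ D * ε ∧
      ‖deriv (deriv (centre Rf xi ell sig)) τ‖ ≤ D * ε := by
  obtain ⟨B, hB⟩ : ∃ B, B = 1 + |Lam| + 2 * (|Cb 0| + |Cb 1|) * (1 + Rf⁻¹) := ⟨_, rfl⟩
  have hB1 : 1 ≤ B := by
    have : 0 ≤ |Lam| + 2 * (|Cb 0| + |Cb 1|) * (1 + Rf⁻¹) := by positivity
    linarith
  refine ⟨60 * (2 + 130 * Rf) * B, 1 / (B * (4 + 16 * Rf)), by nlinarith, by positivity, ?_⟩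
  intro ε hε hε0 xi ell sf τ₁ τ₂ sig h12 hS hT τ hτ
  rw [lt_div_iff₀ (by positivity)] at hε0
  have hBε : ε ≤ B * ε := by nlinarith
  have hB0 : 0 < B * ε := by positivity
  have hb' : B * ε * 4 + 16 * (Rf * (B * ε)) < 1 := by linarith
  have hRb : 0 < Rf * (B * ε) := by positivity
  have hbd := smallParams_bounds hRf hkap hε (by linarith : ε ≤ 1) hS
  simp only [← hB] at hbd
  obtain ⟨b, hb⟩ : ∃ b, b = B * ε := ⟨_, rfl⟩
  rw [← hb] at hbd hb' hB0 hRb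
  have hD : 60 * (2 + 130 * Rf) * B * ε = 60 * ((2 + 130 * Rf) * b) := by rw [hb]; ring
  rw [hD]
  have hbb : 60 * b ≤ 60 * ((2 + 130 * Rf) * b) := by linarith
  obtain ⟨hp, hp2, hq⟩ := timeChange_deriv_le hRf h12 hS.smooth_ell hT hB0.le (by linarith)
    (by linarith) (fun s hs => ⟨(hbd s hs).1, (hbd s hs).2.1, (hbd s hs).2.2.1⟩) hτ
  have hsig : ContDiffAt ℝ ∞ sig τ := hT.smooth.contDiffAt
  have key : ∀ (F : ℝ → E4) (A : ℝ), ContDiffAt ℝ ∞ F (sig τ) → ‖deriv F (sig τ)‖ ≤ A →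
      ‖deriv (deriv F) (sig τ)‖ ≤ A → ContDiffAt ℝ ∞ (fun s => F (sig s)) τ ∧
      ‖deriv (fun s => F (sig s)) τ‖ ≤ 60 * A ∧
      ‖deriv (deriv fun s => F (sig s)) τ‖ ≤ 60 * A := by
    intro F A hF h1 h2
    have hA : 0 ≤ A := (norm_nonneg _).trans h1
    obtain ⟨d1, d2⟩ := deriv_comp_two hF hsig
    rw [d1, d2]
    refine ⟨ContDiffAt.comp (g := F) (f := sig) τ hF hsig, ?_, ?_⟩
    · rw [norm_smul, Real.norm_eq_abs]
      calc |deriv sig τ| * ‖deriv F (sig τ)‖ ≤ 2 * A := by gcongr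
        _ ≤ 60 * A := by linarith
    · refine (norm_add_le _ _).trans ?_
      rw [norm_smul, norm_smul, Real.norm_eq_abs, Real.norm_eq_abs, abs_of_nonneg (sq_nonneg (deriv sig τ))]
      calc _ ≤ 56 * A + 4 * A := by gcongr
        _ = 60 * A := by ring
  obtain ⟨l0, l1, l2, x1, x2⟩ := hbd _ (hT.mem τ hτ)
  obtain ⟨z0, z1, z2⟩ := centre_deriv_le hRf hS.smooth_xi.contDiffAt hS.smooth_ell.contDiffAt
    (by linarith) l0 l1 l2 x1 x2
  obtain ⟨k0, k1, k2⟩ := key ell b hS.smooth_ell.contDiffAt l1 l2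
  obtain ⟨k3, k4, k5⟩ := key _ _ z0 z1 z2
  exact ⟨k3, k0, by linarith, k1.trans hbb, k2.trans hbb, k4, k5⟩

/-! ### Control of the jet of `Y = K Ũ` by lower-order quantities -/

/-- `|∇̸ f|²` through the rotation fields on `ℝ × ℝ⁴`. -/
def ang5 (f : X5 → ℝ) : X5 → ℝ := fun x =>
  ∑ i : Fin 4, ∑ j ∈ Finset.Ioi i, rot5 i j f x ^ 2

lemma ang5_nonneg (f : X5 → ℝ) (x : X5) : 0 ≤ ang5 f x :=
  Finset.sum_nonneg fun _ _ => Finset.sum_nonneg fun _ _ => sq_nonneg _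

lemma sum_pairs {M : Type*} [AddCommMonoid M] (g : Fin 4 → Fin 4 → M) :
    ∑ i : Fin 4, ∑ j ∈ Finset.Ioi i, g i j
      = g 0 1 + (g 0 2 + (g 0 3 + (g 1 2 + (g 1 3 + g 2 3)))) := by
  have h0 : Finset.Ioi (0 : Fin 4) = {1, 2, 3} := by decide
  have h1 : Finset.Ioi (1 : Fin 4) = {2, 3} := by decide
  have h2 : Finset.Ioi (2 : Fin 4) = {3} := by decide
  have h3 : Finset.Ioi (3 : Fin 4) = ∅ := by decide
  rw [Fin.sum_univ_four, h0, h1, h2, h3, Finset.sum_insert (by decide),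
    Finset.sum_insert (by decide), Finset.sum_insert (by decide)]
  simp only [Finset.sum_singleton, Finset.sum_empty, add_zero, add_assoc]

lemma ya_eq (f : X5 → ℝ) (x : X5) : ya f x = rD f x := by
  rw [ya, rho, rD, Finset.sum_div]
  exact Finset.sum_congr rfl fun j _ => by ring

/-- Lagrange's identity. -/
lemma gsq_sub_ya {f : X5 → ℝ} {x : X5} (h : x.2 ≠ 0) :
    gsq f x - ya f x ^ 2 = ang5 f x / rr x ^ 2 := by
  have hr := (rr_pos h).ne'
  have h2 : rr x ^ 2 * gsq f x - rho f x ^ 2 = ang5 f x := by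
    rw [rr_sq, gsq, rho, ang5, sum_pairs fun i j => rot5 i j f x ^ 2]
    simp only [rot5, Fin.sum_univ_four]
    ring
  rw [← h2, ya]; field_simp

lemma angSq_at {f : Fld} {x : X5} (h : DifferentiableAt ℝ (uc f) x) :
    angSq f x.1 x.2 = ang5 (uc f) x := by
  refine Finset.sum_congr rfl fun i _ => Finset.sum_congr rfl fun j _ => ?_
  rw [rot_at h]

/-- Sum of the squares of the radial derivatives of the functions `Ũ_k`, `|k| ≤ 1`. -/
def lowN (f : Fld) : Fld := fun τ y =>
  dR f τ y ^ 2 + dR (dT f) τ y ^ 2 + dR (rMul 1 (dR f)) τ y ^ 2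
    + ∑ i : Fin 4, ∑ j ∈ Finset.Ioi i, dR (rot i j f) τ y ^ 2

/-- The squares of the jet of a function with weights. -/
def jetL (f : X5 → ℝ) : X5 → ℝ := fun x =>
  rr x ^ 2 * rD f x ^ 2 + f x ^ 2 + ang5 f x + pd 0 f x ^ 2

lemma K_ev {f : Fld} {x : X5} (hf : Sm (uc f) x) :
    uc (K f) =ᶠ[𝓝 x] fun z => rp (3 / 2) z * rD (uc f) z := by
  filter_upwards [dR_ev hf] with z hz
  change rp (3 / 2) z * uc (dR f) z = _
  rw [hz]

lemma K_sm {f : Fld} {x : X5} (h : x.2 ≠ 0) (hf : Sm (uc f) x) : Sm (uc (K f)) x :=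
  Sm.congr ((rp_sm _ h).mul (rD_sm h hf)) (K_ev hf)

lemma rp_three_half_sq {x : X5} : rp (3 / 2) x ^ 2 = rr x ^ 3 := by
  have h0 : 0 ≤ rr x := norm_nonneg _
  rw [rp, ← Real.rpow_natCast, ← Real.rpow_mul h0, ← Real.rpow_natCast]; norm_num

/-- Since `∂_r` commutes with `∂_τ` and the rotations, the whole jet of `Y = r^{3/2} ∂_r Ũ` is
made of radial derivatives of the `Ũ_k`. -/
lemma jetL_le {f : Fld} {x : X5} (h : x.2 ≠ 0) (hf : Sm (uc f) x) :
    jetL (uc (K f)) x ≤ 3 * (rr x ^ 3 * lowN f x.1 x.2) := by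
  have hr := rr_pos h
  have hK := K_ev hf
  have hg := rD_sm h hf
  have hp := rp_sm (3 / 2) h
  have hP := rp_three_half_sq (x := x)
  have e0 : uc (K f) x ^ 2 = rr x ^ 3 * dR f x.1 x.2 ^ 2 := by
    rw [hK.eq_of_nhds, mul_pow, hP, dR_at hf.diff]
  have eT : pd 0 (uc (K f)) x ^ 2 = rr x ^ 3 * dR (dT f) x.1 x.2 ^ 2 := by
    rw [pd_congr' _ hK, pd_mul _ hp hg, pd_rp _ h, dR_dT_at hf, (rD_pd_zero_ev h hf).eq_of_nhds]
    simp only [Fin.cases_zero]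
    rw [← hP]; ring
  have eO : ang5 (uc (K f)) x
      = rr x ^ 3 * ∑ i : Fin 4, ∑ j ∈ Finset.Ioi i, dR (rot i j f) x.1 x.2 ^ 2 := by
    rw [ang5, Finset.mul_sum]
    refine Finset.sum_congr rfl fun i _ => ?_
    rw [Finset.mul_sum]
    refine Finset.sum_congr rfl fun j _ => ?_
    have e : dR (rot i j f) x.1 x.2 = rD (rot5 i j (uc f)) x :=
      (uc_congr_dR (rot5_sm i j hf) (rot_ev hf i j)).eq_of_nhds
    rw [(rot5_congr i j hK).eq_of_nhds, (rot5_rp_mul_ev _ i j h hg).eq_of_nhds, mul_pow, hP, e,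
      (rD_rot5_ev i j h hf).eq_of_nhds]
  have e1 : uc (rMul 1 (dR f)) =ᶠ[𝓝 x] fun z => rp 1 z * rD (uc f) z := by
    filter_upwards [dR_ev hf] with z hz
    change rp 1 z * uc (dR f) z = _
    rw [hz]
  have eR1 : dR (rMul 1 (dR f)) x.1 x.2 = rD (uc f) x + rr x * rD (rD (uc f)) x := by
    have := (uc_congr_dR ((rp_sm 1 h).mul hg) e1).eq_of_nhds
    refine this.trans ?_
    rw [rD_mul' (rp_sm 1 h).diff hg.diff, rD_rp _ h]
    simp only [rp, Real.rpow_one]; field_simp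
  have eR : rr x ^ 2 * rD (uc (K f)) x ^ 2
      = rr x ^ 3 * (1 / 2 * dR f x.1 x.2 + dR (rMul 1 (dR f)) x.1 x.2) ^ 2 := by
    rw [rD_congr' hK, rD_mul' hp.diff hg.diff, rD_rp _ h, eR1, dR_at hf.diff, ← hP]
    field_simp; ring
  rw [jetL, e0, eT, eO, eR, lowN]
  have h3 : 0 ≤ rr x ^ 3 := by positivity
  have hS : 0 ≤ ∑ i : Fin 4, ∑ j ∈ Finset.Ioi i, dR (rot i j f) x.1 x.2 ^ 2 :=
    Finset.sum_nonneg fun _ _ => Finset.sum_nonneg fun _ _ => sq_nonneg _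
  generalize ∑ i : Fin 4, ∑ j ∈ Finset.Ioi i, dR (rot i j f) x.1 x.2 ^ 2 = S at *
  generalize dR f x.1 x.2 = a
  generalize dR (rMul 1 (dR f)) x.1 x.2 = c
  generalize dR (dT f) x.1 x.2 = d
  have : (1 / 2 * a + c) ^ 2 + a ^ 2 + S + d ^ 2 ≤ 3 * (a ^ 2 + d ^ 2 + c ^ 2 + S) := by
    nlinarith [sq_nonneg (a / 2 - c), sq_nonneg a, sq_nonneg d, sq_nonneg c]
  calc _ = rr x ^ 3 * ((1 / 2 * a + c) ^ 2 + a ^ 2 + S + d ^ 2) := by ring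
    _ ≤ rr x ^ 3 * (3 * (a ^ 2 + d ^ 2 + c ^ 2 + S)) := by gcongr
    _ = _ := by ring

/-! ### Compactly supported weights approximating `χ_R r^p` -/

/-- The cutoff `χ_R`, cut off again at the radius `exp n` on a logarithmic scale. -/
def capκ (chi : ℝ → ℝ) (R n : ℝ) : ℝ → ℝ := fun r => cut chi R r * (1 - chi (Real.log r / n))

/-- The weight `r^p`, tamed to `r^{p-2}` beyond the radius `ρ`. -/
def capv (p ρ : ℝ) : ℝ → ℝ := fun r => r ^ p / (1 + r / ρ) ^ 2

section weights
variable {chi : ℝ → ℝ} {R n p ρ r : ℝ}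

lemma capv_pos (hρ : 0 < ρ) (hr : 0 < r) : 0 < capv p ρ r := by
  have := Real.rpow_pos_of_pos hr p
  unfold capv; positivity

lemma capv_le (hρ : 0 < ρ) (hr : 0 < r) : capv p ρ r ≤ r ^ p := by
  have h1 := (Real.rpow_pos_of_pos hr p).le
  have h2 : 0 < r / ρ := by positivity
  exact div_le_self h1 (one_le_pow₀ (by linarith))

lemma capv_le' (hρ : 0 < ρ) (hr : 0 < r) : capv p ρ r ≤ r ^ p * (ρ ^ 2 / r ^ 2) := by
  have h1 := Real.rpow_pos_of_pos hr p
  have h2 : 0 < r / ρ := by positivity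
  have h3 : ρ ^ 2 / r ^ 2 = 1 / (r / ρ) ^ 2 := by field_simp
  rw [capv, h3, div_eq_mul_one_div]
  gcongr
  linarith

lemma capv_hasDerivAt (hρ : 0 < ρ) (hr : 0 < r) :
    HasDerivAt (capv p ρ) (capv p ρ r * (p - 2 * (r / ρ) / (1 + r / ρ)) / r) r := by
  have h2 : 0 < r / ρ := by positivity
  have h3 : 1 + r / ρ ≠ 0 := by positivity
  have h4 : ρ + r ≠ 0 := by positivity
  have d1 := Real.hasDerivAt_rpow_const (x := r) (p := p) (Or.inl hr.ne')
  have d2 := (((hasDerivAt_id r).div_const ρ).const_add 1).pow 2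
  refine (d1.div d2 (pow_ne_zero 2 h3)).congr_deriv ?_
  rw [Real.rpow_sub_one hr.ne', capv]
  simp only [id, Pi.pow_apply, Nat.add_one_sub_one, pow_one, Nat.cast_ofNat]
  field_simp

lemma capv_smooth (hρ : 0 < ρ) (hr : 0 < r) : ContDiffAt ℝ ∞ (capv p ρ) r := by
  have h3 : (1 + r / ρ) ^ 2 ≠ 0 := by positivity
  exact (Real.contDiffAt_rpow_const_of_ne hr.ne').div
    ((contDiffAt_const.add (contDiffAt_id.div_const ρ)).pow 2) h3

lemma cut_nonneg (hchi : IsCutoffProfile chi) : 0 ≤ cut chi R r := (hchi.mem_Icc _).1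
lemma cut_zero (hchi : IsCutoffProfile chi) (hR : 0 < R) (h : r ≤ R) : cut chi R r = 0 :=
  hchi.zero_of_le _ ((div_le_one hR).2 h)
lemma cut_smooth (hchi : IsCutoffProfile chi) : ContDiff ℝ ∞ (cut chi R) :=
  hchi.smooth.comp (contDiff_id.div_const R)

lemma capκ_nonneg (hchi : IsCutoffProfile chi) : 0 ≤ capκ chi R n r :=
  mul_nonneg (cut_nonneg hchi) (by linarith [(hchi.mem_Icc (Real.log r / n)).2])

lemma capκ_le (hchi : IsCutoffProfile chi) : capκ chi R n r ≤ cut chi R r :=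
  mul_le_of_le_one_right (cut_nonneg hchi) (by linarith [(hchi.mem_Icc (Real.log r / n)).1])

lemma logcut_smooth (hchi : IsCutoffProfile chi) (hr : 0 < r) :
    ContDiffAt ℝ ∞ (fun s => chi (Real.log s / n)) r :=
  ContDiffAt.comp (g := chi) (f := fun s => Real.log s / n) r hchi.smooth.contDiffAt
    ((Real.contDiffAt_log.2 hr.ne').div_const n)

/-- Capped weights are admissible: taming `r^p` to `r^{p-2}` lowers the logarithmic derivative from
`p` to no less than `p - 2`, which the coercivity of the bulk form still tolerates. -/
theorem cap_weight (hchi : IsCutoffProfile chi) {δ α : ℝ} (hR : 0 < R) (hn : 0 < n) (hρ : 0 < ρ)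
    (hδ : δ ≤ p) (hp : p ≤ 3 / 2 - 2 * α) :
    Weight R (Real.exp (2 * n)) δ α (capκ chi R n) (capv p ρ) where
  smooth_κ r hr := (cut_smooth hchi).contDiffAt.mul (contDiffAt_const.sub (logcut_smooth hchi hr))
  smooth_v r hr := capv_smooth hρ hr
  nonneg r := capκ_nonneg hchi
  zero_in r hr := by rw [capκ, cut_zero hchi hR hr, zero_mul]
  zero_out r hr := by
    have h0 : 2 * n ≤ Real.log r := (Real.le_log_iff_exp_le ((Real.exp_pos _).trans_le hr)).2 hr
    rw [capκ, hchi.one_of_ge _ ((le_div_iff₀ hn).2 h0), sub_self, mul_zero]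
  pos r hr := capv_pos hρ hr
  low r hr := by
    have hr0 := hR.trans_le hr
    have h1 := capv_pos (p := p) hρ hr0
    have h2 : 0 < r / ρ := by positivity
    have h3 : (r / ρ) / (1 + r / ρ) ≤ 1 := (div_le_one (by positivity)).2 (by linarith)
    rw [(capv_hasDerivAt hρ hr0).deriv, mul_div_cancel₀ _ hr0.ne', mul_comm (capv p ρ r),
      mul_div_assoc]
    gcongr; linarith
  high r hr := by
    have hr0 := hR.trans_le hr
    have h1 := capv_pos (p := p) hρ hr0
    have h3 : 0 ≤ (r / ρ) / (1 + r / ρ) := by positivity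
    rw [(capv_hasDerivAt hρ hr0).deriv, mul_div_cancel₀ _ hr0.ne', mul_comm (capv p ρ r),
      mul_div_assoc]
    exact mul_le_mul_of_nonneg_right (by linarith) h1.le

lemma exists_deriv_bound (hchi : IsCutoffProfile chi) : ∃ D, 0 ≤ D ∧ ∀ s, |deriv chi s| ≤ D := by
  obtain ⟨D, hD⟩ := (isCompact_Icc (a := (1 : ℝ)) (b := 2)).exists_bound_of_continuousOn
    (hchi.smooth.continuous_deriv (by simp)).continuousOn
  refine ⟨D, (norm_nonneg _).trans (hD 1 (by norm_num)), fun s => ?_⟩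
  have hD0 : 0 ≤ D := (norm_nonneg _).trans (hD 1 (by norm_num))
  by_cases hs : s ∈ Icc (1 : ℝ) 2
  · exact hD s hs
  · have : deriv chi s = 0 := by
      rcases not_and_or.1 hs with h | h
      · have e : chi =ᶠ[𝓝 s] fun _ => 0 := by
          filter_upwards [gt_mem_nhds (not_le.1 h)] with t ht using hchi.zero_of_le t ht.le
        rw [e.deriv_eq, deriv_const]
      · have e : chi =ᶠ[𝓝 s] fun _ => 1 := by
          filter_upwards [lt_mem_nhds (not_le.1 h)] with t ht using hchi.one_of_ge t ht.le
        rw [e.deriv_eq, deriv_const]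
    rw [this, abs_zero]; exact hD0

lemma abs_deriv_capκ_le (hchi : IsCutoffProfile chi) {D : ℝ} (hD : ∀ s, |deriv chi s| ≤ D)
    (hn : 0 < n) (hr : 0 < r) :
    |deriv (capκ chi R n) r| ≤ |deriv (cut chi R) r| + cut chi R r * (D / (n * r)) := by
  have d1 := ((cut_smooth hchi (R := R)).contDiffAt (x := r)).differentiableAt (by simp)
  have d2 : HasDerivAt (fun s => chi (Real.log s / n)) (deriv chi (Real.log r / n) * (r⁻¹ / n)) r :=
    HasDerivAt.comp (h₂ := chi) r (hchi.smooth.contDiffAt.differentiableAt (by simp)).hasDerivAt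
      ((Real.hasDerivAt_log hr.ne').div_const n)
  have d3 : HasDerivAt (capκ chi R n) _ r := d1.hasDerivAt.fun_mul (d2.const_sub 1)
  have h1 := hchi.mem_Icc (Real.log r / n)
  have hc := cut_nonneg (R := R) (r := r) hchi
  rw [d3.deriv]
  refine (abs_add_le _ _).trans (add_le_add ?_ ?_)
  · rw [abs_mul]
    exact mul_le_of_le_one_right (abs_nonneg _) (abs_le.2 ⟨by linarith [h1.2], by linarith [h1.1]⟩)
  · rw [abs_mul, abs_of_nonneg hc, abs_neg, abs_mul, abs_of_pos (by positivity : 0 < r⁻¹ / n)]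
    have : D / (n * r) = D * (r⁻¹ / n) := by field_simp
    rw [this]
    gcongr
    exact hD _
end weights

/-! ### Comparison of the weighted densities with the stated norms -/

section compare
variable {chi : ℝ → ℝ} {R n p ρ : ℝ} {Y : Fld} {x : X5}

lemma om_cap_le (hchi : IsCutoffProfile chi) (hρ : 0 < ρ) (hr : 0 < rr x) :
    om (capκ chi R n) (capv p ρ) (rr x) ≤ cut chi R (rr x) * rr x ^ p / rr x ^ 3 := by
  have h1 := capv_pos (p := p) hρ hr
  have h2 := cut_nonneg (R := R) (r := rr x) hchi
  unfold om
  gcongr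
  · exact capκ_le hchi
  · exact capv_le hρ hr

lemma om_cap_nonneg (hchi : IsCutoffProfile chi) (hρ : 0 < ρ) (hr : 0 < rr x) :
    0 ≤ om (capκ chi R n) (capv p ρ) (rr x) := by
  have h1 := capv_pos (p := p) hρ hr
  have h2 := capκ_nonneg (R := R) (n := n) (r := rr x) hchi
  unfold om; positivity

lemma rpow_neg_nat {r : ℝ} (hr : 0 < r) (k : ℕ) : r ^ (-(k : ℝ)) = 1 / r ^ k := by
  rw [Real.rpow_neg hr.le, Real.rpow_natCast, one_div]

/-- Integrand of `Ẽ^p`. -/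
def gE (chi : ℝ → ℝ) (R p : ℝ) (Y : Fld) : Fld := fun τ y => cut chi R ‖y‖ * ‖y‖ ^ p *
    ((dR Y τ y) ^ 2 + ‖y‖ ^ (-2 : ℝ) * (Y τ y) ^ 2 + ‖y‖ ^ (-4 : ℝ) * angSq Y τ y)
/-- Integrand of `B^p`. -/
def gB (chi : ℝ → ℝ) (R p : ℝ) (Y : Fld) : Fld := fun τ y => cut chi R ‖y‖ * ‖y‖ ^ (p - 1) *
    ((dR Y τ y) ^ 2 + ‖y‖ ^ (-2 : ℝ) * ((Y τ y) ^ 2 + angSq Y τ y))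
/-- Integrand of the cutoff error. -/
def gC (chi : ℝ → ℝ) (R p : ℝ) (Y : Fld) : Fld := fun τ y => |deriv (cut chi R) ‖y‖| * ‖y‖ ^ p *
    ((dR Y τ y) ^ 2 + (dT Y τ y) ^ 2 + ‖y‖ ^ (-2 : ℝ) * (angSq Y τ y + (Y τ y) ^ 2))
/-- Integrand of the source term. -/
def gS (chi : ℝ → ℝ) (R p : ℝ) (G Y : Fld) : Fld := fun τ y => cut chi R ‖y‖ * ‖y‖ ^ p *
    (|G τ y| * (|dR Y τ y| + ‖y‖ ^ (-1 : ℝ) * |Y τ y| + ‖y‖ ^ (-3 : ℝ) * Real.sqrt (angSq Y τ y)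
      + ‖y‖ ^ (-2 : ℝ) * |dT Y τ y|))
/-- Integrand dominated by the lower-order quantities. -/
def gL (chi : ℝ → ℝ) (R p : ℝ) (f : Fld) : Fld := fun τ y =>
  cut chi R ‖y‖ * ‖y‖ ^ (p - 1) * lowN f τ y

lemma dFN_le (hchi : IsCutoffProfile chi) (hρ : 0 < ρ) (hr : 0 < rr x)
    (hY : DifferentiableAt ℝ (uc Y) x) :
    dFN (capκ chi R n) (capv p ρ) (uc Y) x ≤ ‖x.2‖ ^ (-3 : ℝ) * gE chi R p Y x.1 x.2 := by
  have h1 := om_cap_le (R := R) (n := n) (p := p) hchi hρ hr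
  have h2 := cut_nonneg (R := R) (r := rr x) hchi
  have h3 := Real.rpow_pos_of_pos hr p
  have h4 := ang5_nonneg (uc Y) x
  have e3 := rpow_neg_nat hr 3
  have e2 := rpow_neg_nat hr 2
  have e4 := rpow_neg_nat hr 4
  push_cast at e3 e2 e4
  change _ ≤ rr x ^ (-3 : ℝ) * (cut chi R (rr x) * rr x ^ p * ((dR Y x.1 x.2) ^ 2
    + rr x ^ (-2 : ℝ) * (uc Y x) ^ 2 + rr x ^ (-4 : ℝ) * angSq Y x.1 x.2))
  rw [e3, e2, e4, dR_at hY, angSq_at hY, dFN, fluxN, ya_eq]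
  calc _ ≤ cut chi R (rr x) * rr x ^ p / rr x ^ 3 * (rD (uc Y) x ^ 2 + (uc Y x / rr x) ^ 2) := by
        gcongr
    _ ≤ cut chi R (rr x) * rr x ^ p / rr x ^ 3
        * (rD (uc Y) x ^ 2 + (uc Y x / rr x) ^ 2 + ang5 (uc Y) x / rr x ^ 4) := by
      have : 0 ≤ ang5 (uc Y) x / rr x ^ 4 := by positivity
      exact mul_le_mul_of_nonneg_left (by linarith) (by positivity)
    _ = _ := by field_simp

variable {f : Fld}

lemma dFL_le (hchi : IsCutoffProfile chi) (hρ : 0 < ρ) (h : x.2 ≠ 0) (hf : Sm (uc f) x) :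
    dFL (capκ chi R n) (capv p ρ) (uc (K f)) x
      ≤ 3 * (‖x.2‖ ^ (-3 : ℝ) * gL chi R p f x.1 x.2) := by
  have hr := rr_pos h
  have h1 := om_cap_le (R := R) (n := n) (p := p) hchi hρ hr
  have h2 := cut_nonneg (R := R) (r := rr x) hchi
  have h3 := Real.rpow_pos_of_pos hr p
  have h4 := ang5_nonneg (uc (K f)) x
  have hj := jetL_le h hf
  have e3 := rpow_neg_nat hr 3
  push_cast at e3
  have e1 : rr x ^ (p - 1) = rr x ^ p / rr x := Real.rpow_sub_one hr.ne' p
  have hfl : fluxL (uc (K f)) x ≤ 3 * (rr x ^ 3 * lowN f x.1 x.2) / rr x ^ 4 := by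
    rw [le_div_iff₀ (by positivity)]
    refine le_trans ?_ hj
    rw [fluxL, gsq_sub_ya h, jetL]
    have : 0 ≤ rr x ^ 2 * rD (uc (K f)) x ^ 2 + uc (K f) x ^ 2 := by positivity
    field_simp
    linarith
  have hfl0 := fluxL_nonneg (Y := uc (K f)) hr
  change _ ≤ 3 * (rr x ^ (-3 : ℝ) * (cut chi R (rr x) * rr x ^ (p - 1) * lowN f x.1 x.2))
  rw [e3, e1, dFL]
  calc _ ≤ cut chi R (rr x) * rr x ^ p / rr x ^ 3
        * (3 * (rr x ^ 3 * lowN f x.1 x.2) / rr x ^ 4) := by gcongr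
    _ = _ := by field_simp

lemma dSrc_le (hchi : IsCutoffProfile chi) (hρ : 0 < ρ) (hr : 0 < rr x)
    (hY : DifferentiableAt ℝ (uc Y) x) {kk : Fin 5 → Fin 5 → X5 → ℝ} {bb : Fin 5 → X5 → ℝ}
    {cc : X5 → ℝ} {G : Fld} (hG : G x.1 x.2 = opL kk bb cc (uc Y) x) :
    dSrc kk bb cc (capκ chi R n) (capv p ρ) (uc Y) x
      ≤ ‖x.2‖ ^ (-3 : ℝ) * gS chi R p G Y x.1 x.2 := by
  have h1 := om_cap_le (R := R) (n := n) (p := p) hchi hρ hr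
  have h0 := om_cap_nonneg (R := R) (n := n) (p := p) hchi hρ hr
  have h2 := cut_nonneg (R := R) (r := rr x) hchi
  have h3 := Real.rpow_pos_of_pos hr p
  have e3 := rpow_neg_nat hr 3
  have e2 := rpow_neg_nat hr 2
  have e1 := rpow_neg_nat hr 1
  push_cast at e3 e2 e1
  rw [pow_one] at e1
  change _ ≤ rr x ^ (-3 : ℝ) * (cut chi R (rr x) * rr x ^ p *
    (|G x.1 x.2| * (|dR Y x.1 x.2| + rr x ^ (-1 : ℝ) * |uc Y x|
      + rr x ^ (-3 : ℝ) * Real.sqrt (angSq Y x.1 x.2) + rr x ^ (-2 : ℝ) * |dT Y x.1 x.2|)))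
  rw [e3, e2, e1, dR_at hY, dT_at hY, dSrc, abs_mul, ← hG, mult_eq hr, abs_mul, abs_neg,
    abs_of_nonneg h0, ya_eq]
  have hsum : |rD (uc Y) x + uc Y x / rr x / 2 + pd 0 (uc Y) x / rr x ^ 2|
      ≤ |rD (uc Y) x| + 1 / rr x * |uc Y x| + 1 / rr x ^ 3 * Real.sqrt (angSq Y x.1 x.2)
        + 1 / rr x ^ 2 * |pd 0 (uc Y) x| := by
    refine (abs_add_three _ _ _).trans ?_
    rw [abs_div, abs_div, abs_div, abs_of_pos hr, abs_two, abs_of_pos (by positivity : 0 < rr x ^ 2)]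
    have a1 : 0 ≤ 1 / rr x ^ 3 * Real.sqrt (angSq Y x.1 x.2) := by positivity
    have a2 : 0 ≤ 1 / rr x * |uc Y x| := by positivity
    have a3 : |uc Y x| / rr x / 2 = 1 / rr x * |uc Y x| / 2 := by ring
    have a4 : |pd 0 (uc Y) x| / rr x ^ 2 = 1 / rr x ^ 2 * |pd 0 (uc Y) x| := by ring
    rw [a3, a4]; linarith
  calc _ ≤ cut chi R (rr x) * rr x ^ p / rr x ^ 3 * (|rD (uc Y) x| + 1 / rr x * |uc Y x|
        + 1 / rr x ^ 3 * Real.sqrt (angSq Y x.1 x.2) + 1 / rr x ^ 2 * |pd 0 (uc Y) x|)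
        * |G x.1 x.2| := by gcongr
    _ = _ := by ring

lemma bulkN_split (h : x.2 ≠ 0) (Y : X5 → ℝ) : bulkN Y x
    = rD Y x ^ 2 + (ang5 Y x + Y x ^ 2) / rr x ^ 2 + pd 0 Y x ^ 2 / rr x ^ 2 := by
  have : gsq Y x = rD Y x ^ 2 + ang5 Y x / rr x ^ 2 := by
    rw [← gsq_sub_ya h, ya_eq]; ring
  rw [bulkN, this]; ring

/-- The derivative of the inner cutoff gives the stated cutoff error. The outer cutoff varies slowly
on a logarithmic scale and costs `ρ² / n` times lower-order quantities. -/
lemma dCut_le (hchi : IsCutoffProfile chi) {D : ℝ} (hD0 : 0 ≤ D) (hD : ∀ s, |deriv chi s| ≤ D)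
    (hn : 0 < n) (hρ : 0 < ρ) (h : x.2 ≠ 0) (h1r : 1 ≤ rr x) (hf : Sm (uc f) x) :
    dCut (capκ chi R n) (capv p ρ) (uc (K f)) x
      ≤ 4 * (‖x.2‖ ^ (-3 : ℝ) * gC chi R p (K f) x.1 x.2)
        + 12 * D * (ρ ^ 2 / n) * (‖x.2‖ ^ (-3 : ℝ) * gL chi R p f x.1 x.2) := by
  have hr := rr_pos h
  have hY := K_sm h hf
  have h2 := cut_nonneg (R := R) (r := rr x) hchi
  have h3 := Real.rpow_pos_of_pos hr p
  have h4 := ang5_nonneg (uc (K f)) x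
  have hj := jetL_le h hf
  have hv := capv_pos (p := p) hρ hr
  have hκ := abs_deriv_capκ_le (R := R) hchi hD hn hr
  have e3 := rpow_neg_nat hr 3
  have e2 := rpow_neg_nat hr 2
  push_cast at e3 e2
  have e1 : rr x ^ (p - 1) = rr x ^ p / rr x := Real.rpow_sub_one hr.ne' p
  change _ ≤ 4 * (rr x ^ (-3 : ℝ) * (|deriv (cut chi R) (rr x)| * rr x ^ p *
      ((dR (K f) x.1 x.2) ^ 2 + (dT (K f) x.1 x.2) ^ 2
        + rr x ^ (-2 : ℝ) * (angSq (K f) x.1 x.2 + (uc (K f) x) ^ 2))))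
    + 12 * D * (ρ ^ 2 / n) * (rr x ^ (-3 : ℝ) * (cut chi R (rr x) * rr x ^ (p - 1)
      * lowN f x.1 x.2))
  rw [e3, e2, e1, dR_at hY.diff, dT_at hY.diff, angSq_at hY.diff, dCut, omd, bulkN_split h,
    abs_div, abs_mul, abs_of_pos hv, abs_of_pos (by positivity : 0 < rr x ^ 3)]
  rw [jetL] at hj
  generalize uc (K f) x = y at *
  generalize rD (uc (K f)) x = a at *
  generalize ang5 (uc (K f)) x = A at *
  generalize pd 0 (uc (K f)) x = t at *
  generalize lowN f x.1 x.2 = N at *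
  generalize rr x = r at *
  have hi1 : 1 / r ≤ 1 := (div_le_one hr).2 h1r
  have hcross : |y / r| * |t| ≤ 1 / 2 * (y ^ 2 / r ^ 2 + t ^ 2) := by
    have := two_mul_le_add_sq |y / r| |t|
    rw [sq_abs, sq_abs, div_pow] at this; linarith
  have hr2 : t ^ 2 / r ^ 2 ≤ t ^ 2 := div_le_self (sq_nonneg _) (one_le_pow₀ h1r)
  have hyr : 0 ≤ y ^ 2 / r ^ 2 := by positivity
  have hAr : 0 ≤ A / r ^ 2 := by positivity
  -- near the inner cutoff
  have hN1 : 3 * (a ^ 2 + (A + y ^ 2) / r ^ 2 + t ^ 2 / r ^ 2) + |y / r| * |t|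
      ≤ 4 * (a ^ 2 + t ^ 2 + 1 / r ^ 2 * (A + y ^ 2)) := by
    have : (A + y ^ 2) / r ^ 2 = A / r ^ 2 + y ^ 2 / r ^ 2 := add_div _ _ _
    rw [one_div_mul_eq_div, this]
    linarith [sq_nonneg a, sq_nonneg t]
  -- near the outer cutoff
  have hN2 : 3 * (a ^ 2 + (A + y ^ 2) / r ^ 2 + t ^ 2 / r ^ 2) + |y / r| * |t|
      ≤ 4 * (3 * (r ^ 3 * N)) / r := by
    have hc : |y / r| * |t| ≤ (y ^ 2 + t ^ 2) / r := by
      rw [abs_div, abs_of_pos hr, div_mul_eq_mul_div]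
      gcongr
      have := two_mul_le_add_sq |y| |t|
      rw [sq_abs, sq_abs] at this
      have : 0 ≤ |y| * |t| := by positivity
      linarith
    have hd : a ^ 2 + (A + y ^ 2) / r ^ 2 + t ^ 2 / r ^ 2 ≤ (3 * (r ^ 3 * N)) / r := by
      have : a ^ 2 + (A + y ^ 2) / r ^ 2 + t ^ 2 / r ^ 2
          = (r ^ 2 * a ^ 2 + y ^ 2 + A + t ^ 2) / r ^ 2 := by field_simp; ring
      rw [this]
      have hj0 : 0 ≤ r ^ 2 * a ^ 2 + y ^ 2 + A + t ^ 2 := by positivity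
      calc _ ≤ (r ^ 2 * a ^ 2 + y ^ 2 + A + t ^ 2) / r := by
            gcongr; nlinarith
        _ ≤ _ := by gcongr
    have hc' : (y ^ 2 + t ^ 2) / r ≤ 3 * (r ^ 3 * N) / r := by
      gcongr
      have : 0 ≤ r ^ 2 * a ^ 2 := by positivity
      linarith
    have : 4 * (3 * (r ^ 3 * N)) / r = 4 * (3 * (r ^ 3 * N) / r) := by ring
    linarith
  have hB0 : 0 ≤ 3 * (a ^ 2 + (A + y ^ 2) / r ^ 2 + t ^ 2 / r ^ 2) + |y / r| * |t| := by positivity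
  generalize 3 * (a ^ 2 + (A + y ^ 2) / r ^ 2 + t ^ 2 / r ^ 2) + |y / r| * |t| = B at *
  have hv1 := capv_le (p := p) hρ hr
  have hv2 := capv_le' (p := p) hρ hr
  generalize capv p ρ r = v at *
  calc |deriv (capκ chi R n) r| * v / r ^ 3 * B
      ≤ (|deriv (cut chi R) r| + cut chi R r * (D / (n * r))) * v / r ^ 3 * B := by gcongr
    _ = |deriv (cut chi R) r| * v / r ^ 3 * B + cut chi R r * (D / (n * r)) * v / r ^ 3 * B := by
      ring
    _ ≤ |deriv (cut chi R) r| * r ^ p / r ^ 3 * (4 * (a ^ 2 + t ^ 2 + 1 / r ^ 2 * (A + y ^ 2)))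
        + cut chi R r * (D / (n * r)) * (r ^ p * (ρ ^ 2 / r ^ 2)) / r ^ 3
          * (4 * (3 * (r ^ 3 * N)) / r) := by gcongr
    _ = _ := by field_simp; ring
end compare

/-! ### Measurability and the lower-order sum -/

section meas
variable {τ₁ τ₂ : ℝ} {h : X5 → ℝ}

lemma slice_measurable (hc : ∀ x : X5, x.1 ∈ Icc τ₁ τ₂ → ContinuousAt h x) {τ : ℝ}
    (hτ : τ ∈ Icc τ₁ τ₂) : Measurable fun y : E4 => ENNReal.ofReal (h (τ, y)) := by
  have : Continuous fun y : E4 => h (τ, y) := continuous_iff_continuousAt.2 fun y =>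
    ContinuousAt.comp (f := fun y : E4 => ((τ, y) : X5)) (hc (τ, y) hτ) (by fun_prop)
  exact (ENNReal.continuous_ofReal.comp this).measurable

lemma bulk_aemeasurable (hc : ∀ x : X5, x.1 ∈ Icc τ₁ τ₂ → ContinuousAt h x) :
    AEMeasurable (fun s => ∫⁻ y : E4, ENNReal.ofReal (h (s, y)))
      (volume.restrict (Icc τ₁ τ₂)) := by
  have h1 : ContinuousOn (fun x : X5 => ENNReal.ofReal (h x)) (Icc τ₁ τ₂ ×ˢ univ) := fun x hx =>
    (ENNReal.continuous_ofReal.continuousAt.comp (hc x hx.1)).continuousWithinAt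
  have h2 := h1.aemeasurable (μ := (volume : Measure ℝ).prod (volume : Measure E4))
    (measurableSet_Icc.prod MeasurableSet.univ)
  rw [← Measure.prod_restrict, Measure.restrict_univ] at h2
  exact h2.lintegral_prod_right'

/-- Fatou's lemma in the form of a limit of bounds. -/
lemma lintegral_le_of_liminf {X : Type*} [MeasurableSpace X] {μ : Measure X} {f : ℕ → X → ℝ≥0∞}
    {g : X → ℝ≥0∞} (hm : ∀ n, AEMeasurable (f n) μ)
    (hl : ∀ᵐ x ∂μ, g x ≤ liminf (fun n => f n x) atTop) {c : ℕ → ℝ≥0∞} {c₀ : ℝ≥0∞}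
    (hc : Tendsto c atTop (𝓝 c₀)) (h : ∀ n, ∫⁻ x, f n x ∂μ ≤ c n) : ∫⁻ x, g x ∂μ ≤ c₀ :=
  calc ∫⁻ x, g x ∂μ ≤ ∫⁻ x, liminf (fun n => f n x) atTop ∂μ := lintegral_mono_ae hl
    _ ≤ liminf (fun n => ∫⁻ x, f n x ∂μ) atTop := lintegral_liminf_le' hm
    _ ≤ liminf c atTop := liminf_le_liminf (Eventually.of_forall h)
    _ = c₀ := hc.liminf_eq
end meas

/-- The functions `Ũ_k`, `0 ≤ |k| ≤ 1`. -/
def lowK (f : Fld) : Fin 9 → Fld :=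
  ![f, dT f, rMul 1 (dR f), rot 0 1 f, rot 0 2 f, rot 0 3 f, rot 1 2 f, rot 1 3 f, rot 2 3 f]

lemma sum_lowK {M : Type*} [AddCommMonoid M] (T : Fld → M) (f : Fld) :
    ∑ k, T (lowK f k) = T f + T (dT f) + T (rMul 1 (dR f))
      + ∑ i : Fin 4, ∑ j ∈ Finset.Ioi i, T (rot i j f) := by
  rw [sum_pairs fun i j => T (rot i j f)]
  simp only [Fin.sum_univ_succ, Fin.sum_univ_zero, lowK]
  simp [add_assoc]

lemma lowK_sm {f : Fld} {x : X5} (h : x.2 ≠ 0) (hf : Sm (uc f) x) (k : Fin 9) :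
    Sm (uc (lowK f k)) x := by
  have hT : Sm (uc (dT f)) x := (pd_sm 0 hf).congr (dT_ev hf)
  have hR : Sm (uc (dR f)) x := (rD_sm h hf).congr (dR_ev hf)
  have hO : ∀ i j, Sm (uc (rot i j f)) x := fun i j => (rot5_sm i j hf).congr (rot_ev hf i j)
  fin_cases k
  exacts [hf, hT, rMul_sm h hR, hO 0 1, hO 0 2, hO 0 3, hO 1 2, hO 1 3, hO 2 3]

section low
variable {chi : ℝ → ℝ} {R p τ₁ τ₂ : ℝ} {f : Fld}

/-- Weighted density of a single square of a radial derivative. -/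
def gR (chi : ℝ → ℝ) (R p : ℝ) (f : Fld) : X5 → ℝ := fun x =>
  ‖x.2‖ ^ (-3 : ℝ) * (cut chi R ‖x.2‖ * ‖x.2‖ ^ (p - 1) * dR f x.1 x.2 ^ 2)

lemma gR_nonneg (hchi : IsCutoffProfile chi) (x : X5) : 0 ≤ gR chi R p f x := by
  have := cut_nonneg (R := R) (r := ‖x.2‖) hchi
  unfold gR; positivity

lemma continuousAt_of_region {g : X5 → ℝ}
    (h1 : ∀ x : X5, x.1 ∈ Icc τ₁ τ₂ → R ≤ rr x → ContinuousAt g x)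
    (h2 : ∀ x, rr x ≤ R → g x = (0 : ℝ)) (x : X5) (hx : x.1 ∈ Icc τ₁ τ₂) : ContinuousAt g x := by
  rcases le_or_gt R (rr x) with h | h
  · exact h1 x hx h
  · have e : g =ᶠ[𝓝 x] fun _ => 0 := (ev_lt h).mono fun z hz => h2 z hz
    exact continuousAt_const.congr e.symm

lemma gR_continuousAt (hchi : IsCutoffProfile chi) (hR : 0 < R)
    (hf : ∀ x : X5, x.1 ∈ Icc τ₁ τ₂ → R ≤ rr x → Sm (uc f) x) (x : X5) (hx : x.1 ∈ Icc τ₁ τ₂) :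
    ContinuousAt (gR chi R p f) x := by
  refine continuousAt_of_region (R := R) (fun x hx h => ?_) (fun x h => ?_) x hx
  · have hr : 0 < rr x := hR.trans_le h
    have h0 := ne_zero_of_rr hr
    have hd : Sm (uc (dR f)) x := (rD_sm h0 (hf x hx h)).congr (dR_ev (hf x hx h))
    have hc : Sm (fun z => cut chi R (rr z)) x := Frr_sm h0 (cut_smooth hchi).contDiffAt
    exact ((rp_sm (-3) h0).mul ((hc.mul (rp_sm (p - 1) h0)).mul (hd.pow 2))).continuousAt
  · have : cut chi R ‖x.2‖ = 0 := cut_zero hchi hR h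
    simp [gR, this]

/-- The lower-order density as a sum of weighted squares of radial derivatives. -/
lemma gL_eq (x : X5) :
    ‖x.2‖ ^ (-3 : ℝ) * gL chi R p f x.1 x.2 = ∑ k, gR chi R p (lowK f k) x := by
  rw [sum_lowK (fun g => gR chi R p g x), gL, lowN]
  simp only [gR, mul_add, Finset.mul_sum]

variable (hchi : IsCutoffProfile chi) (hR : 0 < R)
  (hf : ∀ x : X5, x.1 ∈ Icc τ₁ τ₂ → R ≤ rr x → Sm (uc f) x)
include hchi hR hf

lemma lowK_continuousAt (k : Fin 9) (x : X5) (hx : x.1 ∈ Icc τ₁ τ₂) :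
    ContinuousAt (gR chi R p (lowK f k)) x :=
  gR_continuousAt hchi hR (fun x hx h => lowK_sm (ne_zero_of_rr (hR.trans_le h)) (hf x hx h) k) x hx

lemma gL_continuousAt (x : X5) (hx : x.1 ∈ Icc τ₁ τ₂) :
    ContinuousAt (fun x : X5 => ‖x.2‖ ^ (-3 : ℝ) * gL chi R p f x.1 x.2) x := by
  simp only [gL_eq]
  exact tendsto_finsetSum _ fun k _ => lowK_continuousAt hchi hR hf k x hx

lemma sliceInt_gL {τ : ℝ} (hτ : τ ∈ Icc τ₁ τ₂) :
    sliceInt (gL chi R p f τ) = ∑ k, Ep chi R (p - 1) (lowK f k) τ := by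
  have e : ∀ y : E4, ENNReal.ofReal (‖y‖ ^ (-3 : ℝ) * gL chi R p f τ y)
      = ∑ k, ENNReal.ofReal (gR chi R p (lowK f k) (τ, y)) := fun y => by
    rw [gL_eq (τ, y), ENNReal.ofReal_sum_of_nonneg fun k _ => gR_nonneg hchi _]
  rw [sliceInt, lintegral_congr e, lintegral_finsetSum _ fun k _ =>
    slice_measurable (lowK_continuousAt hchi hR hf k) hτ]
  rfl

lemma sliceInt_gL_le {τ : ℝ} (hτ : τ ∈ Icc τ₁ τ₂) :
    sliceInt (gL chi R p f τ) ≤ lowSum chi R p f τ₁ τ₂ := by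
  rw [sliceInt_gL hchi hR hf hτ, lowSum, ← sum_lowK fun g => lowTerm chi R p g τ₁ τ₂]
  refine Finset.sum_le_sum fun k _ => ?_
  refine le_trans ?_ le_add_self
  exact le_iSup₂ (f := fun τ (_ : τ ∈ Icc τ₁ τ₂) => Ep chi R (p - 1) (lowK f k) τ) τ hτ

lemma bulkInt_gL_le : bulkInt τ₁ τ₂ (gL chi R p f) ≤ lowSum chi R p f τ₁ τ₂ := by
  have e : bulkInt τ₁ τ₂ (gL chi R p f)
      = ∫⁻ s in Icc τ₁ τ₂, ∑ k, ∫⁻ y : E4, ENNReal.ofReal (gR chi R p (lowK f k) (s, y)) :=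
    setLIntegral_congr_fun measurableSet_Icc fun s hs => sliceInt_gL hchi hR hf hs
  rw [e, lintegral_finsetSum' _ fun k _ => bulk_aemeasurable (lowK_continuousAt hchi hR hf k),
    lowSum, ← sum_lowK fun g => lowTerm chi R p g τ₁ τ₂]
  refine Finset.sum_le_sum fun k _ => ?_
  refine le_trans ?_ le_self_add
  refine lintegral_mono fun s => lintegral_mono fun y => ENNReal.ofReal_le_ofReal ?_
  have h1 := cut_nonneg (R := R) (r := ‖y‖) hchi
  have h2 : 0 ≤ angSq (lowK f k) s y :=
    Finset.sum_nonneg fun _ _ => Finset.sum_nonneg fun _ _ => sq_nonneg _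
  have h3 : 0 ≤ ‖y‖ ^ (-2 : ℝ) * ((lowK f k s y) ^ 2 + angSq (lowK f k) s y) := by positivity
  change ‖y‖ ^ (-3 : ℝ) * (cut chi R ‖y‖ * ‖y‖ ^ (p - 1) * dR (lowK f k) s y ^ 2) ≤ _
  refine mul_le_mul_of_nonneg_left (mul_le_mul_of_nonneg_left ?_ (by positivity)) (by positivity)
  linarith
end low

/-! ### Removal of the outer cutoff -/

section limit
variable {chi : ℝ → ℝ} {R p α δ η D τ₁ τ₂ : ℝ} {f G : Fld}
  {kk : Fin 5 → Fin 5 → X5 → ℝ} {bb : Fin 5 → X5 → ℝ} {cc : X5 → ℝ}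

/-- The energy inequality with the capped weight, in terms of the stated norms. -/
lemma cap_estimate (hchi : IsCutoffProfile chi) (hD0 : 0 ≤ D) (hD : ∀ s, |deriv chi s| ≤ D)
    (hα : 0 < α) (hα' : α < 3 / 4) (hδ : 0 < δ) (hδp : δ ≤ p) (hp : p ≤ 3 / 2 - 2 * α)
    (hη : 40000 * η ≤ δ) (hηα : 32 * η ≤ α)
    (hf : ∀ x : X5, x.1 ∈ Icc τ₁ τ₂ → R ≤ rr x → Sm (uc f) x)
    (hP : Perturbed R τ₁ τ₂ η kk bb cc (uc (K f)))
    (hG : ∀ x : X5, x.1 ∈ Icc τ₁ τ₂ → R < rr x → G x.1 x.2 = opL kk bb cc (uc (K f)) x)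
    {n ρ : ℝ} (hn : 0 < n) (hρ : 0 < ρ) {τ : ℝ} (hτ : τ ∈ Icc τ₁ τ₂) :
    ENNReal.ofReal (α / 2)
        * (∫⁻ y, ENNReal.ofReal (dFN (capκ chi R n) (capv p ρ) (uc (K f)) (τ, y)))
      + ENNReal.ofReal (δ / 24) * (∫⁻ s in Icc τ₁ τ, ∫⁻ y,
        ENNReal.ofReal (dBk (capκ chi R n) (capv p ρ) (uc (K f)) (s, y)))
      ≤ ENNReal.ofReal (2 + 1 / α) * (3 * lowSum chi R p f τ₁ τ₂)
        + 10 * (EpTilde chi R p (K f) τ₁ + 3 * lowSum chi R p f τ₁ τ₂)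
        + (sourceInt chi R p G (K f) τ₁ τ₂ + (4 * ErrChi chi R p (K f) τ₁ τ₂
          + ENNReal.ofReal (12 * D * (ρ ^ 2 / n)) * lowSum chi R p f τ₁ τ₂)) := by
  have hR0 : 0 < R := by linarith [hP.one_le]
  have hw := cap_weight hchi hR0 hn hρ hδp hp
  have hτ1 : τ₁ ∈ Icc τ₁ τ₂ := ⟨le_rfl, hτ.1.trans hτ.2⟩
  have hsub : Icc τ₁ τ ⊆ Icc τ₁ τ₂ := Icc_subset_Icc_right hτ.2
  set κ := capκ chi R n with hκ
  set v := capv p ρ with hv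
  set Y := uc (K f) with hY
  have hκ0 : ∀ x : X5, rr x ≤ R → κ (rr x) = 0 := fun x hx => hw.zero_in _ hx
  have hom : ∀ x : X5, 0 ≤ om κ v (rr x) := fun x => by
    rcases le_or_gt (rr x) R with h | h
    · rw [om_zero (hκ0 x h)]
    · exact om_cap_nonneg hchi hρ (hR0.trans h)
  have nN : ∀ x : X5, 0 ≤ dFN κ v Y x := fun x =>
    mul_nonneg (hom x) (by unfold fluxN; positivity)
  have nL : ∀ x : X5, 0 ≤ dFL κ v Y x := fun x => by
    rcases le_or_gt (rr x) R with h | h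
    · rw [dFL, om_zero (hκ0 x h), zero_mul]
    · exact mul_nonneg (hom x) (fluxL_nonneg (hR0.trans h))
  have nB : ∀ x : X5, 0 ≤ dBk κ v Y x := fun x => by
    have : 0 ≤ gsq Y x := Finset.sum_nonneg fun _ _ => sq_nonneg _
    exact mul_nonneg (div_nonneg (hom x) (norm_nonneg _)) (by unfold bulkN; positivity)
  have main := energy_inequality hw hP hα hα' hδ (by linarith) hη hηα hτ
  have i1 := sI_nonneg (τ := τ) fun y => nN (τ, y)
  have i2 := sI_nonneg (τ := τ) fun y => nL (τ, y)
  have i3 := sI_nonneg (τ := τ₁) fun y => nN (τ₁, y)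
  have i4 := sI_nonneg (τ := τ₁) fun y => nL (τ₁, y)
  have j1 : 0 ≤ ∫ s in τ₁..τ, sI (dBk κ v Y) s := intervalIntegral.integral_nonneg hτ.1
    fun s _ => sI_nonneg fun y => nB (s, y)
  have j2 : 0 ≤ ∫ s in τ₁..τ, sI (dSrc kk bb cc κ v Y) s := intervalIntegral.integral_nonneg hτ.1
    fun s _ => sI_nonneg fun y => abs_nonneg _
  have j3 : 0 ≤ ∫ s in τ₁..τ, sI (dCut κ v Y) s := intervalIntegral.integral_nonneg hτ.1
    fun s _ => sI_nonneg fun y => dCut_nonneg _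
  have main' := ENNReal.ofReal_le_ofReal main
  have hα1 : 0 ≤ 2 + 1 / α := by positivity
  rw [ENNReal.ofReal_add (by positivity) (by positivity), ENNReal.ofReal_mul (by positivity),
    ENNReal.ofReal_mul (by positivity), (cc_dFN hw hP).ofReal_sI hτ fun y => nN (τ, y),
    (cc_dBk hw hP).ofReal_bulk hτ fun x _ => nB x,
    ENNReal.ofReal_add (by positivity) (by positivity),
    ENNReal.ofReal_add (by positivity) (by positivity), ENNReal.ofReal_add j2 j3,
    ENNReal.ofReal_mul hα1, ENNReal.ofReal_mul (by norm_num), ENNReal.ofReal_add i3 i4,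
    (cc_dFN hw hP).ofReal_sI hτ1 fun y => nN (τ₁, y),
    (cc_dFL hw hP).ofReal_sI hτ1 fun y => nL (τ₁, y),
    (cc_dFL hw hP).ofReal_sI hτ fun y => nL (τ, y),
    (cc_dSrc hw hP).ofReal_bulk hτ fun x _ => abs_nonneg _,
    (cc_dCut hw hP).ofReal_bulk hτ fun x _ => dCut_nonneg x] at main'
  have hL : ∀ s ∈ Icc τ₁ τ₂, ∫⁻ y, ENNReal.ofReal (dFL κ v Y (s, y))
      ≤ 3 * lowSum chi R p f τ₁ τ₂ := by
    intro s hs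
    calc ∫⁻ y, ENNReal.ofReal (dFL κ v Y (s, y))
        ≤ ∫⁻ y, 3 * ENNReal.ofReal (‖y‖ ^ (-3 : ℝ) * gL chi R p f s y) := by
          refine lintegral_mono fun y => ?_
          rcases le_or_gt (rr (s, y)) R with h | h
          · rw [dFL, om_zero (hκ0 (s, y) h), zero_mul, ENNReal.ofReal_zero]; exact zero_le
          · have := ENNReal.ofReal_le_ofReal (dFL_le (x := (s, y)) (R := R) (n := n) (p := p) hchi hρ
              (ne_zero_of_rr (hR0.trans h)) (hf (s, y) hs h.le))
            rwa [ENNReal.ofReal_mul (by norm_num), ENNReal.ofReal_ofNat] at this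
      _ = 3 * sliceInt (gL chi R p f s) := lintegral_const_mul' _ _ (by simp)
      _ ≤ _ := by gcongr; exact sliceInt_gL_le hchi hR0 hf hs
  have hN : ∫⁻ y, ENNReal.ofReal (dFN κ v Y (τ₁, y)) ≤ EpTilde chi R p (K f) τ₁ := by
    refine lintegral_mono fun y => ?_
    rcases le_or_gt (rr (τ₁, y)) R with h | h
    · rw [dFN, om_zero (hκ0 (τ₁, y) h), zero_mul, ENNReal.ofReal_zero]; exact zero_le
    · exact ENNReal.ofReal_le_ofReal (dFN_le (x := (τ₁, y)) hchi hρ (hR0.trans h)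
        (hP.smY (τ₁, y) hτ1 h.le).diff)
  have hS : ∫⁻ s in Icc τ₁ τ, ∫⁻ y, ENNReal.ofReal (dSrc kk bb cc κ v Y (s, y))
      ≤ sourceInt chi R p G (K f) τ₁ τ₂ := by
    refine (lintegral_mono_set hsub).trans (setLIntegral_mono' measurableSet_Icc fun s hs => ?_)
    refine lintegral_mono fun y => ?_
    rcases le_or_gt (rr (s, y)) R with h | h
    · rw [dSrc, mult_zero (hκ0 (s, y) h), zero_mul, abs_zero, ENNReal.ofReal_zero]; exact zero_le
    · exact ENNReal.ofReal_le_ofReal (dSrc_le (x := (s, y)) hchi hρ (hR0.trans h)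
        (hP.smY (s, y) hs h.le).diff (hG (s, y) hs h))
  have hc : 0 ≤ 12 * D * (ρ ^ 2 / n) := by positivity
  have hgL := gL_continuousAt (p := p) hchi hR0 hf
  have hC : ∫⁻ s in Icc τ₁ τ, ∫⁻ y, ENNReal.ofReal (dCut κ v Y (s, y))
      ≤ 4 * ErrChi chi R p (K f) τ₁ τ₂
        + ENNReal.ofReal (12 * D * (ρ ^ 2 / n)) * lowSum chi R p f τ₁ τ₂ := by
    refine (lintegral_mono_set hsub).trans ?_
    calc ∫⁻ s in Icc τ₁ τ₂, ∫⁻ y, ENNReal.ofReal (dCut κ v Y (s, y))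
        ≤ ∫⁻ s in Icc τ₁ τ₂, (4 * sliceInt (gC chi R p (K f) s)
          + ENNReal.ofReal (12 * D * (ρ ^ 2 / n)) * sliceInt (gL chi R p f s)) := by
          refine setLIntegral_mono' measurableSet_Icc fun s hs => ?_
          rw [sliceInt, sliceInt, ← lintegral_const_mul' _ _ (by simp),
            ← lintegral_const_mul' _ _ ENNReal.ofReal_ne_top,
            ← lintegral_add_right _ ((slice_measurable hgL hs).const_mul _)]
          refine lintegral_mono fun y => ?_
          rcases le_or_gt (rr (s, y)) R with h | h
          · rw [dCut, omd_zero hw (hκ0 (s, y) h), abs_zero, zero_mul, ENNReal.ofReal_zero]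
            exact zero_le
          · have h1 := ENNReal.ofReal_le_ofReal (dCut_le (x := (s, y)) (R := R) (n := n) (p := p) hchi
              hD0 hD hn hρ (ne_zero_of_rr (hR0.trans h)) (hP.one_le.trans h.le) (hf (s, y) hs h.le))
            refine h1.trans (ENNReal.ofReal_add_le.trans ?_)
            rw [ENNReal.ofReal_mul (by norm_num), ENNReal.ofReal_mul hc, ENNReal.ofReal_ofNat]
      _ = 4 * ErrChi chi R p (K f) τ₁ τ₂
          + ENNReal.ofReal (12 * D * (ρ ^ 2 / n)) * bulkInt τ₁ τ₂ (gL chi R p f) := by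
        have hm : AEMeasurable (fun s => sliceInt (gL chi R p f s)) (volume.restrict (Icc τ₁ τ₂)) :=
          bulk_aemeasurable hgL
        rw [lintegral_add_right' _ (hm.const_mul _),
          lintegral_const_mul' _ _ (by simp), lintegral_const_mul' _ _ ENNReal.ofReal_ne_top]
        rfl
      _ ≤ _ := by gcongr; exact bulkInt_gL_le hchi hR0 hf
  refine main'.trans ?_
  rw [ENNReal.ofReal_ofNat]
  gcongr
  · exact hL τ hτ
  · exact hL τ₁ hτ1

lemma capκ_tendsto (hchi : IsCutoffProfile chi) (r : ℝ) :
    Tendsto (fun j : ℕ => capκ chi R (((j : ℝ) + 1) ^ 3) r) atTop (𝓝 (cut chi R r)) := by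
  have h1 : Tendsto (fun j : ℕ => Real.log r / ((j : ℝ) + 1) ^ 3) atTop (𝓝 0) :=
    Tendsto.div_atTop tendsto_const_nhds ((tendsto_pow_atTop (by norm_num)).comp
      (tendsto_atTop_add_const_right _ _ tendsto_natCast_atTop_atTop))
  have h2 : ∀ᶠ j : ℕ in atTop, capκ chi R (((j : ℝ) + 1) ^ 3) r = cut chi R r := by
    filter_upwards [h1.eventually (gt_mem_nhds one_pos)] with j hj
    rw [capκ, hchi.zero_of_le _ hj.le, sub_zero, mul_one]
  exact tendsto_const_nhds.congr' (h2.mono fun j hj => hj.symm)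

lemma capv_tendsto (r : ℝ) :
    Tendsto (fun j : ℕ => capv p ((j : ℝ) + 1) r) atTop (𝓝 (r ^ p)) := by
  have h1 : Tendsto (fun j : ℕ => r / ((j : ℝ) + 1)) atTop (𝓝 0) :=
    Tendsto.div_atTop tendsto_const_nhds
      (tendsto_atTop_add_const_right _ _ tendsto_natCast_atTop_atTop)
  have h2 : Tendsto (fun j : ℕ => r ^ p / (1 + r / ((j : ℝ) + 1)) ^ 2) atTop
      (𝓝 (r ^ p / (1 + 0) ^ 2)) := tendsto_const_nhds.div ((h1.const_add 1).pow 2) (by norm_num)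
  simpa [capv] using h2

lemma om_tendsto (hchi : IsCutoffProfile chi) (r : ℝ) :
    Tendsto (fun j : ℕ => om (capκ chi R (((j : ℝ) + 1) ^ 3)) (capv p ((j : ℝ) + 1)) r) atTop
      (𝓝 (cut chi R r * r ^ p / r ^ 3)) :=
  ((capκ_tendsto hchi r).mul (capv_tendsto r)).div_const _

lemma le_ofReal_inv_mul {a : ℝ} (ha : 0 < a) {X c : ℝ≥0∞} (h : ENNReal.ofReal a * X ≤ c) :
    X ≤ ENNReal.ofReal (1 / a) * c := by
  calc X = ENNReal.ofReal (1 / a) * (ENNReal.ofReal a * X) := by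
        rw [← mul_assoc, ← ENNReal.ofReal_mul (by positivity), one_div_mul_cancel ha.ne',
          ENNReal.ofReal_one, one_mul]
    _ ≤ _ := by gcongr

/-- The angular part of the energy `Ẽ^p[K f]` is a lower-order quantity; the rest is the density
`fluxN` controlled by the energy inequality. -/
lemma gE_le (hchi : IsCutoffProfile chi) {x : X5} (h : x.2 ≠ 0) (hf : Sm (uc f) x) :
    ‖x.2‖ ^ (-3 : ℝ) * gE chi R p (K f) x.1 x.2
      ≤ cut chi R (rr x) * rr x ^ p / rr x ^ 3 * fluxN (uc (K f)) x
        + 3 * (‖x.2‖ ^ (-3 : ℝ) * gL chi R p f x.1 x.2) := by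
  have hr := rr_pos h
  have hY := K_sm h hf
  have h2 := cut_nonneg (R := R) (r := rr x) hchi
  have h3 := Real.rpow_pos_of_pos hr p
  have hj := jetL_le h hf
  have e3 := rpow_neg_nat hr 3
  have e2 := rpow_neg_nat hr 2
  have e4 := rpow_neg_nat hr 4
  push_cast at e3 e2 e4
  have e1 : rr x ^ (p - 1) = rr x ^ p / rr x := Real.rpow_sub_one hr.ne' p
  change rr x ^ (-3 : ℝ) * (cut chi R (rr x) * rr x ^ p * ((dR (K f) x.1 x.2) ^ 2
    + rr x ^ (-2 : ℝ) * (uc (K f) x) ^ 2 + rr x ^ (-4 : ℝ) * angSq (K f) x.1 x.2))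
    ≤ _ + 3 * (rr x ^ (-3 : ℝ) * (cut chi R (rr x) * rr x ^ (p - 1) * lowN f x.1 x.2))
  rw [e3, e2, e4, e1, dR_at hY.diff, angSq_at hY.diff, fluxN, ya_eq]
  have hA : ang5 (uc (K f)) x ≤ 3 * (rr x ^ 3 * lowN f x.1 x.2) := by
    refine le_trans ?_ hj
    rw [jetL]
    have : 0 ≤ rr x ^ 2 * rD (uc (K f)) x ^ 2 + uc (K f) x ^ 2 + pd 0 (uc (K f)) x ^ 2 := by
      positivity
    linarith
  calc _ = cut chi R (rr x) * rr x ^ p / rr x ^ 3 * (rD (uc (K f)) x ^ 2 + (uc (K f) x / rr x) ^ 2)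
        + cut chi R (rr x) * rr x ^ p / rr x ^ 7 * ang5 (uc (K f)) x := by field_simp
    _ ≤ cut chi R (rr x) * rr x ^ p / rr x ^ 3 * (rD (uc (K f)) x ^ 2 + (uc (K f) x / rr x) ^ 2)
        + cut chi R (rr x) * rr x ^ p / rr x ^ 7 * (3 * (rr x ^ 3 * lowN f x.1 x.2)) := by gcongr
    _ = _ := by field_simp

lemma gB_le (hchi : IsCutoffProfile chi) {Y : Fld} {x : X5} (h : x.2 ≠ 0)
    (hY : DifferentiableAt ℝ (uc Y) x) : ‖x.2‖ ^ (-3 : ℝ) * gB chi R p Y x.1 x.2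
      ≤ cut chi R (rr x) * rr x ^ p / rr x ^ 3 / rr x * bulkN (uc Y) x := by
  have hr := rr_pos h
  have h2 := cut_nonneg (R := R) (r := rr x) hchi
  have h3 := Real.rpow_pos_of_pos hr p
  have e3 := rpow_neg_nat hr 3
  have e2 := rpow_neg_nat hr 2
  push_cast at e3 e2
  have e1 : rr x ^ (p - 1) = rr x ^ p / rr x := Real.rpow_sub_one hr.ne' p
  change rr x ^ (-3 : ℝ) * (cut chi R (rr x) * rr x ^ (p - 1) * ((dR Y x.1 x.2) ^ 2
    + rr x ^ (-2 : ℝ) * ((uc Y x) ^ 2 + angSq Y x.1 x.2))) ≤ _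
  rw [e3, e2, e1, dR_at hY, angSq_at hY, bulkN_split h]
  calc _ = cut chi R (rr x) * rr x ^ p / rr x ^ 3 / rr x
        * (rD (uc Y) x ^ 2 + (ang5 (uc Y) x + uc Y x ^ 2) / rr x ^ 2) := by field_simp; ring
    _ ≤ _ := by
      have : 0 ≤ pd 0 (uc Y) x ^ 2 / rr x ^ 2 := by positivity
      exact mul_le_mul_of_nonneg_left (by linarith) (by positivity)

/-- The constant of the estimate. -/
def estConst (α δ : ℝ) : ℝ := (1 / (α / 2) + 1 / (δ / 24)) * (3 * (2 + 1 / α) + 45) + 3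

/-- The `r^p` estimate for a perturbed operator. -/
theorem rp_estimate (hchi : IsCutoffProfile chi)
    (hα : 0 < α) (hα' : α < 3 / 4) (hδ : 0 < δ) (hδp : δ ≤ p) (hp : p ≤ 3 / 2 - 2 * α)
    (hη : 40000 * η ≤ δ) (hηα : 32 * η ≤ α) (h12 : τ₁ ≤ τ₂)
    (hf : ∀ x : X5, x.1 ∈ Icc τ₁ τ₂ → R ≤ rr x → Sm (uc f) x)
    (hP : Perturbed R τ₁ τ₂ η kk bb cc (uc (K f)))
    (hG : ∀ x : X5, x.1 ∈ Icc τ₁ τ₂ → R < rr x → G x.1 x.2 = opL kk bb cc (uc (K f)) x) :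
    (⨆ τ ∈ Icc τ₁ τ₂, EpTilde chi R p (K f) τ) + Bp chi R p (K f) τ₁ τ₂
      ≤ ENNReal.ofReal (estConst α δ) * (EpTilde chi R p (K f) τ₁ + lowSum chi R p f τ₁ τ₂
        + ErrChi chi R p (K f) τ₁ τ₂ + sourceInt chi R p G (K f) τ₁ τ₂) := by
  obtain ⟨D, hD0, hD⟩ := exists_deriv_bound hchi
  have hR0 : 0 < R := by linarith [hP.one_le]
  have key := fun (j : ℕ) (τ : ℝ) (hτ : τ ∈ Icc τ₁ τ₂) => cap_estimate
    (n := ((j : ℝ) + 1) ^ 3) (ρ := (j : ℝ) + 1) hchi hD0 hD hα hα' hδ hδp hp hη hηα hf hP hG (by positivity) (by positivity) hτ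
  have hw := fun (j : ℕ) => cap_weight (n := ((j : ℝ) + 1) ^ 3) (ρ := (j : ℝ) + 1) hchi hR0
    (by positivity) (by positivity) hδp hp
  have hLs := fun (τ : ℝ) (hτ : τ ∈ Icc τ₁ τ₂) => sliceInt_gL_le (p := p) hchi hR0 hf hτ
  generalize hE : EpTilde chi R p (K f) τ₁ = E at *
  generalize hL : lowSum chi R p f τ₁ τ₂ = L at *
  generalize hEr : ErrChi chi R p (K f) τ₁ τ₂ = Er at *
  generalize hS : sourceInt chi R p G (K f) τ₁ τ₂ = S at *
  obtain ⟨T, hT⟩ : ∃ T, T = E + L + Er + S := ⟨_, rfl⟩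
  rw [← hT]
  have hLT : L ≤ T := by rw [hT]; exact (le_add_self.trans le_self_add).trans le_self_add
  have hET : E ≤ T := by rw [hT]; exact (le_self_add.trans le_self_add).trans le_self_add
  have hErT : Er ≤ T := by rw [hT]; exact le_add_self.trans le_self_add
  have hST : S ≤ T := by rw [hT]; exact le_add_self
  rcases eq_or_ne L ⊤ with hLtop | hLtop
  · have hTt : T = ⊤ := top_le_iff.1 (hLtop ▸ hLT)
    have : 0 < estConst α δ := by unfold estConst; positivity
    rw [hTt, ENNReal.mul_top (by simpa using this)]; exact le_top
  obtain ⟨W, hW⟩ : ∃ W, W = ENNReal.ofReal (2 + 1 / α) * (3 * L) + 10 * (E + 3 * L)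
    + (S + (4 * Er + 0 * L)) := ⟨_, rfl⟩
  have hWT : W ≤ ENNReal.ofReal (3 * (2 + 1 / α) + 45) * T := by
    calc W ≤ ENNReal.ofReal (2 + 1 / α) * (3 * T) + 10 * (T + 3 * T) + (T + (4 * T + 0 * T)) := by
          rw [hW]; gcongr
      _ = _ := by
        have hk : 0 ≤ 2 + 1 / α := by positivity
        generalize 2 + 1 / α = k at hk ⊢
        rw [ENNReal.ofReal_add (by positivity) (by norm_num), ENNReal.ofReal_mul (by norm_num),
          ENNReal.ofReal_ofNat, ENNReal.ofReal_ofNat]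
        ring
  -- the contribution of the outer cutoff tends to zero
  have hlim : Tendsto (fun j : ℕ => ENNReal.ofReal (2 + 1 / α) * (3 * L) + 10 * (E + 3 * L)
      + (S + (4 * Er + ENNReal.ofReal (12 * D * (((j : ℝ) + 1) ^ 2 / ((j : ℝ) + 1) ^ 3)) * L)))
      atTop (𝓝 W) := by
    have h1 : Tendsto (fun j : ℕ => 12 * D * (((j : ℝ) + 1) ^ 2 / ((j : ℝ) + 1) ^ 3)) atTop
        (𝓝 0) := by
      have := (tendsto_one_div_add_atTop_nhds_zero_nat (𝕜 := ℝ)).const_mul (12 * D)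
      rw [mul_zero] at this
      refine this.congr fun j => ?_
      have : (j : ℝ) + 1 ≠ 0 := by positivity
      field_simp
    have h2 := ENNReal.tendsto_ofReal h1
    rw [ENNReal.ofReal_zero] at h2
    rw [hW]
    exact tendsto_const_nhds.add (tendsto_const_nhds.add (tendsto_const_nhds.add
      (ENNReal.Tendsto.mul_const h2 (Or.inr hLtop))))
  have hEt : ∀ τ ∈ Icc τ₁ τ₂, EpTilde chi R p (K f) τ
      ≤ ENNReal.ofReal (1 / (α / 2)) * W + 3 * L := by
    intro τ hτ
    have hN : ∫⁻ y : E4, ENNReal.ofReal (cut chi R (rr (τ, y)) * rr (τ, y) ^ p / rr (τ, y) ^ 3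
        * fluxN (uc (K f)) (τ, y)) ≤ ENNReal.ofReal (1 / (α / 2)) * W := by
      refine lintegral_le_of_liminf (fun j => ?_) (Eventually.of_forall fun y => ?_)
        (ENNReal.Tendsto.const_mul hlim (Or.inr ENNReal.ofReal_ne_top)) fun j =>
          le_ofReal_inv_mul (by positivity) (le_self_add.trans (key j τ hτ))
      · exact (slice_measurable (cc_dFN (hw j) hP).cont hτ).aemeasurable
      · exact (ENNReal.tendsto_ofReal ((om_tendsto (R := R) (p := p) hchi _).mul_const _)).liminf_eq.ge
    have hgL := gL_continuousAt (p := p) hchi hR0 hf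
    calc EpTilde chi R p (K f) τ
        ≤ ∫⁻ y : E4, (ENNReal.ofReal (cut chi R (rr (τ, y)) * rr (τ, y) ^ p / rr (τ, y) ^ 3
        * fluxN (uc (K f)) (τ, y)) + 3 * ENNReal.ofReal (‖y‖ ^ (-3 : ℝ) * gL chi R p f τ y)) := by
          refine lintegral_mono fun y => ?_
          rcases le_or_gt (rr (τ, y)) R with h | h
          · have : cut chi R ‖y‖ = 0 := cut_zero hchi hR0 h
            simp [this]
          · refine (ENNReal.ofReal_le_ofReal (gE_le (x := (τ, y)) hchi (ne_zero_of_rr (hR0.trans h))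
              (hf (τ, y) hτ h.le))).trans (ENNReal.ofReal_add_le.trans ?_)
            rw [ENNReal.ofReal_mul (by norm_num : (0 : ℝ) ≤ 3), ENNReal.ofReal_ofNat]
      _ = _ + 3 * sliceInt (gL chi R p f τ) := by
        rw [lintegral_add_right _ ((slice_measurable hgL hτ).const_mul _),
          lintegral_const_mul' _ _ (by simp)]
        rfl
      _ ≤ _ := by gcongr; exact hLs τ hτ
  have hB : Bp chi R p (K f) τ₁ τ₂ ≤ ENNReal.ofReal (1 / (δ / 24)) * W := by
    have hN : ∫⁻ s in Icc τ₁ τ₂, ∫⁻ y : E4, ENNReal.ofReal (cut chi R (rr (s, y))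
        * rr (s, y) ^ p / rr (s, y) ^ 3 / rr (s, y) * bulkN (uc (K f)) (s, y))
        ≤ ENNReal.ofReal (1 / (δ / 24)) * W := by
      refine lintegral_le_of_liminf (fun j => bulk_aemeasurable (cc_dBk (hw j) hP).cont)
        ((ae_restrict_iff' measurableSet_Icc).2 (Eventually.of_forall fun s hs => ?_))
        (ENNReal.Tendsto.const_mul hlim (Or.inr ENNReal.ofReal_ne_top)) fun j =>
          le_ofReal_inv_mul (by positivity) (le_add_self.trans (key j τ₂ (right_mem_Icc.2 h12)))
      refine le_trans (lintegral_mono fun y => ?_) (lintegral_liminf_le fun j =>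
        slice_measurable (cc_dBk (hw j) hP).cont hs)
      exact (ENNReal.tendsto_ofReal (((om_tendsto (R := R) (p := p) hchi _).div_const _).mul_const
        _)).liminf_eq.ge
    refine le_trans (setLIntegral_mono' measurableSet_Icc fun s hs => lintegral_mono fun y => ?_) hN
    rcases le_or_gt (rr (s, y)) R with h | h
    · have : cut chi R ‖y‖ = 0 := cut_zero hchi hR0 h
      simp [this]
    · exact ENNReal.ofReal_le_ofReal (gB_le (x := (s, y)) hchi (ne_zero_of_rr (hR0.trans h))
        (hP.smY (s, y) hs h.le).diff)
  calc _ ≤ (ENNReal.ofReal (1 / (α / 2)) * W + 3 * L) + ENNReal.ofReal (1 / (δ / 24)) * W :=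
        add_le_add (iSup₂_le hEt) hB
    _ ≤ (ENNReal.ofReal (1 / (α / 2)) * (ENNReal.ofReal (3 * (2 + 1 / α) + 45) * T) + 3 * T)
        + ENNReal.ofReal (1 / (δ / 24)) * (ENNReal.ofReal (3 * (2 + 1 / α) + 45) * T) := by gcongr
    _ = _ := by
      have h1 : 0 ≤ 3 * (2 + 1 / α) + 45 := by positivity
      have h2 : 0 ≤ 1 / (α / 2) := by positivity
      have h3 : 0 ≤ 1 / (δ / 24) := by positivity
      rw [estConst]
      generalize 3 * (2 + 1 / α) + 45 = a at h1 ⊢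
      generalize 1 / (α / 2) = b at h2 ⊢
      generalize 1 / (δ / 24) = d at h3 ⊢
      rw [ENNReal.ofReal_add (by positivity) (by norm_num),
        ENNReal.ofReal_mul (by positivity), ENNReal.ofReal_add h2 h3, ENNReal.ofReal_ofNat]
      ring
end limit

/-! ### The estimate for a single geometry -/

/-- The `r^p` estimate on a geometry whose smallness parameter is below the threshold `g₀`. -/
theorem exists_geo_estimate : ∃ C g₀ : ℝ, 1 ≤ C ∧ 0 < g₀ ∧ ∀ G : Geo, G.gap < g₀ →
    ∀ τ₁ τ₂ : ℝ, τ₁ ≤ τ₂ → G.T = Icc τ₁ τ₂ → ∀ chi : ℝ → ℝ, IsCutoffProfile chi →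
    ∀ α δ p : ℝ, 0 < α → α < 3 / 4 → 0 < δ → δ ≤ p → p ≤ 3 / 2 - 2 * α →
    40000 * (C * G.gap) ≤ δ → 32 * (C * G.gap) ≤ α → ∀ U F : Fld,
    (∀ x ∈ G.reg, Sm (uc U) x) → (∀ x ∈ G.reg, Pgraph G.eta G.l U x.1 x.2 = F x.1 x.2) →
    (⨆ τ ∈ Icc τ₁ τ₂, EpTilde chi G.R p (K (rMul (3 / 2) U)) τ)
        + Bp chi G.R p (K (rMul (3 / 2) U)) τ₁ τ₂
      ≤ ENNReal.ofReal (estConst α δ) * (EpTilde chi G.R p (K (rMul (3 / 2) U)) τ₁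
        + lowSum chi G.R p (rMul (3 / 2) U) τ₁ τ₂ + ErrChi chi G.R p (K (rMul (3 / 2) U)) τ₁ τ₂
        + sourceInt chi G.R p
          (fun τ y => G1 G.eta F τ y + G2 G.eta G.l (rMul (3 / 2) U) τ y)
          (K (rMul (3 / 2) U)) τ₁ τ₂) := by
  obtain ⟨C, hC, hev⟩ := exists_perturbed
  rw [small, eventually_comap, Metric.eventually_nhds_iff] at hev
  obtain ⟨g₀, hg₀, hev⟩ := hev
  refine ⟨C, g₀, hC, hg₀, ?_⟩
  intro G hG τ₁ τ₂ h12 hT chi hchi α δ p hα hα' hδ hδp hp hη hηα U F hU hF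
  have hgap : 0 ≤ G.gap := add_nonneg G.e_nonneg (by have := G.one_le; positivity)
  obtain ⟨hreg, hpert⟩ := hev (y := G.gap) (by rwa [Real.dist_0_eq_abs, abs_of_nonneg hgap]) G rfl
  have hR : 0 < G.R := by linarith [G.one_le]
  have hne : ∀ x ∈ G.reg, x.2 ≠ 0 := fun x hx => ne_zero_of_rr (hR.trans_le hx.2)
  have hf : ∀ x ∈ G.reg, Sm (uc (rMul (3 / 2) U)) x := fun x hx => rMul_sm (hne x hx) (hU x hx)
  have hReg : ∀ x ∈ G.reg, Reg G.eta G.l x := fun x hx => by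
    obtain ⟨h1, h2, h3, h4⟩ := hreg x hx
    exact ⟨G.sm_eta _ hx.1, hne x hx, h1, h2, h3, h4⟩
  have hP := hpert τ₁ τ₂ hT (uc (K (rMul (3 / 2) U))) fun x hx => K_sm (hne x hx) (hf x hx)
  -- the equation holds on an open set of radii, so it may be differentiated
  have heq : ∀ τ (y : E4), τ ∈ Icc τ₁ τ₂ → G.R < ‖y‖ →
      G1 G.eta F τ y + G2 G.eta G.l (rMul (3 / 2) U) τ y = opL (kk G.eta G.l) (bb G.eta G.l)
        (cc G.eta G.l) (uc (K (rMul (3 / 2) U))) (τ, y) := by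
    intro τ y hτ h
    have hnear : ∀ᶠ y' in 𝓝 y, (τ, y') ∈ G.reg := by
      filter_upwards [continuous_norm.continuousAt.eventually (lt_mem_nhds h)] with y' hy
      exact ⟨hT ▸ hτ, le_of_lt hy⟩
    have h1 : ∀ᶠ y' in 𝓝 y, Reg G.eta G.l (τ, y') := hnear.mono fun y hy => hReg (τ, y) hy
    have h2 : ∀ᶠ y' in 𝓝 y, Sm (uc U) (τ, y') := hnear.mono fun y hy => hU (τ, y) hy
    have h3 : ∀ᶠ y' in 𝓝 y, Pgraph G.eta G.l U τ y' = F τ y' :=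
      hnear.mono fun y hy => hF (τ, y) hy
    exact commuted_equation h1 h2 h3
  have heq' : ∀ x : X5, x.1 ∈ Icc τ₁ τ₂ → G.R < rr x →
      G1 G.eta F x.1 x.2 + G2 G.eta G.l (rMul (3 / 2) U) x.1 x.2 = opL (kk G.eta G.l)
        (bb G.eta G.l) (cc G.eta G.l) (uc (K (rMul (3 / 2) U))) x := by
    rintro ⟨τ, y⟩ hx h
    exact heq τ y hx h
  exact rp_estimate (G := fun τ y => G1 G.eta F τ y + G2 G.eta G.l (rMul (3 / 2) U) τ y) hchi hα hα'
    hδ hδp hp hη hηα h12 (fun x hx h => hf x ⟨hT ▸ hx, h⟩) hP heq'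

/-- Radii with `R^{-α}` small. -/
lemma exists_radius {α s : ℝ} (hα : 0 < α) (hs : 0 < s) : ∃ R : ℝ, 1 ≤ R ∧ R ^ (-α) < s := by
  obtain ⟨R, h1, h2⟩ := ((tendsto_rpow_neg_atTop hα).eventually (gt_mem_nhds hs)).and
    (eventually_ge_atTop 1) |>.exists
  exact ⟨R, h2, h1⟩

end HypRp

end

open HypRp

theorem mainTheorem6
    (Rf : ℝ) (hRf : 0 < Rf) (kap : ℝ) (hkap : 0 < kap) (hkap' : kap < 5 / 4)
    (Lam : ℝ) (Cb : ℕ → ℝ) (chi : ℝ → ℝ) (hchi : IsCutoffProfile chi)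
    (α : ℝ) (hα : 0 < α) (hα' : α < 3 / 4) :
    ∃ M Rt εt : ℝ, 0 < M ∧ 0 < Rt ∧ 0 < εt ∧ M * (εt + Rt ^ (-α)) < 2 * α ∧
    ∀ δ : ℝ, 0 < δ → ∃ C : ℝ≥0,
    ∀ R ε : ℝ, Rt < R → 0 < ε → ε < εt → M * (ε + R ^ (-α)) ≤ δ →
    ∀ (xi ell : ℝ → E4) (sf τ₁ τ₂ : ℝ) (sig : ℝ → ℝ), τ₁ < τ₂ →
    SmallParams Rf kap Lam Cb ε sf xi ell →
    IsTimeChange Rf sf ell τ₁ τ₂ sig →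
    ∀ U F : Fld,
    (∀ τ ∈ Icc τ₁ τ₂, ∀ y : E4, R ≤ ‖y‖ →
      ContDiffAt ℝ ∞ (Function.uncurry U) (τ, y)) →
    (∀ τ ∈ Icc τ₁ τ₂, ∀ y : E4, R ≤ ‖y‖ →
      Pgraph (centre Rf xi ell sig) (fun s => ell (sig s)) U τ y = F τ y) →
    ∀ p : ℝ, δ < p → p < 3 / 2 - 2 * α →
    let eta : ℝ → E4 := centre Rf xi ell sig
    let l : ℝ → E4 := fun s => ell (sig s)
    let Ut : Fld := rMul (3 / 2) U
    let Y : Fld := K Ut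
    let G : Fld := fun τ y => G1 eta F τ y + G2 eta l Ut τ y
    (⨆ τ ∈ Icc τ₁ τ₂, EpTilde chi R p Y τ) + Bp chi R p Y τ₁ τ₂
      ≤ C * (EpTilde chi R p Y τ₁ + lowSum chi R p Ut τ₁ τ₂
          + ErrChi chi R p Y τ₁ τ₂ + sourceInt chi R p G Y τ₁ τ₂) := by
  obtain ⟨C, g₀, hC, hg₀, hest⟩ := exists_geo_estimate
  obtain ⟨D, ε₀, hD, hε₀, hpar⟩ := exists_param_bounds hRf hkap' Lam Cb
  -- the relative size of the perturbation is `C (D ε + 1 / R)`, at most `M (ε + R^{-α}) / 40000`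
  obtain ⟨M, hM⟩ : ∃ M, M = 40000 * (C * D) := ⟨_, rfl⟩
  have hCD : 1 ≤ C * D := one_le_mul_of_one_le_of_one_le hC hD
  have hM0 : 0 < M := by linarith
  obtain ⟨s, hs⟩ : ∃ s, s = min α g₀ / M := ⟨_, rfl⟩
  have hs0 : 0 < s := hs ▸ div_pos (lt_min hα hg₀) hM0
  obtain ⟨Rt, hRt, hRts⟩ := exists_radius hα (half_pos hs0)
  have hεs : min ε₀ (s / 2) + Rt ^ (-α) < s := by linarith [min_le_right ε₀ (s / 2)]
  have hMs : M * s = min α g₀ := by rw [hs]; field_simp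
  refine ⟨M, Rt, min ε₀ (s / 2), hM0, by linarith, lt_min hε₀ (half_pos hs0), ?_, ?_⟩
  · have := mul_lt_mul_of_pos_left hεs hM0
    linarith [min_le_left α g₀]
  intro δ hδ
  refine ⟨(estConst α δ).toNNReal, ?_⟩
  intro R ε hR hε hεt hMδ xi ell sf τ₁ τ₂ sig h12 hS hT U F hU hF p hp hp'
  have hR1 : 1 ≤ R := by linarith
  have hb := hpar ε hε (hεt.trans_le (min_le_left _ _)) xi ell sf τ₁ τ₂ sig h12 hS hT
  let G : Geo :=
    { eta := centre Rf xi ell sig, l := fun s => ell (sig s), T := Icc τ₁ τ₂, R := R, e := D * ε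
      one_le := hR1, e_nonneg := by positivity
      sm_eta := fun τ hτ => (hb τ hτ).1
      sm_l := fun τ hτ => (hb τ hτ).2.1
      l_le := fun τ hτ => (hb τ hτ).2.2.1
      dl_le := fun τ hτ => (hb τ hτ).2.2.2.1
      ddl_le := fun τ hτ => (hb τ hτ).2.2.2.2.1
      deta_le := fun τ hτ => (hb τ hτ).2.2.2.2.2.1
      ddeta_le := fun τ hτ => (hb τ hτ).2.2.2.2.2.2 }
  have hRα : 1 / R ≤ R ^ (-α) := by
    rw [one_div, ← Real.rpow_neg_one]
    exact Real.rpow_le_rpow_of_exponent_le hR1 (by linarith)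
  have hRα0 : 0 < R ^ (-α) := Real.rpow_pos_of_pos (by linarith) _
  have hRRt : R ^ (-α) ≤ Rt ^ (-α) :=
    Real.rpow_le_rpow_of_nonpos (by linarith) hR.le (by linarith)
  have hgap : G.gap ≤ D * (ε + R ^ (-α)) := by
    have : R ^ (-α) ≤ D * R ^ (-α) := le_mul_of_one_le_left hRα0.le hD
    change D * ε + 1 / R ≤ _
    linarith
  have hgap0 : 0 ≤ G.gap := add_nonneg G.e_nonneg (one_div_nonneg.2 (by linarith [G.one_le]))
  have hCgap : 40000 * (C * G.gap) ≤ M * (ε + R ^ (-α)) := by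
    have := mul_le_mul_of_nonneg_left hgap (by linarith : 0 ≤ 40000 * C)
    rw [hM]; linarith
  have hlt : M * (ε + R ^ (-α)) < min α g₀ := by
    rw [← hMs]
    exact mul_lt_mul_of_pos_left (by linarith [min_le_right ε₀ (s / 2)]) hM0
  have hCg : G.gap ≤ C * G.gap := le_mul_of_one_le_left hgap0 hC
  have hα1 := min_le_left α g₀
  have hg1 := min_le_right α g₀
  exact hest G (by linarith) τ₁ τ₂ h12.le rfl chi hchi α δ p hα hα' hδ hp.le hp'.le
    (hCgap.trans hMδ) (by linarith) U F (fun x hx => hU x.1 hx.1 x.2 hx.2)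
    (fun x hx => hF x.1 hx.1 x.2 hx.2)
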